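/- **Theorem.** Let $\mathcal N=(N,\mathcal O_{\mathcal N})$ be a (real, smooth) supermanifold of dimension $m|n$ with a connection $\nabla$ on its tangent sheaf $\mathcal T_{\mathcal N}$, for example a Riemannian supermanifold with its Levi-Civita connection. Let $T\mathcal N$ be the tangent bundle of $\mathcal N$, with local coordinates $(q_i,v_i)$ induced by local coordinates $(q_i)$ of $\mathcal N$. For a supermanifold $\mathcal S$ with body $S$, let $\partial_t$ denote the even vector field of differentiation in the direction of $\mathbb R$ on $\mathbb R\times\mathcal S$, and $\mathrm{inj}_{t=0}:\mathcal S\to\mathbb R\times\mathcal S$ the embedding at time $0$. A supercurve in $\mathcal N$ parametrized by $\mathcal S$ is a morphism $\Phi:(\mathbb R\times\mathcal S)|_W\to\mathcal N$ with $W\subset\mathbb R\times S$ open; for $\mathcal S=\mathbb R^{0|1}$ this is a supercurve defined on an open subsupermanifold of $\mathbb R^{1|1}\cong\mathbb R\times\mathbb R^{0|1}$. It is called a supergeodesic if $$\frac{\nabla}{dt}\bigl(T\Phi^*(\partial_t)\bigr)=0,$$ where $T\Phi^*(\partial_t)=\partial_t\circ\Phi^*$ is the velocity vector field along $\Phi$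 and $\frac{\nabla}{dt}=(\Phi^*\nabla)_{\partial_t}$ is the covariant derivative for the pull-back connection. Let $\partial_t\Phi:(\mathbb R\times\mathcal S)|_W\to T\mathcal N$ be the partial derivative of $\Phi$, given in coordinates by $(\partial_t\Phi)^*(q_i)=\Phi^*(q_i)$ and $(\partial_t\Phi)^*(v_i)=\partial_t\Phi^*(q_i)$. For a morphism $\mathcal J\in\mathrm{Mor}(\mathcal S,T\mathcal N)$, a *supergeodesic with initial condition* $\mathcal J$ is a pair $(W,\Phi)$ such that $W\subset\mathbb R\times S$ is open and, for every $s\in S$, the set $\{t\in\mathbb R:(t,s)\in W\}$ is an interval containing $0$, and $\Phi:(\mathbb R\times\mathcal S)|_W\to\mathcal N$ is a supergeodesic with $\partial_t\Phi\circ\mathrm{inj}_{t=0}=\mathcal J$. 1. For every $\mathcal J\in\mathrm{Mor}(\mathbb R^{0|1},T\mathcal N)$ there is a unique maximal supergeodesic with initial condition $\mathcal J$: there is a supergeodesic $(W,\Phi)$ with initial condition $\mathcal J$ such that every supergeodesic $(W',\Phi')$ with initial condition $\mathcal J$ satisfies $W'\subset W$ and $\Phi'=\Phi|_{W'}$. 2.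 The same holds with $\mathbb R^{0|1}$ replaced by an arbitrary supermanifold $\mathcal S$. 3. Let $\mathcal S$ be a supermanifold and $W\subset\mathbb R\times S$ open. A supercurve $\Phi:(\mathbb R\times\mathcal S)|_W\to\mathcal N$ is a supergeodesic if and only if for every system $(q_k)$ of local coordinates of $\mathcal N$ on an open set $U\subset N$ one has, on the preimage of $U$, $$\partial_t^2\,\Phi^*(q_k)+\sum_{i,j}\partial_t\Phi^*(q_i)\,\partial_t\Phi^*(q_j)\,\Phi^*(\Gamma_{ji}^k)=0\qquad\text{for all }k,$$ where the Christoffel symbols are defined by $\nabla_{\partial_{q_j}}\partial_{q_i}=\sum_k\Gamma_{ji}^k\,\partial_{q_k}$. -/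

import Mathlib

open TopologicalSpace
open scoped ContDiff

universe u v w

noncomputable section

/-- The sign `(-1) ^ i` of a parity `i`. -/
def superSign (i : ZMod 2) : ℝ := if i = 0 then 1 else -1

/-- Extension by zero of a function on a subset. -/
def extendZero {α β : Type*} [Zero β] (U : Set α) (f : U → β) (x : α) : β :=
  open Classical in if h : x ∈ U then f ⟨x, h⟩ else 0

lemma extendZero_of_mem {α β : Type*} [Zero β] {U : Set α} (f : U → β) {x : α} (h : x ∈ U) :
    extendZero U f x = f ⟨x, h⟩ := by simp [extendZero, h]

/-! ### Superspaces -/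

/-- A topological space with a sheaf `O` of supercommutative real superalgebras. `gr U i` is the
space of sections of parity `i`, and `val U f x` is the residue of `f` at the point `x` (the number
often written `f~(x)`); on a supermanifold it is the only real number `r` such that `f - r` is not
invertible near `x`. -/
structure SuperSpace where
  body : Type u
  [top : TopologicalSpace body]
  O : Opens body → Type u
  [ring : ∀ U, Ring (O U)]
  [alg : ∀ U, Algebra ℝ (O U)]
  res : ∀ {U V : Opens body}, V ≤ U → (O U →ₐ[ℝ] O V)
  res_self : ∀ {U : Opens body} (h : U ≤ U) (f : O U), res h f = f
  res_res : ∀ {U V W : Opens body} (h : V ≤ U) (h' : W ≤ V) (f : O U),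
    res h' (res h f) = res (h'.trans h) f
  locality : ∀ {U : Opens body} (f g : O U),
    (∀ x ∈ U, ∃ (V : Opens body) (h : V ≤ U), x ∈ V ∧ res h f = res h g) → f = g
  gluing : ∀ {ι : Type u} (U : ι → Opens body) (s : ∀ i, O (U i)),
    (∀ i j, res (inf_le_left : U i ⊓ U j ≤ U i) (s i) =
      res (inf_le_right : U i ⊓ U j ≤ U j) (s j)) →
    ∃ f : O (⨆ i, U i), ∀ i, res (le_iSup U i) f = s i
  gr : ∀ U : Opens body, ZMod 2 → Submodule ℝ (O U)
  gr_isCompl : ∀ U, IsCompl (gr U 0) (gr U 1)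
  one_mem : ∀ U, (1 : O U) ∈ gr U 0
  mul_mem : ∀ {U} {i j : ZMod 2} {a b : O U}, a ∈ gr U i → b ∈ gr U j → a * b ∈ gr U (i + j)
  res_mem : ∀ {U V : Opens body} (h : V ≤ U) {i : ZMod 2} {a : O U}, a ∈ gr U i →
    res h a ∈ gr V i
  supercomm : ∀ {U} {i j : ZMod 2} {a b : O U}, a ∈ gr U i → b ∈ gr U j →
    a * b = superSign (i * j) • (b * a)
  val : ∀ U : Opens body, O U →ₐ[ℝ] (U → ℝ)
  val_res : ∀ {U V : Opens body} (h : V ≤ U) (f : O U) (x : V),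
    val V (res h f) x = val U f ⟨x, h x.2⟩

attribute [instance] SuperSpace.top SuperSpace.ring SuperSpace.alg

namespace SuperSpace

lemma val_odd (X : SuperSpace.{u}) {U : Opens X.body} {a : X.O U} (h : a ∈ X.gr U 1) :
    X.val U a = 0 := by
  have h1 : a * a = -(a * a) := by
    simpa [superSign] using X.supercomm h h
  have h2 := congrArg (X.val U) h1
  funext x
  have h3 := congrFun h2 x
  simp only [map_mul, map_neg, Pi.mul_apply, Pi.neg_apply] at h3
  have : X.val U a x * X.val U a x = 0 := by linarith
  simpa using this

end SuperSpace

/-- A morphism of superspaces: a continuous map together with a morphism of sheaves of superalgebras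
that is compatible with residues, that is, local on stalks. -/
@[ext]
structure SuperSpace.Hom (X : SuperSpace.{u}) (Y : SuperSpace.{v}) where
  toMap : C(X.body, Y.body)
  pull : ∀ U : Opens Y.body, Y.O U →ₐ[ℝ] X.O (U.comap toMap)
  pull_res : ∀ {U V : Opens Y.body} (h : V ≤ U) (f : Y.O U),
    pull V (Y.res h f) = X.res (fun _ hx => h hx) (pull U f)
  pull_mem : ∀ {U : Opens Y.body} {i : ZMod 2} {a : Y.O U}, a ∈ Y.gr U i →
    pull U a ∈ X.gr _ i
  pull_val : ∀ {U : Opens Y.body} (f : Y.O U) (x : U.comap toMap),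
    X.val _ (pull U f) x = Y.val U f ⟨toMap x, x.2⟩

namespace SuperSpace

/-- Composition of morphisms. -/
def Hom.comp {X : SuperSpace.{u}} {Y : SuperSpace.{v}} {Z : SuperSpace.{w}}
    (g : Hom Y Z) (f : Hom X Y) : Hom X Z where
  toMap := g.toMap.comp f.toMap
  pull U := (f.pull (U.comap g.toMap)).comp (g.pull U)
  pull_res {U V} h a := (congrArg (f.pull _) (g.pull_res h a)).trans
    (f.pull_res (U := U.comap g.toMap) (V := V.comap g.toMap) (fun _ hx => h hx) (g.pull U a))
  pull_mem h := f.pull_mem (g.pull_mem h)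
  pull_val {U} a x := (f.pull_val (U := U.comap g.toMap) (g.pull U a) x).trans
    (g.pull_val a ⟨f.toMap x, x.2⟩)

/-- Pull-back of a section over `U` to an open set that is mapped into `U`. -/
def Hom.pullTo {X : SuperSpace.{u}} {Y : SuperSpace.{v}} (f : Hom X Y) {U : Opens Y.body}
    {V : Opens X.body} (h : V ≤ U.comap f.toMap) : Y.O U →ₐ[ℝ] X.O V :=
  (X.res h).comp (f.pull U)

/-- An open subset of an open subset, as an open subset of the whole space. -/
def up {α : Type*} [TopologicalSpace α] {W : Opens α} (U : Opens W) : Opens α :=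
  ⟨Subtype.val '' (U : Set W), W.isOpen.isOpenMap_subtype_val _ U.isOpen⟩

lemma mem_up {α : Type*} [TopologicalSpace α] {W : Opens α} {U : Opens W} {x : α} :
    x ∈ up U ↔ ∃ h : x ∈ W, (⟨x, h⟩ : W) ∈ U := by
  constructor
  · rintro ⟨y, hy, rfl⟩; exact ⟨y.2, hy⟩
  · rintro ⟨h, hx⟩; exact ⟨_, hx, rfl⟩

lemma coe_mem_up {α : Type*} [TopologicalSpace α] {W : Opens α} {U : Opens W} {x : W} :
    (x : α) ∈ up U ↔ x ∈ U := by
  rw [mem_up]; exact ⟨fun h => h.2, fun h => ⟨x.2, h⟩⟩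

lemma up_mono {α : Type*} [TopologicalSpace α] {W : Opens α} {U V : Opens W} (h : V ≤ U) :
    up V ≤ up U := fun _ hx => mem_up.2 ⟨(mem_up.1 hx).1, h (mem_up.1 hx).2⟩

lemma up_iSup {α : Type*} [TopologicalSpace α] {W : Opens α} {ι : Type*} (U : ι → Opens W) :
    up (⨆ i, U i) = ⨆ i, up (U i) := by
  ext x
  simp only [SetLike.mem_coe, mem_up, Opens.mem_iSup]
  tauto

lemma up_inf {α : Type*} [TopologicalSpace α] {W : Opens α} (U V : Opens W) :
    up U ⊓ up V ≤ up (U ⊓ V) := fun _ hx =>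
  mem_up.2 ⟨(mem_up.1 hx.1).1, (mem_up.1 hx.1).2, (mem_up.1 hx.2).2⟩

/-- The open subspace of a superspace with underlying open set `W`. -/
def restrict (X : SuperSpace.{u}) (W : Opens X.body) : SuperSpace.{u} where
  body := W
  O U := X.O (up U)
  res h := X.res (up_mono h)
  res_self h f := X.res_self _ f
  res_res h h' f := X.res_res _ _ f
  locality {U} f g H := X.locality f g fun x hx => by
    obtain ⟨hW, hU⟩ := mem_up.1 hx
    obtain ⟨V, h, hV, e⟩ := H ⟨x, hW⟩ hU
    exact ⟨up V, up_mono h, mem_up.2 ⟨hW, hV⟩, e⟩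
  gluing {ι} U s H := by
    obtain ⟨f, hf⟩ := X.gluing (fun i => up (U i)) s (fun i j => by
      have := congrArg (X.res (up_inf (U i) (U j))) (H i j)
      simpa only [X.res_res] using this)
    refine ⟨X.res (up_iSup U).le f, fun i => ?_⟩
    rw [X.res_res]
    exact hf i
  gr U := X.gr (up U)
  gr_isCompl U := X.gr_isCompl _
  one_mem U := X.one_mem _
  mul_mem := X.mul_mem
  res_mem h := X.res_mem _
  supercomm := X.supercomm
  val U := AlgHom.mk' 
    { toFun := fun f x => X.val (up U) f ⟨x, coe_mem_up.2 x.2⟩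
      map_one' := by ext; simp
      map_mul' := by intros; ext; simp
      map_zero' := by ext; simp
      map_add' := by intros; ext; simp } (by intros; ext; simp)
  val_res h f x := X.val_res _ f _

/-- The inclusion of a smaller open subspace into a larger one. -/
def restrictIncl (X : SuperSpace.{u}) {W' W : Opens X.body} (h : W' ≤ W) :
    Hom (X.restrict W') (X.restrict W) where
  toMap := ⟨fun x => ⟨x.1, h x.2⟩, by fun_prop⟩
  pull U := X.res fun _ hx => mem_up.2 ⟨h (mem_up.1 hx).1, (mem_up.1 hx).2⟩
  pull_res _ f := (X.res_res _ _ f).trans (X.res_res _ _ f).symm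
  pull_mem := X.res_mem _
  pull_val f x := X.val_res _ f _

/-- An open immersion: an isomorphism onto an open subspace. -/
structure Hom.IsOpenImmersion {X : SuperSpace.{u}} {Y : SuperSpace.{v}} (f : Hom X Y) : Prop where
  isOpenEmbedding : Topology.IsOpenEmbedding f.toMap
  bijective : ∀ U : Opens Y.body, (U : Set Y.body) ⊆ Set.range f.toMap →
    Function.Bijective (f.pull U)

end SuperSpace

/-! ### Superdomains -/

/-- The Grassmann algebra on `q` odd generators. -/
abbrev Grassmann (q : ℕ) : Type := ExteriorAlgebra ℝ (Fin q → ℝ)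

instance (q : ℕ) : Module.Finite ℝ (Grassmann q) :=
  Module.Finite.of_basis (Pi.basisFun ℝ (Fin q)).ExteriorAlgebra

/-- The subspace of elements of parity `i` of the Grassmann algebra. -/
abbrev grassmannPart (q : ℕ) (i : ZMod 2) : Submodule ℝ (Grassmann q) :=
  CliffordAlgebra.evenOdd (0 : QuadraticForm ℝ (Fin q → ℝ)) i

lemma grassmann_supercomm {q : ℕ} {i j : ZMod 2} {a b : Grassmann q}
    (ha : a ∈ grassmannPart q i) (hb : b ∈ grassmannPart q j) :
    a * b = superSign (i * j) • (b * a) := by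
  have h := CliffordAlgebra.map_mul_map_of_isOrtho_of_mem_evenOdd
    (QuadraticMap.Isometry.id (0 : QuadraticForm ℝ (Fin q → ℝ)))
    (QuadraticMap.Isometry.id (0 : QuadraticForm ℝ (Fin q → ℝ)))
    (fun x y => by simp [QuadraticMap.IsOrtho]) a b ha hb
  simp only [CliffordAlgebra.map_id, AlgHom.id_apply] at h
  rw [h]
  have h2 : ∀ k : ZMod 2, k = 0 ∨ k = 1 := by decide
  rcases h2 i with rfl | rfl <;> rcases h2 j with rfl | rfl <;> simp [superSign]

/-- A function on a subset of `ℝ ^ p` with values in a Grassmann algebra is smooth if all its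
components are smooth. -/
def GrassmannSmooth {E : Type*} [NormedAddCommGroup E] [NormedSpace ℝ E] {q : ℕ} (U : Set E)
    (f : E → Grassmann q) : Prop :=
  ∀ l : Grassmann q →ₗ[ℝ] ℝ, ContDiffOn ℝ ∞ (fun x => l (f x)) U

section

variable {E : Type*} [NormedAddCommGroup E] [NormedSpace ℝ E] {q : ℕ} {U : Set E}

lemma GrassmannSmooth.congr {f g : E → Grassmann q} (hf : GrassmannSmooth U f)
    (h : ∀ x ∈ U, g x = f x) : GrassmannSmooth U g := fun l =>
  (hf l).congr fun x hx => by rw [h x hx]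

lemma GrassmannSmooth.add {f g : E → Grassmann q} (hf : GrassmannSmooth U f)
    (hg : GrassmannSmooth U g) : GrassmannSmooth U (fun x => f x + g x) := fun l => by
  simpa only [map_add] using (hf l).add (hg l)

lemma GrassmannSmooth.comp_linear {r : ℕ} {f : E → Grassmann q} (hf : GrassmannSmooth U f)
    (L : Grassmann q →ₗ[ℝ] Grassmann r) : GrassmannSmooth U (fun x => L (f x)) := fun l =>
  hf (l.comp L)

lemma GrassmannSmooth.mul {f g : E → Grassmann q} (hf : GrassmannSmooth U f)
    (hg : GrassmannSmooth U g) : GrassmannSmooth U (fun x => f x * g x) := fun l => by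
  let b := (Pi.basisFun ℝ (Fin q)).ExteriorAlgebra
  have h : ∀ x, l (f x * g x) =
      ∑ i, ∑ j, b.coord i (f x) * b.coord j (g x) * l (b i * b j) := fun x => by
    conv_lhs => rw [← b.sum_repr (f x), ← b.sum_repr (g x)]
    simp only [Finset.sum_mul, Finset.mul_sum, map_sum, smul_mul_smul_comm, map_smul, smul_eq_mul,
      Module.Basis.coord_apply]
    exact Finset.sum_comm
  simp only [h]
  exact ContDiffOn.sum fun i _ => ContDiffOn.sum fun j _ =>
    ((hf _).mul (hg _)).mul contDiffOn_const

lemma GrassmannSmooth.const (a : Grassmann q) : GrassmannSmooth U (fun _ => a) := fun _ =>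
  contDiffOn_const

end

/-- The superfunctions on an open subset `U` of `ℝ ^ p` with `q` odd coordinates: the smooth
functions on `U` with values in the Grassmann algebra. -/
def superFun (p q : ℕ) (U : Set (Fin p → ℝ)) : Subalgebra ℝ (U → Grassmann q) where
  carrier := {f | GrassmannSmooth U (extendZero U f)}
  mul_mem' {f g} hf hg := (hf.mul hg).congr fun x hx => by
    simp [extendZero_of_mem _ hx]
  add_mem' {f g} hf hg := (hf.add hg).congr fun x hx => by
    simp [extendZero_of_mem _ hx]
  algebraMap_mem' r := (GrassmannSmooth.const (algebraMap ℝ _ r)).congr fun x hx => by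
    simp [extendZero_of_mem _ hx]

lemma GrassmannSmooth.of_locally {E : Type*} [NormedAddCommGroup E] [NormedSpace ℝ E] {q : ℕ}
    {U : Set E} {f : E → Grassmann q}
    (h : ∀ x ∈ U, ∃ V : Set E, IsOpen V ∧ x ∈ V ∧ GrassmannSmooth V f) :
    GrassmannSmooth U f := fun l x hx => by
  obtain ⟨V, hV, hx, hs⟩ := h x hx
  exact ((hs l).contDiffAt (hV.mem_nhds hx)).contDiffWithinAt

/-- The even or odd superfunctions. -/
def superFunPart (p q : ℕ) (U : Set (Fin p → ℝ)) (i : ZMod 2) : Submodule ℝ (superFun p q U) where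
  carrier := {f | ∀ x, f.1 x ∈ grassmannPart q i}
  add_mem' hf hg x := Submodule.add_mem _ (hf x) (hg x)
  zero_mem' _ := Submodule.zero_mem _
  smul_mem' r _ hf x := Submodule.smul_mem _ r (hf x)

lemma grassmannPart_disjoint {q : ℕ} {a : Grassmann q} (h0 : a ∈ grassmannPart q 0)
    (h1 : a ∈ grassmannPart q 1) : a = 0 :=
  Submodule.disjoint_def.1 (CliffordAlgebra.evenOdd_isCompl _).disjoint a h0 h1

lemma exists_grassmannProj (q : ℕ) : ∃ P Q : Grassmann q →ₗ[ℝ] Grassmann q,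
    (∀ a, P a ∈ grassmannPart q 0) ∧ (∀ a, Q a ∈ grassmannPart q 1) ∧ ∀ a, a = P a + Q a := by
  have h := CliffordAlgebra.evenOdd_isCompl (0 : QuadraticForm ℝ (Fin q → ℝ))
  exact ⟨(grassmannPart q 0).projection _ h, (grassmannPart q 1).projection _ h.symm,
    Submodule.projection_apply_mem h, Submodule.projection_apply_mem h.symm, fun a =>
      (Submodule.projection_add_projection_eq_self h a).symm⟩

lemma isCompl_of {M : Type*} [AddCommGroup M] [Module ℝ M] {P Q : Submodule ℝ M}
    (h : ∀ a ∈ P, a ∈ Q → a = 0) (h' : ∀ a, ∃ b ∈ P, ∃ c ∈ Q, b + c = a) : IsCompl P Q :=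
  ⟨Submodule.disjoint_def.2 h, codisjoint_iff.2 (Submodule.eq_top_iff'.2 fun a =>
    Submodule.mem_sup.2 (h' a))⟩

/-- Restriction of superfunctions. -/
def superFunRes {p q : ℕ} {U V : Set (Fin p → ℝ)} (h : V ⊆ U) :
    superFun p q U →ₐ[ℝ] superFun p q V :=
  AlgHom.mk'
    { toFun := fun f => ⟨fun x => f.1 ⟨x, h x.2⟩, GrassmannSmooth.congr
        (fun l => (f.2 l).mono h) fun x hx => by
          rw [extendZero_of_mem _ hx, extendZero_of_mem _ (h hx)]⟩
      map_one' := rfl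
      map_mul' := fun _ _ => rfl
      map_zero' := rfl
      map_add' := fun _ _ => rfl } (fun _ _ => rfl)

open SuperSpace in
/-- The superspace `ℝ ^ (p|q)`. -/
def superR (p q : ℕ) : SuperSpace.{0} where
  body := Fin p → ℝ
  O U := superFun p q U
  res h := superFunRes h
  res_self _ _ := rfl
  res_res _ _ _ := rfl
  locality {U} f g H := by
    refine Subtype.ext (funext fun x => ?_)
    obtain ⟨V, h, hV, e⟩ := H x x.2
    exact congrFun (congrArg Subtype.val e) ⟨x.1, hV⟩
  gluing {ι} U s H := by
    have hmem : ∀ x : ↥(⨆ i, U i), ∃ i, x.1 ∈ U i := fun x => Opens.mem_iSup.1 x.2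
    choose k hk using hmem
    have key : ∀ i (x : ↥(⨆ i, U i)) (hx : x.1 ∈ U i),
        (s (k x)).1 ⟨x, hk x⟩ = (s i).1 ⟨x, hx⟩ := fun i x hx =>
      congrFun (congrArg Subtype.val (H (k x) i)) ⟨x.1, hk x, hx⟩
    refine ⟨⟨fun x => (s (k x)).1 ⟨x, hk x⟩, ?_⟩, fun i => ?_⟩
    · refine GrassmannSmooth.of_locally fun x hx => ?_
      obtain ⟨i, hi⟩ := Opens.mem_iSup.1 hx
      refine ⟨U i, (U i).isOpen, hi, (s i).2.congr fun y hy => ?_⟩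
      rw [extendZero_of_mem _ (Opens.mem_iSup.2 ⟨i, hy⟩), extendZero_of_mem _ hy]
      exact key i ⟨y, _⟩ hy
    · exact Subtype.ext (funext fun x => key i ⟨x.1, Opens.mem_iSup.2 ⟨i, x.2⟩⟩ x.2)
  gr U := superFunPart p q U
  gr_isCompl U := by
    refine isCompl_of (fun f h0 h1 => Subtype.ext (funext fun x =>
      grassmannPart_disjoint (h0 x) (h1 x))) fun f => ?_
    obtain ⟨P, Q, hP, hQ, h⟩ := exists_grassmannProj q
    have hs : ∀ L : Grassmann q →ₗ[ℝ] Grassmann q,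
        (fun x => L (f.1 x)) ∈ superFun p q U := fun L =>
      (GrassmannSmooth.comp_linear f.2 L).congr fun x hx => by
        rw [extendZero_of_mem _ hx, extendZero_of_mem _ hx]
    exact ⟨⟨_, hs P⟩, fun x => hP _, ⟨_, hs Q⟩, fun x => hQ _,
      Subtype.ext (funext fun x => (h _).symm)⟩
  one_mem U x := CliffordAlgebra.one_le_evenOdd_zero _ (Submodule.one_le.1 le_rfl)
  mul_mem ha hb x := CliffordAlgebra.evenOdd_mul_le _ _ _ (Submodule.mul_mem_mul (ha x) (hb x))
  res_mem h _ _ ha x := ha ⟨x.1, h x.2⟩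
  supercomm ha hb := Subtype.ext (funext fun x => grassmann_supercomm (ha x) (hb x))
  val U := AlgHom.mk'
    { toFun := fun f x => ExteriorAlgebra.algebraMapInv (f.1 x)
      map_one' := by ext; simp
      map_mul' := by intros; ext; simp
      map_zero' := by ext; simp
      map_add' := by intros; ext; simp } (by intros; ext; simp)
  val_res _ _ _ := rfl

/-- The superdomain `V ^ (p|q)` over an open subset `V` of `ℝ ^ p`. -/
abbrev superDomain (p q : ℕ) (V : Opens (Fin p → ℝ)) : SuperSpace.{0} :=
  (superR p q).restrict V

lemma superDomain_val_continuous {p q : ℕ} {V : Opens (Fin p → ℝ)}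
    {U : Opens (superDomain p q V).body} (f : (superDomain p q V).O U) :
    Continuous ((superDomain p q V).val U f) := by
  have h := (f.2 ExteriorAlgebra.algebraMapInv.toLinearMap).continuousOn.domRestrict
  have h2 : Continuous (fun x : U => (⟨x.1.1, SuperSpace.coe_mem_up.2 x.2⟩ :
    (↥((SuperSpace.up U : Opens (Fin p → ℝ)) : Set (Fin p → ℝ))))) := by fun_prop
  exact (h.comp h2).congr fun x => congrArg ExteriorAlgebra.algebraMapInv
    (extendZero_of_mem f.1 (SuperSpace.coe_mem_up.2 x.2))

/-- A supermanifold of dimension `m|n`: a Hausdorff second countable superspace that is locally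
isomorphic to superdomains of dimension `m|n`. -/
structure SuperSpace.IsSupermanifold (X : SuperSpace.{u}) (m n : ℕ) : Prop where
  t2 : T2Space X.body
  secondCountable : SecondCountableTopology X.body
  exists_chart : ∀ x : X.body, ∃ (V : Opens (Fin m → ℝ))
    (c : SuperSpace.Hom (superDomain m n V) X), c.IsOpenImmersion ∧ x ∈ Set.range c.toMap

/-! ### The product of the real line with a superspace -/

/-- The slice of an open subset of `ℝ × X` at time `t`. -/
def timeSlice {α : Type*} [TopologicalSpace α] (W : Opens (ℝ × α)) (t : ℝ) : Opens α :=
  ⟨{s | (t, s) ∈ W}, W.isOpen.preimage (by fun_prop)⟩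

namespace SuperSpace

variable (S : SuperSpace.{u})

/-- The coordinate expression in a chart `c` of a family `f t` of superfunctions on the time slices
of `W`, as a Grassmann algebra valued function of the time and the even coordinates. -/
def timeExpr {p q : ℕ} {V : Opens (Fin p → ℝ)} (c : Hom (superDomain p q V) S)
    {W : Opens (ℝ × S.body)} (f : ∀ t, S.O (timeSlice W t)) (z : ℝ × (Fin p → ℝ)) : Grassmann q :=
  extendZero _ (c.pull _ (f z.1)).1 z.2

/-- The set of times and even coordinates for which `timeExpr` is given by the family. -/
def timeDom {p q : ℕ} {V : Opens (Fin p → ℝ)} (c : Hom (superDomain p q V) S)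
    (W : Opens (ℝ × S.body)) : Set (ℝ × (Fin p → ℝ)) :=
  {z | ∃ h : z.2 ∈ V, (z.1, c.toMap ⟨z.2, h⟩) ∈ W}

variable {S}

lemma timeExpr_eq {p q : ℕ} {V : Opens (Fin p → ℝ)} (c : Hom (superDomain p q V) S)
    {W : Opens (ℝ × S.body)} (f : ∀ t, S.O (timeSlice W t)) {z : ℝ × (Fin p → ℝ)}
    (hz : z ∈ timeDom S c W) :
    timeExpr S c f z = (c.pull _ (f z.1)).1 ⟨z.2, mem_up.2 hz⟩ :=
  extendZero_of_mem _ _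

lemma timeExpr_res {p q : ℕ} {V : Opens (Fin p → ℝ)} (c : Hom (superDomain p q V) S)
    {W W' : Opens (ℝ × S.body)} (h : W' ≤ W) (f : ∀ t, S.O (timeSlice W t))
    {z : ℝ × (Fin p → ℝ)} (hz : z ∈ timeDom S c W') :
    timeExpr S c (fun t => S.res (fun _ hs => h hs : timeSlice W' t ≤ timeSlice W t) (f t)) z =
      timeExpr S c f z := by
  have hz' : z ∈ timeDom S c W := ⟨hz.1, h hz.2⟩
  exact (timeExpr_eq c _ hz).trans ((congrFun (congrArg Subtype.val
    (c.pull_res _ (f z.1))) _).trans (timeExpr_eq c f hz').symm)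

lemma isOpen_timeDom {p q : ℕ} {V : Opens (Fin p → ℝ)} (c : Hom (superDomain p q V) S)
    (W : Opens (ℝ × S.body)) : IsOpen (timeDom S c W) := by
  have h : timeDom S c W = (fun x : ℝ × V => (x.1, x.2.1)) ''
      {x : ℝ × V | (x.1, c.toMap x.2) ∈ W} := by
    ext z
    constructor
    · rintro ⟨h, hz⟩; exact ⟨(z.1, ⟨z.2, h⟩), hz, rfl⟩
    · rintro ⟨x, hx, rfl⟩; exact ⟨x.2.2, hx⟩
  rw [h]
  exact (IsOpenMap.id.prodMap V.isOpen.isOpenMap_subtype_val) _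
    (W.isOpen.preimage (by
      have := c.toMap.continuous
      exact continuous_fst.prodMk (this.comp continuous_snd)))

variable (S)

/-- The superfunctions on an open subset `W` of `ℝ × S`: families `f t` of superfunctions on the
time slices of `W` that in every chart of `S` depend smoothly on the time and the even coordinates
together. -/
def timeFun (W : Opens (ℝ × S.body)) : Subalgebra ℝ (∀ t, S.O (timeSlice W t)) where
  carrier := {f | ∀ (p q : ℕ) (V : Opens (Fin p → ℝ)) (c : Hom (superDomain p q V) S),
    c.IsOpenImmersion → GrassmannSmooth (timeDom S c W) (timeExpr S c f)}
  mul_mem' {f g} hf hg p q V c hc := ((hf p q V c hc).mul (hg p q V c hc)).congr fun z hz => by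
    rw [timeExpr_eq c _ hz, timeExpr_eq c _ hz, timeExpr_eq c _ hz, Pi.mul_apply, map_mul]; rfl
  add_mem' {f g} hf hg p q V c hc := ((hf p q V c hc).add (hg p q V c hc)).congr fun z hz => by
    rw [timeExpr_eq c _ hz, timeExpr_eq c _ hz, timeExpr_eq c _ hz, Pi.add_apply, map_add]; rfl
  algebraMap_mem' r p q V c hc := (GrassmannSmooth.const (algebraMap ℝ _ r)).congr fun z hz => by
    rw [timeExpr_eq c _ hz, Pi.algebraMap_apply, AlgHom.commutes]; rfl

variable {S}

/-- The family of restrictions of a family of superfunctions. -/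
def timeFunRes {W W' : Opens (ℝ × S.body)} (h : W' ≤ W) : S.timeFun W →ₐ[ℝ] S.timeFun W' :=
  AlgHom.mk'
    { toFun := fun f => ⟨fun t => S.res (fun _ hs => h hs) (f.1 t), fun p q V c hc =>
        GrassmannSmooth.congr
          (fun l => (f.2 p q V c hc l).mono fun _ hz => ⟨hz.1, h hz.2⟩)
          fun _ hz => timeExpr_res c h f.1 hz⟩
      map_one' := Subtype.ext (funext fun _ => map_one _)
      map_mul' := fun _ _ => Subtype.ext (funext fun _ => map_mul _ _ _)
      map_zero' := Subtype.ext (funext fun _ => map_zero _)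
      map_add' := fun _ _ => Subtype.ext (funext fun _ => map_add _ _ _) }
    (fun _ _ => Subtype.ext (funext fun _ => map_smul _ _ _))

variable (S) in
/-- The families of superfunctions of parity `i`. -/
def timeFunPart (W : Opens (ℝ × S.body)) (i : ZMod 2) : Submodule ℝ (S.timeFun W) where
  carrier := {f | ∀ t, f.1 t ∈ S.gr _ i}
  add_mem' hf hg t := Submodule.add_mem _ (hf t) (hg t)
  zero_mem' _ := Submodule.zero_mem _
  smul_mem' r _ hf t := Submodule.smul_mem _ r (hf t)

lemma timeFunPart_isCompl (W : Opens (ℝ × S.body)) :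
    IsCompl (S.timeFunPart W 0) (S.timeFunPart W 1) := by
  refine isCompl_of (fun f h0 h1 => Subtype.ext (funext fun t =>
    Submodule.disjoint_def.1 (S.gr_isCompl _).disjoint _ (h0 t) (h1 t))) fun f => ?_
  have h : ∀ t, ∃ a ∈ S.gr (timeSlice W t) 0, ∃ b ∈ S.gr (timeSlice W t) 1, a + b = f.1 t :=
    fun t => Submodule.mem_sup.1 ((S.gr_isCompl _).sup_eq_top ▸ Submodule.mem_top)
  choose a ha b hb hab using h
  have key : ∀ (p q : ℕ) (V : Opens (Fin p → ℝ)) (c : Hom (superDomain p q V) S),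
      c.IsOpenImmersion → GrassmannSmooth (timeDom S c W) (timeExpr S c a) ∧
        GrassmannSmooth (timeDom S c W) (timeExpr S c b) := by
    intro p q V c hc
    obtain ⟨P, Q, hP, hQ, h⟩ := exists_grassmannProj q
    have e : ∀ z ∈ timeDom S c W, timeExpr S c a z = P (timeExpr S c f.1 z) ∧
        timeExpr S c b z = Q (timeExpr S c f.1 z) := by
      intro z hz
      have ea : timeExpr S c a z ∈ grassmannPart q 0 := by
        rw [timeExpr_eq c _ hz]; exact c.pull_mem (ha z.1) _
      have eb : timeExpr S c b z ∈ grassmannPart q 1 := by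
        rw [timeExpr_eq c _ hz]; exact c.pull_mem (hb z.1) _
      have ef : timeExpr S c f.1 z = timeExpr S c a z + timeExpr S c b z := by
        rw [timeExpr_eq c _ hz, timeExpr_eq c _ hz, timeExpr_eq c _ hz, ← hab, map_add]; rfl
      have h1 := h (timeExpr S c f.1 z)
      have h2 : timeExpr S c a z - P (timeExpr S c f.1 z) =
          Q (timeExpr S c f.1 z) - timeExpr S c b z := by
        rw [sub_eq_sub_iff_add_eq_add, ← ef, add_comm]; exact h1
      have h3 := grassmannPart_disjoint (Submodule.sub_mem _ ea (hP _))
        (h2 ▸ Submodule.sub_mem _ (hQ _) eb)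
      exact ⟨sub_eq_zero.1 h3, (sub_eq_zero.1 (h2.symm.trans h3)).symm⟩
    exact ⟨((f.2 p q V c hc).comp_linear P).congr fun z hz => (e z hz).1,
      ((f.2 p q V c hc).comp_linear Q).congr fun z hz => (e z hz).2⟩
  exact ⟨⟨a, fun p q V c hc => (key p q V c hc).1⟩, ha,
    ⟨b, fun p q V c hc => (key p q V c hc).2⟩, hb, Subtype.ext (funext hab)⟩

lemma timeFun_gluing {ι : Type u} (W : ι → Opens (ℝ × S.body)) (s : ∀ i, S.timeFun (W i))
    (H : ∀ i j, timeFunRes (inf_le_left : W i ⊓ W j ≤ W i) (s i) =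
      timeFunRes (inf_le_right : W i ⊓ W j ≤ W j) (s j)) :
    ∃ f : S.timeFun (⨆ i, W i), ∀ i, timeFunRes (le_iSup W i) f = s i := by
  have hle : ∀ t, timeSlice (⨆ i, W i) t ≤ ⨆ i, timeSlice (W i) t := fun t x hx => by
    obtain ⟨i, hi⟩ := Opens.mem_iSup.1 (show (t, x) ∈ ⨆ i, W i from hx)
    exact Opens.mem_iSup.2 ⟨i, hi⟩
  have hg : ∀ t, ∃ f : S.O (timeSlice (⨆ i, W i) t), ∀ i,
      S.res (fun _ hx => le_iSup W i hx : timeSlice (W i) t ≤ _) f = (s i).1 t := fun t => by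
    obtain ⟨f, hf⟩ := S.gluing (fun i => timeSlice (W i) t) (fun i => (s i).1 t)
      (fun i j => congrFun (congrArg Subtype.val (H i j)) t)
    exact ⟨S.res (hle t) f, fun i => (S.res_res _ _ f).trans (hf i)⟩
  choose f hf using hg
  refine ⟨⟨f, fun p q V c hc => GrassmannSmooth.of_locally fun z hz => ?_⟩, fun i =>
    Subtype.ext (funext fun t => hf t i)⟩
  obtain ⟨i, hi⟩ := Opens.mem_iSup.1 hz.2
  refine ⟨timeDom S c (W i), isOpen_timeDom c _, ⟨hz.1, hi⟩,
    ((s i).2 p q V c hc).congr fun y hy => ?_⟩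
  rw [← timeExpr_res c (le_iSup W i) f hy]
  exact congrArg (fun g => timeExpr S c g y) (funext fun t => hf t i)

variable (S)

/-- The product of the real line with a superspace `S`. -/
def timeProd : SuperSpace.{u} where
  body := ℝ × S.body
  O W := S.timeFun W
  res h := timeFunRes h
  res_self h f := Subtype.ext (funext fun t => S.res_self _ _)
  res_res h h' f := Subtype.ext (funext fun t => S.res_res _ _ _)
  locality f g H := Subtype.ext (funext fun t => S.locality _ _ fun x hx => by
    obtain ⟨W, h, hW, e⟩ := H (t, x) hx
    exact ⟨timeSlice W t, fun _ hy => h hy, hW, congrFun (congrArg Subtype.val e) t⟩)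
  gluing := timeFun_gluing
  gr W := S.timeFunPart W
  gr_isCompl := timeFunPart_isCompl
  one_mem W t := S.one_mem _
  mul_mem ha hb t := S.mul_mem (ha t) (hb t)
  res_mem h _ _ ha t := S.res_mem _ (ha t)
  supercomm ha hb := Subtype.ext (funext fun t => S.supercomm (ha t) (hb t))
  val W := AlgHom.mk'
    { toFun := fun f x => S.val (timeSlice W x.1.1) (f.1 x.1.1) ⟨x.1.2, x.2⟩
      map_one' := by ext; simp
      map_mul' := by intros; ext; simp
      map_zero' := by ext; simp
      map_add' := by intros; ext; simp } (by intros; ext; simp)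
  val_res h f x := S.val_res _ (f.1 x.1.1) ⟨x.1.2, x.2⟩

variable {S}

/-- `g` is the derivative of the superfunction `f` on `W` in the direction of the time. -/
def IsTimeDeriv {W : Opens S.timeProd.body} (f g : S.timeProd.O W) : Prop :=
  ∀ (p q : ℕ) (V : Opens (Fin p → ℝ)) (c : Hom (superDomain p q V) S), c.IsOpenImmersion →
    ∀ z ∈ timeDom S c W, ∀ l : Grassmann q →ₗ[ℝ] ℝ,
      HasDerivAt (fun t => l (timeExpr S c f.1 (t, z.2))) (l (timeExpr S c g.1 z)) z.1

open Classical in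
/-- The even vector field of differentiation with respect to the time on `ℝ × S`. -/
def timeDeriv {W : Opens S.timeProd.body} (f : S.timeProd.O W) : S.timeProd.O W :=
  if h : ∃ g, IsTimeDeriv f g then h.choose else 0

/-- The embedding of `S` at time `0` into an open subspace of `ℝ × S` that contains the image. -/
def injZero (W : Opens S.timeProd.body) (h : ∀ s, ((0 : ℝ), s) ∈ W) :
    Hom S (S.timeProd.restrict W) where
  toMap := ⟨fun s => ⟨(0, s), h s⟩, by
    exact Continuous.subtype_mk (continuous_const.prodMk continuous_id) _⟩
  pull U := (S.res (U := timeSlice (up U) 0) fun s hs => mem_up.2 ⟨h s, hs⟩).comp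
    ((Pi.evalAlgHom ℝ (fun t => S.O (timeSlice (up U) t)) 0).comp (S.timeFun (up U)).val)
  pull_res _ f := (S.res_res _ _ _).trans (S.res_res _ _ _).symm
  pull_mem ha := S.res_mem _ (ha 0)
  pull_val f x := S.val_res _ (f.1 0) x

end SuperSpace

/-! ### The tangent bundle -/

namespace SuperSpace

/-- An even numerical tangent vector of `N` at a point `pt`: an even derivation of the stalk at `pt`
with values in the real numbers. -/
@[ext]
structure TangentVec (N : SuperSpace.{u}) where
  pt : N.body
  app : ∀ U : Opens N.body, pt ∈ U → (N.O U →ₗ[ℝ] ℝ)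
  app_res : ∀ {U V : Opens N.body} (h : V ≤ U) (hp : pt ∈ V) (a : N.O U),
    app V hp (N.res h a) = app U (h hp) a
  app_odd : ∀ {U : Opens N.body} (hp : pt ∈ U) {a : N.O U}, a ∈ N.gr U 1 → app U hp a = 0
  leibniz : ∀ {U : Opens N.body} (hp : pt ∈ U) (a b : N.O U),
    app U hp (a * b) = app U hp a * N.val U b ⟨pt, hp⟩ + N.val U a ⟨pt, hp⟩ * app U hp b

/-- The topology of the body of the tangent bundle: the coarsest one for which the projection and
the fibrewise linear functions defined by the superfunctions of `N` are continuous. -/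
instance (N : SuperSpace.{u}) : TopologicalSpace (TangentVec N) :=
  .generateFrom {s | ∃ (U : Opens N.body) (a : N.O U) (I : Set ℝ), IsOpen I ∧
    s = {ξ | ∃ h : ξ.pt ∈ U, ξ.app U h a ∈ I}}

/-- A morphism from `A` to `N` together with an even vector field along it. -/
@[ext]
structure TangentPoint (A : SuperSpace.{u}) (N : SuperSpace.{v}) where
  base : Hom A N
  vec : ∀ U : Opens N.body, N.O U →ₗ[ℝ] A.O (U.comap base.toMap)
  vec_res : ∀ {U V : Opens N.body} (h : V ≤ U) (a : N.O U),
    vec V (N.res h a) = A.res (fun _ hx => h hx) (vec U a)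
  vec_mem : ∀ {U : Opens N.body} {i : ZMod 2} {a : N.O U}, a ∈ N.gr U i → vec U a ∈ A.gr _ i
  leibniz : ∀ {U : Opens N.body} (a b : N.O U),
    vec U (a * b) = vec U a * base.pull U b + base.pull U a * vec U b

lemma Hom.ext' {X : SuperSpace.{u}} {Y : SuperSpace.{v}} {f g : Hom X Y} (h : f.toMap = g.toMap)
    (h' : ∀ U a, f.pull U a = X.res (by rw [h]) (g.pull U a)) : f = g := by
  cases f; cases g; cases h
  congr 1
  funext U
  ext a
  exact (h' U a).trans (X.res_self _ _)

lemma TangentPoint.ext' {A : SuperSpace.{u}} {N : SuperSpace.{v}} {f g : TangentPoint A N}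
    (h : f.base = g.base) (h' : ∀ U a, f.vec U a = A.res (by rw [h]) (g.vec U a)) : f = g := by
  cases f; cases g; cases h
  congr 1
  funext U
  ext a
  exact (h' U a).trans (A.res_self _ _)

/-- Composition of an even vector field along a morphism with a morphism. -/
def TangentPoint.precomp {A : SuperSpace.{u}} {N : SuperSpace.{v}} {A' : SuperSpace.{w}}
    (ξ : TangentPoint A N) (ψ : Hom A' A) : TangentPoint A' N where
  base := ξ.base.comp ψ
  vec U := (ψ.pull (U.comap ξ.base.toMap)).toLinearMap.comp (ξ.vec U)
  vec_res {U V} h a := (congrArg (ψ.pull _) (ξ.vec_res h a)).trans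
    (ψ.pull_res (U := U.comap ξ.base.toMap) (V := V.comap ξ.base.toMap) (fun _ hx => h hx)
      (ξ.vec U a))
  vec_mem h := ψ.pull_mem (ξ.vec_mem h)
  leibniz a b := (congrArg (ψ.pull _) (ξ.leibniz a b)).trans (by
    rw [map_add, map_mul, map_mul]; rfl)

/-- The underlying map of an even vector field along a morphism. -/
def TangentPoint.bodyMap {A : SuperSpace.{u}} {N : SuperSpace.{v}} (ξ : TangentPoint A N)
    (x : A.body) : TangentVec N where
  pt := ξ.base.toMap x
  app U h :=
    { toFun := fun a => A.val _ (ξ.vec U a) ⟨x, h⟩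
      map_add' := by intros; simp
      map_smul' := by intros; simp }
  app_res h hp a := (congrArg (fun b => A.val _ b ⟨x, hp⟩) (ξ.vec_res h a)).trans
    (A.val_res _ _ _)
  app_odd {U} hp a ha := congrFun (A.val_odd (ξ.vec_mem ha)) ⟨x, hp⟩
  leibniz {U} hp a b := by
    have := congrArg (fun c => A.val _ c ⟨x, hp⟩) (ξ.leibniz a b)
    simp only [map_add, map_mul, Pi.add_apply, Pi.mul_apply, ξ.base.pull_val] at this
    exact this

lemma TangentPoint.bodyMap_precomp {A : SuperSpace.{u}} {N : SuperSpace.{v}}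
    {A' : SuperSpace.{w}} (ξ : TangentPoint A N) (ψ : Hom A' A) (x : A'.body) :
    (ξ.precomp ψ).bodyMap x = ξ.bodyMap (ψ.toMap x) := by
  refine TangentVec.ext rfl (heq_of_eq ?_)
  funext U h
  ext a
  exact ψ.pull_val (ξ.vec U a) ⟨x, h⟩

lemma TangentPoint.continuous_bodyMap {p q : ℕ} {V : Opens (Fin p → ℝ)} {N : SuperSpace.{v}}
    (ξ : TangentPoint (superDomain p q V) N) : Continuous ξ.bodyMap := by
  refine continuous_generateFrom_iff.2 ?_
  rintro _ ⟨U, a, I, hI, rfl⟩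
  have h1 := superDomain_val_continuous (ξ.vec U a)
  have h2 := (U.comap ξ.base.toMap).isOpen.isOpenMap_subtype_val _ (hI.preimage h1)
  convert h2 using 1
  ext x
  constructor
  · rintro ⟨h, hx⟩; exact ⟨⟨x, h⟩, hx, rfl⟩
  · rintro ⟨y, hy, rfl⟩; exact ⟨y.2, hy⟩

/-- A superdomain with an even vector field along a morphism to `N` whose underlying map has values
in the set `W` of tangent vectors. -/
structure TestPoint (N : SuperSpace.{u}) (W : Set (TangentVec N)) where
  p : ℕ
  q : ℕ
  V : Opens (Fin p → ℝ)
  point : TangentPoint (superDomain p q V) N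
  mem : ∀ x, point.bodyMap x ∈ W

namespace TestPoint

variable {N : SuperSpace.{u}} {W W' : Set (TangentVec N)}

/-- The superdomain of a test point. -/
abbrev dom (τ : TestPoint N W) : SuperSpace.{0} := superDomain τ.p τ.q τ.V

/-- Composition of a test point with a morphism of superdomains. -/
def precomp (τ : TestPoint N W) {p q : ℕ} {V : Opens (Fin p → ℝ)}
    (ψ : Hom (superDomain p q V) τ.dom) : TestPoint N W :=
  ⟨p, q, V, τ.point.precomp ψ, fun x => by rw [TangentPoint.bodyMap_precomp]; exact τ.mem _⟩

/-- A test point with values in a smaller set, regarded as one with values in a larger set. -/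
def mono (h : W' ⊆ W) (τ : TestPoint N W') : TestPoint N W :=
  ⟨τ.p, τ.q, τ.V, τ.point, fun x => h (τ.mem x)⟩

end TestPoint

/-- Pull-back of global superfunctions. -/
def Hom.pullTop {X : SuperSpace.{u}} {Y : SuperSpace.{v}} (f : Hom X Y) : Y.O ⊤ →ₐ[ℝ] X.O ⊤ :=
  f.pullTo fun _ _ => trivial

lemma Hom.pullTop_comp {X : SuperSpace.{u}} {Y : SuperSpace.{v}} {Z : SuperSpace.{w}}
    (g : Hom Y Z) (f : Hom X Y) (a : Z.O ⊤) :
    (g.comp f).pullTop a = f.pullTop (g.pullTop a) :=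
  (X.res_res _ _ _).symm.trans (congrArg (X.res _)
    (f.pull_res (U := (⊤ : Opens Z.body).comap g.toMap) (V := ⊤) (fun _ _ => trivial)
      (g.pull ⊤ a)).symm)

variable (N : SuperSpace.{u})

/-- The superfunctions on the open subset `W` of the tangent bundle of `N`. The tangent bundle
represents the functor that maps `A` to the set of even vector fields along morphisms from `A` to
`N`, so that a superfunction on it is a family of superfunctions on the superdomains `A`, one for
each element of this set, that is natural in `A`. In coordinates `x i` of `N` the tangent bundle has
the coordinates `x i` and `v i`, whose values on a vector field `X` along a morphism are the
pull-back of `x i` and `X (x i)`. -/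
def tangentFun (W : Set (TangentVec N)) : Subalgebra ℝ (∀ τ : TestPoint N W, τ.dom.O ⊤) where
  carrier := {f | ∀ (τ : TestPoint N W) (p q : ℕ) (V : Opens (Fin p → ℝ))
    (ψ : Hom (superDomain p q V) τ.dom), f (τ.precomp ψ) = ψ.pullTop (f τ)}
  mul_mem' {f g} hf hg τ p q V ψ := by
    rw [Pi.mul_apply, Pi.mul_apply, map_mul, ← hf, ← hg]; rfl
  add_mem' {f g} hf hg τ p q V ψ := by
    rw [Pi.add_apply, Pi.add_apply, map_add, ← hf, ← hg]; rfl
  algebraMap_mem' r τ p q V ψ := (AlgHom.commutes _ r).symm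

variable {N}

/-- Restriction of superfunctions on the tangent bundle. -/
def tangentFunRes {W W' : Set (TangentVec N)} (h : W' ⊆ W) : N.tangentFun W →ₐ[ℝ] N.tangentFun W' :=
  AlgHom.mk'
    { toFun := fun f => ⟨fun τ => f.1 (τ.mono h), fun τ p q V ψ => f.2 (τ.mono h) p q V ψ⟩
      map_one' := rfl
      map_mul' := fun _ _ => rfl
      map_zero' := rfl
      map_add' := fun _ _ => rfl } (fun _ _ => rfl)

variable (N) in
/-- The superfunctions of parity `i` on the tangent bundle. -/
def tangentFunPart (W : Set (TangentVec N)) (i : ZMod 2) : Submodule ℝ (N.tangentFun W) where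
  carrier := {f | ∀ τ, f.1 τ ∈ τ.dom.gr ⊤ i}
  add_mem' hf hg τ := Submodule.add_mem _ (hf τ) (hg τ)
  zero_mem' _ := Submodule.zero_mem _
  smul_mem' r _ hf τ := Submodule.smul_mem _ r (hf τ)

lemma Hom.pullTop_mem {X : SuperSpace.{u}} {Y : SuperSpace.{v}} (f : Hom X Y) {i : ZMod 2}
    {a : Y.O ⊤} (h : a ∈ Y.gr ⊤ i) : f.pullTop a ∈ X.gr ⊤ i :=
  X.res_mem _ (f.pull_mem h)

lemma parts_unique (X : SuperSpace.{u}) {U : Opens X.body} {a b a' b' : X.O U}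
    (ha : a ∈ X.gr U 0) (hb : b ∈ X.gr U 1) (ha' : a' ∈ X.gr U 0) (hb' : b' ∈ X.gr U 1)
    (h : a + b = a' + b') : a = a' ∧ b = b' := by
  have h2 : a - a' = b' - b := by rw [sub_eq_sub_iff_add_eq_add, h, add_comm]
  have h3 := Submodule.disjoint_def.1 (X.gr_isCompl U).disjoint _ (Submodule.sub_mem _ ha ha')
    (h2 ▸ Submodule.sub_mem _ hb' hb)
  exact ⟨sub_eq_zero.1 h3, (sub_eq_zero.1 (h2.symm.trans h3)).symm⟩

lemma tangentFunPart_isCompl (W : Set (TangentVec N)) :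
    IsCompl (N.tangentFunPart W 0) (N.tangentFunPart W 1) := by
  refine isCompl_of (fun f h0 h1 => Subtype.ext (funext fun τ =>
    Submodule.disjoint_def.1 (τ.dom.gr_isCompl _).disjoint _ (h0 τ) (h1 τ))) fun f => ?_
  have h : ∀ τ : TestPoint N W, ∃ a ∈ τ.dom.gr ⊤ 0, ∃ b ∈ τ.dom.gr ⊤ 1, a + b = f.1 τ :=
    fun τ => Submodule.mem_sup.1 ((τ.dom.gr_isCompl _).sup_eq_top ▸ Submodule.mem_top)
  choose a ha b hb hab using h
  have key : ∀ (τ : TestPoint N W) (p q : ℕ) (V : Opens (Fin p → ℝ))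
      (ψ : Hom (superDomain p q V) τ.dom),
      a (τ.precomp ψ) = ψ.pullTop (a τ) ∧ b (τ.precomp ψ) = ψ.pullTop (b τ) :=
    fun τ p q V ψ => parts_unique _ (ha _) (hb _) (ψ.pullTop_mem (ha τ)) (ψ.pullTop_mem (hb τ))
      ((hab _).trans ((f.2 τ p q V ψ).trans ((congrArg ψ.pullTop (hab τ).symm).trans
        (map_add _ _ _))))
  exact ⟨⟨a, fun τ p q V ψ => (key τ p q V ψ).1⟩, ha, ⟨b, fun τ p q V ψ => (key τ p q V ψ).2⟩, hb,
    Subtype.ext (funext hab)⟩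

/-- The inclusion of an open subspace. -/
def inclusion (X : SuperSpace.{u}) (W : Opens X.body) : Hom (X.restrict W) X where
  toMap := ⟨Subtype.val, continuous_subtype_val⟩
  pull _ := X.res fun _ hx => (mem_up.1 hx).2
  pull_res _ f := (X.res_res _ _ f).trans (X.res_res _ _ f).symm
  pull_mem := X.res_mem _
  pull_val f _ := X.val_res _ f _

/-- A morphism with values in an open subset, regarded as a morphism to the open subspace. -/
def Hom.codRestrict {X : SuperSpace.{u}} {Y : SuperSpace.{v}} (f : Hom X Y) (W : Opens Y.body)
    (h : ∀ x, f.toMap x ∈ W) : Hom X (Y.restrict W) where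
  toMap := ⟨fun x => ⟨f.toMap x, h x⟩, by
    have := f.toMap.continuous
    exact Continuous.subtype_mk this _⟩
  pull U := f.pullTo (U := up U) fun x hx => mem_up.2 ⟨h x, hx⟩
  pull_res h' a := (congrArg (X.res _) (f.pull_res (up_mono h') a)).trans
    ((X.res_res _ _ _).trans (X.res_res _ _ _).symm)
  pull_mem ha := X.res_mem _ (f.pull_mem ha)
  pull_val a x := (X.val_res _ _ x).trans (f.pull_val a _)

lemma codRestrict_incl {X : SuperSpace.{u}} {Y : SuperSpace.{v}}
    {V P : Opens Y.body}
    (f : Hom X (Y.restrict V)) (hP : P ≤ V) (h : ∀ x, ((inclusion Y V).comp f).toMap x ∈ P) :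
    (Y.restrictIncl hP).comp (((inclusion Y V).comp f).codRestrict P h) = f := by
  refine Hom.ext' rfl fun U a => ?_
  have hQ : (up (U.comap (Y.restrictIncl hP).toMap)).comap (inclusion Y V).toMap ≤ U :=
    fun x hx => (mem_up.1 hx).2
  exact (congrArg (X.res _) ((congrArg (f.pull _) (Y.res_res _ _ a)).trans
    (f.pull_res (U := U) hQ a))).trans (X.res_res _ _ _)

section Gluing

variable {N : SuperSpace.{u}} {W : Set (TangentVec N)}

/-- The open set of points of the domain of a test point that are mapped to `W'`. -/
def TestPoint.preim (τ : TestPoint N W) (W' : Opens (TangentVec N)) : Opens (Fin τ.p → ℝ) :=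
  up (W := τ.V) ⟨τ.point.bodyMap ⁻¹' W', W'.isOpen.preimage τ.point.continuous_bodyMap⟩

lemma TestPoint.preim_le (τ : TestPoint N W) (W' : Opens (TangentVec N)) : τ.preim W' ≤ τ.V :=
  fun _ hx => (mem_up.1 hx).1

/-- The restriction of a test point to the open set of points that are mapped to `W'`. -/
def TestPoint.loc (τ : TestPoint N W) (W' : Opens (TangentVec N)) :
    TestPoint N (W' : Set (TangentVec N)) :=
  ⟨τ.p, τ.q, τ.preim W', τ.point.precomp (restrictIncl _ (τ.preim_le W')), fun x => by
    rw [TangentPoint.bodyMap_precomp]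
    exact (mem_up.1 x.2).2⟩

/-- The value of a global superfunction on a superdomain at a point. -/
def domValue {p q : ℕ} {V : Opens (Fin p → ℝ)} (g : (superDomain p q V).O ⊤) (y : V) : Grassmann q :=
  g.1 ⟨y, mem_up.2 ⟨y.2, trivial⟩⟩

lemma domValue_ext {p q : ℕ} {V : Opens (Fin p → ℝ)} {g g' : (superDomain p q V).O ⊤}
    (h : ∀ y, domValue g y = domValue g' y) : g = g' :=
  Subtype.ext (funext fun y => h ⟨y.1, (mem_up.1 y.2).1⟩)

lemma domValue_incl {p q : ℕ} {V V' : Opens (Fin p → ℝ)} (h : V' ≤ V)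
    (g : (superDomain p q V).O ⊤) (y : V') :
    domValue ((restrictIncl (superR p q) h).pullTop g) y = domValue g ⟨y, h y.2⟩ := rfl

/-- The value of a superfunction on `W'` on the restriction of a test point. -/
def locValue (τ : TestPoint N W) (W' : Opens (TangentVec N))
    (f : N.tangentFun (W' : Set (TangentVec N))) (y : τ.preim W') : Grassmann τ.q :=
  domValue (f.1 (τ.loc W')) y

lemma mem_preim {τ : TestPoint N W} {W' : Opens (TangentVec N)} {y : τ.V} :
    y.1 ∈ τ.preim W' ↔ τ.point.bodyMap y ∈ W' := coe_mem_up

lemma locValue_res (τ : TestPoint N W) {W' W'' : Opens (TangentVec N)} (h : W'' ≤ W')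
    (f : N.tangentFun (W' : Set (TangentVec N))) {y : Fin τ.p → ℝ} (hy : y ∈ τ.preim W'')
    (hy' : y ∈ τ.preim W') :
    locValue τ W'' (tangentFunRes h f) ⟨y, hy⟩ = locValue τ W' f ⟨y, hy'⟩ := by
  have hle : τ.preim W'' ≤ τ.preim W' := up_mono fun _ hx => h hx
  have e := f.2 (τ.loc W') τ.p τ.q (τ.preim W'') (restrictIncl (superR τ.p τ.q) hle)
  exact congrArg (fun g => domValue g ⟨y, hy⟩) e

/-- The values of a natural family on a test point are those on its restrictions. -/
lemma domValue_loc (τ : TestPoint N W) (W' : Opens (TangentVec N))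
    (h : (W' : Set (TangentVec N)) ⊆ W) (f : N.tangentFun W) {y : Fin τ.p → ℝ}
    (hy : y ∈ τ.preim W') :
    locValue τ W' (tangentFunRes h f) ⟨y, hy⟩ = domValue (f.1 τ) ⟨y, τ.preim_le W' hy⟩ :=
  congrArg (fun g => domValue g ⟨y, hy⟩) (f.2 τ _ _ _ (restrictIncl (superR τ.p τ.q)
    (τ.preim_le W')))

/-- A natural family is determined on a test point by its values on the restrictions. -/
lemma locValue_mono (W' : Opens (TangentVec N)) (h : (W' : Set (TangentVec N)) ⊆ W)
    (f : N.tangentFun (W' : Set (TangentVec N))) (τ : TestPoint N (W' : Set (TangentVec N)))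
    {y : Fin τ.p → ℝ} (hy : y ∈ (τ.mono h).preim W') :
    locValue (τ.mono h) W' f ⟨y, hy⟩ = domValue (f.1 τ) ⟨y, (τ.mono h).preim_le W' hy⟩ :=
  congrArg (fun g => domValue g ⟨y, hy⟩) (f.2 τ _ _ _ (restrictIncl (superR τ.p τ.q)
    ((τ.mono h).preim_le W')))

lemma congr_point {p q : ℕ} {V : Opens (Fin p → ℝ)} {a b : TangentPoint (superDomain p q V) N}
    (f : N.tangentFun W) (h : a = b) (hb : ∀ x, b.bodyMap x ∈ W) :
    f.1 ⟨p, q, V, a, fun x => h ▸ hb x⟩ = f.1 ⟨p, q, V, b, hb⟩ := by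
  subst h; rfl

lemma locValue_precomp (τ : TestPoint N W) {p q : ℕ} {V : Opens (Fin p → ℝ)}
    (ψ : Hom (superDomain p q V) τ.dom) (W' : Opens (TangentVec N))
    (f : N.tangentFun (W' : Set (TangentVec N))) (g : τ.dom.O ⊤)
    (hg : ∀ (y : τ.V) (hi : y.1 ∈ τ.preim W'), domValue g y = locValue τ W' f ⟨y, hi⟩)
    {y : Fin p → ℝ} (hy : y ∈ (τ.precomp ψ).preim W') :
    locValue (τ.precomp ψ) W' f ⟨y, hy⟩ =
      domValue (ψ.pullTop g) ⟨y, (τ.precomp ψ).preim_le W' hy⟩ := by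
  have hle := (τ.precomp ψ).preim_le W'
  have hP := τ.preim_le W'
  have hmem : ∀ x, ((inclusion (superR τ.p τ.q) τ.V).comp (ψ.comp
      (restrictIncl (superR p q) hle))).toMap x ∈ τ.preim W' := fun x => by
    have h1 := (mem_up.1 x.2).2
    have h2 : (τ.point.precomp ψ).bodyMap ⟨x.1, hle x.2⟩ ∈ W' := h1
    have h3 := τ.point.bodyMap_precomp ψ ⟨x.1, hle x.2⟩
    exact mem_preim.2 (h3 ▸ h2)
  have e1 := codRestrict_incl (ψ.comp (restrictIncl (superR p q) hle)) hP hmem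
  set ψ' := ((inclusion (superR τ.p τ.q) τ.V).comp (ψ.comp
      (restrictIncl (superR p q) hle))).codRestrict (τ.preim W') hmem
  have e2 : (restrictIncl (superR τ.p τ.q) hP).pullTop g = f.1 (τ.loc W') :=
    domValue_ext fun z => hg ⟨z.1, hP z.2⟩ z.2
  have e3 : (τ.loc W').point.precomp ψ' = ((τ.precomp ψ).loc W').point :=
    congrArg (fun c => τ.point.precomp c) e1
  have e4 := f.2 (τ.loc W') p q _ ψ'
  have e5 : ψ'.pullTop (f.1 (τ.loc W')) =
      (restrictIncl (superR p q) hle).pullTop (ψ.pullTop g) := by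
    rw [← e2, ← Hom.pullTop_comp, e1, Hom.pullTop_comp]
    rfl
  have e6 : f.1 ((τ.precomp ψ).loc W') = (restrictIncl (superR p q) hle).pullTop (ψ.pullTop g) :=
    (congr_point f e3 _).symm.trans (e4.trans e5)
  exact congrArg (fun g => domValue g ⟨y, hy⟩) e6

lemma tangentFun_gluing {ι : Type u} (W : ι → Opens (TangentVec N))
    (s : ∀ i, N.tangentFun (W i : Set (TangentVec N)))
    (H : ∀ i j, tangentFunRes (show ((W i ⊓ W j : Opens (TangentVec N)) : Set (TangentVec N)) ⊆ W i
        from fun _ h => h.1) (s i) =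
      tangentFunRes (show ((W i ⊓ W j : Opens (TangentVec N)) : Set (TangentVec N)) ⊆ W j
        from fun _ h => h.2) (s j)) :
    ∃ f : N.tangentFun ((⨆ i, W i : Opens (TangentVec N)) : Set (TangentVec N)),
      ∀ i, tangentFunRes (show (W i : Set (TangentVec N)) ⊆ _ from le_iSup W i) f = s i := by
  have hk : ∀ (τ : TestPoint N ((⨆ i, W i : Opens (TangentVec N)) : Set (TangentVec N))) (y : τ.V),
      ∃ i, y.1 ∈ τ.preim (W i) := fun τ y => by
    obtain ⟨i, hi⟩ := Opens.mem_iSup.1 (τ.mem y)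
    exact ⟨i, mem_preim.2 hi⟩
  choose k hk using hk
  have key : ∀ (τ : TestPoint N ((⨆ i, W i : Opens (TangentVec N)) : Set (TangentVec N)))
      (y : Fin τ.p → ℝ) (i j) (hi : y ∈ τ.preim (W i)) (hj : y ∈ τ.preim (W j)),
      locValue τ (W i) (s i) ⟨y, hi⟩ = locValue τ (W j) (s j) ⟨y, hj⟩ := by
    intro τ y i j hi hj
    have hy : y ∈ τ.preim (W i ⊓ W j) := up_inf _ _ ⟨hi, hj⟩
    rw [← locValue_res τ inf_le_left (s i) hy hi, ← locValue_res τ inf_le_right (s j) hy hj]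
    exact congrArg (fun f => locValue τ _ f ⟨y, hy⟩) (H i j)
  have hg : ∀ τ : TestPoint N ((⨆ i, W i : Opens (TangentVec N)) : Set (TangentVec N)),
      ∃ g : τ.dom.O ⊤, ∀ (i) (y : τ.V) (hi : y.1 ∈ τ.preim (W i)),
        domValue g y = locValue τ (W i) (s i) ⟨y, hi⟩ := by
    intro τ
    have hV : ∀ z : (up ⊤ : Opens (Fin τ.p → ℝ)), z.1 ∈ τ.V := fun z => (mem_up.1 z.2).1
    refine ⟨⟨fun z => locValue τ _ (s (k τ ⟨z.1, hV z⟩)) ⟨z.1, hk τ ⟨z.1, hV z⟩⟩, ?_⟩,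
      fun i y hi => key τ y.1 _ i _ hi⟩
    refine GrassmannSmooth.of_locally fun z hz => ?_
    have hz' : z ∈ τ.V := (mem_up.1 hz).1
    obtain ⟨i, hi⟩ : ∃ i, z ∈ τ.preim (W i) := ⟨_, hk τ ⟨z, hz'⟩⟩
    refine ⟨τ.preim (W i), (τ.preim (W i)).isOpen, hi, GrassmannSmooth.congr
      (f := extendZero _ ((s i).1 (τ.loc (W i))).1) (fun l => ?_) fun y hy => ?_⟩
    · exact ((((s i).1 (τ.loc (W i))).2) l).mono fun y hy => mem_up.2 ⟨hy, Opens.mem_top _⟩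
    · exact (extendZero_of_mem _ (mem_up.2 ⟨τ.preim_le _ hy, Opens.mem_top _⟩)).trans
        ((key τ y _ i _ hy).trans
          (extendZero_of_mem _ (mem_up.2 ⟨hy, Opens.mem_top _⟩)).symm)
  choose g hg using hg
  refine ⟨⟨g, fun τ p q V ψ => domValue_ext fun y => ?_⟩, fun i => ?_⟩
  · obtain ⟨i, hi⟩ : ∃ i, y.1 ∈ (τ.precomp ψ).preim (W i) := ⟨_, hk (τ.precomp ψ) y⟩
    exact (hg (τ.precomp ψ) i y hi).trans
      (locValue_precomp τ ψ (W i) (s i) (g τ) (hg τ i) hi)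
  · refine Subtype.ext (funext fun τ => domValue_ext fun y => ?_)
    have hi : y.1 ∈ (τ.mono (le_iSup W i)).preim (W i) := mem_preim.2 (τ.mem y)
    exact (hg (τ.mono (le_iSup W i)) i y hi).trans (locValue_mono (W i) _ (s i) τ hi)

end Gluing

end SuperSpace

namespace SuperSpace

variable {N : SuperSpace.{u}}

/-- The superspace consisting of one point. -/
abbrev superPoint : SuperSpace.{0} := superDomain 0 0 ⊤

/-- The point of `superPoint`. -/
def superPoint.pt : superPoint.body := ⟨fun i => i.elim0, trivial⟩

/-- Real functions on a subset of the point, as superfunctions. -/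
def superPointConst (U : Set (Fin 0 → ℝ)) : (U → ℝ) →ₐ[ℝ] superFun 0 0 U :=
  AlgHom.codRestrict (AlgHom.pi fun x =>
      (Algebra.ofId ℝ (Grassmann 0)).comp (Pi.evalAlgHom ℝ (fun _ => ℝ) x)) _ fun g => by
    refine GrassmannSmooth.of_locally fun x hx => ⟨Set.univ, isOpen_univ, trivial, ?_⟩
    exact (GrassmannSmooth.const (extendZero U (fun x => algebraMap ℝ (Grassmann 0) (g x)) 0)).congr
      fun y _ => by rw [Subsingleton.elim y 0]; rfl

lemma superPointConst_apply (U : Set (Fin 0 → ℝ)) (g : U → ℝ) (x : U) :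
    (superPointConst U g).1 x = algebraMap ℝ (Grassmann 0) (g x) := rfl

lemma algebraMap_grassmann_mem (q : ℕ) (r : ℝ) :
    algebraMap ℝ (Grassmann q) r ∈ grassmannPart q 0 := by
  rw [Algebra.algebraMap_eq_smul_one]
  exact Submodule.smul_mem _ _
    (CliffordAlgebra.one_le_evenOdd_zero _ (Submodule.one_le.1 le_rfl))

lemma algebraMap_grassmann_mem' (q : ℕ) {r : ℝ} {i : ZMod 2} (h : i = 1 → r = 0) :
    algebraMap ℝ (Grassmann q) r ∈ grassmannPart q i := by
  have h2 : ∀ k : ZMod 2, k = 0 ∨ k = 1 := by decide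
  rcases h2 i with rfl | rfl
  · exact algebraMap_grassmann_mem q r
  · rw [h rfl, map_zero]; exact Submodule.zero_mem _

/-- The morphism from the one point space to `N` given by a point of `N`. -/
def pointHom (x : N.body) : Hom superPoint N where
  toMap := ⟨fun _ => x, continuous_const⟩
  pull U := (superPointConst _).comp ((AlgHom.pi fun y =>
    Pi.evalAlgHom ℝ (fun _ : U => ℝ) ⟨x, (mem_up.1 y.2).2⟩).comp (N.val U))
  pull_res h a := congrArg (superPointConst _) (funext fun y => N.val_res h a _)
  pull_mem {U i a} ha y := algebraMap_grassmann_mem' 0 (by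
    rintro rfl
    exact congrFun (N.val_odd ha) _)
  pull_val a y := ExteriorAlgebra.algebraMap_leftInverse _ _

/-- A tangent vector of `N` as an even vector field along a morphism from the one point space. -/
def TangentVec.toPoint (ξ : TangentVec N) : TangentPoint superPoint N where
  base := pointHom ξ.pt
  vec U := (superPointConst _).toLinearMap.comp (LinearMap.pi fun y => ξ.app U (mem_up.1 y.2).2)
  vec_res h a := congrArg (superPointConst _) (funext fun y => ξ.app_res h _ a)
  vec_mem {U i a} ha y := algebraMap_grassmann_mem' 0 (by
    rintro rfl
    exact ξ.app_odd _ ha)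
  leibniz {U} a b := (congrArg (superPointConst _)
    (funext fun y => ξ.leibniz (mem_up.1 y.2).2 a b)).trans (by
      refine (map_add (superPointConst _) _ _).trans ?_
      exact congrArg₂ (· + ·) (map_mul (superPointConst _) _ _) (map_mul (superPointConst _) _ _))

lemma TangentVec.toPoint_bodyMap (ξ : TangentVec N) (x : superPoint.body) :
    ξ.toPoint.bodyMap x = ξ := by
  refine TangentVec.ext rfl (heq_of_eq ?_)
  funext U h
  ext a
  exact ExteriorAlgebra.algebraMap_leftInverse _ _

/-- A tangent vector as a test point. -/
def TangentVec.toTest {W : Set (TangentVec N)} (ξ : W) : TestPoint N W :=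
  ⟨0, 0, ⊤, ξ.1.toPoint, fun x => by rw [TangentVec.toPoint_bodyMap]; exact ξ.2⟩

variable (N)

/-- The tangent bundle of `N`. -/
def tangent : SuperSpace.{u} where
  body := TangentVec N
  O W := N.tangentFun W
  res h := tangentFunRes h
  res_self _ _ := rfl
  res_res _ _ _ := rfl
  locality {W} f g H := Subtype.ext (funext fun τ => domValue_ext fun y => by
    obtain ⟨W', h, hy, e⟩ := H _ (τ.mem y)
    have hy' : y.1 ∈ τ.preim W' := mem_preim.2 hy
    exact (domValue_loc τ W' h f hy').symm.trans ((congrArg (fun f =>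
      locValue τ W' f ⟨y.1, hy'⟩) e).trans (domValue_loc τ W' h g hy')))
  gluing := tangentFun_gluing
  gr W := N.tangentFunPart W
  gr_isCompl W := tangentFunPart_isCompl _
  one_mem W τ := τ.dom.one_mem _
  mul_mem ha hb τ := τ.dom.mul_mem (ha τ) (hb τ)
  res_mem h _ _ ha τ := ha (τ.mono h)
  supercomm ha hb := Subtype.ext (funext fun τ => τ.dom.supercomm (ha τ) (hb τ))
  val W := AlgHom.mk'
    { toFun := fun f ξ => superPoint.val ⊤ (f.1 (TangentVec.toTest ξ)) ⟨superPoint.pt, trivial⟩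
      map_one' := by ext; exact congrFun (map_one (superPoint.val ⊤)) _
      map_mul' := by intros; ext; exact congrFun (map_mul (superPoint.val ⊤) _ _) _
      map_zero' := by ext; exact congrFun (map_zero (superPoint.val ⊤)) _
      map_add' := by intros; ext; exact congrFun (map_add (superPoint.val ⊤) _ _) _ }
    (by intros; ext; exact congrFun (map_smul (superPoint.val ⊤) _ _) _)
  val_res _ _ _ := rfl

variable {N}

/-- The natural family of superfunctions defined by a natural family of sections. -/
lemma tangentFun_mem {W : Set (TangentVec N)} {U : Opens N.body} (hW : ∀ ξ ∈ W, ξ.pt ∈ U)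
    (F : ∀ τ : TestPoint N W, τ.dom.O (U.comap τ.point.base.toMap))
    (hF : ∀ (τ : TestPoint N W) (p q : ℕ) (V : Opens (Fin p → ℝ))
      (ψ : Hom (superDomain p q V) τ.dom), F (τ.precomp ψ) = ψ.pull _ (F τ)) :
    (fun τ : TestPoint N W => τ.dom.res (V := ⊤) (fun x _ => hW _ (τ.mem x)) (F τ)) ∈
      N.tangentFun W := fun τ p q V ψ =>
  (congrArg (SuperSpace.res _ _) (hF τ p q V ψ)).trans
    ((SuperSpace.res_res _ _ (W := (⊤ : Opens _)) (fun _ _ => Opens.mem_top _) _).symm.trans (congrArg (SuperSpace.res _ _)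
      (ψ.pull_res (U := U.comap τ.point.base.toMap) (V := ⊤) (fun x _ => hW _ (τ.mem x))
        (F τ)).symm))

/-- The pull-back of a superfunction on `N` to the tangent bundle: its value on a vector field along
a morphism `φ` is the pull-back by `φ`. -/
def tangentPull {W : Set (TangentVec N)} {U : Opens N.body} (hW : ∀ ξ ∈ W, ξ.pt ∈ U) :
    N.O U →ₐ[ℝ] N.tangentFun W :=
  AlgHom.codRestrict (AlgHom.pi fun τ =>
      τ.point.base.pullTo (V := ⊤) (fun x _ => hW _ (τ.mem x))) _ fun a =>
    tangentFun_mem hW (fun τ => τ.point.base.pull U a) fun _ _ _ _ _ => rfl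

lemma tangentPull_val {W : Set (TangentVec N)} {U : Opens N.body} (hW : ∀ ξ ∈ W, ξ.pt ∈ U)
    (a : N.O U) (ξ : W) :
    superPoint.val ⊤ ((tangentPull hW a).1 (TangentVec.toTest ξ)) ⟨superPoint.pt, trivial⟩ =
      N.val U a ⟨ξ.1.pt, hW _ ξ.2⟩ :=
  (superPoint.val_res (U := U.comap (pointHom ξ.1.pt).toMap) (V := ⊤) (fun _ _ => hW _ ξ.2)
    ((pointHom ξ.1.pt).pull U a) ⟨superPoint.pt, trivial⟩).trans
      ((pointHom ξ.1.pt).pull_val a ⟨superPoint.pt, hW _ ξ.2⟩)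

variable (N)

/-- The projection of the tangent bundle. -/
def tangentProj : Hom N.tangent N where
  toMap := ⟨TangentVec.pt, continuous_def.2 fun s hs =>
    TopologicalSpace.isOpen_generateFrom_of_mem
      ⟨⟨s, hs⟩, 0, Set.univ, isOpen_univ, Set.ext fun _ =>
        ⟨fun h => ⟨h, trivial⟩, fun h => h.1⟩⟩⟩
  pull _ := tangentPull fun _ h => h
  pull_res h a := Subtype.ext (funext fun τ =>
    (congrArg (τ.dom.res (V := ⊤) (fun x _ => τ.mem x)) (τ.point.base.pull_res h a)).trans
      (τ.dom.res_res _ _ _))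
  pull_mem ha τ := τ.dom.res_mem (V := ⊤) (fun x _ => τ.mem x) (τ.point.base.pull_mem ha)
  pull_val {U} a ξ := tangentPull_val (W := {ξ | ξ.pt ∈ U}) (fun _ h => h) a ξ

/-- The fibrewise linear superfunction on the tangent bundle given by the differential of a
superfunction on `N`: its value on an even vector field `X` along a morphism is `X a`. -/
def tangentDiff (U : Opens N.body) (a : N.O U) : N.tangent.O (U.comap N.tangentProj.toMap) :=
  (⟨fun τ => τ.dom.res (V := ⊤) (fun x _ => τ.mem x) (τ.point.vec U a),
    tangentFun_mem (fun _ h => h) (fun τ => τ.point.vec U a) fun _ _ _ _ _ => rfl⟩ :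
      N.tangentFun {ξ | ξ.pt ∈ U})

end SuperSpace

/-! ### Vector fields and connections -/

namespace SuperSpace

variable (N : SuperSpace.{u})

/-- The derivations of parity `i` of the sheaf of superfunctions on the open set `U`. -/
def superDer (U : Opens N.body) (i : ZMod 2) :
    Submodule ℝ (∀ V : Set.Iic U, N.O V →ₗ[ℝ] N.O V) where
  carrier := {D |
    (∀ (V V' : Set.Iic U) (h : V'.1 ≤ V.1) (a : N.O V), D V' (N.res h a) = N.res h (D V a)) ∧
    (∀ (V : Set.Iic U) (j : ZMod 2), ∀ a ∈ N.gr V j, D V a ∈ N.gr V (i + j)) ∧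
    (∀ (V : Set.Iic U) (j : ZMod 2), ∀ a ∈ N.gr V j, ∀ b : N.O V,
      D V (a * b) = D V a * b + superSign (i * j) • (a * D V b))}
  add_mem' {D E} hD hE := by
    refine ⟨fun V V' h a => ?_, fun V j a ha => ?_, fun V j a ha b => ?_⟩
    · simp only [Pi.add_apply, LinearMap.add_apply, map_add, hD.1 V V' h a, hE.1 V V' h a]
    · exact Submodule.add_mem _ (hD.2.1 V j a ha) (hE.2.1 V j a ha)
    · simp only [Pi.add_apply, LinearMap.add_apply, hD.2.2 V j a ha b, hE.2.2 V j a ha b, add_mul,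
        mul_add, smul_add]
      abel
  zero_mem' := by
    refine ⟨fun V V' h a => ?_, fun V j a ha => Submodule.zero_mem _, fun V j a ha b => ?_⟩ <;> simp
  smul_mem' r D hD := by
    refine ⟨fun V V' h a => ?_, fun V j a ha => ?_, fun V j a ha b => ?_⟩
    · simp only [Pi.smul_apply, LinearMap.smul_apply, map_smul, hD.1 V V' h a]
    · exact Submodule.smul_mem _ r (hD.2.1 V j a ha)
    · simp only [Pi.smul_apply, LinearMap.smul_apply, hD.2.2 V j a ha b, smul_add, smul_mul_assoc,
        mul_smul_comm, smul_comm r]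

/-- The vector fields on the open set `U`: the sums of an even and an odd derivation. -/
def vectorField (U : Opens N.body) : Submodule ℝ (∀ V : Set.Iic U, N.O V →ₗ[ℝ] N.O V) :=
  N.superDer U 0 ⊔ N.superDer U 1

variable {N}

/-- The value of a vector field on a superfunction. -/
def vectorField.app {U : Opens N.body} (X : N.vectorField U) {V : Opens N.body} (h : V ≤ U) :
    N.O V →ₗ[ℝ] N.O V := X.1 ⟨V, h⟩

/-- The restriction of a vector field. -/
def vectorField.res {U U' : Opens N.body} (h : U' ≤ U) (X : N.vectorField U) :
    N.vectorField U' :=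
  ⟨fun V => X.1 ⟨V.1, V.2.trans h⟩, by
    obtain ⟨D, hD, E, hE, e⟩ := Submodule.mem_sup.1 X.2
    refine Submodule.mem_sup.2 ⟨fun V => D ⟨V.1, V.2.trans h⟩, ?_,
      fun V => E ⟨V.1, V.2.trans h⟩, ?_, ?_⟩
    · exact ⟨fun V V' => hD.1 ⟨V.1, V.2.trans h⟩ ⟨V'.1, V'.2.trans h⟩,
        fun V => hD.2.1 ⟨V.1, V.2.trans h⟩, fun V => hD.2.2 ⟨V.1, V.2.trans h⟩⟩
    · exact ⟨fun V V' => hE.1 ⟨V.1, V.2.trans h⟩ ⟨V'.1, V'.2.trans h⟩,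
        fun V => hE.2.1 ⟨V.1, V.2.trans h⟩, fun V => hE.2.2 ⟨V.1, V.2.trans h⟩⟩
    · rw [← e]; rfl⟩

lemma superDer_mul {U : Opens N.body} {f : N.O U} {i j : ZMod 2} (hf : f ∈ N.gr U i)
    {D : ∀ V : Set.Iic U, N.O V →ₗ[ℝ] N.O V} (hD : D ∈ N.superDer U j) :
    (fun V : Set.Iic U => (LinearMap.mulLeft ℝ (N.res V.2 f)).comp (D V)) ∈
      N.superDer U (i + j) := by
  refine ⟨fun V V' h a => ?_, fun V k a ha => ?_, fun V k a ha b => ?_⟩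
  · simp only [LinearMap.comp_apply, LinearMap.mulLeft_apply, map_mul, hD.1 V V' h a]
    exact congrArg (· * _) (N.res_res _ _ f).symm
  · rw [add_assoc]
    exact N.mul_mem (N.res_mem _ hf) (hD.2.1 V k a ha)
  · simp only [LinearMap.comp_apply, LinearMap.mulLeft_apply, hD.2.2 V k a ha b]
    have h1 := N.supercomm (N.res_mem V.2 hf) ha
    have h2 : superSign ((i + j) * k) = superSign (j * k) * superSign (i * k) := by
      have h3 : ∀ k : ZMod 2, k = 0 ∨ k = 1 := by decide
      rcases h3 i with rfl | rfl <;> rcases h3 j with rfl | rfl <;> rcases h3 k with rfl | rfl <;>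
        simp [superSign, show (1 : ZMod 2) + 1 = 0 from rfl]
    have h4 : superSign (i * k) * superSign (i * k) = 1 := by
      unfold superSign; split_ifs <;> norm_num
    have h5 : a * N.res V.2 f = superSign (i * k) • (N.res V.2 f * a) := by
      rw [h1, smul_smul, h4, one_smul]
    rw [mul_add, mul_assoc, mul_smul_comm, ← mul_assoc a, h5, h2, smul_mul_assoc, smul_smul,
      mul_assoc (superSign (j * k)), h4, mul_one, mul_assoc]

/-- The product of a superfunction and a vector field. -/
def vectorField.mul {U : Opens N.body} (f : N.O U) (X : N.vectorField U) : N.vectorField U :=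
  ⟨fun V => (LinearMap.mulLeft ℝ (N.res V.2 f)).comp (X.1 V), by
    obtain ⟨D, hD, E, hE, e⟩ := Submodule.mem_sup.1 X.2
    have hf : f ∈ N.gr U 0 ⊔ N.gr U 1 := by rw [(N.gr_isCompl U).sup_eq_top]; trivial
    obtain ⟨f0, h0, f1, h1, e'⟩ := Submodule.mem_sup.1 hf
    have h00 := superDer_mul h0 hD
    have h01 := superDer_mul h0 hE
    have h10 := superDer_mul h1 hD
    have h11 := superDer_mul h1 hE
    rw [show (0 : ZMod 2) + 0 = 0 from rfl] at h00
    rw [show (0 : ZMod 2) + 1 = 1 from rfl] at h01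
    rw [show (1 : ZMod 2) + 0 = 1 from rfl] at h10
    rw [show (1 : ZMod 2) + 1 = 0 from rfl] at h11
    have key := Submodule.add_mem_sup (Submodule.add_mem _ h00 h11) (Submodule.add_mem _ h01 h10)
    refine (congrArg (· ∈ N.superDer U 0 ⊔ N.superDer U 1) ?_).mp key
    funext V
    refine LinearMap.ext fun a => ?_
    rw [← e, ← e']
    simp only [Pi.add_apply, LinearMap.add_apply, LinearMap.comp_apply, LinearMap.mulLeft_apply,
      map_add, add_mul]
    abel⟩

variable (N) in
/-- A connection on `N`: an even connection on the tangent sheaf, given by the covariant derivatives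
`nabla U X Y` of vector fields `Y` in the direction of vector fields `X` on open sets `U`. -/
structure Connection where
  nabla : ∀ U : Opens N.body, N.vectorField U →ₗ[ℝ] N.vectorField U →ₗ[ℝ] N.vectorField U
  nabla_res : ∀ {U V : Opens N.body} (h : V ≤ U) (X Y : N.vectorField U),
    vectorField.res h (nabla U X Y) = nabla V (vectorField.res h X) (vectorField.res h Y)
  nabla_mem : ∀ {U : Opens N.body} {i j : ZMod 2} {X Y : N.vectorField U},
    X.1 ∈ N.superDer U i → Y.1 ∈ N.superDer U j → (nabla U X Y).1 ∈ N.superDer U (i + j)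
  nabla_mul : ∀ {U : Opens N.body} (f : N.O U) (X Y : N.vectorField U),
    nabla U (vectorField.mul f X) Y = vectorField.mul f (nabla U X Y)
  leibniz : ∀ {U : Opens N.body} {i j : ZMod 2} {X : N.vectorField U} {f : N.O U}
    (Y : N.vectorField U), X.1 ∈ N.superDer U i → f ∈ N.gr U j →
    nabla U X (vectorField.mul f Y) =
      vectorField.mul (vectorField.app X le_rfl f) Y + superSign (i * j) • vectorField.mul f (nabla U X Y)

/-! ### Supergeodesics -/

variable {S : SuperSpace.{v}} {W : Opens S.timeProd.body}

/-- The vector field of differentiation with respect to the time on the open subspace `W` of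
`ℝ × S`. -/
def dt {U : Opens (S.timeProd.restrict W).body} (a : (S.timeProd.restrict W).O U) :
    (S.timeProd.restrict W).O U :=
  timeDeriv (W := up U) a

/-- `Z` is the covariant derivative with respect to the time of the vector field `X` along `Φ`, that
is, the derivative of `X` in the direction `dt` for the pull-back of the connection by `Φ`: if on an
open set `U` of `N` one has `X = ∑ a i • Φ^* Y i`, and the vector field `dt ∘ Φ^*` along `Φ` is
`∑ b j • Φ^* E j`, for superfunctions `a i`, `b j` on the source and vector fields `Y i`, `E j`
on `U`, then `Z = ∑ dt (a i) • Φ^* Y i + ∑ ∑ a i • b j • Φ^* (nabla (E j) (Y i))` on `U`. Such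
expressions exist on every coordinate domain `U`. -/
def IsCovDeriv (D : N.Connection) (Φ : Hom (S.timeProd.restrict W) N)
    (X Z : ∀ V : Opens N.body, N.O V → (S.timeProd.restrict W).O (V.comap Φ.toMap)) : Prop :=
  ∀ (U : Opens N.body) (k l : ℕ)
    (a : Fin k → (S.timeProd.restrict W).O (U.comap Φ.toMap)) (Y : Fin k → N.vectorField U)
    (b : Fin l → (S.timeProd.restrict W).O (U.comap Φ.toMap)) (E : Fin l → N.vectorField U),
    (∀ (V : Opens N.body) (h : V ≤ U) (f : N.O V), X V f =
      ∑ i, (S.timeProd.restrict W).res (fun _ hx => h hx) (a i) * Φ.pull V (vectorField.app (Y i) h f)) →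
    (∀ (V : Opens N.body) (h : V ≤ U) (f : N.O V), dt (Φ.pull V f) =
      ∑ j, (S.timeProd.restrict W).res (fun _ hx => h hx) (b j) * Φ.pull V (vectorField.app (E j) h f)) →
    ∀ (V : Opens N.body) (h : V ≤ U) (f : N.O V), Z V f =
      ∑ i, (S.timeProd.restrict W).res (fun _ hx => h hx) (dt (a i)) * Φ.pull V (vectorField.app (Y i) h f) +
      ∑ i, ∑ j, (S.timeProd.restrict W).res (fun _ hx => h hx) (a i * b j) *
        Φ.pull V (vectorField.app (D.nabla U (E j) (Y i)) h f)

/-- A supercurve `Φ`, parametrized by `S` and defined on an open subspace of `ℝ × S`, is a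
supergeodesic if the covariant derivative with respect to the time of its velocity vector field
`dt ∘ Φ^*` is zero. -/
def IsSupergeodesic (D : N.Connection) (Φ : Hom (S.timeProd.restrict W) N) : Prop :=
  IsCovDeriv D Φ (fun V f => dt (Φ.pull V f)) (fun _ _ => 0)

/-- `Ψ` is the derivative of the supercurve `Φ` with respect to the time, as a morphism to the
tangent bundle: it is the lift of `Φ` that corresponds to the vector field `dt ∘ Φ^*` along `Φ`. -/
def IsVelocity (Φ : Hom (S.timeProd.restrict W) N) (Ψ : Hom (S.timeProd.restrict W) N.tangent) :
    Prop :=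
  N.tangentProj.comp Ψ = Φ ∧ ∀ (U : Opens N.body) (f : N.O U),
    Ψ.pull (U.comap N.tangentProj.toMap) (N.tangentDiff U f) = dt ((N.tangentProj.comp Ψ).pull U f)

/-- `Φ` is a supergeodesic with initial condition `J` whose domain `W` meets every line `ℝ × {s}` in
an interval that contains `0`. -/
structure IsGeodesicFrom (D : N.Connection) (J : Hom S N.tangent) (W : Opens S.timeProd.body)
    (Φ : Hom (S.timeProd.restrict W) N) : Prop where
  zero_mem : ∀ s : S.body, ((0 : ℝ), s) ∈ W
  ordConnected : ∀ s : S.body, {t : ℝ | (t, s) ∈ W}.OrdConnected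
  geodesic : IsSupergeodesic D Φ
  initial : ∃ Ψ : Hom (S.timeProd.restrict W) N.tangent,
    IsVelocity Φ Ψ ∧ Ψ.comp (injZero W zero_mem) = J

/-- There is a supergeodesic with initial condition `J` such that every supergeodesic with initial
condition `J` is a restriction of it. -/
def HasUniqueGeodesic (D : N.Connection) (J : Hom S N.tangent) : Prop :=
  ∃ (W : Opens S.timeProd.body) (Φ : Hom (S.timeProd.restrict W) N), IsGeodesicFrom D J W Φ ∧
    ∀ (W' : Opens S.timeProd.body) (Φ' : Hom (S.timeProd.restrict W') N),
      IsGeodesicFrom D J W' Φ' → ∃ h : W' ≤ W, Φ' = Φ.comp (S.timeProd.restrictIncl h)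

/-! ### Coordinates -/

/-- The parity of the coordinate with a given index. -/
def coordParity {m n : ℕ} : Fin m ⊕ Fin n → ZMod 2 := Sum.elim (fun _ => 0) (fun _ => 1)

/-- The standard coordinates of a superdomain. -/
def stdCoord {m n : ℕ} (V : Opens (Fin m → ℝ)) : Fin m ⊕ Fin n → (superDomain m n V).O ⊤
  | .inl i => ⟨fun x => algebraMap ℝ (Grassmann n) (x.1 i), GrassmannSmooth.congr
      (f := fun x => algebraMap ℝ (Grassmann n) (x i))
      (fun l => by
        simp only [Algebra.algebraMap_eq_smul_one, map_smul, smul_eq_mul]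
        fun_prop)
      fun _ hx => extendZero_of_mem _ hx⟩
  | .inr j => ⟨fun _ => ExteriorAlgebra.ι ℝ (Pi.single j 1),
      (GrassmannSmooth.const (ExteriorAlgebra.ι ℝ (Pi.single j 1))).congr
        fun _ hx => extendZero_of_mem _ hx⟩

/-- `x` is a system of coordinates of `N` on the open set `U`. -/
def IsCoord {m n : ℕ} {U : Opens N.body} (x : Fin m ⊕ Fin n → N.O U) : Prop :=
  ∃ (V : Opens (Fin m → ℝ)) (c : Hom (superDomain m n V) N) (h : ∀ y, c.toMap y ∈ U),
    c.IsOpenImmersion ∧ (U : Set N.body) ⊆ Set.range c.toMap ∧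
      ∀ i, c.pullTo (V := ⊤) (fun y _ => h y) (x i) = stdCoord V i

/-- `d i` is the vector field of differentiation with respect to the coordinate `x i`. -/
def IsCoordDer {m n : ℕ} {U : Opens N.body} (x : Fin m ⊕ Fin n → N.O U)
    (d : Fin m ⊕ Fin n → N.vectorField U) : Prop :=
  ∀ i, (d i).1 ∈ N.superDer U (coordParity i) ∧ ∀ j, vectorField.app (d i) le_rfl (x j) = if i = j then 1 else 0

/-- The second order system of differential equations for supergeodesics in coordinates; the
Christoffel symbol with indices `j, i, k` is the value of `nabla (d j) (d i)` on `x k`. -/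
def GeodesicEquation {m n : ℕ} (D : N.Connection) (Φ : Hom (S.timeProd.restrict W) N)
    {U : Opens N.body} (x : Fin m ⊕ Fin n → N.O U) (d : Fin m ⊕ Fin n → N.vectorField U) : Prop :=
  ∀ k, dt (dt (Φ.pull U (x k))) + ∑ i, ∑ j, dt (Φ.pull U (x i)) * dt (Φ.pull U (x j)) *
    Φ.pull U (vectorField.app (D.nabla U (d j) (d i)) le_rfl (x k)) = 0

end SuperSpace
end

/-!
The proof works with values at Grassmann-valued points. A Grassmann-valued point (`GrPoint`) of a
superspace consists of a point of the body and a parity preserving morphism from the germs at this point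
to a Grassmann algebra. On a superdomain a superfunction is a smooth function `g` with values in a
Grassmann algebra, and its value at the Grassmann-valued point with coordinates `x + ν, ξ`, where `x` is
real and `ν` is even and nilpotent, is the finite Taylor expansion of `g` at `x` in the direction `ν`,
with the `ξ` substituted for the odd generators (`taylorExt`, `coordExt`). By Hadamard's lemma and the
nilpotency of the ideal of elements without constant term, every Grassmann-valued point is of this form
(`Hom.IsOpenImmersion.grPoint_ext`, `eq_coordPt`). Superfunctions and morphisms on a supermanifold are
determined by their values at Grassmann-valued points (`IsSupermanifold.sec_ext`,
`IsSupermanifold.hom_ext`). Conversely, a family of Grassmann-valued points that depends smoothly on the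
time and on the even coordinates in a chart is a morphism (`Hom.IsOpenImmersion.exists_time_hom`). For a
fixed Grassmann-valued point `x` of `S`, the derivative `dt f` of a superfunction `f` on `ℝ × S` has at
`(t, x)` the ordinary derivative of `t ↦ f (t, x)` as its value (`hasDerivAt_curve`).

*The equation in coordinates.* A derivation along a morphism is determined by its values on the
coordinates (`grDeriv_eq`, `along_eq_sum`). This gives the chain rule for `dt` (`dt_pull_eq_sum`) and the
expansion of a vector field in the coordinate vector fields (`vectorField.eq_sum`). With the Leibniz
rule, the covariant derivative of the velocity, computed from any expansion of the velocity in vector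
fields, is expressed by the left-hand sides of the system of differential equations
(`covDeriv_eq_zero`, `isSupergeodesic_iff`).

*Local existence and uniqueness.* At a fixed Grassmann-valued point of `S` the system is an ordinary
differential equation of the first order for the Grassmann-valued coordinates and velocities, which form
a finite-dimensional real vector space, with a smooth right-hand side (`geodesicField`,
`hasDerivAt_coordCurve`). Its flow is smooth in the time and the initial values together
(`exists_smooth_flow_on`). This is derived from the inverse function theorem in the Banach space of
continuous curves, where the superposition operator of a smooth map is smooth. The initial condition
is expressed in charts of `S` and of the tangent bundle, and the flow applied to it gives the coordinates
of a supergeodesic for small times (`exists_local_geodesic`). Two supergeodesics with the same initial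
condition agree where both are defined: on the interval of times at which both have a value at `x`, their
velocities agree on a set that is open by the uniqueness of the solutions of ordinary differential
equations, closed as `N` is Hausdorff, and not empty as it contains `0` (`IsPartialGeodesic.eq`).

*The tangent bundle.* Its superfunctions are defined as natural families on the vector fields along
morphisms from superdomains. A chart of `N` induces a chart of the tangent bundle, because the superdomain
with coordinates `x i, v i` carries a vector field along a morphism through which all others factor
uniquely (`exists_universal_tangentPoint`, `exists_tangent_chart`). Hence a point of the tangent bundle is
determined by its projection and its components in a chart (`Hom.IsOpenImmersion.tangent_ext`), and every
supercurve has a velocity (`exists_isVelocity`).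

*Maximal supergeodesics.* The supergeodesics with a given initial condition, on domains that may miss
some of the lines `ℝ × {s}`, agree on the intersections of their domains. They are therefore glued to a
supergeodesic on the union (`exists_glue`, `exists_maximal_partialGeodesic`), which meets all these lines
by local existence (`hasUniqueGeodesic`).
-/

noncomputable section

/-! ### The Grassmann algebra as a normed algebra -/

/-- The left regular representation of the Grassmann algebra, on coordinates with respect to the
standard basis. -/
def grassmannRep (q : ℕ) : Grassmann q →ₐ[ℝ] ((Finset (Fin q) → ℝ) →L[ℝ] (Finset (Fin q) → ℝ)) :=
  ((Module.End.toContinuousLinearMap (𝕜 := ℝ) (Finset (Fin q) → ℝ)).toAlgHom.comp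
    ((Pi.basisFun ℝ (Fin q)).ExteriorAlgebra.equivFun.conjAlgEquiv ℝ).toAlgHom).comp
    (Algebra.lmul ℝ (Grassmann q))

/-- The representation is faithful, because `c` is recovered as `c * 1`. -/
lemma grassmannRep_injective (q : ℕ) : Function.Injective (grassmannRep q) := by
  intro a b h
  have e : ∀ c, grassmannRep q c ((Pi.basisFun ℝ (Fin q)).ExteriorAlgebra.equivFun 1) =
      (Pi.basisFun ℝ (Fin q)).ExteriorAlgebra.equivFun c := fun c => by
    change (Pi.basisFun ℝ (Fin q)).ExteriorAlgebra.equivFun (c *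
      (Pi.basisFun ℝ (Fin q)).ExteriorAlgebra.equivFun.symm
        ((Pi.basisFun ℝ (Fin q)).ExteriorAlgebra.equivFun 1)) = _
    rw [LinearEquiv.symm_apply_apply, mul_one]
  exact (Pi.basisFun ℝ (Fin q)).ExteriorAlgebra.equivFun.injective (by rw [← e a, h, e b])

/-- The operator norm of left multiplication. The topology does not depend on this choice, since the
Grassmann algebra is finite-dimensional. -/
instance (q : ℕ) : NormedRing (Grassmann q) :=
  NormedRing.induced _ _ (grassmannRep q) (grassmannRep_injective q)

instance (q : ℕ) : NormedAlgebra ℝ (Grassmann q) :=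
  NormedAlgebra.induced ℝ _ _ (grassmannRep q)

section

variable {E : Type*} [NormedAddCommGroup E] [NormedSpace ℝ E] {q : ℕ}

lemma ContDiffOn.linearMap_comp {F G : Type*} [NormedAddCommGroup F] [NormedSpace ℝ F]
    [FiniteDimensional ℝ F] [NormedAddCommGroup G] [NormedSpace ℝ G] {U : Set E} {f : E → F}
    {n : WithTop ℕ∞} (hf : ContDiffOn ℝ n f U) (l : F →ₗ[ℝ] G) :
    ContDiffOn ℝ n (fun x => l (f x)) U :=
  (l.toContinuousLinearMap.contDiff (n := n)).comp_contDiffOn hf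

lemma grassmannSmooth_iff {U : Set E} {f : E → Grassmann q} :
    GrassmannSmooth U f ↔ ContDiffOn ℝ ∞ f U := by
  refine ⟨fun h => ?_, fun h l => h.linearMap_comp l⟩
  have e : f = fun x => (Pi.basisFun ℝ (Fin q)).ExteriorAlgebra.equivFun.symm
      ((Pi.basisFun ℝ (Fin q)).ExteriorAlgebra.equivFun (f x)) := by
    funext x; simp
  rw [e]
  refine ContDiffOn.linearMap_comp (F := Finset (Fin q) → ℝ)
    (contDiffOn_pi.2 fun i => ?_) (LinearEquiv.toLinearMap _)
  exact h ((Pi.basisFun ℝ (Fin q)).ExteriorAlgebra.coord i)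

end

/-! ### Nilpotency and parity in the Grassmann algebra -/

/-- The residue of an element of the Grassmann algebra. -/
abbrev gbody {q : ℕ} : Grassmann q →ₐ[ℝ] ℝ := ExteriorAlgebra.algebraMapInv

lemma gbody_algebraMap {q : ℕ} (r : ℝ) : gbody (algebraMap ℝ (Grassmann q) r) = r :=
  ExteriorAlgebra.algebraMap_leftInverse _ r

lemma gbody_odd {q : ℕ} {a : Grassmann q} (h : a ∈ grassmannPart q 1) : gbody a = 0 := by
  have h1 : a * a = -(a * a) := by simpa [superSign] using grassmann_supercomm h h
  have h2 := congrArg gbody h1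
  simp only [map_mul, map_neg] at h2
  have : gbody a * gbody a = 0 := by linarith
  simpa using this

/-- The elements of the Grassmann algebra all of whose homogeneous components have degree at
least `k`. -/
def grassmannFil (q k : ℕ) : Submodule ℝ (Grassmann q) :=
  ⨆ j : {n : ℕ // k ≤ n}, LinearMap.range (ExteriorAlgebra.ι ℝ (M := Fin q → ℝ)) ^ (j : ℕ)

lemma pow_le_grassmannFil {q k n : ℕ} (h : k ≤ n) :
    LinearMap.range (ExteriorAlgebra.ι ℝ (M := Fin q → ℝ)) ^ n ≤ grassmannFil q k :=
  le_iSup (fun j : {n : ℕ // k ≤ n} =>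
    LinearMap.range (ExteriorAlgebra.ι ℝ (M := Fin q → ℝ)) ^ (j : ℕ)) ⟨n, h⟩

lemma grassmannFil_mul {q i j : ℕ} {a b : Grassmann q} (ha : a ∈ grassmannFil q i)
    (hb : b ∈ grassmannFil q j) : a * b ∈ grassmannFil q (i + j) := by
  have h : grassmannFil q i * grassmannFil q j ≤ grassmannFil q (i + j) := by
    rw [grassmannFil, Submodule.iSup_mul]
    refine iSup_le fun x => ?_
    rw [grassmannFil, Submodule.mul_iSup]
    refine iSup_le fun y => ?_
    rw [← pow_add]
    exact pow_le_grassmannFil (add_le_add x.2 y.2)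
  exact h (Submodule.mul_mem_mul ha hb)

lemma grassmannFil_zero (q : ℕ) : grassmannFil q 0 = ⊤ := by
  refine eq_top_iff.2 ?_
  rw [← CliffordAlgebra.iSup_ι_range_eq_top (0 : QuadraticForm ℝ (Fin q → ℝ))]
  exact iSup_le fun n => pow_le_grassmannFil (Nat.zero_le n)

lemma gbody_fil {q : ℕ} {a : Grassmann q} (ha : a ∈ grassmannFil q 1) : gbody a = 0 := by
  have h : grassmannFil q 1 ≤ LinearMap.ker (gbody (q := q)).toLinearMap := by
    refine iSup_le ?_
    rintro ⟨n, hn⟩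
    obtain ⟨n, rfl⟩ := Nat.exists_eq_add_of_le' hn
    rw [pow_succ', Submodule.mul_le]
    rintro _ ⟨v, rfl⟩ b -
    have h : gbody (ExteriorAlgebra.ι ℝ v) = 0 :=
      gbody_odd (CliffordAlgebra.ι_mem_evenOdd_one _ v)
    exact LinearMap.mem_ker.2 ((map_mul gbody _ _).trans (by rw [h, zero_mul]))
  exact h ha

lemma mem_grassmannFil_one {q : ℕ} {a : Grassmann q} : a ∈ grassmannFil q 1 ↔ gbody a = 0 := by
  refine ⟨gbody_fil, fun h => ?_⟩
  have h0 : a ∈ (1 : Submodule ℝ (Grassmann q)) ⊔ grassmannFil q 1 := by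
    have : grassmannFil q 0 ≤ 1 ⊔ grassmannFil q 1 := by
      refine iSup_le ?_
      rintro ⟨n, -⟩
      rcases n with _ | n
      · rw [pow_zero]; exact le_sup_left
      · exact (pow_le_grassmannFil (Nat.succ_pos n)).trans le_sup_right
    exact this (grassmannFil_zero q ▸ Submodule.mem_top)
  obtain ⟨b, hb, c, hc, rfl⟩ := Submodule.mem_sup.1 h0
  obtain ⟨r, rfl⟩ := Submodule.mem_one.1 hb
  have h2 := gbody_fil hc
  rw [map_add, h2, add_zero, gbody_algebraMap] at h
  simpa [h] using hc

lemma grassmannFil_eq_bot (q : ℕ) : grassmannFil q (q + 1) = ⊥ := by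
  refine le_bot_iff.1 (iSup_le ?_)
  rintro ⟨n, hn⟩
  change ⋀[ℝ]^n (Fin q → ℝ) ≤ ⊥
  rw [← ExteriorAlgebra.ιMulti_span_fixedDegree, Submodule.span_le]
  rintro _ ⟨v, rfl⟩
  -- more than `q` vectors of `ℝ^q` are linearly dependent, so that their product vanishes
  refine (ExteriorAlgebra.ιMulti ℝ n).map_linearDependent v fun h => ?_
  have := h.fintype_card_le_finrank
  simp at this
  omega

lemma zmod_two_cases (i : ZMod 2) : i = 0 ∨ i = 1 := by
  revert i; decide

/-- The projection of the Grassmann algebra onto the part of parity `i`. -/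
def grassmannProj (q : ℕ) (i : ZMod 2) : Grassmann q →ₗ[ℝ] Grassmann q :=
  if i = 0 then (exists_grassmannProj q).choose else (exists_grassmannProj q).choose_spec.choose

lemma grassmannProj_mem {q : ℕ} (i : ZMod 2) (a : Grassmann q) :
    grassmannProj q i a ∈ grassmannPart q i := by
  obtain ⟨h0, h1, -⟩ := (exists_grassmannProj q).choose_spec.choose_spec
  rcases zmod_two_cases i with rfl | rfl
  · exact h0 a
  · exact h1 a

lemma grassmannProj_add {q : ℕ} (a : Grassmann q) :
    grassmannProj q 0 a + grassmannProj q 1 a = a :=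
  ((exists_grassmannProj q).choose_spec.choose_spec.2.2 a).symm

lemma grassmannProj_eq {q : ℕ} {i : ZMod 2} {a : Grassmann q} (h : a ∈ grassmannPart q i) :
    grassmannProj q i a = a := by
  have h1 := grassmannProj_add a
  have h2 := grassmannProj_mem 0 a
  have h3 := grassmannProj_mem 1 a
  rcases zmod_two_cases i with rfl | rfl
  · refine sub_eq_zero.1 (grassmannPart_disjoint (Submodule.sub_mem _ h2 h) ?_)
    have : grassmannProj q 0 a - a = - grassmannProj q 1 a := by
      nth_rewrite 2 [← h1]; abel
    rw [this]; exact Submodule.neg_mem _ h3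
  · refine sub_eq_zero.1 (grassmannPart_disjoint ?_ (Submodule.sub_mem _ h3 h))
    have : grassmannProj q 1 a - a = - grassmannProj q 0 a := by
      nth_rewrite 2 [← h1]; abel
    rw [this]; exact Submodule.neg_mem _ h2

lemma gbody_proj_zero {q : ℕ} (a : Grassmann q) : gbody (grassmannProj q 0 a) = gbody a := by
  conv_rhs => rw [← grassmannProj_add a, map_add, gbody_odd (grassmannProj_mem 1 a), add_zero]

lemma grassmann_even_comm {q : ℕ} {a : Grassmann q} (ha : a ∈ grassmannPart q 0)
    (b : Grassmann q) : a * b = b * a := by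
  rw [← grassmannProj_add b, mul_add, add_mul,
    grassmann_supercomm ha (grassmannProj_mem 0 b), grassmann_supercomm ha (grassmannProj_mem 1 b)]
  simp [superSign]

lemma grassmannPart_mul {q : ℕ} {i j : ZMod 2} {a b : Grassmann q} (ha : a ∈ grassmannPart q i)
    (hb : b ∈ grassmannPart q j) : a * b ∈ grassmannPart q (i + j) :=
  CliffordAlgebra.evenOdd_mul_le _ _ _ (Submodule.mul_mem_mul ha hb)

lemma ι_mem_grassmannPart {q : ℕ} (v : Fin q → ℝ) :
    ExteriorAlgebra.ι ℝ v ∈ grassmannPart q 1 :=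
  CliffordAlgebra.ι_mem_evenOdd_one _ v

lemma grassmann_odd_sq {q : ℕ} {a : Grassmann q} (h : a ∈ grassmannPart q 1) : a * a = 0 := by
  have h1 : a * a = -(a * a) := by simpa [superSign] using grassmann_supercomm h h
  have h2 : (2 : ℝ) • (a * a) = 0 := by
    rw [two_smul]; nth_rewrite 1 [h1]; exact neg_add_cancel _
  simpa using h2

/-- The substitution of the odd parts of the elements `ξ j` for the generators of the Grassmann
algebra. -/
def grassmannSubst {n q : ℕ} (ξ : Fin n → Grassmann q) : Grassmann n →ₐ[ℝ] Grassmann q :=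
  ExteriorAlgebra.lift ℝ ⟨(Pi.basisFun ℝ (Fin n)).constr ℝ (fun j => grassmannProj q 1 (ξ j)),
    fun v => grassmann_odd_sq (by
      rw [Module.Basis.constr_apply_fintype]
      exact Submodule.sum_mem _ fun j _ => Submodule.smul_mem _ _ (grassmannProj_mem 1 _))⟩

lemma grassmannSubst_ι {n q : ℕ} (ξ : Fin n → Grassmann q) (v : Fin n → ℝ) :
    grassmannSubst ξ (ExteriorAlgebra.ι ℝ v) = ∑ j, v j • grassmannProj q 1 (ξ j) := by
  rw [grassmannSubst, ExteriorAlgebra.lift_ι_apply, Module.Basis.constr_apply_fintype]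
  simp

lemma grassmannSubst_ι_single {n q : ℕ} (ξ : Fin n → Grassmann q) (j : Fin n) :
    grassmannSubst ξ (ExteriorAlgebra.ι ℝ (Pi.single j 1)) = grassmannProj q 1 (ξ j) := by
  rw [grassmannSubst_ι, Finset.sum_eq_single j] <;> simp +contextual

lemma grassmannSubst_mem {n q : ℕ} (ξ : Fin n → Grassmann q) {i : ZMod 2} {a : Grassmann n}
    (ha : a ∈ grassmannPart n i) : grassmannSubst ξ a ∈ grassmannPart q i := by
  have key : ∀ k : ℕ, ∀ b ∈ LinearMap.range (ExteriorAlgebra.ι ℝ (M := Fin n → ℝ)) ^ k,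
      grassmannSubst ξ b ∈ grassmannPart q (k : ZMod 2) := by
    intro k
    induction k with
    | zero =>
      intro b hb
      rw [pow_zero] at hb
      obtain ⟨r, rfl⟩ := Submodule.mem_one.1 hb
      rw [AlgHom.commutes, Nat.cast_zero]
      exact SuperSpace.algebraMap_grassmann_mem q r
    | succ k ih =>
      intro b hb
      rw [pow_succ'] at hb
      refine Submodule.mul_induction_on hb ?_ fun x y hx hy => ?_
      · rintro _ ⟨v, rfl⟩ c hc
        rw [map_mul, Nat.cast_succ, add_comm]
        refine grassmannPart_mul ?_ (ih c hc)
        rw [grassmannSubst_ι]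
        exact Submodule.sum_mem _ fun j _ => Submodule.smul_mem _ _ (grassmannProj_mem 1 _)
      · rw [map_add]; exact Submodule.add_mem _ hx hy
  have h : grassmannPart n i ≤ (grassmannPart q i).comap (grassmannSubst ξ).toLinearMap := by
    refine iSup_le ?_
    rintro ⟨k, rfl⟩ b hb
    exact key k b hb
  exact h ha

lemma gbody_grassmannSubst {n q : ℕ} (ξ : Fin n → Grassmann q) (a : Grassmann n) :
    gbody (grassmannSubst ξ a) = gbody a := by
  have h : (gbody (q := q)).comp (grassmannSubst ξ) = gbody (q := n) := by
    refine ExteriorAlgebra.hom_ext (LinearMap.ext fun v => ?_)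
    change gbody (grassmannSubst ξ (ExteriorAlgebra.ι ℝ v)) = gbody (ExteriorAlgebra.ι ℝ v)
    rw [gbody_odd (grassmannSubst_mem ξ (ι_mem_grassmannPart v)), gbody_odd (ι_mem_grassmannPart v)]
  exact DFunLike.congr_fun h a

lemma contDiff_grassmannSubst {n q : ℕ} (a : Grassmann n) :
    ContDiff ℝ ∞ (fun ξ : Fin n → Grassmann q => grassmannSubst ξ a) := by
  induction a using ExteriorAlgebra.induction with
  | algebraMap r => simpa only [AlgHom.commutes] using contDiff_const
  | ι v =>
    simp only [grassmannSubst_ι]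
    refine ContDiff.sum fun j _ => ContDiff.const_smul (v j) ?_
    exact ((grassmannProj q 1).toContinuousLinearMap.contDiff).comp (contDiff_apply _ _ j)
  | mul a b ha hb => simpa only [map_mul] using ha.mul hb
  | add a b ha hb => simpa only [map_add] using ha.add hb

/-- Every element of the Grassmann algebra is the sum of its residue and of multiples of the
generators. -/
lemma exists_eq_gbody_add {q : ℕ} (a : Grassmann q) : ∃ b : Fin q → Grassmann q,
    a = algebraMap ℝ _ (gbody a) + ∑ j, ExteriorAlgebra.ι ℝ (Pi.single j 1) * b j := by
  induction a using ExteriorAlgebra.induction with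
  | algebraMap r => exact ⟨0, by rw [gbody_algebraMap]; simp⟩
  | ι v =>
    refine ⟨fun j => algebraMap ℝ _ (v j), ?_⟩
    rw [gbody_odd (ι_mem_grassmannPart v), map_zero, zero_add]
    conv_lhs => rw [← Finset.univ_sum_single v, map_sum]
    refine Finset.sum_congr rfl fun j _ => ?_
    rw [← Algebra.commutes, ← Algebra.smul_def, ← map_smul, ← Pi.single_smul', smul_eq_mul, mul_one]
  | add a b ha hb =>
    obtain ⟨c, hc⟩ := ha
    obtain ⟨d, hd⟩ := hb
    refine ⟨c + d, ?_⟩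
    conv_lhs => rw [hc, hd]
    simp only [map_add, Pi.add_apply, mul_add, Finset.sum_add_distrib]
    abel
  | mul a b ha hb =>
    obtain ⟨c, hc⟩ := ha
    obtain ⟨d, hd⟩ := hb
    refine ⟨fun j => c j * b + gbody a • d j, ?_⟩
    have h : a * b = algebraMap ℝ _ (gbody a) * (algebraMap ℝ _ (gbody b) +
        ∑ j, ExteriorAlgebra.ι ℝ (Pi.single j 1) * d j) +
        (∑ j, ExteriorAlgebra.ι ℝ (Pi.single j 1) * c j) * b := by rw [← hd, ← add_mul, ← hc]
    rw [map_mul, h, map_mul]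
    simp only [mul_add, Finset.sum_add_distrib, Finset.sum_mul, Finset.mul_sum,
      mul_smul_comm, ← Algebra.smul_def, mul_assoc]
    abel
end

noncomputable section

/-! ### Superposition operators and the smooth flow of an ordinary differential equation -/

section Nemytskii

variable {K : Type*} [TopologicalSpace K] [CompactSpace K]
  {E F : Type w} [NormedAddCommGroup E] [NormedSpace ℝ E] [NormedAddCommGroup F] [NormedSpace ℝ F]

/-- Pointwise application of a continuous family of linear maps. -/
def pointwiseApply : C(K, E →L[ℝ] F) →L[ℝ] C(K, E) →L[ℝ] C(K, F) :=
  LinearMap.mkContinuous₂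
    (LinearMap.mk₂ ℝ (fun (A : C(K, E →L[ℝ] F)) (h : C(K, E)) =>
        (⟨fun s => A s (h s), by fun_prop⟩ : C(K, F)))
      (fun _ _ _ => by ext; simp) (fun _ _ _ => by ext; simp)
      (fun _ _ _ => by ext; simp) (fun _ _ _ => by ext; simp)) 1
    fun A h => by
      rw [one_mul]
      refine (ContinuousMap.norm_le _ (by positivity)).2 fun s => ?_
      exact ((A s).le_opNorm _).trans (mul_le_mul (A.norm_coe_le_norm s) (h.norm_coe_le_norm s)
        (norm_nonneg _) (norm_nonneg A))

/-- The superposition operator of a continuously differentiable map is differentiable. -/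
lemma hasFDerivAt_superposition {f : E → F} (hf : ContDiff ℝ 1 f) (γ : C(K, E)) :
    HasFDerivAt (fun γ : C(K, E) => (⟨f, hf.continuous⟩ : C(E, F)).comp γ)
      (pointwiseApply ((⟨fderiv ℝ f, hf.continuous_fderiv one_ne_zero⟩ : C(E, E →L[ℝ] F)).comp γ))
      γ := by
  set N : C(K, E) → C(K, E →L[ℝ] F) := fun γ =>
    (⟨fderiv ℝ f, hf.continuous_fderiv one_ne_zero⟩ : C(E, E →L[ℝ] F)).comp γ
  have hN : Continuous N := ContinuousMap.continuous_postcomp _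
  rw [hasFDerivAt_iff_isLittleO, Asymptotics.isLittleO_iff]
  intro ε hε
  obtain ⟨r, hr, h1⟩ := (Metric.continuous_iff (α := C(K, E)) (β := C(K, E →L[ℝ] F))).1 hN γ ε hε
  filter_upwards [Metric.ball_mem_nhds γ hr] with δ hδ
  refine (ContinuousMap.norm_le _ (by positivity)).2 fun s => ?_
  have h2 : ∀ z ∈ segment ℝ (γ s) (δ s), ‖fderiv ℝ f z - fderiv ℝ f (γ s)‖ ≤ ε := by
    rintro z ⟨a, b, ha, hb, hab, rfl⟩
    have h3 : a • γ + b • δ ∈ Metric.ball γ r :=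
      convex_ball γ r (Metric.mem_ball_self hr) hδ ha hb hab
    have h4 := (ContinuousMap.dist_apply_le_dist s).trans (h1 _ h3).le
    rw [dist_eq_norm] at h4
    exact h4
  have h5 := (convex_segment (γ s) (δ s)).norm_image_sub_le_of_norm_hasFDerivWithin_le'
    (f := f) (f' := fderiv ℝ f) (φ := fderiv ℝ f (γ s)) (C := ε)
    (fun z _ => ((hf.differentiable one_ne_zero) z).hasFDerivAt.hasFDerivWithinAt) h2
    (left_mem_segment ℝ _ _) (right_mem_segment ℝ _ _)
  refine le_trans (le_of_eq ?_) (h5.trans (mul_le_mul_of_nonneg_left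
    ((δ - γ).norm_coe_le_norm s) hε.le))
  rfl

/-- The superposition operator of a smooth map is smooth. -/
lemma contDiff_superposition {f : E → F} (hf : ContDiff ℝ ∞ f) :
    ContDiff ℝ ∞ (fun γ : C(K, E) => (⟨f, hf.continuous⟩ : C(E, F)).comp γ) := by
  rw [contDiff_infty]
  intro n
  induction n generalizing F with
  | zero =>
    exact contDiff_zero.2 (ContinuousMap.continuous_postcomp _)
  | succ n ih =>
    rw [Nat.cast_succ, contDiff_succ_iff_hasFDerivAt (n := n)]
    have hf' : ContDiff ℝ ∞ (fderiv ℝ f) := hf.fderiv_right (by norm_cast)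
    refine ⟨_, ?_, fun γ => hasFDerivAt_superposition (hf.of_le (by norm_cast)) γ⟩
    exact (pointwiseApply (K := K) (E := E) (F := F)).contDiff.comp (ih hf')

end Nemytskii

section Integral

variable {F : Type*} [NormedAddCommGroup F] [NormedSpace ℝ F]

open MeasureTheory in
/-- The primitive that vanishes at `0` of a continuous function on `[-1, 1]`. -/
def primitive : C(Set.Icc (-1 : ℝ) 1, F) →L[ℝ] C(Set.Icc (-1 : ℝ) 1, F) :=
  LinearMap.mkContinuous
    { toFun := fun γ => ⟨fun t => ∫ s in (0 : ℝ)..t,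
          Set.IccExtend (by norm_num : (-1 : ℝ) ≤ 1) γ s, by
        have h : Continuous (Set.IccExtend (by norm_num : (-1 : ℝ) ≤ 1) γ) := γ.continuous.Icc_extend'
        exact (intervalIntegral.continuous_primitive
          (fun a b => h.intervalIntegrable a b) 0).comp continuous_subtype_val⟩
      map_add' := fun γ δ => by
        ext t
        have h : ∀ γ : C(Set.Icc (-1 : ℝ) 1, F), Continuous (Set.IccExtend (by norm_num : (-1 : ℝ) ≤ 1) γ) :=
          fun γ => γ.continuous.Icc_extend'
        exact intervalIntegral.integral_add ((h γ).intervalIntegrable _ _)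
          ((h δ).intervalIntegrable _ _)
      map_smul' := fun r γ => by
        ext t
        exact intervalIntegral.integral_smul r _ } 1
    fun γ => by
      rw [one_mul]
      refine (ContinuousMap.norm_le _ (norm_nonneg _)).2 fun t => ?_
      refine (intervalIntegral.norm_integral_le_of_norm_le_const (C := ‖γ‖)
        fun s _ => γ.norm_coe_le_norm _).trans ?_
      have : |(t : ℝ) - 0| ≤ 1 := by rw [sub_zero]; exact abs_le.2 t.2
      nlinarith [norm_nonneg γ]

lemma primitive_apply (γ : C(Set.Icc (-1 : ℝ) 1, F)) (t : Set.Icc (-1 : ℝ) 1) :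
    primitive γ t = ∫ s in (0 : ℝ)..t, Set.IccExtend (by norm_num : (-1 : ℝ) ≤ 1) γ s := rfl

end Integral

section Hadamard

variable {F : Type} [NormedAddCommGroup F] [NormedSpace ℝ F] [CompleteSpace F]

/-- Hadamard's lemma. -/
lemma exists_hadamard {m : ℕ} {f : (Fin m → ℝ) → F} (hf : ContDiff ℝ ∞ f) (y₀ : Fin m → ℝ) :
    ∃ g : Fin m → (Fin m → ℝ) → F, (∀ i, ContDiff ℝ ∞ (g i)) ∧
      ∀ y, f y = f y₀ + ∑ i, (y i - y₀ i) • g i y := by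
  have hf' : ContDiff ℝ ∞ (fderiv ℝ f) := hf.fderiv_right (by norm_cast)
  let c : (Fin m → ℝ) →L[ℝ] C(Set.Icc (-1 : ℝ) 1, Fin m → ℝ) := LinearMap.mkContinuous
    { toFun := fun y => (⟨fun s => (s : ℝ) • y, by fun_prop⟩ : C(Set.Icc (-1 : ℝ) 1, Fin m → ℝ))
      map_add' := fun y z => by ext1 s; exact smul_add _ _ _
      map_smul' := fun r y => by ext1 s; exact smul_comm _ _ _ } 1 fun y => by
    rw [one_mul]
    refine (ContinuousMap.norm_le _ (norm_nonneg _)).2 fun s => ?_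
    refine (norm_smul_le _ _).trans (mul_le_of_le_one_left (norm_nonneg _) ?_)
    exact abs_le.2 s.2
  let p : (Fin m → ℝ) → C(Set.Icc (-1 : ℝ) 1, Fin m → ℝ) := fun y =>
    ContinuousMap.const _ y₀ + c (y - y₀)
  have hp : ContDiff ℝ ∞ p :=
    contDiff_const.add (c.contDiff.comp (contDiff_id.sub contDiff_const))
  let ev : C(Set.Icc (-1 : ℝ) 1, (Fin m → ℝ) →L[ℝ] F) →L[ℝ] ((Fin m → ℝ) →L[ℝ] F) :=
    ContinuousMap.evalCLM ℝ ⟨1, by norm_num⟩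
  refine ⟨fun i y => ev (primitive ((⟨_, hf'.continuous⟩ : C(_, _)).comp (p y))) (Pi.single i 1),
    fun i => ?_, fun y => ?_⟩
  · exact (((ev.comp primitive).contDiff).comp
      ((contDiff_superposition hf').comp hp)).clm_apply contDiff_const
  · have h1 : ∀ s ∈ Set.uIcc (0 : ℝ) 1, HasDerivAt (fun s : ℝ => f (y₀ + s • (y - y₀)))
        (fderiv ℝ f (y₀ + s • (y - y₀)) (y - y₀)) s := fun s _ => by
      have h2 := ((hf.differentiable (by simp)) (y₀ + s • (y - y₀))).hasFDerivAt
      have h3 : HasDerivAt (fun s : ℝ => y₀ + s • (y - y₀)) (y - y₀) s := by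
        simpa using ((hasDerivAt_id s).smul_const (y - y₀)).const_add y₀
      exact h2.comp_hasDerivAt s h3
    have hc : Continuous fun s : ℝ => fderiv ℝ f (y₀ + s • (y - y₀)) :=
      hf'.continuous.comp (by fun_prop)
    have h4 := intervalIntegral.integral_eq_sub_of_hasDerivAt h1
      ((hc.clm_apply continuous_const).intervalIntegrable _ _)
    have h5 : ev (primitive ((⟨_, hf'.continuous⟩ : C(_, _)).comp (p y))) =
        ∫ s in (0 : ℝ)..1, fderiv ℝ f (y₀ + s • (y - y₀)) := by
      refine (primitive_apply _ _).trans (intervalIntegral.integral_congr fun s hs => ?_)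
      have hs' : s ∈ Set.Icc (-1 : ℝ) 1 := by
        rw [Set.uIcc_of_le zero_le_one] at hs; exact ⟨by linarith [hs.1], hs.2⟩
      simp only [Set.IccExtend_of_mem _ _ hs']
      rfl
    have h6 : ∑ i, (y i - y₀ i) •
        ev (primitive ((⟨_, hf'.continuous⟩ : C(_, _)).comp (p y))) (Pi.single i 1) =
        ev (primitive ((⟨_, hf'.continuous⟩ : C(_, _)).comp (p y))) (y - y₀) := by
      conv_rhs => rw [← Finset.univ_sum_single (y - y₀), map_sum]
      refine Finset.sum_congr rfl fun i _ => ?_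
      rw [← map_smul, ← Pi.single_smul', smul_eq_mul, mul_one]; rfl
    rw [h6, h5, ContinuousLinearMap.intervalIntegral_apply (hc.intervalIntegrable _ _), h4]
    simp

end Hadamard

/-- A function that is smooth near a point agrees near the point with a function that is smooth on the
whole space. -/
lemma exists_contDiff_eventuallyEq {E F : Type*} [NormedAddCommGroup E] [NormedSpace ℝ E]
    [FiniteDimensional ℝ E] [NormedAddCommGroup F] [NormedSpace ℝ F] {U : Set E} (hU : IsOpen U)
    {f : E → F} (hf : ContDiffOn ℝ ∞ f U) {x₀ : E} (hx : x₀ ∈ U) :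
    ∃ g : E → F, ContDiff ℝ ∞ g ∧ ∀ᶠ y in nhds x₀, g y = f y := by
  obtain ⟨r, hr, hrU⟩ := Metric.isOpen_iff.1 hU x₀ hx
  let χ : ContDiffBump x₀ := ⟨r / 4, r / 2, by positivity, by linarith⟩
  refine ⟨fun y => χ y • f y, contDiff_iff_contDiffAt.2 fun y => ?_, ?_⟩
  · by_cases hy : y ∈ U
    · exact χ.contDiff.contDiffAt.smul (hf.contDiffAt (hU.mem_nhds hy))
    · have h1 : y ∉ tsupport χ := fun h => hy (hrU (by
        rw [χ.tsupport_eq] at h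
        exact Metric.closedBall_subset_ball (by change r / 2 < r; linarith) h))
      have h2 : (fun y => χ y • f y) =ᶠ[nhds y] fun _ => 0 := by
        filter_upwards [notMem_tsupport_iff_eventuallyEq.1 h1] with z hz
        rw [hz]; exact zero_smul _ _
      exact contDiffAt_const.congr_of_eventuallyEq h2
  · filter_upwards [Metric.closedBall_mem_nhds x₀ χ.rIn_pos] with y hy
    rw [χ.one_of_mem_closedBall hy, one_smul]

section Flow

variable {E : Type*} [NormedAddCommGroup E] [NormedSpace ℝ E]

/-- The constant functions on `[-1, 1]`. -/
def constCurve : E →L[ℝ] C(Set.Icc (-1 : ℝ) 1, E) :=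
  LinearMap.mkContinuous
    { toFun := fun x => ContinuousMap.const _ x
      map_add' := fun _ _ => rfl
      map_smul' := fun _ _ => rfl } 1
    fun x => by
      rw [one_mul]
      exact (ContinuousMap.norm_le _ (norm_nonneg _)).2 fun s => le_rfl

variable [CompleteSpace E]

/-- A smooth family, parametrized by the initial value `x` and a factor `ε`, of solutions of the
integral equation `γ = x + ε ∫ f (γ)` on `[-1, 1]`, obtained from the inverse function theorem in
the space of continuous curves. -/
lemma exists_smooth_family {f : E → E} (hf : ContDiff ℝ ∞ f) (x₀ : E) :
    ∃ (σ ρ : ℝ) (Γ : E × ℝ → C(Set.Icc (-1 : ℝ) 1, E)), 0 < σ ∧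
      ContDiffOn ℝ ∞ Γ (Metric.ball (x₀, 0) σ) ∧
      (∀ p ∈ Metric.ball (x₀, (0 : ℝ)) σ, Γ p ∈ Metric.ball (constCurve x₀) ρ ∧
        Γ p = constCurve p.1 + p.2 • primitive ((⟨f, hf.continuous⟩ : C(E, E)).comp (Γ p))) ∧
      ∀ p ∈ Metric.ball (x₀, (0 : ℝ)) σ, ∀ γ ∈ Metric.ball (constCurve x₀) ρ,
        γ = constCurve p.1 + p.2 • primitive ((⟨f, hf.continuous⟩ : C(E, E)).comp γ) →
          γ = Γ p := by
  let C := C(Set.Icc (-1 : ℝ) 1, E)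
  let N : C → C := fun γ => (⟨f, hf.continuous⟩ : C(E, E)).comp γ
  have hN : ContDiff ℝ ∞ N := contDiff_superposition hf
  let G : (E × ℝ) × C → (E × ℝ) × C := fun z =>
    (z.1, z.2 - constCurve z.1.1 - z.1.2 • primitive (N z.2))
  have hG : ContDiff ℝ ∞ G := contDiff_fst.prodMk
    ((contDiff_snd.sub (constCurve.contDiff.comp (contDiff_fst.comp contDiff_fst))).sub
      ((contDiff_snd.comp contDiff_fst).smul ((primitive.contDiff.comp hN).comp contDiff_snd)))
  let a : (E × ℝ) × C := ((x₀, 0), constCurve x₀)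
  let L : (E × ℝ) × C →L[ℝ] C :=
    constCurve.comp ((ContinuousLinearMap.fst ℝ E ℝ).comp (ContinuousLinearMap.fst ℝ (E × ℝ) C)) +
      ((ContinuousLinearMap.snd ℝ E ℝ).comp (ContinuousLinearMap.fst ℝ (E × ℝ) C)).smulRight
        (primitive (N (constCurve x₀)))
  have hL : ∀ p γ γ', L (p, γ) = L (p, γ') := fun p γ γ' => rfl
  -- at `ε = 0` the derivative of `G` is `(p, γ) ↦ (p, γ - L p)`, whose inverse is `(p, γ) ↦ (p, γ + L p)`
  let G' : ((E × ℝ) × C) ≃L[ℝ] ((E × ℝ) × C) := ContinuousLinearEquiv.equivOfInverse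
    ((ContinuousLinearMap.fst ℝ (E × ℝ) C).prod (ContinuousLinearMap.snd ℝ (E × ℝ) C - L))
    ((ContinuousLinearMap.fst ℝ (E × ℝ) C).prod (ContinuousLinearMap.snd ℝ (E × ℝ) C + L))
    (fun z => Prod.ext rfl (by
      change z.2 - L z + L (z.1, z.2 - L z) = z.2
      rw [hL z.1 _ z.2]; exact sub_add_cancel _ _))
    (fun z => Prod.ext rfl (by
      change z.2 + L z - L (z.1, z.2 + L z) = z.2
      rw [hL z.1 _ z.2]; exact add_sub_cancel_right _ _))
  have hG' : HasFDerivAt G (G' : ((E × ℝ) × C) →L[ℝ] ((E × ℝ) × C)) a := by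
    have h1 : HasFDerivAt (fun z : (E × ℝ) × C => primitive (N z.2))
        (fderiv ℝ (fun z : (E × ℝ) × C => primitive (N z.2)) a) a :=
      ((((primitive.contDiff (n := ∞)).comp (hN.comp contDiff_snd) :
        ContDiff ℝ ∞ (fun z : (E × ℝ) × C => primitive (N z.2))).differentiable (by simp))
          a).hasFDerivAt
    have h2 := (((ContinuousLinearMap.snd ℝ E ℝ).comp
      (ContinuousLinearMap.fst ℝ (E × ℝ) C)).hasFDerivAt (x := a)).smul h1
    have h3 := ((ContinuousLinearMap.fst ℝ (E × ℝ) C).hasFDerivAt (x := a)).prodMk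
      ((((ContinuousLinearMap.snd ℝ (E × ℝ) C).hasFDerivAt (x := a)).sub
        ((constCurve.comp ((ContinuousLinearMap.fst ℝ E ℝ).comp
          (ContinuousLinearMap.fst ℝ (E × ℝ) C))).hasFDerivAt (x := a))).sub h2)
    refine h3.congr_fderiv (ContinuousLinearMap.ext fun z => Prod.ext rfl ?_)
    change z.2 - constCurve z.1.1 - ((0 : ℝ) • _ + z.1.2 • primitive (N (constCurve x₀))) =
      z.2 - (constCurve z.1.1 + z.1.2 • primitive (N (constCurve x₀)))
    rw [zero_smul, zero_add, sub_sub]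
  have hne : (∞ : WithTop ℕ∞) ≠ 0 := by simp
  let e := (hG.contDiffAt (x := a)).toOpenPartialHomeomorph G hG' hne
  have he : ∀ z, e z = G z := fun z => rfl
  have hGa : G a = ((x₀, 0), 0) := by
    refine Prod.ext rfl ?_
    change constCurve x₀ - constCurve x₀ - (0 : ℝ) • _ = 0
    rw [sub_self, zero_smul, sub_zero]
  have ha : a ∈ e.source := (hG.contDiffAt (x := a)).mem_toOpenPartialHomeomorph_source hG' hne
  -- the derivative of `G` is invertible near `a`, so that the local inverse is smooth at all points of a
  -- neighbourhood and not only at `G a`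
  have hinv : ∀ᶠ z in nhds a, fderiv ℝ G z ∈
      Set.range ((↑) : (((E × ℝ) × C) ≃L[ℝ] ((E × ℝ) × C)) → _) :=
    (hG.continuous_fderiv (by simp)).continuousAt.eventually
      (by rw [hG'.fderiv]; exact ContinuousLinearEquiv.nhds G')
  have hsrc : ∀ᶠ z in nhds a, z ∈ e.source := e.open_source.mem_nhds ha
  obtain ⟨ρ, hρ, hρ'⟩ := Metric.eventually_nhds_iff_ball.1 (hinv.and hsrc)
  have hta : ((x₀, 0), 0) ∈ e.target := hGa ▸ e.map_source ha
  have hsymm : e.symm ((x₀, 0), 0) = a := by rw [← hGa]; exact e.left_inv ha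
  have hc : ContinuousAt (fun p : E × ℝ => e.symm (p, 0)) (x₀, 0) :=
    ContinuousAt.comp (f := fun p : E × ℝ => (p, (0 : C))) (e.continuousAt_symm hta)
      (by fun_prop)
  have h1 : ∀ᶠ p : E × ℝ in nhds (x₀, 0), e.symm (p, 0) ∈ Metric.ball a ρ :=
    hc.eventually (p := fun z => z ∈ Metric.ball a ρ)
      (by simp only [hsymm]; exact Metric.ball_mem_nhds a hρ)
  have h2 : ∀ᶠ p : E × ℝ in nhds (x₀, 0), (p, (0 : C)) ∈ e.target :=
    (show ContinuousAt (fun p : E × ℝ => (p, (0 : C))) (x₀, 0) by fun_prop).eventually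
      (p := fun z => z ∈ e.target) (e.open_target.mem_nhds hta)
  obtain ⟨σ, hσ, hσ'⟩ := Metric.eventually_nhds_iff_ball.1 (h1.and h2)
  have hfix : ∀ p ∈ Metric.ball (x₀, (0 : ℝ)) σ, e.symm (p, 0) = (p, (e.symm (p, 0)).2) ∧
      (e.symm (p, 0)).2 = constCurve p.1 + p.2 • primitive (N (e.symm (p, 0)).2) := by
    intro p hp
    have h3 : G (e.symm (p, 0)) = (p, 0) := e.right_inv (hσ' p hp).2
    have h4 : (e.symm (p, 0)).1 = p := congrArg Prod.fst h3
    have h5 : (e.symm (p, 0)).2 - constCurve (e.symm (p, 0)).1.1 -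
      (e.symm (p, 0)).1.2 • primitive (N (e.symm (p, 0)).2) = 0 := congrArg Prod.snd h3
    rw [h4, sub_sub, sub_eq_zero] at h5
    exact ⟨Prod.ext h4 rfl, h5⟩
  refine ⟨min σ ρ, ρ, fun p => (e.symm (p, 0)).2, lt_min hσ hρ, fun p hp => ?_, fun p hp => ?_,
    fun p hp γ hγ h => ?_⟩
  · have hp' := Metric.ball_subset_ball (min_le_left σ ρ) hp
    obtain ⟨D, hD⟩ := (hρ' _ (hσ' p hp').1).1
    have h6 : ContDiffAt ℝ ∞ e.symm (p, 0) := e.contDiffAt_symm (hσ' p hp').2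
      (f₀' := D) (by rw [hD]; exact ((hG.differentiable (by simp)) _).hasFDerivAt)
      hG.contDiffAt
    exact (contDiffAt_snd.comp p (h6.comp p (contDiffAt_id.prodMk contDiffAt_const))).contDiffWithinAt
  · have hp' := Metric.ball_subset_ball (min_le_left σ ρ) hp
    refine ⟨?_, (hfix p hp').2⟩
    have h7 := (hσ' p hp').1
    rw [Metric.mem_ball, Prod.dist_eq] at h7
    exact (le_max_right _ _).trans_lt h7
  · have hp' := Metric.ball_subset_ball (min_le_left σ ρ) hp
    have hp2 := Metric.ball_subset_ball (min_le_right σ ρ) hp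
    have h8 : (p, γ) ∈ Metric.ball a ρ := by
      rw [Metric.mem_ball, Prod.dist_eq]
      exact max_lt hp2 hγ
    have h9 : G (p, γ) = (p, 0) := by
      refine Prod.ext rfl ?_
      change γ - constCurve p.1 - p.2 • primitive (N γ) = 0
      rw [sub_sub, sub_eq_zero]; exact h
    have h10 := e.left_inv (hρ' _ h8).2
    rw [he, h9] at h10
    change γ = (e.symm (p, 0)).2
    rw [h10]

/-- The local flow of a smooth vector field is smooth in the time and the initial value together. It
is the value at time `1` of the solutions for the vector field multiplied by the time. -/
lemma exists_smooth_flow {f : E → E} (hf : ContDiff ℝ ∞ f) (x₀ : E) :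
    ∃ (T : ℝ) (φ : ℝ × E → E), 0 < T ∧
      ContDiffOn ℝ ∞ φ (Set.Ioo (-T) T ×ˢ Metric.ball x₀ T) ∧
      ∀ x ∈ Metric.ball x₀ T, φ (0, x) = x ∧
        ∀ t ∈ Set.Ioo (-T) T, HasDerivAt (fun t => φ (t, x)) (f (φ (t, x))) t := by
  obtain ⟨σ, ρ, Γ, hσ, hΓ, hsol, huniq⟩ := exists_smooth_family hf x₀
  let one : Set.Icc (-1 : ℝ) 1 := ⟨1, by norm_num⟩
  have hT : 0 < σ / 2 := by positivity
  have hball : ∀ t ∈ Set.Icc (-(σ / 2)) (σ / 2), ∀ x ∈ Metric.ball x₀ (σ / 2),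
      (x, t) ∈ Metric.ball (x₀, (0 : ℝ)) σ := by
    intro t ht x hx
    rw [Metric.mem_ball, Prod.dist_eq]
    refine max_lt ((Metric.mem_ball.1 hx).trans (by linarith)) ?_
    rw [Real.dist_eq, sub_zero]
    exact (abs_le.2 ht).trans_lt (by linarith)
  have hval : ∀ p ∈ Metric.ball (x₀, (0 : ℝ)) σ, ∀ s : Set.Icc (-1 : ℝ) 1, Γ p s = p.1 +
      p.2 • ∫ u in (0 : ℝ)..s, f (Set.IccExtend (by norm_num : (-1 : ℝ) ≤ 1) (Γ p) u) := by
    intro p hp s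
    have := DFunLike.congr_fun (hsol p hp).2 s
    rw [this]; rfl
  -- by uniqueness, the solution for the factor `s * σ / 2` is the solution for `σ / 2` at rescaled times
  have hrep : ∀ x ∈ Metric.ball x₀ (σ / 2), ∀ s : Set.Icc (-1 : ℝ) 1,
      Γ (x, σ / 2) s = Γ (x, s * (σ / 2)) one := by
    intro x hx s
    have hp := hball (σ / 2) ⟨by linarith, le_rfl⟩ x hx
    have hs : (s : ℝ) * (σ / 2) ∈ Set.Icc (-(σ / 2)) (σ / 2) := by
      constructor <;> nlinarith [s.2.1, s.2.2]
    have hmem : ∀ u : Set.Icc (-1 : ℝ) 1, (s : ℝ) * u ∈ Set.Icc (-1 : ℝ) 1 := fun u =>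
      abs_le.1 (by
        rw [abs_mul]
        exact mul_le_one₀ (abs_le.2 s.2) (abs_nonneg _) (abs_le.2 u.2))
    have hcont : Continuous fun u : Set.Icc (-1 : ℝ) 1 => (⟨s * u, hmem u⟩ : Set.Icc (-1 : ℝ) 1) := by
      fun_prop
    have h1 := huniq (x, s * (σ / 2)) (hball _ hs x hx)
      ((Γ (x, σ / 2)).comp ⟨_, hcont⟩) ?_ ?_
    · have h2 := DFunLike.congr_fun h1 one
      rw [← h2]
      change _ = Γ (x, σ / 2) ⟨s * 1, _⟩
      congr 1
      exact Subtype.ext (mul_one _).symm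
    · have h3 := (hsol _ hp).1
      have : Nonempty (Set.Icc (-1 : ℝ) 1) := ⟨one⟩
      rw [Metric.mem_ball, ContinuousMap.dist_lt_iff_of_nonempty] at h3 ⊢
      intro u
      exact h3 _
    · ext u
      change Γ (x, σ / 2) ⟨s * u, hmem u⟩ = x + ((s : ℝ) * (σ / 2)) • ∫ w in (0 : ℝ)..u,
        f (Γ (x, σ / 2) ⟨s * (Set.projIcc (-1 : ℝ) 1 (by norm_num) w), hmem _⟩)
      rw [hval _ hp]
      change x + (σ / 2) • _ = _
      have h4 := intervalIntegral.smul_integral_comp_mul_left (a := 0) (b := u)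
        (fun v => f (Set.IccExtend (by norm_num : (-1 : ℝ) ≤ 1) (Γ (x, σ / 2)) v)) (s : ℝ)
      rw [mul_zero] at h4
      rw [← h4, smul_smul, mul_comm (σ / 2)]
      refine congrArg (fun I => x + ((s : ℝ) * (σ / 2)) • I)
        (intervalIntegral.integral_congr fun w hw => ?_)
      have hw' : w ∈ Set.Icc (-1 : ℝ) 1 := by
        have h5 : Set.uIcc 0 (u : ℝ) ⊆ Set.Icc (-1 : ℝ) 1 :=
          Set.uIcc_subset_Icc ⟨by norm_num, by norm_num⟩ u.2
        exact h5 hw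
      have h6 := hmem ⟨w, hw'⟩
      change f (Set.IccExtend _ (Γ (x, σ / 2)) (s * w)) = f (Γ (x, σ / 2) _)
      rw [Set.IccExtend_of_mem _ _ h6]
      congr 2
      refine Subtype.ext ?_
      change (s : ℝ) * w = s * (Set.projIcc (-1 : ℝ) 1 _ w)
      rw [Set.projIcc_of_mem _ hw']
  refine ⟨σ / 2, fun p => Γ (p.2, p.1) one, hT, ?_, fun x hx => ⟨?_, fun t ht => ?_⟩⟩
  · have h1 : ContDiffOn ℝ ∞ (fun p : ℝ × E => Γ (p.2, p.1))
        (Set.Ioo (-(σ / 2)) (σ / 2) ×ˢ Metric.ball x₀ (σ / 2)) :=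
      hΓ.comp (contDiff_snd.prodMk contDiff_fst).contDiffOn fun p hp =>
        hball _ (Set.Ioo_subset_Icc_self hp.1) _ hp.2
    exact (ContinuousMap.evalCLM ℝ one).contDiff.comp_contDiffOn h1
  · refine (hval (x, 0) (hball 0 ⟨by linarith, hT.le⟩ x hx) one).trans ?_
    rw [zero_smul, add_zero]
  · have hp := hball (σ / 2) ⟨by linarith, le_rfl⟩ x hx
    have hdiv : ∀ τ ∈ Set.Ioo (-(σ / 2)) (σ / 2), τ / (σ / 2) ∈ Set.Icc (-1 : ℝ) 1 := fun τ hτ =>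
      ⟨by rw [le_div_iff₀ hT]; linarith [hτ.1], by rw [div_le_iff₀ hT]; linarith [hτ.2]⟩
    have hφ : ∀ τ ∈ Set.Ioo (-(σ / 2)) (σ / 2), Γ (x, τ) one =
        x + (σ / 2) • ∫ u in (0 : ℝ)..τ / (σ / 2),
          f (Set.IccExtend (by norm_num : (-1 : ℝ) ≤ 1) (Γ (x, σ / 2)) u) := fun τ hτ => by
      have h1 := hrep x hx ⟨_, hdiv τ hτ⟩
      rw [div_mul_cancel₀ _ hT.ne'] at h1
      rw [← h1]
      exact hval _ hp _
    have hcont : Continuous fun u =>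
        f (Set.IccExtend (by norm_num : (-1 : ℝ) ≤ 1) (Γ (x, σ / 2)) u) :=
      hf.continuous.comp (Γ (x, σ / 2)).continuous.Icc_extend'
    have h2 := intervalIntegral.integral_hasDerivAt_right (hcont.intervalIntegrable 0 (t / (σ / 2)))
      (hcont.stronglyMeasurableAtFilter _ _) hcont.continuousAt
    have h3 := ((h2.scomp t ((hasDerivAt_id t).div_const (σ / 2))).const_smul (σ / 2)).const_add x
    have h4 : (σ / 2) • ((1 / (σ / 2)) • f (Set.IccExtend (by norm_num : (-1 : ℝ) ≤ 1)
        (Γ (x, σ / 2)) (t / (σ / 2)))) = f (Γ (x, t) one) := by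
      rw [smul_smul, mul_one_div_cancel hT.ne', one_smul, Set.IccExtend_of_mem _ _ (hdiv t ht),
        hrep x hx, div_mul_cancel₀ _ hT.ne']
    have h5 := h3.congr_deriv h4
    refine h5.congr_of_eventuallyEq ?_
    filter_upwards [isOpen_Ioo.mem_nhds ht] with τ hτ
    exact hφ τ hτ

/-- The local flow of a vector field that is smooth on an open set. -/
lemma exists_smooth_flow_on [FiniteDimensional ℝ E] {U : Set E} (hU : IsOpen U) {f : E → E}
    (hf : ContDiffOn ℝ ∞ f U) {x₀ : E} (hx₀ : x₀ ∈ U) :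
    ∃ (T : ℝ) (φ : ℝ × E → E), 0 < T ∧
      ContDiffOn ℝ ∞ φ (Set.Ioo (-T) T ×ˢ Metric.ball x₀ T) ∧
      ∀ x ∈ Metric.ball x₀ T, φ (0, x) = x ∧ ∀ t ∈ Set.Ioo (-T) T, φ (t, x) ∈ U ∧
        HasDerivAt (fun t => φ (t, x)) (f (φ (t, x))) t := by
  -- near `x₀` the flow of a globally smooth extension `g` does not leave the set where `g` equals `f`
  obtain ⟨g, hg, hgf⟩ := exists_contDiff_eventuallyEq hU hf hx₀
  obtain ⟨T, φ, hT, hφ, h⟩ := exists_smooth_flow hg x₀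
  have hmem : ((0 : ℝ), x₀) ∈ Set.Ioo (-T) T ×ˢ Metric.ball x₀ T :=
    ⟨⟨by linarith, hT⟩, Metric.mem_ball_self hT⟩
  have hc : ContinuousAt φ (0, x₀) := hφ.continuousOn.continuousAt
    ((isOpen_Ioo.prod Metric.isOpen_ball).mem_nhds hmem)
  have h1 : ∀ᶠ z in nhds ((0 : ℝ), x₀), φ z ∈ U ∧ g (φ z) = f (φ z) := by
    refine hc.eventually (p := fun y => y ∈ U ∧ g y = f y) ?_
    rw [(h x₀ (Metric.mem_ball_self hT)).1]
    exact (hU.eventually_mem hx₀).and hgf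
  obtain ⟨r, hr, hr'⟩ := Metric.eventually_nhds_iff_ball.1 h1
  have hsub : ∀ t ∈ Set.Ioo (-(min T r)) (min T r), ∀ x ∈ Metric.ball x₀ (min T r),
      (t, x) ∈ Metric.ball ((0 : ℝ), x₀) r := by
    intro t ht x hx
    rw [Metric.mem_ball, Prod.dist_eq]
    refine max_lt ?_ (lt_of_lt_of_le hx (min_le_right _ _))
    rw [Real.dist_eq, sub_zero]
    exact (abs_lt.2 ht).trans_le (min_le_right _ _)
  have hIoo : Set.Ioo (-(min T r)) (min T r) ⊆ Set.Ioo (-T) T :=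
    Set.Ioo_subset_Ioo (neg_le_neg (min_le_left _ _)) (min_le_left _ _)
  have hB : Metric.ball x₀ (min T r) ⊆ Metric.ball x₀ T := Metric.ball_subset_ball (min_le_left _ _)
  refine ⟨min T r, φ, lt_min hT hr, hφ.mono (Set.prod_mono hIoo hB), fun x hx =>
    ⟨(h x (hB hx)).1, fun t ht => ⟨(hr' _ (hsub t ht x hx)).1, ?_⟩⟩⟩
  have := (h x (hB hx)).2 t (hIoo ht)
  rwa [(hr' _ (hsub t ht x hx)).2] at this

end Flow
end

noncomputable section

/-! ### Values of superfunctions at Grassmann-valued points -/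

section Taylor

variable {E : Type*} [NormedAddCommGroup E] [NormedSpace ℝ E] {m n q : ℕ}

/-- The directional derivative as an operator on functions. -/
def dirDeriv {F : Type*} [NormedAddCommGroup F] [NormedSpace ℝ F] (v : E) (g : E → F) : E → F :=
  fun y => fderiv ℝ g y v

/-- The term of degree `k` of the Taylor expansion of `g` at `y` in the nilpotent direction
`∑ i, ν i • e i`, with the elements `ξ j` substituted for the generators. -/
def taylorTerm (e : Fin m → E) (ν : Fin m → Grassmann q) (ξ : Fin n → Grassmann q) :
    ℕ → (E → Grassmann n) → E → Grassmann q
  | 0, g, y => grassmannSubst ξ (g y)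
  | k + 1, g, y => ((k : ℝ) + 1)⁻¹ • ∑ i, ν i * taylorTerm e ν ξ k (dirDeriv (e i) g) y

variable {F : Type*} [NormedAddCommGroup F] [NormedSpace ℝ F]

lemma ContDiffOn.dirDeriv {U : Set E} (hU : IsOpen U) {g : E → F} (hg : ContDiffOn ℝ ∞ g U) (v : E) :
    ContDiffOn ℝ ∞ (dirDeriv v g) U :=
  (hg.fderiv_of_isOpen hU (by norm_cast)).clm_apply contDiffOn_const

lemma ContDiffOn.differentiableAt_of_isOpen {U : Set E} (hU : IsOpen U) {g : E → F}
    (hg : ContDiffOn ℝ ∞ g U) {y : E} (hy : y ∈ U) : DifferentiableAt ℝ g y :=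
  (hg.contDiffAt (hU.mem_nhds hy)).differentiableAt (by simp)

lemma dirDeriv_congr {U : Set E} (hU : IsOpen U) {g g' : E → F} (h : ∀ y ∈ U, g y = g' y) (v : E)
    {y : E} (hy : y ∈ U) : dirDeriv v g y = dirDeriv v g' y := by
  have : g =ᶠ[nhds y] g' := by filter_upwards [hU.mem_nhds hy] with z hz using h z hz
  rw [dirDeriv, dirDeriv, this.fderiv_eq]

lemma dirDeriv_add {U : Set E} (hU : IsOpen U) {f g : E → F} (hf : ContDiffOn ℝ ∞ f U)
    (hg : ContDiffOn ℝ ∞ g U) (v : E) {y : E} (hy : y ∈ U) :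
    dirDeriv v (fun y => f y + g y) y = dirDeriv v f y + dirDeriv v g y := by
  simp only [dirDeriv]
  rw [fderiv_fun_add (hf.differentiableAt_of_isOpen hU hy) (hg.differentiableAt_of_isOpen hU hy)]
  rfl

lemma dirDeriv_mul {U : Set E} (hU : IsOpen U) {f g : E → Grassmann n} (hf : ContDiffOn ℝ ∞ f U)
    (hg : ContDiffOn ℝ ∞ g U) (v : E) {y : E} (hy : y ∈ U) :
    dirDeriv v (fun y => f y * g y) y = dirDeriv v f y * g y + f y * dirDeriv v g y := by
  simp only [dirDeriv]
  rw [fderiv_fun_mul' (hf.differentiableAt_of_isOpen hU hy) (hg.differentiableAt_of_isOpen hU hy)]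
  simp [add_comm]

lemma dirDeriv_linear {G : Type*} [NormedAddCommGroup G] [NormedSpace ℝ G] [FiniteDimensional ℝ F]
    {U : Set E} (hU : IsOpen U) {f : E → F} (hf : ContDiffOn ℝ ∞ f U) (L : F →ₗ[ℝ] G)
    (v : E) {y : E} (hy : y ∈ U) : dirDeriv v (fun y => L (f y)) y = L (dirDeriv v f y) := by
  have h := (L.toContinuousLinearMap.hasFDerivAt (x := f y)).comp y
    (hf.differentiableAt_of_isOpen hU hy).hasFDerivAt
  simp only [dirDeriv]
  rw [show fderiv ℝ (fun y => L (f y)) y = _ from h.fderiv]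
  rfl

lemma dirDeriv_mem {U : Set E} (hU : IsOpen U) {f : E → Grassmann n} (hf : ContDiffOn ℝ ∞ f U)
    {i : ZMod 2} (h : ∀ y ∈ U, f y ∈ grassmannPart n i) (v : E) {y : E} (hy : y ∈ U) :
    dirDeriv v f y ∈ grassmannPart n i := by
  rw [← dirDeriv_congr hU (fun y hy => grassmannProj_eq (h y hy)) v hy, dirDeriv_linear hU hf _ v hy]
  exact grassmannProj_mem i _

variable {e : Fin m → E} {ν : Fin m → Grassmann q} {ξ : Fin n → Grassmann q} {U : Set E}

lemma taylorTerm_congr (hU : IsOpen U) {g g' : E → Grassmann n} (h : ∀ y ∈ U, g y = g' y) (k : ℕ)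
    {y : E} (hy : y ∈ U) : taylorTerm e ν ξ k g y = taylorTerm e ν ξ k g' y := by
  induction k generalizing g g' with
  | zero => simp only [taylorTerm, h y hy]
  | succ k ih =>
    simp only [taylorTerm]
    congr 1
    exact Finset.sum_congr rfl fun i _ => by
      rw [ih fun y hy => dirDeriv_congr hU h (e i) hy]

lemma taylorTerm_add (hU : IsOpen U) {f g : E → Grassmann n} (hf : ContDiffOn ℝ ∞ f U)
    (hg : ContDiffOn ℝ ∞ g U) (k : ℕ) {y : E} (hy : y ∈ U) :
    taylorTerm e ν ξ k (fun y => f y + g y) y = taylorTerm e ν ξ k f y + taylorTerm e ν ξ k g y := by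
  induction k generalizing f g with
  | zero => simp only [taylorTerm, map_add]
  | succ k ih =>
    simp only [taylorTerm, ← smul_add, ← Finset.sum_add_distrib, ← mul_add]
    congr 1
    exact Finset.sum_congr rfl fun i _ => by
      rw [← ih (hf.dirDeriv hU _) (hg.dirDeriv hU _),
        taylorTerm_congr hU (fun y hy => dirDeriv_add hU hf hg (e i) hy) k hy]

lemma taylorTerm_const (a : Grassmann n) (k : ℕ) (y : E) :
    taylorTerm e ν ξ (k + 1) (fun _ => a) y = 0 := by
  induction k generalizing a with
  | zero => simp [taylorTerm, dirDeriv]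
  | succ k ih =>
    rw [taylorTerm]
    have : ∀ v : E, dirDeriv v (fun _ : E => a) = fun _ => 0 := fun v => by ext; simp [dirDeriv]
    simp only [this, ih, mul_zero, Finset.sum_const_zero, smul_zero]

/-- The Leibniz rule for Taylor expansions in even directions. -/
lemma taylorTerm_mul (hU : IsOpen U) (hν : ∀ i, ν i ∈ grassmannPart q 0) {f g : E → Grassmann n}
    (hf : ContDiffOn ℝ ∞ f U) (hg : ContDiffOn ℝ ∞ g U) (k : ℕ) {y : E} (hy : y ∈ U) :
    taylorTerm e ν ξ k (fun y => f y * g y) y =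
      ∑ ab ∈ Finset.HasAntidiagonal.antidiagonal k, taylorTerm e ν ξ ab.1 f y * taylorTerm e ν ξ ab.2 g y := by
  induction k generalizing f g with
  | zero => simp [taylorTerm]
  | succ k ih =>
    have hs : ∀ (a : ℕ) (h : E → Grassmann n), ∑ i, ν i * taylorTerm e ν ξ a (dirDeriv (e i) h) y =
        ((a : ℝ) + 1) • taylorTerm e ν ξ (a + 1) h y := fun a h => by
      rw [taylorTerm, smul_smul, mul_inv_cancel₀ (by positivity), one_smul]
    have h1 : ∀ i, ν i * taylorTerm e ν ξ k (dirDeriv (e i) fun y => f y * g y) y =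
        ∑ ab ∈ Finset.HasAntidiagonal.antidiagonal k,
          ((ν i * taylorTerm e ν ξ ab.1 (dirDeriv (e i) f) y) * taylorTerm e ν ξ ab.2 g y +
          taylorTerm e ν ξ ab.1 f y * (ν i * taylorTerm e ν ξ ab.2 (dirDeriv (e i) g) y)) :=
        fun i => by
      rw [taylorTerm_congr hU (fun y hy => dirDeriv_mul hU hf hg (e i) hy) k hy,
        taylorTerm_add hU ((hf.dirDeriv hU _).mul hg) (hf.mul (hg.dirDeriv hU _)) k hy,
        ih (hf.dirDeriv hU _) hg, ih hf (hg.dirDeriv hU _), ← Finset.sum_add_distrib,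
        Finset.mul_sum]
      refine Finset.sum_congr rfl fun ab _ => ?_
      rw [mul_add, mul_assoc, ← mul_assoc (ν i) (taylorTerm e ν ξ ab.1 f y),
        grassmann_even_comm (hν i) (taylorTerm e ν ξ ab.1 f y), mul_assoc]
    have h2 : ∑ i, ν i * taylorTerm e ν ξ k (dirDeriv (e i) fun y => f y * g y) y =
        ((k : ℝ) + 1) • ∑ ab ∈ Finset.HasAntidiagonal.antidiagonal (k + 1),
          taylorTerm e ν ξ ab.1 f y * taylorTerm e ν ξ ab.2 g y := by
      -- split the factor `k + 1` as the sum of the two degrees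
      have h3 : ((k : ℝ) + 1) • ∑ ab ∈ Finset.HasAntidiagonal.antidiagonal (k + 1),
          taylorTerm e ν ξ ab.1 f y * taylorTerm e ν ξ ab.2 g y =
          ∑ ab ∈ Finset.HasAntidiagonal.antidiagonal (k + 1),
            (ab.1 : ℝ) • (taylorTerm e ν ξ ab.1 f y * taylorTerm e ν ξ ab.2 g y) +
          ∑ ab ∈ Finset.HasAntidiagonal.antidiagonal (k + 1),
            (ab.2 : ℝ) • (taylorTerm e ν ξ ab.1 f y * taylorTerm e ν ξ ab.2 g y) := by
        rw [Finset.smul_sum, ← Finset.sum_add_distrib]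
        refine Finset.sum_congr rfl fun ab hab => ?_
        rw [← add_smul]
        congr 1
        exact_mod_cast (Finset.HasAntidiagonal.mem_antidiagonal.1 hab).symm
      rw [h3, Finset.Nat.sum_antidiagonal_succ, Finset.Nat.sum_antidiagonal_succ']
      simp only [Nat.cast_zero, zero_smul, zero_add]
      rw [Finset.sum_congr rfl fun i _ => h1 i, Finset.sum_comm, ← Finset.sum_add_distrib]
      refine Finset.sum_congr rfl fun ab _ => ?_
      rw [Finset.sum_add_distrib, ← Finset.sum_mul, ← Finset.mul_sum, hs, hs, smul_mul_assoc,
        mul_smul_comm, Nat.cast_succ, Nat.cast_succ]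
    rw [taylorTerm, h2, smul_smul, inv_mul_cancel₀ (by positivity), one_smul]

lemma grassmannFil_anti {i j : ℕ} (h : i ≤ j) : grassmannFil q j ≤ grassmannFil q i :=
  iSup_le fun x => pow_le_grassmannFil (h.trans x.2)

lemma eq_zero_of_mem_fil {k : ℕ} (hk : q < k) {a : Grassmann q} (ha : a ∈ grassmannFil q k) :
    a = 0 := by
  have := grassmannFil_anti (q := q) hk ha
  rwa [grassmannFil_eq_bot, Submodule.mem_bot] at this

lemma taylorTerm_mem_fil (hν : ∀ i, ν i ∈ grassmannFil q 1) (k : ℕ) (g : E → Grassmann n) (y : E) :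
    taylorTerm e ν ξ k g y ∈ grassmannFil q k := by
  induction k generalizing g with
  | zero => rw [grassmannFil_zero]; trivial
  | succ k ih =>
    rw [taylorTerm]
    refine Submodule.smul_mem _ _ (Submodule.sum_mem _ fun i _ => ?_)
    rw [add_comm]
    exact grassmannFil_mul (hν i) (ih _)

lemma taylorTerm_mem (hU : IsOpen U) (hν : ∀ i, ν i ∈ grassmannPart q 0) {g : E → Grassmann n}
    (hg : ContDiffOn ℝ ∞ g U) {i : ZMod 2} (h : ∀ y ∈ U, g y ∈ grassmannPart n i) (k : ℕ)
    {y : E} (hy : y ∈ U) : taylorTerm e ν ξ k g y ∈ grassmannPart q i := by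
  induction k generalizing g with
  | zero => exact grassmannSubst_mem ξ (h y hy)
  | succ k ih =>
    rw [taylorTerm]
    refine Submodule.smul_mem _ _ (Submodule.sum_mem _ fun j _ => ?_)
    rw [← zero_add i]
    exact grassmannPart_mul (hν j) (ih (hg.dirDeriv hU _) fun y hy => dirDeriv_mem hU hg h _ hy)

lemma contDiffOn_taylorTerm (hU : IsOpen U) {g : E → Grassmann n} (hg : ContDiffOn ℝ ∞ g U) (k : ℕ) :
    ContDiffOn ℝ ∞ (fun z : E × (Fin m → Grassmann q) × (Fin n → Grassmann q) =>
      taylorTerm e z.2.1 z.2.2 k g z.1) (U ×ˢ Set.univ) := by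
  induction k generalizing g with
  | zero =>
    let b := (Pi.basisFun ℝ (Fin n)).ExteriorAlgebra
    have h : ∀ z : E × (Fin m → Grassmann q) × (Fin n → Grassmann q),
        taylorTerm e z.2.1 z.2.2 0 g z.1 = ∑ I, b.coord I (g z.1) • grassmannSubst z.2.2 (b I) := by
      intro z
      rw [taylorTerm]
      conv_lhs => rw [← b.sum_repr (g z.1)]
      simp only [map_sum, map_smul, Module.Basis.coord_apply]
    simp only [h]
    refine ContDiffOn.sum fun I _ => ContDiffOn.fun_smul ?_ ?_
    · exact (hg.linearMap_comp (b.coord I)).comp contDiff_fst.contDiffOn fun z hz => hz.1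
    · exact ((contDiff_grassmannSubst (b I)).comp
        (contDiff_snd.comp contDiff_snd)).contDiffOn
  | succ k ih =>
    simp only [taylorTerm]
    refine ContDiffOn.const_smul _ (ContDiffOn.sum fun i _ => ContDiffOn.mul ?_ ?_)
    · exact ((contDiff_apply ℝ (Grassmann q) i).comp (contDiff_fst.comp contDiff_snd)).contDiffOn
    · exact ih (hg.dirDeriv hU _)

/-- The Taylor expansion of `g` at `y` in the nilpotent direction `∑ i, ν i • e i`, with the elements
`ξ j` substituted for the generators. It is a finite sum, because products of more than `q` nilpotent
elements of the Grassmann algebra vanish. -/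
def taylorExt (e : Fin m → E) (ν : Fin m → Grassmann q) (ξ : Fin n → Grassmann q)
    (g : E → Grassmann n) (y : E) : Grassmann q :=
  ∑ k ∈ Finset.range (q + 1), taylorTerm e ν ξ k g y

lemma taylorExt_congr (hU : IsOpen U) {g g' : E → Grassmann n} (h : ∀ y ∈ U, g y = g' y)
    {y : E} (hy : y ∈ U) : taylorExt e ν ξ g y = taylorExt e ν ξ g' y :=
  Finset.sum_congr rfl fun k _ => taylorTerm_congr hU h k hy

lemma taylorExt_add (hU : IsOpen U) {f g : E → Grassmann n} (hf : ContDiffOn ℝ ∞ f U)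
    (hg : ContDiffOn ℝ ∞ g U) {y : E} (hy : y ∈ U) :
    taylorExt e ν ξ (fun y => f y + g y) y = taylorExt e ν ξ f y + taylorExt e ν ξ g y := by
  simp only [taylorExt, ← Finset.sum_add_distrib]
  exact Finset.sum_congr rfl fun k _ => taylorTerm_add hU hf hg k hy

lemma taylorExt_mul (hU : IsOpen U) (hν : ∀ i, ν i ∈ grassmannPart q 0)
    (hν' : ∀ i, ν i ∈ grassmannFil q 1) {f g : E → Grassmann n}
    (hf : ContDiffOn ℝ ∞ f U) (hg : ContDiffOn ℝ ∞ g U) {y : E} (hy : y ∈ U) :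
    taylorExt e ν ξ (fun y => f y * g y) y = taylorExt e ν ξ f y * taylorExt e ν ξ g y := by
  simp only [taylorExt, taylorTerm_mul hU hν hf hg _ hy,
    Finset.Nat.sum_antidiagonal_eq_sum_range_succ
      (fun a b => taylorTerm e ν ξ a f y * taylorTerm e ν ξ b g y)]
  rw [Finset.sum_range_diag_flip (q + 1)
    (fun a b => taylorTerm e ν ξ a f y * taylorTerm e ν ξ b g y), Finset.sum_mul_sum]
  refine Finset.sum_congr rfl fun a _ => ?_
  -- the products of total degree above `q` are missing from the sum on the left, but they vanish
  refine Finset.sum_subset (Finset.range_subset_range.2 (Nat.sub_le _ _)) fun b _ hb => ?_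
  refine eq_zero_of_mem_fil (k := a + b) ?_ (grassmannFil_mul (taylorTerm_mem_fil hν' _ _ _)
    (taylorTerm_mem_fil hν' _ _ _))
  rw [Finset.mem_range] at hb
  omega

lemma taylorExt_const (a : Grassmann n) (y : E) :
    taylorExt e ν ξ (fun _ => a) y = grassmannSubst ξ a := by
  rw [taylorExt, Finset.sum_range_succ', Finset.sum_eq_zero fun k _ => taylorTerm_const a k y,
    zero_add]
  rfl

lemma taylorExt_mem (hU : IsOpen U) (hν : ∀ i, ν i ∈ grassmannPart q 0) {g : E → Grassmann n}
    (hg : ContDiffOn ℝ ∞ g U) {i : ZMod 2} (h : ∀ y ∈ U, g y ∈ grassmannPart n i)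
    {y : E} (hy : y ∈ U) : taylorExt e ν ξ g y ∈ grassmannPart q i :=
  Submodule.sum_mem _ fun k _ => taylorTerm_mem hU hν hg h k hy

lemma gbody_taylorExt (hν : ∀ i, ν i ∈ grassmannFil q 1) (g : E → Grassmann n) (y : E) :
    gbody (taylorExt e ν ξ g y) = gbody (g y) := by
  rw [taylorExt, Finset.sum_range_succ', map_add, map_sum, Finset.sum_eq_zero fun k _ => ?_,
    zero_add, taylorTerm, gbody_grassmannSubst]
  exact gbody_fil (grassmannFil_anti (Nat.succ_le_succ (Nat.zero_le k))
    (taylorTerm_mem_fil hν (k + 1) g y))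

lemma contDiffOn_taylorExt (hU : IsOpen U) {g : E → Grassmann n} (hg : ContDiffOn ℝ ∞ g U) :
    ContDiffOn ℝ ∞ (fun z : E × (Fin m → Grassmann q) × (Fin n → Grassmann q) =>
      taylorExt e z.2.1 z.2.2 g z.1) (U ×ˢ Set.univ) :=
  ContDiffOn.sum fun k _ => contDiffOn_taylorTerm hU hg k

/-- The Taylor expansion of a linear function ends with the term of degree one. -/
lemma taylorExt_linear (l : E →L[ℝ] ℝ) (y : E) (hν : ∀ i, ν i ∈ grassmannFil q 1) :
    taylorExt e ν ξ (fun y => algebraMap ℝ (Grassmann n) (l y)) y =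
      algebraMap ℝ (Grassmann q) (l y) + ∑ i, l (e i) • ν i := by
  have hd : ∀ v : E, dirDeriv v (fun y => algebraMap ℝ (Grassmann n) (l y)) =
      fun _ => algebraMap ℝ (Grassmann n) (l v) := fun v => by
    funext y
    refine (dirDeriv_linear isOpen_univ l.contDiff.contDiffOn (Algebra.linearMap ℝ (Grassmann n)) v
      (Set.mem_univ y)).trans ?_
    simp [dirDeriv]
  have h2 : ∀ k, taylorTerm e ν ξ (k + 1 + 1) (fun y => algebraMap ℝ (Grassmann n) (l y)) y = 0 := by
    intro k
    rw [taylorTerm]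
    simp only [hd, taylorTerm_const, mul_zero, Finset.sum_const_zero, smul_zero]
  have h1 : taylorTerm e ν ξ 1 (fun y => algebraMap ℝ (Grassmann n) (l y)) y = ∑ i, l (e i) • ν i := by
    rw [taylorTerm]
    simp only [taylorTerm, hd, AlgHom.commutes, Nat.cast_zero, zero_add, inv_one]
    rw [one_smul]
    simp only [Algebra.smul_def]
    exact Finset.sum_congr rfl fun i _ => (Algebra.commutes _ _).symm
  rw [taylorExt, Finset.sum_range_succ', taylorTerm, AlgHom.commutes, add_comm]
  congr 1
  rcases q with _ | q
  · rw [Finset.range_zero, Finset.sum_empty]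
    refine (Finset.sum_eq_zero fun i _ => ?_).symm
    rw [eq_zero_of_mem_fil Nat.zero_lt_one (hν i), smul_zero]
  · rw [Finset.sum_range_succ', Finset.sum_eq_zero fun k _ => h2 k, zero_add, h1]

/-- The Taylor expansion of a function with a parameter `t`. -/
lemma taylorExt_slice {D : Set (ℝ × E)} (hD : IsOpen D) {g : ℝ × E → Grassmann n}
    (hg : ContDiffOn ℝ ∞ g D) {t : ℝ} {y : E} (h : (t, y) ∈ D) :
    taylorExt (fun i => ((0 : ℝ), e i)) ν ξ g (t, y) = taylorExt e ν ξ (fun y => g (t, y)) y := by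
  refine Finset.sum_congr rfl fun k hk => ?_
  clear hk
  induction k generalizing g y with
  | zero => rfl
  | succ k ih =>
    simp only [taylorTerm]
    congr 1
    refine Finset.sum_congr rfl fun i _ => ?_
    rw [ih (hg.dirDeriv hD _) h]
    congr 1
    refine taylorTerm_congr (U := {y | (t, y) ∈ D}) (hD.preimage (by fun_prop)) (fun z hz => ?_) k h
    have h1 := (hg.differentiableAt_of_isOpen hD hz).hasFDerivAt.comp z
      (hasFDerivAt_prodMk_right t z)
    simp only [dirDeriv]
    rw [show fderiv ℝ (fun y => g (t, y)) z = _ from h1.fderiv]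
    rfl

end Taylor
end

noncomputable section

namespace SuperSpace

/-! ### Grassmann-valued points -/

/-- A point of `N` with values in the Grassmann algebra on `q` generators: a point of the body
together with a morphism from the stalk at this point to the Grassmann algebra that preserves the
parity and is compatible with residues. -/
@[ext]
structure GrPoint (N : SuperSpace.{u}) (q : ℕ) where
  pt : N.body
  app : ∀ U : Opens N.body, pt ∈ U → (N.O U →ₐ[ℝ] Grassmann q)
  app_res : ∀ {U V : Opens N.body} (h : V ≤ U) (hp : pt ∈ V) (a : N.O U),
    app V hp (N.res h a) = app U (h hp) a
  app_mem : ∀ {U : Opens N.body} (hp : pt ∈ U) {i : ZMod 2} {a : N.O U}, a ∈ N.gr U i →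
    app U hp a ∈ grassmannPart q i
  app_val : ∀ {U : Opens N.body} (hp : pt ∈ U) (a : N.O U),
    gbody (app U hp a) = N.val U a ⟨pt, hp⟩

variable {X : SuperSpace.{u}} {Y : SuperSpace.{v}} {Z : SuperSpace.{w}} {q : ℕ}

lemma GrPoint.ext' {g g' : GrPoint X q} (h : g.pt = g'.pt)
    (h' : ∀ U (hp : g.pt ∈ U) a, g.app U hp a = g'.app U (h ▸ hp) a) : g = g' := by
  cases g; cases g'; cases h
  congr 1
  funext U hp
  ext a
  exact h' U hp a

lemma GrPoint.app_congr {g g' : GrPoint X q} (h : g = g') {U : Opens X.body} (hp : g.pt ∈ U)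
    (hp' : g'.pt ∈ U) (a : X.O U) : g.app U hp a = g'.app U hp' a := by
  subst h; rfl

/-- The image of a Grassmann-valued point under a morphism. -/
def Hom.mapPt (Φ : Hom X Y) (g : GrPoint X q) : GrPoint Y q where
  pt := Φ.toMap g.pt
  app U h := (g.app (U.comap Φ.toMap) h).comp (Φ.pull U)
  app_res {U V} h hp a := (congrArg (g.app _ _) (Φ.pull_res h a)).trans
    (g.app_res (U := U.comap Φ.toMap) (V := V.comap Φ.toMap) (fun _ hx => h hx) hp _)
  app_mem {U} hp _ _ ha := g.app_mem (U := U.comap Φ.toMap) hp (Φ.pull_mem ha)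
  app_val {U} hp a := (g.app_val (U := U.comap Φ.toMap) hp _).trans (Φ.pull_val a ⟨g.pt, hp⟩)

lemma mapPt_comp (Ψ : Hom Y Z) (Φ : Hom X Y) (g : GrPoint X q) :
    (Ψ.comp Φ).mapPt g = Ψ.mapPt (Φ.mapPt g) := rfl

/-- A Grassmann-valued point as a point of an open subspace. -/
def GrPoint.restrict (g : GrPoint X q) {W : Opens X.body} (h : g.pt ∈ W) :
    GrPoint (X.restrict W) q where
  pt := ⟨g.pt, h⟩
  app U hp := g.app (up U) (mem_up.2 ⟨h, hp⟩)
  app_res _ _ a := g.app_res _ _ a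
  app_mem _ _ _ ha := g.app_mem _ ha
  app_val _ a := g.app_val _ a

lemma inclusion_mapPt_restrict (g : GrPoint X q) {W : Opens X.body} (h : g.pt ∈ W) :
    (inclusion X W).mapPt (g.restrict h) = g :=
  GrPoint.ext' rfl fun U _ a => g.app_res (U := U) (fun _ hx => (mem_up.1 hx).2) _ a

lemma restrictIncl_mapPt_restrict (g : GrPoint X q) {W W' : Opens X.body} (hW : W' ≤ W)
    (h : g.pt ∈ W') : (X.restrictIncl hW).mapPt (g.restrict h) = g.restrict (hW h) :=
  GrPoint.ext' rfl fun U hp a => g.app_res (U := up U)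
    (fun _ hx => mem_up.2 ⟨hW (mem_up.1 hx).1, (mem_up.1 hx).2⟩) (mem_up.2 ⟨h, hp⟩) a

/-- The tautological Grassmann-valued points of a superdomain. -/
def domPt {p q : ℕ} {V : Opens (Fin p → ℝ)} (y : V) : GrPoint (superDomain p q V) q where
  pt := y
  app U h := (Pi.evalAlgHom ℝ (fun _ => Grassmann q)
    (⟨y.1, mem_up.2 ⟨y.2, h⟩⟩ : ((up (W := V) U : Opens (Fin p → ℝ)) : Set (Fin p → ℝ)))).comp
      (superFun p q ((up (W := V) U : Opens (Fin p → ℝ)) : Set (Fin p → ℝ))).val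
  app_res _ _ _ := rfl
  app_mem _ _ _ ha := ha _
  app_val _ _ := rfl

/-- Superfunctions on a superdomain are functions with values in the Grassmann algebra, so that they are
determined by their values at the tautological points. -/
lemma domPt_ext {p q : ℕ} {V : Opens (Fin p → ℝ)} {U : Opens (superDomain p q V).body}
    {f f' : (superDomain p q V).O U}
    (h : ∀ (y : V) (hy : y ∈ U), (domPt y).app U hy f = (domPt y).app U hy f') : f = f' :=
  Subtype.ext (funext fun x => h ⟨x.1, (mem_up.1 x.2).1⟩ (mem_up.1 x.2).2)

/-! ### Morphisms, open immersions and charts -/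

lemma Hom.pull_congr {f g : Hom X Y} (h : f = g) {U : Opens Y.body} (a : Y.O U) :
    f.pull U a = X.res (by rw [h]) (g.pull U a) := by
  subst h; exact (X.res_self _ _).symm

/-- A family of Grassmann-valued points of `N`, parametrized by a superdomain, that is continuous and
depends smoothly on the parameter, is a morphism. -/
def Hom.ofPts {p q : ℕ} {V : Opens (Fin p → ℝ)} (g : V → GrPoint X q)
    (hc : Continuous fun y => (g y).pt)
    (hs : ∀ (U : Opens X.body) (a : X.O U), ∃ F : (Fin p → ℝ) → Grassmann q,
      ContDiffOn ℝ ∞ F {y | ∃ hy : y ∈ V, (g ⟨y, hy⟩).pt ∈ U} ∧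
        ∀ (y : V) (hy : (g y).pt ∈ U), (g y).app U hy a = F y) :
    Hom (superDomain p q V) X where
  toMap := ⟨fun y => (g y).pt, hc⟩
  pull U := AlgHom.codRestrict (AlgHom.pi fun y : (up (W := V) (U.comap ⟨fun y => (g y).pt, hc⟩) :
      Opens (Fin p → ℝ)) => (g ⟨y.1, (mem_up.1 y.2).1⟩).app U (mem_up.1 y.2).2) _ fun a => by
    obtain ⟨F, hF, h⟩ := hs U a
    refine GrassmannSmooth.congr (f := F) (grassmannSmooth_iff.2 (hF.mono fun y hy => mem_up.1 hy))
      fun y hy => ?_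
    exact (extendZero_of_mem _ hy).trans (h _ _)
  pull_res h a := Subtype.ext (funext fun y => (g _).app_res h _ a)
  pull_mem ha y := (g _).app_mem _ ha
  pull_val a y := (g _).app_val _ a

namespace Hom.IsOpenImmersion

variable {c : Hom X Y} (hc : c.IsOpenImmersion)

include hc in
lemma injective : Function.Injective c.toMap := hc.isOpenEmbedding.injective

/-- The image of an open set under an open immersion. -/
def img (B : Opens X.body) : Opens Y.body := ⟨c.toMap '' B, hc.isOpenEmbedding.isOpenMap _ B.isOpen⟩

/-- The range of an open immersion. -/
def range : Opens Y.body := ⟨Set.range c.toMap, hc.isOpenEmbedding.isOpen_range⟩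

end Hom.IsOpenImmersion

lemma mem_gr_of_injective {U : Opens X.body} {U' : Opens Y.body} {φ : Y.O U' →ₐ[ℝ] X.O U}
    (hφ : Function.Injective φ) (h : ∀ i, ∀ a ∈ Y.gr U' i, φ a ∈ X.gr U i) {i : ZMod 2} {a : Y.O U'}
    (ha : φ a ∈ X.gr U i) : a ∈ Y.gr U' i := by
  have htop : a ∈ Y.gr U' 0 ⊔ Y.gr U' 1 := by rw [(Y.gr_isCompl U').sup_eq_top]; trivial
  obtain ⟨a0, h0, a1, h1, rfl⟩ := Submodule.mem_sup.1 htop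
  rcases zmod_two_cases i with rfl | rfl
  · have := (parts_unique X (h 0 a0 h0) (h 1 a1 h1) ha (Submodule.zero_mem _)
      (by rw [add_zero, map_add])).2
    rw [hφ (this.trans (map_zero φ).symm), add_zero]; exact h0
  · have := (parts_unique X (h 0 a0 h0) (h 1 a1 h1) (Submodule.zero_mem _) ha
      (by rw [zero_add, map_add])).1
    rw [hφ (this.trans (map_zero φ).symm), zero_add]; exact h1

namespace Hom.IsOpenImmersion

variable {c : Hom X Y} (hc : c.IsOpenImmersion)

/-- Pull-back by an open immersion of the sections over an open subset of its range. -/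
def pullEquiv (U : Opens Y.body) (hU : U ≤ hc.range) : Y.O U ≃ₐ[ℝ] X.O (U.comap c.toMap) :=
  AlgEquiv.ofBijective (c.pull U) (hc.bijective U fun _ hy => hU hy)

lemma pull_pullEquiv_symm (U : Opens Y.body) (hU : U ≤ hc.range) (a : X.O (U.comap c.toMap)) :
    c.pull U ((hc.pullEquiv U hU).symm a) = a :=
  (hc.pullEquiv U hU).apply_symm_apply a

/-- The underlying map of the inverse of an open immersion. -/
def invMap : C(hc.range, X.body) :=
  ⟨fun y => hc.isOpenEmbedding.isEmbedding.toHomeomorph.symm ⟨y.1, y.2⟩,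
    hc.isOpenEmbedding.isEmbedding.toHomeomorph.symm.continuous⟩

lemma map_invMap (y : hc.range) : c.toMap (hc.invMap y) = y.1 :=
  congrArg Subtype.val (hc.isOpenEmbedding.isEmbedding.toHomeomorph.apply_symm_apply ⟨y.1, y.2⟩)

lemma invMap_map (x : X.body) : hc.invMap ⟨c.toMap x, ⟨x, rfl⟩⟩ = x :=
  hc.isOpenEmbedding.isEmbedding.toHomeomorph.symm_apply_apply x

lemma up_comap_invMap_le (U : Opens X.body) : up (U.comap hc.invMap) ≤ hc.range :=
  fun _ hy => (mem_up.1 hy).1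

lemma comap_up_comap_invMap_le (U : Opens X.body) :
    (up (U.comap hc.invMap)).comap c.toMap ≤ U := fun x hx => by
  have h : hc.invMap ⟨c.toMap x, ⟨x, rfl⟩⟩ ∈ U := (mem_up.1 hx).2
  rwa [invMap_map] at h

/-- The inverse of an open immersion on sections. -/
def invPull (U : Opens X.body) : X.O U →ₐ[ℝ] Y.O (up (U.comap hc.invMap)) :=
  (hc.pullEquiv _ (hc.up_comap_invMap_le U)).symm.toAlgHom.comp
    (X.res (hc.comap_up_comap_invMap_le U))

lemma pull_invPull (U : Opens X.body) (a : X.O U) :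
    c.pull _ (hc.invPull U a) = X.res (hc.comap_up_comap_invMap_le U) a :=
  hc.pull_pullEquiv_symm _ (hc.up_comap_invMap_le U) _

lemma pull_injective {U : Opens Y.body} (hU : U ≤ hc.range) : Function.Injective (c.pull U) :=
  (hc.bijective U fun _ hy => hU hy).1

/-- The inverse of an open immersion, defined on the open subspace over its range. -/
def inv : Hom (Y.restrict hc.range) X where
  toMap := hc.invMap
  pull U := hc.invPull U
  pull_res {U V} h a := by
    refine hc.pull_injective (hc.up_comap_invMap_le V) ?_
    refine (hc.pull_invPull V _).trans ?_
    refine (X.res_res _ _ a).trans ?_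
    refine Eq.trans ?_ (c.pull_res (up_mono fun _ hx => h hx) (hc.invPull U a)).symm
    exact ((congrArg (X.res _) (hc.pull_invPull U a)).trans (X.res_res _ _ a)).symm
  pull_mem {U i a} ha := by
    refine mem_gr_of_injective (φ := c.pull _) (hc.pull_injective (hc.up_comap_invMap_le U))
      (fun i a ha => c.pull_mem ha) ?_
    exact hc.pull_invPull U a ▸ X.res_mem _ ha
  pull_val {U} a y := by
    have hy : hc.invMap y.1 ∈ U := y.2
    have hx : c.toMap (hc.invMap y.1) ∈ up (U.comap hc.invMap) := by
      have h : y.1.1 ∈ up (U.comap hc.invMap) := coe_mem_up.2 hy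
      exact (hc.map_invMap y.1).symm ▸ h
    have h1 := c.pull_val (hc.invPull U a) ⟨hc.invMap y.1, hx⟩
    have h2 : X.val _ (c.pull _ (hc.invPull U a)) ⟨hc.invMap y.1, hx⟩ =
        X.val U a ⟨hc.invMap y.1, hy⟩ :=
      (congrArg (fun b => X.val _ b ⟨hc.invMap y.1, hx⟩) (hc.pull_invPull U a)).trans
        (X.val_res _ a _)
    refine Eq.trans ?_ (h1.symm.trans h2)
    refine congrArg (Y.val (up (U.comap hc.invMap)) (hc.invPull U a)) ?_
    exact Subtype.ext (hc.map_invMap y.1).symm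

lemma inv_mapPt (g : GrPoint X q) :
    hc.inv.mapPt ((c.mapPt g).restrict (show c.toMap g.pt ∈ hc.range from ⟨g.pt, rfl⟩)) = g := by
  refine GrPoint.ext' (hc.invMap_map g.pt) fun U hp a => ?_
  have hm : c.toMap g.pt ∈ up (U.comap hc.invMap) := mem_up.2 ⟨⟨g.pt, rfl⟩, hp⟩
  exact (congrArg (g.app ((up (U.comap hc.invMap)).comap c.toMap) hm) (hc.pull_invPull U a)).trans
    (g.app_res _ _ a)

lemma invPull_pull {U : Opens Y.body} (a : Y.O U) :
    hc.invPull _ (c.pull U a) = Y.res (fun y hy => by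
      have h := (mem_up.1 hy).2
      have h2 : c.toMap (hc.invMap ⟨y, (mem_up.1 hy).1⟩) ∈ U := h
      rwa [map_invMap] at h2) a := by
  refine hc.pull_injective (hc.up_comap_invMap_le _) ?_
  exact (hc.pull_invPull _ _).trans (c.pull_res _ a).symm

lemma mapPt_inv (g : GrPoint (Y.restrict hc.range) q) :
    c.mapPt (hc.inv.mapPt g) = (SuperSpace.inclusion Y hc.range).mapPt g := by
  refine GrPoint.ext' (hc.map_invMap g.pt) fun U hp a => ?_
  have hp' : g.pt.1 ∈ U := (hc.map_invMap g.pt) ▸ hp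
  refine (congrArg (g.app ((U.comap c.toMap).comap hc.invMap) hp) (hc.invPull_pull a)).trans ?_
  refine Eq.trans ?_ (g.app_res (U := U.comap (SuperSpace.inclusion Y hc.range).toMap)
    (V := (U.comap c.toMap).comap hc.invMap) (fun y hy => ?_) hp _)
  · exact congrArg (g.app ((U.comap c.toMap).comap hc.invMap) hp) (Y.res_res _ _ a).symm
  · have h2 : c.toMap (hc.invMap y) ∈ U := hy
    have h3 : y.1 ∈ U := (hc.map_invMap y) ▸ h2
    exact h3

/-- Grassmann-valued points over the range of an open immersion come from its source. -/
lemma exists_mapPt_eq (g : GrPoint Y q) (h : g.pt ∈ hc.range) : ∃ g' : GrPoint X q, c.mapPt g' = g :=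
  ⟨hc.inv.mapPt (g.restrict h), by rw [mapPt_inv, inclusion_mapPt_restrict]⟩

include hc in
lemma mapPt_injective {g g' : GrPoint X q} (h : c.mapPt g = c.mapPt g') : g = g' := by
  rw [← hc.inv_mapPt g, ← hc.inv_mapPt g']
  congr 1
  have : ∀ (a b : GrPoint Y q) (ha : a.pt ∈ hc.range) (hb : b.pt ∈ hc.range), a = b →
      a.restrict ha = b.restrict hb := by rintro a _ _ _ rfl; rfl
  exact this _ _ _ _ h

lemma restrictIncl {W' W : Opens X.body} (h : W' ≤ W) : (X.restrictIncl h).IsOpenImmersion where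
  isOpenEmbedding := by
    refine Topology.IsOpenEmbedding.of_continuous_injective_isOpenMap
      (X.restrictIncl h).toMap.continuous (fun x y e => Subtype.ext (congrArg (fun z : W => z.1) e))
      fun s hs => ?_
    have h1 := W'.isOpen.isOpenMap_subtype_val s hs
    have h2 := h1.preimage (continuous_subtype_val (p := (· ∈ W)))
    refine cast (congrArg IsOpen (Set.ext fun x => ⟨?_, ?_⟩)) h2
    · rintro ⟨y, hy, e⟩; exact ⟨y, hy, Subtype.ext e⟩
    · rintro ⟨y, hy, rfl⟩; exact ⟨y, hy, rfl⟩
  bijective U hU := by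
    have hle : up U ≤ up (U.comap (X.restrictIncl h).toMap) := fun x hx => by
      obtain ⟨hW, hx⟩ := mem_up.1 hx
      obtain ⟨y, hy⟩ := hU hx
      have : y.1 = x := congrArg (fun z : W => z.1) hy
      refine mem_up.2 ⟨this ▸ y.2, ?_⟩
      exact hx
    refine ⟨fun a b e => ?_, fun b => ⟨X.res hle b, ?_⟩⟩
    · have key : ∀ a : X.O (up U), X.res hle ((X.restrictIncl h).pull U a) = a := fun a =>
        (X.res_res _ _ a).trans (X.res_self _ a)
      exact (key a).symm.trans ((congrArg (X.res hle) e).trans (key b))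
    · exact (X.res_res _ _ b).trans (X.res_self _ b)

lemma inclusion (W : Opens X.body) : (SuperSpace.inclusion X W).IsOpenImmersion where
  isOpenEmbedding := W.isOpen.isOpenEmbedding_subtypeVal
  bijective U hU := by
    have hle : U ≤ up (U.comap (SuperSpace.inclusion X W).toMap) := fun x hx => by
      obtain ⟨y, rfl⟩ := hU hx
      exact mem_up.2 ⟨y.2, hx⟩
    refine ⟨fun a b e => ?_, fun b => ⟨X.res hle b, ?_⟩⟩
    · have key : ∀ a : X.O U, X.res hle ((SuperSpace.inclusion X W).pull U a) = a := fun a =>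
        (X.res_res _ _ a).trans (X.res_self _ a)
      exact (key a).symm.trans ((congrArg (X.res hle) e).trans (key b))
    · exact (X.res_res _ _ b).trans (X.res_self _ b)

end Hom.IsOpenImmersion

/-! ### Supermanifolds -/

section Supermanifold

variable {m n : ℕ}

/-- Superfunctions on a supermanifold are determined by their values at the Grassmann-valued points
given by charts. -/
lemma IsSupermanifold.sec_ext (hX : X.IsSupermanifold m n) {U : Opens X.body} {a b : X.O U}
    (h : ∀ (V : Opens (Fin m → ℝ)) (c : Hom (superDomain m n V) X), c.IsOpenImmersion →
      ∀ (y : V) (hy : c.toMap y ∈ U),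
        (c.mapPt (domPt y)).app U hy a = (c.mapPt (domPt y)).app U hy b) : a = b := by
  refine X.locality a b fun x hx => ?_
  obtain ⟨V, c, hc, hxc⟩ := hX.exists_chart x
  refine ⟨U ⊓ hc.range, inf_le_left, ⟨hx, hxc⟩, hc.pull_injective inf_le_right ?_⟩
  refine domPt_ext fun y hy => ?_
  have h1 := h V c hc y hy.1
  rw [← (c.mapPt (domPt y)).app_res (V := U ⊓ hc.range) inf_le_left hy,
    ← (c.mapPt (domPt y)).app_res (V := U ⊓ hc.range) inf_le_left hy] at h1
  exact h1

/-- Morphisms from a supermanifold are determined by the images of the Grassmann-valued points given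
by charts. -/
lemma IsSupermanifold.hom_ext (hX : X.IsSupermanifold m n) {f g : Hom X Y}
    (h : ∀ (V : Opens (Fin m → ℝ)) (c : Hom (superDomain m n V) X), c.IsOpenImmersion →
      ∀ y : V, f.mapPt (c.mapPt (domPt y)) = g.mapPt (c.mapPt (domPt y))) : f = g := by
  have e : f.toMap = g.toMap := by
    ext x
    obtain ⟨V, c, hc, y, rfl⟩ := hX.exists_chart x
    exact congrArg GrPoint.pt (h V c hc y)
  refine Hom.ext' e fun U a => hX.sec_ext fun V c hc y hy => ?_
  have h1 := GrPoint.app_congr (h V c hc y) (U := U) hy (by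
    change f.toMap (c.toMap y) ∈ U at hy
    rw [e] at hy; exact hy) a
  refine h1.trans ?_
  exact ((c.mapPt (domPt y)).app_res (U := U.comap g.toMap) (V := U.comap f.toMap)
    (by rw [e]) hy (g.pull U a)).symm

lemma domain_hom_ext {p q : ℕ} {V : Opens (Fin p → ℝ)} {f g : Hom (superDomain p q V) Y}
    (h : ∀ y : V, f.mapPt (domPt y) = g.mapPt (domPt y)) : f = g := by
  have e : f.toMap = g.toMap := by
    ext x
    exact congrArg GrPoint.pt (h x)
  refine Hom.ext' e fun U a => domPt_ext fun y hy => ?_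
  have h1 := GrPoint.app_congr (h y) (U := U) hy (by
    change f.toMap y ∈ U at hy
    rw [e] at hy; exact hy) a
  exact h1

end Supermanifold

/-! ### Gluing of morphisms -/

/-- Morphisms to `Y` on the members of an open cover that agree on the intersections can be glued. -/
lemma exists_glue {ι : Type u} (W : ι → Opens X.body) (W₀ : Opens X.body) (hle : ∀ i, W i ≤ W₀)
    (hcov : ∀ x ∈ W₀, ∃ i, x ∈ W i) (f : ∀ i, Hom (X.restrict (W i)) Y)
    (hf : ∀ i j, (f i).comp (X.restrictIncl (inf_le_left : W i ⊓ W j ≤ W i)) =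
      (f j).comp (X.restrictIncl (inf_le_right : W i ⊓ W j ≤ W j))) :
    ∃ F : Hom (X.restrict W₀) Y, ∀ i, F.comp (X.restrictIncl (hle i)) = f i := by
  choose k hk using hcov
  have hpt : ∀ i j x (hi : x ∈ W i) (hj : x ∈ W j), (f i).toMap ⟨x, hi⟩ = (f j).toMap ⟨x, hj⟩ :=
    fun i j x hi hj => congrArg (fun g : Hom (X.restrict (W i ⊓ W j)) Y => g.toMap ⟨x, hi, hj⟩)
      (hf i j)
  let φ : W₀ → Y.body := fun x => (f (k x.1 x.2)).toMap ⟨x.1, hk x.1 x.2⟩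
  have hφ : ∀ i x (hi : x ∈ W i), φ ⟨x, hle i hi⟩ = (f i).toMap ⟨x, hi⟩ := fun i x hi =>
    hpt _ _ _ _ _
  have hcont : Continuous φ := continuous_iff_continuousAt.2 fun x => by
    have hx := hk x.1 x.2
    have h1 : ContinuousAt (φ ∘ fun y : W (k x.1 x.2) => (⟨y.1, hle _ y.2⟩ : W₀)) ⟨x.1, hx⟩ := by
      have : (φ ∘ fun y : W (k x.1 x.2) => (⟨y.1, hle _ y.2⟩ : W₀)) = (f (k x.1 x.2)).toMap :=
        funext fun y => hφ _ _ _
      rw [this]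
      exact (f (k x.1 x.2)).toMap.continuous.continuousAt
    exact ((Hom.IsOpenImmersion.restrictIncl (hle (k x.1 x.2))).isOpenEmbedding.continuousAt_iff
      (x := ⟨x.1, hx⟩)).1 h1
  let Φ : C(W₀, Y.body) := ⟨φ, hcont⟩
  let A : Opens Y.body → ι → Opens X.body := fun U i => up (U.comap (f i).toMap)
  let A₀ : Opens Y.body → Opens X.body := fun U => up (U.comap Φ)
  have hA : ∀ U i, A U i ≤ A₀ U := fun U i x hx => by
    obtain ⟨hi, hx⟩ := mem_up.1 hx
    refine mem_up.2 ⟨hle i hi, ?_⟩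
    change φ ⟨x, hle i hi⟩ ∈ U
    rw [hφ]; exact hx
  have hA' : ∀ U x, x ∈ A₀ U → ∃ i, x ∈ A U i := fun U x hx => by
    obtain ⟨hW, hx⟩ := mem_up.1 hx
    exact ⟨k x hW, mem_up.2 ⟨hk x hW, hx⟩⟩
  have hloc : ∀ (U : Opens Y.body) (a b : X.O (A₀ U)),
      (∀ i, X.res (hA U i) a = X.res (hA U i) b) → a = b := fun U a b h =>
    X.locality a b fun x hx => by
      obtain ⟨i, hi⟩ := hA' U x hx
      exact ⟨A U i, hA U i, hi, h i⟩
  have hex : ∀ (U : Opens Y.body) (a : Y.O U), ∃ s : X.O (A₀ U), ∀ i,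
      X.res (hA U i) s = (f i).pull U a := by
    intro U a
    obtain ⟨s, hs⟩ := X.gluing (A U) (fun i => (f i).pull U a) fun i j => by
      have hle1 : A U i ⊓ A U j ≤ up (U.comap ((f i).comp
          (X.restrictIncl (inf_le_left : W i ⊓ W j ≤ W i))).toMap) := fun x hx =>
        mem_up.2 ⟨⟨(mem_up.1 hx.1).1, (mem_up.1 hx.2).1⟩, (mem_up.1 hx.1).2⟩
      have h1 := congrArg (X.res hle1) (Hom.pull_congr (hf i j) a)
      refine Eq.trans ?_ (h1.trans ?_)
      · exact (X.res_res _ _ ((f i).pull U a)).symm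
      · exact (X.res_res _ _ _).trans (X.res_res _ _ ((f j).pull U a))
    refine ⟨X.res (fun x hx => Opens.mem_iSup.2 (hA' U x hx)) s, fun i => ?_⟩
    rw [X.res_res]
    exact hs i
  choose s hs using hex
  have hpull : ∀ (U : Opens Y.body) (a : Y.O U) (t : X.O (A₀ U)),
      (∀ i, X.res (hA U i) t = (f i).pull U a) → s U a = t := fun U a t h =>
    hloc U _ _ fun i => (hs U a i).trans (h i).symm
  let F : Hom (X.restrict W₀) Y :=
    { toMap := Φ
      pull := fun U => AlgHom.mk'
        { toFun := s U
          map_one' := hpull U 1 1 fun i => (map_one _).trans (map_one ((f i).pull U)).symm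
          map_mul' := fun a b => hpull U _ _ fun i => (map_mul _ _ _).trans
            ((congrArg₂ (· * ·) (hs U a i) (hs U b i)).trans (map_mul ((f i).pull U) a b).symm)
          map_zero' := hpull U 0 0 fun i => (map_zero _).trans (map_zero ((f i).pull U)).symm
          map_add' := fun a b => hpull U _ _ fun i => (map_add _ _ _).trans
            ((congrArg₂ (· + ·) (hs U a i) (hs U b i)).trans (map_add ((f i).pull U) a b).symm) }
        (fun r a => hpull U _ _ fun i => (map_smul _ _ _).trans
          ((congrArg (r • ·) (hs U a i)).trans (map_smul ((f i).pull U) r a).symm))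
      pull_res := fun {U V} h a => by
        refine hpull V _ _ fun i => ?_
        rw [(f i).pull_res h a, ← hs U a i]
        exact (X.res_res _ _ _).trans (X.res_res _ _ _).symm
      pull_mem := fun {U i a} ha => by
        have h1 : s U a ∈ X.gr (A₀ U) 0 ⊔ X.gr (A₀ U) 1 := by
          rw [(X.gr_isCompl _).sup_eq_top]; trivial
        obtain ⟨a0, h0, a1, h1, e⟩ := Submodule.mem_sup.1 h1
        have h2 : ∀ j, X.res (hA U j) a0 + X.res (hA U j) a1 ∈ X.gr (A U j) i := fun j => by
          rw [← map_add, e, hs]; exact (f j).pull_mem ha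
        change s U a ∈ X.gr (A₀ U) i
        rw [← e]
        rcases zmod_two_cases i with rfl | rfl
        · have : a1 = 0 := hloc U _ _ fun j => by
            rw [map_zero]
            exact (parts_unique X (X.res_mem _ h0) (X.res_mem _ h1) (h2 j) (Submodule.zero_mem _)
              (add_zero _).symm).2
          rw [this, add_zero]; exact h0
        · have : a0 = 0 := hloc U _ _ fun j => by
            rw [map_zero]
            exact (parts_unique X (X.res_mem _ h0) (X.res_mem _ h1) (Submodule.zero_mem _) (h2 j)
              (zero_add _).symm).1
          rw [this, zero_add]; exact h1
      pull_val := fun {U} a x => by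
        have hx : x.1.1 ∈ A U (k x.1.1 x.1.2) := mem_up.2 ⟨hk x.1.1 x.1.2, x.2⟩
        have h1 := (f (k x.1.1 x.1.2)).pull_val a ⟨⟨x.1.1, hk x.1.1 x.1.2⟩, x.2⟩
        rw [← hs U a] at h1
        exact (X.val_res (hA U _) (s U a) ⟨x.1.1, hx⟩).symm.trans h1 }
  refine ⟨F, fun i => ?_⟩
  have e : (F.comp (X.restrictIncl (hle i))).toMap = (f i).toMap := by
    ext x
    exact hφ i x.1 x.2
  refine Hom.ext' e fun U a => ?_
  have h1 : up (U.comap (F.comp (X.restrictIncl (hle i))).toMap) ≤ A U i :=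
    up_mono (by rw [e]; exact le_rfl)
  refine Eq.trans ?_ (congrArg (X.res h1) (hs U a i))
  exact (X.res_res _ _ _).symm

end SuperSpace
end

noncomputable section

namespace SuperSpace

/-! ### Coordinates of Grassmann-valued points -/

section CoordExt

variable {m n q : ℕ}

/-- The residues of the even coordinates. -/
def coordBody (X : Fin m ⊕ Fin n → Grassmann q) : Fin m → ℝ := fun i => gbody (X (.inl i))

/-- The projection of a family of elements of the Grassmann algebra to the families with the parities
of the coordinates. -/
def parityProj : (Fin m ⊕ Fin n → Grassmann q) →ₗ[ℝ] (Fin m ⊕ Fin n → Grassmann q) :=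
  LinearMap.pi fun k => (grassmannProj q (coordParity k)).comp (LinearMap.proj k)

lemma parityProj_apply (X : Fin m ⊕ Fin n → Grassmann q) (k : Fin m ⊕ Fin n) :
    parityProj X k = grassmannProj q (coordParity k) (X k) := rfl

lemma parityProj_eq {X : Fin m ⊕ Fin n → Grassmann q}
    (h : ∀ k, X k ∈ grassmannPart q (coordParity k)) : parityProj X = X :=
  funext fun k => grassmannProj_eq (h k)

lemma coordBody_parityProj (X : Fin m ⊕ Fin n → Grassmann q) :
    coordBody (parityProj X) = coordBody X := funext fun _ => gbody_proj_zero _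

/-- The nilpotent parts of the even coordinates. -/
def coordNil (X : Fin m ⊕ Fin n → Grassmann q) (i : Fin m) : Grassmann q :=
  grassmannProj q 0 (X (.inl i)) - algebraMap ℝ _ (gbody (X (.inl i)))

lemma coordNil_even (X : Fin m ⊕ Fin n → Grassmann q) (i : Fin m) :
    coordNil X i ∈ grassmannPart q 0 :=
  Submodule.sub_mem _ (grassmannProj_mem 0 _) (algebraMap_grassmann_mem q _)

lemma coordNil_fil (X : Fin m ⊕ Fin n → Grassmann q) (i : Fin m) :
    coordNil X i ∈ grassmannFil q 1 := by
  rw [mem_grassmannFil_one, coordNil, map_sub, gbody_proj_zero, gbody_algebraMap, sub_self]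

/-- The value at the coordinates `X` of the superfunction with coordinate expression `G`. -/
def coordExt (X : Fin m ⊕ Fin n → Grassmann q) (G : (Fin m → ℝ) → Grassmann n) : Grassmann q :=
  taylorExt (fun i => Pi.single i 1) (coordNil X) (fun j => X (.inr j)) G (coordBody X)

lemma contDiff_coordBody :
    ContDiff ℝ ∞ (coordBody : (Fin m ⊕ Fin n → Grassmann q) → Fin m → ℝ) :=
  contDiff_pi.2 fun i => ((gbody (q := q)).toLinearMap.toContinuousLinearMap.contDiff).comp
    (contDiff_apply ℝ (Grassmann q) (Sum.inl i : Fin m ⊕ Fin n))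

lemma contDiff_coordNil :
    ContDiff ℝ ∞ (coordNil : (Fin m ⊕ Fin n → Grassmann q) → Fin m → Grassmann q) :=
  contDiff_pi.2 fun i => ContDiff.sub
    (((grassmannProj q 0).toContinuousLinearMap.contDiff).comp
      (contDiff_apply ℝ (Grassmann q) (Sum.inl i : Fin m ⊕ Fin n)))
    ((((Algebra.linearMap ℝ (Grassmann q)).comp
      (gbody (q := q)).toLinearMap).toContinuousLinearMap.contDiff).comp
      (contDiff_apply ℝ (Grassmann q) (Sum.inl i : Fin m ⊕ Fin n)))

lemma contDiffOn_coordExt {U : Set (Fin m → ℝ)} (hU : IsOpen U) {G : (Fin m → ℝ) → Grassmann n}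
    (hG : ContDiffOn ℝ ∞ G U) :
    ContDiffOn ℝ ∞ (fun X : Fin m ⊕ Fin n → Grassmann q => coordExt X G) {X | coordBody X ∈ U} :=
  (contDiffOn_taylorExt (q := q) (e := fun i => Pi.single i 1) hU hG).comp
    (t := U ×ˢ Set.univ) (f := fun X : Fin m ⊕ Fin n → Grassmann q =>
      (coordBody X, coordNil X, fun j => X (.inr j)))
    (contDiff_coordBody.prodMk (contDiff_coordNil.prodMk
      (contDiff_pi.2 fun j => contDiff_apply ℝ (Grassmann q) (Sum.inr j : Fin m ⊕ Fin n)))).contDiffOn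
    fun _ hX => ⟨hX, trivial⟩

/-- The coordinate expressions of the standard coordinates. -/
def stdFun (k : Fin m ⊕ Fin n) (y : Fin m → ℝ) : Grassmann n :=
  Sum.elim (fun i => algebraMap ℝ (Grassmann n) (y i))
    (fun j => ExteriorAlgebra.ι ℝ (Pi.single j 1)) k

lemma contDiff_stdFun (k : Fin m ⊕ Fin n) : ContDiff ℝ ∞ (stdFun (m := m) (n := n) k) := by
  rcases k with i | j
  · exact ((Algebra.linearMap ℝ (Grassmann n)).toContinuousLinearMap.contDiff).comp
      (contDiff_apply ℝ ℝ i)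
  · exact contDiff_const

lemma stdFun_mem (k : Fin m ⊕ Fin n) (y : Fin m → ℝ) :
    stdFun k y ∈ grassmannPart n (coordParity k) := by
  rcases k with i | j
  · exact algebraMap_grassmann_mem n _
  · exact ι_mem_grassmannPart _

lemma coordExt_stdFun (X : Fin m ⊕ Fin n → Grassmann q) (k : Fin m ⊕ Fin n) :
    coordExt X (stdFun k) = parityProj X k := by
  rcases k with i | j
  · have h := taylorExt_linear (e := fun i => Pi.single i 1) (ν := coordNil X)
      (ξ := fun j => X (.inr j)) (ContinuousLinearMap.proj i : (Fin m → ℝ) →L[ℝ] ℝ)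
      (coordBody X) (coordNil_fil X)
    refine h.trans ?_
    rw [Finset.sum_eq_single i]
    · simp [coordNil, coordBody, parityProj_apply, coordParity]
    · intro j _ hj
      simp [hj.symm]
    · simp
  · exact (taylorExt_const _ _).trans (grassmannSubst_ι_single _ j)

end CoordExt

/-- A function that is smooth on an open subset of a superdomain, as a superfunction. -/
def mkSec {p q : ℕ} {V : Opens (Fin p → ℝ)} (U : Opens (superDomain p q V).body)
    (G : (Fin p → ℝ) → Grassmann q) (hG : ContDiffOn ℝ ∞ G {y | ∃ h : y ∈ V, (⟨y, h⟩ : V) ∈ U}) :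
    (superDomain p q V).O U :=
  ⟨fun x => G x.1, GrassmannSmooth.congr (f := G)
    (grassmannSmooth_iff.2 (hG.mono fun _ hy => mem_up.1 hy)) fun _ hy => extendZero_of_mem _ hy⟩

/-- The coordinate expression of a superfunction on a superdomain. -/
def secFun {p q : ℕ} {V : Opens (Fin p → ℝ)} {U : Opens (superDomain p q V).body}
    (f : (superDomain p q V).O U) : (Fin p → ℝ) → Grassmann q :=
  extendZero ((up (W := V) U : Opens (Fin p → ℝ)) : Set (Fin p → ℝ)) f.1

lemma contDiffOn_secFun {p q : ℕ} {V : Opens (Fin p → ℝ)} {U : Opens (superDomain p q V).body}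
    (f : (superDomain p q V).O U) :
    ContDiffOn ℝ ∞ (secFun f) ((up (W := V) U : Opens (Fin p → ℝ)) : Set (Fin p → ℝ)) :=
  grassmannSmooth_iff.1 f.2

lemma domPt_secFun {p q : ℕ} {V : Opens (Fin p → ℝ)} {U : Opens (superDomain p q V).body}
    (f : (superDomain p q V).O U) (y : V) (hy : y ∈ U) :
    (domPt y).app U hy f = secFun f y.1 :=
  (extendZero_of_mem f.1 (mem_up.2 ⟨y.2, hy⟩)).symm

lemma secFun_eq {p q : ℕ} {V : Opens (Fin p → ℝ)} {U : Opens (superDomain p q V).body}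
    (f : (superDomain p q V).O U) {y : Fin p → ℝ}
    (hy : y ∈ ((up (W := V) U : Opens (Fin p → ℝ)) : Set (Fin p → ℝ))) :
    secFun f y = f.1 ⟨y, hy⟩ := extendZero_of_mem f.1 hy

section

variable {m n q : ℕ} {V : Opens (Fin m → ℝ)}

/-- The Grassmann-valued point of a superdomain with given coordinates. -/
def coordPt (X : Fin m ⊕ Fin n → Grassmann q) (hX : coordBody X ∈ V) :
    GrPoint (superDomain m n V) q where
  pt := ⟨coordBody X, hX⟩
  app U hU := AlgHom.ofLinearMap
    { toFun := fun f => coordExt X (secFun f)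
      map_add' := fun f g => by
        have hU' : coordBody X ∈ up (W := V) U := mem_up.2 ⟨hX, hU⟩
        refine (taylorExt_congr (up (W := V) U).isOpen (fun y hy => ?_) hU').trans
          (taylorExt_add (up (W := V) U).isOpen (contDiffOn_secFun f) (contDiffOn_secFun g) hU')
        rw [secFun_eq _ hy, secFun_eq _ hy, secFun_eq _ hy]; rfl
      map_smul' := fun r f => by
        have hU' : coordBody X ∈ up (W := V) U := mem_up.2 ⟨hX, hU⟩
        refine (taylorExt_congr (g' := fun y => algebraMap ℝ (Grassmann n) r * secFun f y)
          (up (W := V) U).isOpen (fun y hy => ?_) hU').trans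
          ((taylorExt_mul (up (W := V) U).isOpen (coordNil_even X) (coordNil_fil X)
            contDiffOn_const (contDiffOn_secFun f) hU').trans ?_)
        · rw [secFun_eq _ hy, secFun_eq _ hy, ← Algebra.smul_def]; rfl
        · rw [taylorExt_const, AlgHom.commutes, ← Algebra.smul_def]; rfl }
    (by
      have hU' : coordBody X ∈ up (W := V) U := mem_up.2 ⟨hX, hU⟩
      refine (taylorExt_congr (g' := fun _ => 1) (up (W := V) U).isOpen (fun y hy => ?_) hU').trans
        ((taylorExt_const _ _).trans (map_one _))
      rw [secFun_eq _ hy]; rfl)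
    (fun f g => by
      have hU' : coordBody X ∈ up (W := V) U := mem_up.2 ⟨hX, hU⟩
      refine (taylorExt_congr (up (W := V) U).isOpen (fun y hy => ?_) hU').trans
        (taylorExt_mul (up (W := V) U).isOpen (coordNil_even X) (coordNil_fil X)
          (contDiffOn_secFun f) (contDiffOn_secFun g) hU')
      rw [secFun_eq _ hy, secFun_eq _ hy, secFun_eq _ hy]; rfl)
  app_res {U U'} h hU f := by
    have hU' : coordBody X ∈ up (W := V) U' := mem_up.2 ⟨hX, hU⟩
    refine taylorExt_congr (up (W := V) U').isOpen (fun y hy => ?_) hU'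
    rw [secFun_eq _ hy, secFun_eq _ (up_mono h hy)]; rfl
  app_mem {U} hU i f hf := by
    have hU' : coordBody X ∈ up (W := V) U := mem_up.2 ⟨hX, hU⟩
    refine taylorExt_mem (up (W := V) U).isOpen (coordNil_even X) (contDiffOn_secFun f)
      (fun y hy => ?_) hU'
    rw [secFun_eq _ hy]; exact hf _
  app_val {U} hU f := by
    have hU' : coordBody X ∈ up (W := V) U := mem_up.2 ⟨hX, hU⟩
    refine (gbody_taylorExt (coordNil_fil X) _ _).trans ?_
    rw [secFun_eq _ hU']; rfl

lemma coordPt_app (X : Fin m ⊕ Fin n → Grassmann q) (hX : coordBody X ∈ V)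
    {U : Opens (superDomain m n V).body} (hU) (f : (superDomain m n V).O U) :
    (coordPt X hX).app U hU f = coordExt X (secFun f) := rfl

lemma stdCoord_eq (k : Fin m ⊕ Fin n) : stdCoord V k = mkSec ⊤ (stdFun k)
    (contDiff_stdFun k).contDiffOn := by
  rcases k with i | j <;> rfl

lemma domPt_stdCoord (k : Fin m ⊕ Fin n) (y : V) (hy) :
    (domPt y).app ⊤ hy (stdCoord V k) = stdFun k y.1 := by
  rw [stdCoord_eq]; rfl

lemma coordPt_stdCoord (X : Fin m ⊕ Fin n → Grassmann q) (hX : coordBody X ∈ V) (hU)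
    (k : Fin m ⊕ Fin n) : (coordPt X hX).app ⊤ hU (stdCoord V k) = parityProj X k := by
  rw [coordPt_app, ← coordExt_stdFun]
  have hU' : coordBody X ∈ up (W := V) ⊤ := mem_up.2 ⟨hX, trivial⟩
  refine taylorExt_congr (up (W := V) ⊤).isOpen (fun y hy => ?_) hU'
  rw [stdCoord_eq]; exact secFun_eq _ hy

lemma stdCoord_mem (k : Fin m ⊕ Fin n) :
    stdCoord V k ∈ (superDomain m n V).gr ⊤ (coordParity k) := by
  rw [stdCoord_eq]; exact fun y => stdFun_mem k y.1

end

/-! ### Coordinate systems -/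

section Coord

variable {N : SuperSpace.{u}} {m n q : ℕ}

/-- The coordinates given by a chart. -/
def Hom.IsOpenImmersion.coord {V : Opens (Fin m → ℝ)} {c : Hom (superDomain m n V) N}
    (hc : c.IsOpenImmersion) (k : Fin m ⊕ Fin n) : N.O hc.range :=
  (hc.pullEquiv hc.range le_rfl).symm ((superDomain m n V).res le_top (stdCoord V k))

lemma Hom.IsOpenImmersion.mapPt_coord {V : Opens (Fin m → ℝ)} {c : Hom (superDomain m n V) N}
    (hc : c.IsOpenImmersion) (k : Fin m ⊕ Fin n) (g : GrPoint (superDomain m n V) q) (h) :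
    (c.mapPt g).app hc.range h (hc.coord k) = g.app ⊤ trivial (stdCoord V k) :=
  (congrArg (g.app (hc.range.comap c.toMap) h) (hc.pull_pullEquiv_symm hc.range le_rfl _)).trans
    (g.app_res _ _ _)

lemma Hom.IsOpenImmersion.isCoord {V : Opens (Fin m → ℝ)} {c : Hom (superDomain m n V) N}
    (hc : c.IsOpenImmersion) : IsCoord hc.coord := by
  refine ⟨V, c, fun y => ⟨y, rfl⟩, hc, subset_rfl, fun k => ?_⟩
  have h1 : ⊤ ≤ hc.range.comap c.toMap := fun y _ => ⟨y, rfl⟩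
  refine (congrArg ((superDomain m n V).res h1) (hc.pull_pullEquiv_symm hc.range le_rfl _)).trans ?_
  exact ((superDomain m n V).res_res le_top h1 _).trans ((superDomain m n V).res_self _ _)

/-- A system of coordinates is given by a chart. -/
lemma IsCoord.exists_chart {U : Opens N.body} {x : Fin m ⊕ Fin n → N.O U} (hx : IsCoord x) :
    ∃ (V : Opens (Fin m → ℝ)) (c : Hom (superDomain m n V) N) (hc : c.IsOpenImmersion)
      (hU : U = hc.range), ∀ k, x k = N.res hU.le (hc.coord k) := by
  obtain ⟨V, c, h, hc, hU, hx⟩ := hx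
  have e : U = hc.range := le_antisymm hU (by rintro _ ⟨y, rfl⟩; exact h y)
  refine ⟨V, c, hc, e, fun k => ?_⟩
  subst e
  refine hc.pull_injective le_rfl (Eq.trans ?_ (congrArg (c.pull _) (N.res_self _ _).symm))
  refine Eq.trans ?_ (hc.pull_pullEquiv_symm hc.range le_rfl _).symm
  rw [← hx k]
  have h1 : ⊤ ≤ hc.range.comap c.toMap := fun y _ => ⟨y, rfl⟩
  exact (((superDomain m n V).res_res h1 le_top (c.pull hc.range (x k))).trans
    ((superDomain m n V).res_self _ _)).symm

lemma IsCoord.mem {U : Opens N.body} {x : Fin m ⊕ Fin n → N.O U} (hx : IsCoord x)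
    (k : Fin m ⊕ Fin n) : x k ∈ N.gr U (coordParity k) := by
  obtain ⟨V, c, hc, rfl, h⟩ := hx.exists_chart
  rw [h k]
  refine N.res_mem _ (mem_gr_of_injective (φ := c.pull _) (hc.pull_injective le_rfl)
    (fun i a ha => c.pull_mem ha) ?_)
  exact (hc.pull_pullEquiv_symm hc.range le_rfl _).symm ▸ SuperSpace.res_mem _ _ (stdCoord_mem k)

/-- Near a point, a superfunction is the sum of a constant and of multiples of the differences of the
coordinates and their values at the point. -/
lemma Hom.IsOpenImmersion.exists_hadamard {V : Opens (Fin m → ℝ)} {c : Hom (superDomain m n V) N}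
    (hc : c.IsOpenImmersion) {U : Opens N.body} (f : N.O U) {p : N.body}
    (hp : p ∈ hc.range) (hU : p ∈ U) :
    ∃ (B : Opens N.body) (h : B ≤ hc.range) (h' : B ≤ U), p ∈ B ∧ ∃ g : Fin m ⊕ Fin n → N.O B,
      N.res h' f = algebraMap ℝ _ (N.val U f ⟨p, hU⟩) +
        ∑ k, (N.res h (hc.coord k) - algebraMap ℝ _ (N.val _ (hc.coord k) ⟨p, hp⟩)) * g k := by
  obtain ⟨y₀, rfl⟩ := hp
  have hy₀ : y₀.1 ∈ up (W := V) (U.comap c.toMap) := mem_up.2 ⟨y₀.2, hU⟩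
  obtain ⟨G, hG, hGF⟩ := exists_contDiff_eventuallyEq (up (W := V) (U.comap c.toMap)).isOpen
    (contDiffOn_secFun (c.pull U f)) hy₀
  -- Hadamard's lemma treats the even coordinates; the part of the value at `y₀` without a constant term is
  -- a multiple of the odd coordinates
  obtain ⟨g, hg, hgG⟩ := _root_.exists_hadamard hG y₀.1
  obtain ⟨b, hb⟩ := exists_eq_gbody_add (G y₀.1)
  obtain ⟨A, hA, hAo, hy₀A⟩ := eventually_nhds_iff.1
    (hGF.and ((up (W := V) (U.comap c.toMap)).isOpen.mem_nhds hy₀))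
  let A' : Opens (superDomain m n V).body := ⟨Subtype.val ⁻¹' A, hAo.preimage continuous_subtype_val⟩
  have hB : hc.img A' ≤ hc.range := by rintro _ ⟨y, -, rfl⟩; exact ⟨y, rfl⟩
  have hB' : hc.img A' ≤ U := by
    rintro _ ⟨y, hy, rfl⟩
    exact (mem_up.1 (hA y.1 hy).2).2
  let g' : Fin m ⊕ Fin n → (Fin m → ℝ) → Grassmann n := Sum.elim g fun j _ => b j
  have hg' : ∀ k, ContDiff ℝ ∞ (g' k) := by
    rintro (i | j)
    · exact hg i
    · exact contDiff_const
  have hp : c.toMap y₀ ∈ hc.range := ⟨y₀, rfl⟩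
  have hval : ∀ k, N.val _ (hc.coord k) ⟨c.toMap y₀, hp⟩ = gbody (stdFun k y₀.1) := fun k => by
    rw [← domPt_stdCoord k y₀ trivial, ← hc.mapPt_coord k (domPt y₀) hp]
    exact ((c.mapPt (domPt y₀)).app_val hp _).symm
  refine ⟨hc.img A', hB, hB', ⟨y₀, hy₀A, rfl⟩, fun k => (hc.pullEquiv _ hB).symm
    (mkSec _ (g' k) (hg' k).contDiffOn), ?_⟩
  refine hc.pull_injective hB (domPt_ext fun y hy => ?_)
  have hyA : y.1 ∈ A := by
    obtain ⟨z, hz, e⟩ := hy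
    exact hc.injective e ▸ hz
  have hy : (c.mapPt (domPt y)).pt ∈ hc.img A' := hy
  have h1 : ∀ k, (c.mapPt (domPt y)).app _ hy ((hc.pullEquiv _ hB).symm
      (mkSec _ (g' k) (hg' k).contDiffOn)) = g' k y.1 := fun k =>
    congrArg ((domPt y).app _ hy) (hc.pull_pullEquiv_symm _ hB _)
  change (c.mapPt (domPt y)).app _ hy _ = (c.mapPt (domPt y)).app _ hy _
  rw [GrPoint.app_res, map_add, map_sum, AlgHom.commutes]
  have h5 : ∀ k, (c.mapPt (domPt y)).app _ (hB hy) (hc.coord k) = stdFun k y.1 := fun k =>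
    (hc.mapPt_coord k (domPt y) (hB hy)).trans (domPt_stdCoord k y trivial)
  simp only [map_mul, map_sub, GrPoint.app_res, AlgHom.commutes, h1, h5, hval]
  have h2 : (c.mapPt (domPt y)).app U (hB' hy) f = G y.1 :=
    (domPt_secFun (c.pull U f) y (hB' hy)).trans (hA y.1 hyA).1.symm
  have h3 : N.val U f ⟨c.toMap y₀, hU⟩ = gbody (G y₀.1) := by
    rw [(hA y₀.1 hy₀A).1, ← domPt_secFun (c.pull U f) y₀ hU]
    exact ((c.mapPt (domPt y₀)).app_val hU f).symm
  rw [h2, h3, hgG, Fintype.sum_sum_type]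
  have h4 : ∀ j, gbody (stdFun (m := m) (n := n) (.inr j) y₀.1) = 0 := fun j =>
    gbody_odd (ι_mem_grassmannPart _)
  simp only [h4, map_zero, sub_zero]
  conv_lhs => rw [hb]
  simp only [stdFun, Sum.elim_inl, Sum.elim_inr, g', gbody_algebraMap, ← map_sub,
    ← Algebra.smul_def]
  abel

/-- A family of linear functionals on the germs at a point with values in a Grassmann algebra that
vanishes on constants and on which the differences of the coordinates and their values act as
multiplication by nilpotent elements is zero. -/
lemma Hom.IsOpenImmersion.germ_eq_zero {V : Opens (Fin m → ℝ)} {c : Hom (superDomain m n V) N}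
    (hc : c.IsOpenImmersion) {p : N.body} (hp : p ∈ hc.range)
    (δ : ∀ U : Opens N.body, U ≤ hc.range → p ∈ U → (N.O U →ₗ[ℝ] Grassmann q))
    (hres : ∀ (U U' : Opens N.body) (h : U' ≤ U) (hU : U ≤ hc.range) (hp : p ∈ U') (f : N.O U),
      δ U' (h.trans hU) hp (N.res h f) = δ U hU (h hp) f)
    (hone : ∀ U hU hp, δ U hU hp 1 = 0)
    (hmul : ∀ k, ∃ μ : Grassmann q, gbody μ = 0 ∧ ∀ (U : Opens N.body) (hU : U ≤ hc.range)
      (hp' : p ∈ U) (g : N.O U), δ U hU hp'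
        ((N.res hU (hc.coord k) - algebraMap ℝ _ (N.val _ (hc.coord k) ⟨p, hp⟩)) * g) =
          μ * δ U hU hp' g)
    (U : Opens N.body) (hU : U ≤ hc.range) (hp' : p ∈ U) (f : N.O U) : δ U hU hp' f = 0 := by
  -- by induction, the values lie in all the powers of the ideal of nilpotent elements
  have key : ∀ k : ℕ, ∀ (U : Opens N.body) (hU : U ≤ hc.range) (hp' : p ∈ U) (f : N.O U),
      δ U hU hp' f ∈ grassmannFil q k := by
    intro k
    induction k with
    | zero => intros; rw [grassmannFil_zero]; trivial
    | succ k ih =>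
      intro U hU hp' f
      obtain ⟨B, hB, hB', hpB, g, hg⟩ := hc.exists_hadamard f hp hp'
      rw [← hres U B hB' hU hpB f, hg, map_add, Algebra.algebraMap_eq_smul_one, map_smul, hone,
        smul_zero, zero_add, map_sum]
      refine Submodule.sum_mem _ fun j _ => ?_
      obtain ⟨μ, hμ, h⟩ := hmul j
      rw [h B (hB'.trans hU) hpB (g j), add_comm k 1]
      exact grassmannFil_mul (mem_grassmannFil_one.2 hμ) (ih _ _ _ _)
  exact eq_zero_of_mem_fil (Nat.lt_succ_self q) (key (q + 1) U hU hp' f)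

lemma coordBody_stdCoord {V : Opens (Fin m → ℝ)} (g : GrPoint (superDomain m n V) q) :
    coordBody (fun k => g.app ⊤ trivial (stdCoord V k)) = g.pt.1 := funext fun i =>
  (g.app_val (U := ⊤) trivial (stdCoord V (.inl i))).trans (gbody_algebraMap _)

/-- A Grassmann-valued point is determined by its underlying point and its coordinates. -/
lemma Hom.IsOpenImmersion.grPoint_ext {V : Opens (Fin m → ℝ)} {c : Hom (superDomain m n V) N}
    (hc : c.IsOpenImmersion) {g g' : GrPoint N q} (hg : g.pt ∈ hc.range) (hg' : g'.pt ∈ hc.range)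
    (h : ∀ k, g.app _ hg (hc.coord k) = g'.app _ hg' (hc.coord k)) : g = g' := by
  have hpt : g.pt = g'.pt := by
    obtain ⟨g, rfl⟩ := hc.exists_mapPt_eq g hg
    obtain ⟨g', rfl⟩ := hc.exists_mapPt_eq g' hg'
    refine congrArg c.toMap (Subtype.ext (funext fun i => ?_))
    have h1 := h (.inl i)
    rw [hc.mapPt_coord, hc.mapPt_coord] at h1
    rw [← coordBody_stdCoord g, ← coordBody_stdCoord g']
    exact congrArg gbody h1
  cases g with | mk p app res mem val =>
  cases g' with | mk p' app' res' mem' val' =>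
  cases hpt
  refine GrPoint.ext' rfl fun U hp f => ?_
  -- the difference of the two points acts on germs as in `germ_eq_zero`
  have h0 := hc.germ_eq_zero hg (fun U _ hp => (app U hp).toLinearMap - (app' U hp).toLinearMap)
    (fun U U' h _ hp f => congrArg₂ (· - ·) (res h hp f) (res' h hp f))
    (fun U _ hp => sub_eq_zero.2 ((map_one (app U hp)).trans (map_one (app' U hp)).symm))
    (fun k => ⟨app _ hg (hc.coord k) - algebraMap ℝ _ (N.val _ (hc.coord k) ⟨p, hg⟩), by
      rw [map_sub, val, gbody_algebraMap, sub_self], fun U hU hp f => by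
      have hk : app _ hg (hc.coord k) = app' _ hg (hc.coord k) := h k
      have h1 : app U hp (N.res hU (hc.coord k)) = app _ hg (hc.coord k) := res hU hp _
      have h2 : app' U hp (N.res hU (hc.coord k)) = app' _ hg (hc.coord k) := res' hU hp _
      simp only [LinearMap.sub_apply, AlgHom.toLinearMap_apply, map_mul, map_sub, AlgHom.commutes,
        h1, h2, hk, mul_sub]⟩) (U ⊓ hc.range) inf_le_right ⟨hp, hg⟩ (N.res inf_le_left f)
  have h1 := sub_eq_zero.1 h0
  exact (res inf_le_left ⟨hp, hg⟩ f).symm.trans (h1.trans (res' inf_le_left ⟨hp, hg⟩ f))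

/-- The Grassmann-valued points of a superdomain are given by their coordinates. -/
lemma eq_coordPt {V : Opens (Fin m → ℝ)} (g : GrPoint (superDomain m n V) q) :
    ∃ hX : coordBody (fun k => g.app ⊤ trivial (stdCoord V k)) ∈ V,
      g = coordPt (fun k => g.app ⊤ trivial (stdCoord V k)) hX := by
  have e := coordBody_stdCoord g
  have hX : coordBody (fun k => g.app ⊤ trivial (stdCoord V k)) ∈ V := e ▸ g.pt.2
  refine ⟨hX, ?_⟩
  have hc : (restrictIncl (superR m n) (le_refl V)).IsOpenImmersion :=
    Hom.IsOpenImmersion.restrictIncl le_rfl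
  have hid : ∀ g : GrPoint (superDomain m n V) q, (restrictIncl (superR m n) (le_refl V)).mapPt g = g :=
    fun g => GrPoint.ext' rfl fun U hp a =>
      congrArg (g.app U hp) ((superDomain m n V).res_self le_rfl a)
  refine hc.mapPt_injective (hc.grPoint_ext ⟨g.pt, rfl⟩ ⟨_, rfl⟩ fun k => ?_)
  refine (hc.mapPt_coord k g _).trans (Eq.trans ?_ (hc.mapPt_coord k (coordPt _ hX) _).symm)
  refine Eq.trans ?_ (coordPt_stdCoord _ hX _ k).symm
  exact congrFun (parityProj_eq fun k => g.app_mem _ (stdCoord_mem k)).symm k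

end Coord

end SuperSpace
end

noncomputable section

/-! ### Coordinate derivations -/

section Contract

open CliffordAlgebra

variable {n : ℕ}

/-- Differentiation with respect to the odd generator with index `j`. -/
def oddDer (j : Fin n) : Grassmann n →ₗ[ℝ] Grassmann n :=
  contractLeft (Q := (0 : QuadraticForm ℝ (Fin n → ℝ))) (LinearMap.proj j)

lemma oddDer_ι_mul (j : Fin n) (v : Fin n → ℝ) (a : Grassmann n) :
    oddDer j (ExteriorAlgebra.ι ℝ v * a) = v j • a - ExteriorAlgebra.ι ℝ v * oddDer j a :=
  contractLeft_ι_mul (Q := (0 : QuadraticForm ℝ (Fin n → ℝ))) (LinearMap.proj j) v a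

lemma oddDer_algebraMap (j : Fin n) (r : ℝ) : oddDer j (algebraMap ℝ (Grassmann n) r) = 0 :=
  contractLeft_algebraMap (Q := (0 : QuadraticForm ℝ (Fin n → ℝ))) (LinearMap.proj j) r

lemma oddDer_ι (j : Fin n) (v : Fin n → ℝ) :
    oddDer j (ExteriorAlgebra.ι ℝ v) = algebraMap ℝ _ (v j) :=
  contractLeft_ι (Q := (0 : QuadraticForm ℝ (Fin n → ℝ))) (LinearMap.proj j) v

lemma oddDer_mul_involute (j : Fin n) (a b : Grassmann n) :
    oddDer j (a * b) = oddDer j a * b +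
      involute (Q := (0 : QuadraticForm ℝ (Fin n → ℝ))) a * oddDer j b := by
  induction a using CliffordAlgebra.left_induction with
  | algebraMap r =>
    change oddDer j (algebraMap ℝ (Grassmann n) r * b) = oddDer j (algebraMap ℝ (Grassmann n) r) * b +
      _
    rw [oddDer_algebraMap, zero_mul, zero_add, AlgHom.commutes, ← Algebra.smul_def, map_smul,
      Algebra.smul_def]
  | add a a' h h' => simp only [add_mul, map_add, h, h']; abel
  | ι_mul a v h =>
    change oddDer j (ExteriorAlgebra.ι ℝ v * a * b) = oddDer j (ExteriorAlgebra.ι ℝ v * a) * b +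
      involute (ι _ v * a) * _
    rw [mul_assoc, oddDer_ι_mul, h, oddDer_ι_mul, map_mul, involute_ι]
    change v j • (a * b) - ι _ v * (_ + _) = (_ - ι _ v * _) * b + _
    rw [sub_mul, smul_mul_assoc, mul_add, neg_mul, neg_mul, mul_assoc, mul_assoc]
    abel

lemma oddDer_mul (j : Fin n) {i : ZMod 2} {a : Grassmann n} (ha : a ∈ grassmannPart n i)
    (b : Grassmann n) :
    oddDer j (a * b) = oddDer j a * b + superSign (1 * i) • (a * oddDer j b) := by
  rw [oddDer_mul_involute]
  rcases zmod_two_cases i with rfl | rfl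
  · rw [involute_eq_of_mem_even ha]; simp [superSign]
  · rw [involute_eq_of_mem_odd ha]; simp [superSign]

lemma involute_oddDer (j : Fin n) (a : Grassmann n) :
    involute (Q := (0 : QuadraticForm ℝ (Fin n → ℝ))) (oddDer j a) =
      -oddDer j (involute (Q := (0 : QuadraticForm ℝ (Fin n → ℝ))) a) := by
  induction a using CliffordAlgebra.left_induction with
  | algebraMap r =>
    have h : oddDer j (algebraMap ℝ (Grassmann n) r) = 0 := oddDer_algebraMap j r
    rw [AlgHom.commutes]
    exact (congrArg _ h).trans ((map_zero _).trans ((congrArg _ h).trans neg_zero).symm)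
  | add a a' h h' => simp only [map_add, h, h', neg_add]
  | ι_mul a v h =>
    have h1 := oddDer_ι_mul j v a
    have h2 := oddDer_ι_mul j v (involute (Q := (0 : QuadraticForm ℝ (Fin n → ℝ))) a)
    rw [map_mul (involute (Q := (0 : QuadraticForm ℝ (Fin n → ℝ)))), involute_ι, neg_mul, map_neg,
      neg_neg]
    refine (congrArg _ h1).trans (Eq.trans ?_ h2.symm)
    refine (map_sub _ _ _).trans ((congrArg₂ (· - ·) (map_smul _ _ _) (map_mul _ _ _)).trans ?_)
    refine (congrArg₂ (fun x y => v j • involute a - x * y) (involute_ι (Q := 0) v) h).trans ?_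
    rw [neg_mul_neg]

lemma oddDer_mem (j : Fin n) {i : ZMod 2} {a : Grassmann n} (ha : a ∈ grassmannPart n i) :
    oddDer j a ∈ grassmannPart n (1 + i) := by
  have h := involute_oddDer j a
  have hp := grassmannProj_add (oddDer j a)
  have h0 := grassmannProj_mem 0 (oddDer j a)
  have h1 := grassmannProj_mem 1 (oddDer j a)
  have e : involute (Q := (0 : QuadraticForm ℝ (Fin n → ℝ))) (oddDer j a) =
      grassmannProj n 0 (oddDer j a) - grassmannProj n 1 (oddDer j a) := by
    conv_lhs => rw [← hp]
    rw [map_add, involute_eq_of_mem_even h0, involute_eq_of_mem_odd h1, sub_eq_add_neg]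
  rcases zmod_two_cases i with rfl | rfl
  · rw [involute_eq_of_mem_even ha, e] at h
    have h2 : (2 : ℝ) • grassmannProj n 0 (oddDer j a) = 0 := by
      rw [two_smul]
      nth_rewrite 3 [← hp] at h
      rw [neg_add, sub_eq_add_neg, add_left_inj] at h
      nth_rewrite 1 [h]; exact neg_add_cancel _
    rw [← hp, (smul_eq_zero.1 h2).resolve_left two_ne_zero, zero_add]
    exact h1
  · rw [involute_eq_of_mem_odd ha, map_neg, neg_neg, e] at h
    have h2 : (2 : ℝ) • grassmannProj n 1 (oddDer j a) = 0 := by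
      rw [two_smul]
      nth_rewrite 3 [← hp] at h
      rw [sub_eq_add_neg, add_right_inj] at h
      nth_rewrite 1 [← h]; exact neg_add_cancel _
    rw [← hp, (smul_eq_zero.1 h2).resolve_left two_ne_zero, add_zero]
    exact h0

end Contract

namespace SuperSpace

variable {N : SuperSpace.{u}} {m n q : ℕ}

section DomDer

variable {V : Opens (Fin m → ℝ)}

lemma secFun_add {U : Opens (superDomain m n V).body} (f g : (superDomain m n V).O U) :
    secFun (f + g) = fun y => secFun f y + secFun g y := by
  funext y
  by_cases h : y ∈ ((up (W := V) U : Opens (Fin m → ℝ)) : Set (Fin m → ℝ))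
  · rw [secFun_eq _ h, secFun_eq _ h, secFun_eq _ h]; rfl
  · simp [secFun, extendZero, h]

lemma secFun_mul {U : Opens (superDomain m n V).body} (f g : (superDomain m n V).O U) :
    secFun (f * g) = fun y => secFun f y * secFun g y := by
  funext y
  by_cases h : y ∈ ((up (W := V) U : Opens (Fin m → ℝ)) : Set (Fin m → ℝ))
  · rw [secFun_eq _ h, secFun_eq _ h, secFun_eq _ h]; rfl
  · simp [secFun, extendZero, h]

lemma secFun_smul {U : Opens (superDomain m n V).body} (r : ℝ) (f : (superDomain m n V).O U) :
    secFun (r • f) = fun y => r • secFun f y := by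
  funext y
  by_cases h : y ∈ ((up (W := V) U : Opens (Fin m → ℝ)) : Set (Fin m → ℝ))
  · rw [secFun_eq _ h, secFun_eq _ h]; rfl
  · simp [secFun, extendZero, h]

/-- Differentiation of superfunctions on a superdomain with respect to a coordinate. -/
def domDer (k : Fin m ⊕ Fin n) (U : Opens (superDomain m n V).body) :
    (superDomain m n V).O U →ₗ[ℝ] (superDomain m n V).O U :=
  match k with
  | .inl i =>
    { toFun := fun f => mkSec U (dirDeriv (Pi.single i 1) (secFun f))
        (((contDiffOn_secFun f).dirDeriv (up (W := V) U).isOpen _).mono fun _ hy => mem_up.2 hy)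
      map_add' := fun f g => Subtype.ext (funext fun y => by
        refine (congrFun (congrArg (dirDeriv (Pi.single i 1)) (secFun_add f g)) y.1).trans ?_
        exact dirDeriv_add (up (W := V) U).isOpen (contDiffOn_secFun f) (contDiffOn_secFun g) _ y.2)
      map_smul' := fun r f => Subtype.ext (funext fun y => by
        refine (congrFun (congrArg (dirDeriv (Pi.single i 1)) (secFun_smul r f)) y.1).trans ?_
        exact dirDeriv_linear (up (W := V) U).isOpen (contDiffOn_secFun f)
          (LinearMap.lsmul ℝ (Grassmann n) r) _ y.2) }
  | .inr j =>
    { toFun := fun f => ⟨fun y => oddDer j (f.1 y), (GrassmannSmooth.comp_linear f.2 (oddDer j)).congr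
        fun y hy => by rw [extendZero_of_mem _ hy, extendZero_of_mem _ hy]⟩
      map_add' := fun f g => Subtype.ext (funext fun y => map_add (oddDer j) _ _)
      map_smul' := fun r f => Subtype.ext (funext fun y => map_smul (oddDer j) _ _) }

lemma domDer_inl_apply (i : Fin m) (U : Opens (superDomain m n V).body)
    (f : (superDomain m n V).O U) (y) :
    (domDer (.inl i) U f).1 y = dirDeriv (Pi.single i 1) (secFun f) y.1 := rfl

lemma domDer_inr_apply (j : Fin n) (U : Opens (superDomain m n V).body)
    (f : (superDomain m n V).O U) (y) :
    (domDer (.inr j) U f).1 y = oddDer j (f.1 y) := rfl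

lemma domDer_res (k : Fin m ⊕ Fin n) {U U' : Opens (superDomain m n V).body} (h : U' ≤ U)
    (f : (superDomain m n V).O U) :
    domDer k U' ((superDomain m n V).res h f) = (superDomain m n V).res h (domDer k U f) := by
  rcases k with i | j
  · refine Subtype.ext (funext fun y => ?_)
    refine dirDeriv_congr (up (W := V) U').isOpen (fun z hz => ?_) _ y.2
    rw [secFun_eq _ hz, secFun_eq _ (up_mono h hz)]; rfl
  · rfl

lemma domDer_mem (k : Fin m ⊕ Fin n) {U : Opens (superDomain m n V).body} {i : ZMod 2}
    {f : (superDomain m n V).O U} (hf : f ∈ (superDomain m n V).gr U i) :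
    domDer k U f ∈ (superDomain m n V).gr U (coordParity k + i) := by
  rcases k with k | j
  · intro y
    rw [domDer_inl_apply, coordParity, Sum.elim_inl, zero_add]
    exact dirDeriv_mem (up (W := V) U).isOpen (contDiffOn_secFun f)
      (fun z hz => (secFun_eq f hz).symm ▸ hf ⟨z, hz⟩) _ y.2
  · exact fun y => oddDer_mem j (hf y)

lemma domDer_mul (k : Fin m ⊕ Fin n) {U : Opens (superDomain m n V).body} {i : ZMod 2}
    {f : (superDomain m n V).O U} (hf : f ∈ (superDomain m n V).gr U i)
    (g : (superDomain m n V).O U) :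
    domDer k U (f * g) = domDer k U f * g + superSign (coordParity k * i) • (f * domDer k U g) := by
  rcases k with k | j
  · refine Subtype.ext (funext fun y => ?_)
    refine (congrFun (congrArg (dirDeriv (Pi.single k 1)) (secFun_mul f g)) y.1).trans ?_
    refine (dirDeriv_mul (up (W := V) U).isOpen (contDiffOn_secFun f) (contDiffOn_secFun g) _
      y.2).trans ?_
    rw [secFun_eq f y.2, secFun_eq g y.2]
    simp only [coordParity, Sum.elim_inl, zero_mul, superSign, if_true, one_smul]
    rfl
  · exact Subtype.ext (funext fun y => oddDer_mul j (hf y) _)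

lemma domDer_stdCoord (k l : Fin m ⊕ Fin n) :
    domDer k ⊤ (stdCoord V l) = if k = l then 1 else 0 := by
  rcases k with i | j
  · refine Subtype.ext (funext fun y => ?_)
    have h1 : dirDeriv (Pi.single i 1) (secFun (stdCoord V l)) y.1 =
        dirDeriv (Pi.single i 1) (stdFun l) y.1 :=
      dirDeriv_congr (up (W := V) ⊤).isOpen (fun z hz => by
        rw [stdCoord_eq]; exact secFun_eq _ hz) _ y.2
    refine (domDer_inl_apply i ⊤ _ y).trans (h1.trans ?_)
    rcases l with l | l
    · have h2 := dirDeriv_linear (f := fun y : Fin m → ℝ => y l) isOpen_univ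
        (contDiff_apply ℝ ℝ l).contDiffOn (Algebra.linearMap ℝ (Grassmann n)) (Pi.single i 1)
        (Set.mem_univ y.1)
      refine h2.trans ?_
      have h3 : dirDeriv (Pi.single i 1) (fun y : Fin m → ℝ => y l) y.1 = if i = l then 1 else 0 := by
        have := (hasFDerivAt_apply (𝕜 := ℝ) l y.1).fderiv
        simp only [dirDeriv, this]
        simp [Pi.single_apply, eq_comm]
      rw [h3]
      by_cases h : i = l
      · subst h; simp; rfl
      · have h' : (Sum.inl i : Fin m ⊕ Fin n) ≠ Sum.inl l := fun e => h (Sum.inl_injective e)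
        simp [h]; rfl
    · rw [if_neg Sum.inl_ne_inr]
      exact congrArg (fun L : (Fin m → ℝ) →L[ℝ] Grassmann n => L (Pi.single i 1))
        (fderiv_const_apply (𝕜 := ℝ) _)
  · refine Subtype.ext (funext fun y => ?_)
    refine (domDer_inr_apply j ⊤ _ y).trans ?_
    rw [stdCoord_eq]
    rcases l with l | l
    · exact (oddDer_algebraMap j _).trans (by simp; rfl)
    · refine (oddDer_ι j _).trans ?_
      by_cases h : j = l
      · subst h; simp; rfl
      · have h' : (Sum.inr j : Fin m ⊕ Fin n) ≠ Sum.inr l := fun e => h (Sum.inr_injective e)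
        simp [h]; rfl

end DomDer

/-- Every coordinate system has coordinate derivations. -/
lemma Hom.IsOpenImmersion.exists_isCoordDer {V : Opens (Fin m → ℝ)} {c : Hom (superDomain m n V) N}
    (hc : c.IsOpenImmersion) : ∃ d : Fin m ⊕ Fin n → N.vectorField hc.range,
      IsCoordDer hc.coord d := by
  let D : Fin m ⊕ Fin n → ∀ U : Set.Iic hc.range, N.O U →ₗ[ℝ] N.O U := fun k U =>
    (hc.pullEquiv U.1 U.2).symm.toLinearMap.comp
      ((domDer k (U.1.comap c.toMap)).comp (c.pull U.1).toLinearMap)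
  have hD : ∀ k (U : Set.Iic hc.range) (f : N.O U),
      c.pull U.1 (D k U f) = domDer k (U.1.comap c.toMap) (c.pull U.1 f) := fun k U f =>
    hc.pull_pullEquiv_symm U.1 U.2 _
  have hDm : ∀ k, D k ∈ N.superDer hc.range (coordParity k) := fun k => by
    refine ⟨fun U U' h a => hc.pull_injective U'.2 ?_, fun U i a ha =>
      mem_gr_of_injective (φ := c.pull U.1) (hc.pull_injective U.2) (fun i a ha => c.pull_mem ha) ?_,
      fun U i a ha b => hc.pull_injective U.2 ?_⟩
    · refine (hD k U' _).trans ((congrArg (domDer k _) (c.pull_res h a)).trans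
        ((domDer_res k _ _).trans (Eq.trans ?_ (c.pull_res h _).symm)))
      exact congrArg ((superDomain m n V).res _) (hD k U a).symm
    · exact (hD k U a).symm ▸ domDer_mem k (c.pull_mem ha)
    · refine (hD k U _).trans ((congrArg (domDer k _) (map_mul (c.pull U.1) a b)).trans
        ((domDer_mul k (c.pull_mem ha) _).trans ?_))
      refine Eq.trans ?_ (map_add (c.pull U.1) _ _).symm
      refine congrArg₂ (· + ·) ?_ ?_
      · exact (congrArg (· * _) (hD k U a).symm).trans (map_mul (c.pull U.1) _ _).symm
      · refine Eq.trans ?_ (map_smul (c.pull U.1) _ _).symm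
        exact congrArg (superSign _ • ·) ((congrArg (_ * ·) (hD k U b).symm).trans
          (map_mul (c.pull U.1) _ _).symm)
  refine ⟨fun k => ⟨D k, ?_⟩, fun k => ⟨hDm k, fun l => hc.pull_injective le_rfl ?_⟩⟩
  · rcases k with k | k
    · exact (le_sup_left : N.superDer hc.range 0 ≤ _) (hDm (.inl k))
    · exact (le_sup_right : N.superDer hc.range 1 ≤ _) (hDm (.inr k))
  · refine (hD k ⟨hc.range, le_refl hc.range⟩ _).trans ?_
    refine (congrArg (domDer k _) (hc.pull_pullEquiv_symm hc.range le_rfl _)).trans ?_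
    refine (domDer_res k _ _).trans ((congrArg _ (domDer_stdCoord k l)).trans ?_)
    split_ifs
    · exact (map_one _).trans (map_one (c.pull hc.range)).symm
    · exact (map_zero _).trans (map_zero (c.pull hc.range)).symm

/-! ### Derivations in coordinates -/

section Derivations

lemma superDer_one {U : Opens N.body} {i : ZMod 2}
    {D : ∀ V : Set.Iic U, N.O V →ₗ[ℝ] N.O V} (hD : D ∈ N.superDer U i) (V : Set.Iic U) :
    D V 1 = 0 := by
  have h := hD.2.2 V 0 1 (N.one_mem _) 1
  rw [mul_one, mul_one, one_mul, mul_zero] at h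
  simpa [superSign] using h

lemma superSign_mul_self (i : ZMod 2) : superSign i * superSign i = 1 := by
  unfold superSign; split_ifs <;> norm_num

lemma superSign_add_mul (i j k : ZMod 2) :
    superSign ((i + j) * k) = superSign (i * k) * superSign (j * k) := by
  rcases zmod_two_cases i with rfl | rfl <;> rcases zmod_two_cases j with rfl | rfl <;>
    rcases zmod_two_cases k with rfl | rfl <;>
    simp [superSign, show (1 : ZMod 2) + 1 = 0 from rfl]

lemma superSign_zero : superSign 0 = 1 := if_pos rfl

variable {V : Opens (Fin m → ℝ)} {c : Hom (superDomain m n V) N} (hc : c.IsOpenImmersion)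

include hc in
lemma coord_sub_mem (k : Fin m ⊕ Fin n) {p : N.body} (hp : p ∈ hc.range) :
    hc.coord k - algebraMap ℝ _ (N.val _ (hc.coord k) ⟨p, hp⟩) ∈ N.gr hc.range (coordParity k) := by
  have h := hc.isCoord.mem k
  rcases k with k | k
  · refine Submodule.sub_mem _ h ?_
    rw [Algebra.algebraMap_eq_smul_one]
    exact Submodule.smul_mem _ _ (N.one_mem _)
  · rw [N.val_odd h]
    simpa using h

/-- A derivation along a Grassmann-valued point is determined by its values on the coordinates. -/
lemma grDeriv_eq {d : Fin m ⊕ Fin n → N.vectorField hc.range} (hd : IsCoordDer hc.coord d)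
    (g : GrPoint N q) (i : ZMod 2) {U₀ : Opens N.body} (hU₀ : U₀ ≤ hc.range) (hg : g.pt ∈ U₀)
    (D : ∀ U : Opens N.body, U ≤ U₀ → g.pt ∈ U → (N.O U →ₗ[ℝ] Grassmann q))
    (hres : ∀ (U U' : Opens N.body) (h : U' ≤ U) (hU : U ≤ U₀) (hp : g.pt ∈ U') (f : N.O U),
      D U' (h.trans hU) hp (N.res h f) = D U hU (h hp) f)
    (hmem : ∀ k, D U₀ le_rfl hg (N.res hU₀ (hc.coord k)) ∈ grassmannPart q (i + coordParity k))
    (hleib : ∀ (U : Opens N.body) (hU : U ≤ U₀) (hp : g.pt ∈ U) (j : ZMod 2) (a b : N.O U),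
      a ∈ N.gr U j → D U hU hp (a * b) =
        D U hU hp a * g.app U hp b + superSign (i * j) • (g.app U hp a * D U hU hp b))
    (U : Opens N.body) (hU : U ≤ U₀) (hp : g.pt ∈ U) (f : N.O U) :
    D U hU hp f = ∑ l, D U₀ le_rfl hg (N.res hU₀ (hc.coord l)) *
      g.app U hp (vectorField.app (d l) (hU.trans hU₀) f) := by
  set β := fun l => D U₀ le_rfl hg (N.res hU₀ (hc.coord l)) with hβ
  have hinf : ∀ U : Opens N.body, g.pt ∈ U → g.pt ∈ U ⊓ U₀ := fun U h => ⟨h, hg⟩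
  -- the difference of both sides, extended to all open subsets of the coordinate domain
  let δ : ∀ U : Opens N.body, U ≤ hc.range → g.pt ∈ U → (N.O U →ₗ[ℝ] Grassmann q) :=
    fun U hU hp => (D (U ⊓ U₀) inf_le_right (hinf _ hp)).comp
      (N.res (inf_le_left : U ⊓ U₀ ≤ U)).toLinearMap -
      ∑ l, (LinearMap.mulLeft ℝ (β l)).comp ((g.app U hp).toLinearMap.comp
        (vectorField.app (d l) hU))
  have hδ : ∀ U hU hp f, δ U hU hp f = D (U ⊓ U₀) inf_le_right (hinf _ hp) (N.res inf_le_left f) -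
      ∑ l, β l * g.app U hp (vectorField.app (d l) hU f) := fun U hU hp f => by
    simp only [δ, LinearMap.sub_apply, LinearMap.comp_apply, LinearMap.sum_apply,
      LinearMap.mulLeft_apply, AlgHom.toLinearMap_apply]
  have hdres : ∀ l (U U' : Opens N.body) (h : U' ≤ U) (hU : U ≤ hc.range) (f : N.O U),
      vectorField.app (d l) (h.trans hU) (N.res h f) = N.res h (vectorField.app (d l) hU f) :=
    fun l U U' h hU f => (hd l).1.1 ⟨U, hU⟩ ⟨U', h.trans hU⟩ h f
  have hD1 : ∀ U hU hp, D U hU hp 1 = 0 := fun U hU hp => by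
    have h := hleib U hU hp 0 1 1 (N.one_mem _)
    rw [mul_one, map_one (g.app U hp), mul_one, one_mul, mul_zero, superSign_zero, one_smul] at h
    simpa using h
  have key := hc.germ_eq_zero (hU₀ hg) δ
    (fun U U' h hU hp f => by
      rw [hδ, hδ, N.res_res]
      refine congrArg₂ (· - ·) ?_ (Finset.sum_congr rfl fun l _ => ?_)
      · rw [← hres (U ⊓ U₀) (U' ⊓ U₀) (inf_le_inf_right _ h) inf_le_right (hinf _ hp), N.res_res]
      · rw [hdres, g.app_res])
    (fun U hU hp => by
      rw [hδ, map_one (N.res _), hD1, Finset.sum_eq_zero, sub_zero]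
      intro l _
      rw [show vectorField.app (d l) hU 1 = 0 from superDer_one (hd l).1 ⟨U, hU⟩, map_zero,
        mul_zero])
    (fun k => by
      have hzmem := coord_sub_mem hc k (hU₀ hg)
      set z := hc.coord k - algebraMap ℝ _ (N.val _ (hc.coord k) ⟨g.pt, hU₀ hg⟩) with hz
      have hzg : gbody (g.app hc.range (hU₀ hg) z) = 0 := by
        rw [hz, map_sub, map_sub, AlgHom.commutes, gbody_algebraMap, g.app_val, sub_self]
      refine ⟨superSign (i * coordParity k) • g.app hc.range (hU₀ hg) z, by
        rw [map_smul, hzg, smul_zero], fun U hU hp' h => ?_⟩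
      have hzU : N.res hU (hc.coord k) - algebraMap ℝ _ (N.val _ (hc.coord k) ⟨g.pt, hU₀ hg⟩) =
          N.res hU z := by rw [hz, map_sub, AlgHom.commutes]
      rw [hzU]
      have h1 : D (U ⊓ U₀) inf_le_right (hinf _ hp') (N.res (inf_le_left : U ⊓ U₀ ≤ U) (N.res hU z)) =
          β k := by
        have h2 : N.res (inf_le_left : U ⊓ U₀ ≤ U) (N.res hU z) =
            N.res (inf_le_right : U ⊓ U₀ ≤ U₀) (N.res hU₀ (hc.coord k)) -
              algebraMap ℝ _ (N.val _ (hc.coord k) ⟨g.pt, hU₀ hg⟩) := by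
          rw [N.res_res, N.res_res, hz, map_sub, AlgHom.commutes]
        rw [h2, map_sub, hres U₀ (U ⊓ U₀) inf_le_right le_rfl (hinf _ hp'),
          Algebra.algebraMap_eq_smul_one, map_smul, hD1, smul_zero, sub_zero]
      have h3 : ∀ l, vectorField.app (d l) hU (N.res hU z) = if l = k then 1 else 0 := fun l => by
        have h4 : vectorField.app (d l) le_rfl z = if l = k then 1 else 0 := by
          rw [hz, map_sub, (hd l).2 k, Algebra.algebraMap_eq_smul_one, map_smul,
            show vectorField.app (d l) le_rfl 1 = 0 from superDer_one (hd l).1 ⟨_, le_refl hc.range⟩,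
            smul_zero, sub_zero]
        rw [hdres l hc.range U hU le_rfl, h4]
        split_ifs <;> simp
      have h5 : ∀ l, vectorField.app (d l) hU (N.res hU z * h) =
          (if l = k then 1 else 0) * h +
            superSign (coordParity l * coordParity k) • (N.res hU z * vectorField.app (d l) hU h) :=
        fun l => by
          rw [← h3 l]
          exact (hd l).1.2.2 ⟨U, hU⟩ (coordParity k) _ (N.res_mem hU hzmem) h
      rw [hδ, hδ, map_mul, hleib _ _ _ (coordParity k) _ _ (N.res_mem _ (N.res_mem _ hzmem)), h1]
      simp only [h5, map_add, map_mul, map_smul, mul_add, Finset.sum_add_distrib, g.app_res]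
      have h6 : ∑ l, β l * (g.app U hp' (if l = k then 1 else 0) * g.app U hp' h) =
          β k * g.app U hp' h := by
        rw [Finset.sum_eq_single k]
        · rw [if_pos rfl, map_one, one_mul]
        · intro l _ hl; rw [if_neg hl, map_zero, zero_mul, mul_zero]
        · simp
      have h7 : ∀ l, β l * superSign (coordParity l * coordParity k) •
          (g.app hc.range (hU₀ hg) z * g.app U hp' (vectorField.app (d l) hU h)) =
          superSign (i * coordParity k) • (g.app hc.range (hU₀ hg) z *
            (β l * g.app U hp' (vectorField.app (d l) hU h))) := fun l => by
        have h8 := grassmann_supercomm (hmem l) (g.app_mem (hU₀ hg) hzmem)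
        rw [mul_smul_comm, ← mul_assoc, h8, superSign_add_mul, smul_mul_assoc, smul_smul, mul_assoc,
          mul_comm (superSign (i * coordParity k)), ← mul_assoc, superSign_mul_self, one_mul]
      rw [h6]
      simp only [h7]
      rw [← Finset.smul_sum, ← Finset.mul_sum, smul_mul_assoc, mul_sub, smul_sub]
      abel)
  have h1 := key U (hU.trans hU₀) hp f
  rw [hδ, sub_eq_zero, hres U (U ⊓ U₀) inf_le_left hU] at h1
  exact h1

end Derivations

end SuperSpace
end

noncomputable section

/-! ### Taylor expansions that depend on the time -/

section

variable {E : Type*} [NormedAddCommGroup E] [NormedSpace ℝ E] {m n q : ℕ} {U : Set E}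
  {e : Fin m → E} {ν : Fin m → Grassmann q} {ξ : Fin n → Grassmann q}

lemma dirDeriv_comm {F : Type*} [NormedAddCommGroup F] [NormedSpace ℝ F] (hU : IsOpen U) {g : E → F}
    (hg : ContDiffOn ℝ ∞ g U) (v w : E) {y : E} (hy : y ∈ U) :
    dirDeriv v (dirDeriv w g) y = dirDeriv w (dirDeriv v g) y := by
  have h1 : ContDiffAt ℝ ∞ g y := hg.contDiffAt (hU.mem_nhds hy)
  have h2 : DifferentiableAt ℝ (fderiv ℝ g) y :=
    (hg.fderiv_of_isOpen hU (m := ∞) (by norm_cast)).differentiableAt_of_isOpen hU hy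
  have h3 : ∀ v w : E, dirDeriv v (dirDeriv w g) y = fderiv ℝ (fderiv ℝ g) y v w := fun v w => by
    have := (h2.hasFDerivAt.clm_apply (hasFDerivAt_const w y)).fderiv
    change fderiv ℝ (fun y => fderiv ℝ g y w) y v = _
    rw [this]
    simp
  rw [h3, h3]
  exact (h1.isSymmSndFDerivAt (by
    rw [minSmoothness_of_isRCLikeNormedField]
    exact WithTop.coe_le_coe.2 (le_top : (2 : ℕ∞) ≤ ⊤))) v w

lemma dirDeriv_pi {F : Type*} [NormedAddCommGroup F] [NormedSpace ℝ F] [FiniteDimensional ℝ F]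
    {ι : Type*} [Fintype ι] (hU : IsOpen U)
    {g : ι → E → F} (hg : ∀ i, ContDiffOn ℝ ∞ (g i) U) (v : E) {y : E} (hy : y ∈ U) :
    dirDeriv v (fun y i => g i y) y = fun i => dirDeriv v (g i) y := by
  funext i
  exact (dirDeriv_linear hU (contDiffOn_pi.2 hg) (LinearMap.proj i) v hy).symm

lemma contDiffOn_taylorTerm' (hU : IsOpen U) {g : E → Grassmann n} (hg : ContDiffOn ℝ ∞ g U) (k : ℕ) :
    ContDiffOn ℝ ∞ (taylorTerm e ν ξ k g) U :=
  (contDiffOn_taylorTerm (q := q) hU hg k).comp (t := U ×ˢ Set.univ) (f := fun y => (y, ν, ξ))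
    (contDiffOn_id.prodMk contDiffOn_const) fun _ hy => ⟨hy, trivial⟩

lemma dirDeriv_taylorTerm (hU : IsOpen U) {g : E → Grassmann n} (hg : ContDiffOn ℝ ∞ g U) (v : E)
    (k : ℕ) {y : E} (hy : y ∈ U) :
    dirDeriv v (taylorTerm e ν ξ k g) y = taylorTerm e ν ξ k (dirDeriv v g) y := by
  induction k generalizing g y with
  | zero => exact dirDeriv_linear hU hg (grassmannSubst ξ).toLinearMap v hy
  | succ k ih =>
    let L : (Fin m → Grassmann q) →ₗ[ℝ] Grassmann q :=
      ((k : ℝ) + 1)⁻¹ • ∑ i, (LinearMap.mulLeft ℝ (ν i)).comp (LinearMap.proj i)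
    have hL : ∀ w, L w = ((k : ℝ) + 1)⁻¹ • ∑ i, ν i * w i := fun w => by
      simp [L, LinearMap.sum_apply]
    have h1 : ∀ g : E → Grassmann n, taylorTerm e ν ξ (k + 1) g =
        fun y => L fun i => taylorTerm e ν ξ k (dirDeriv (e i) g) y := fun g => by
      funext y; rw [hL]; rfl
    have h2 : ∀ i, ContDiffOn ℝ ∞ (taylorTerm e ν ξ k (dirDeriv (e i) g)) U := fun i =>
      contDiffOn_taylorTerm' hU (hg.dirDeriv hU _) k
    rw [h1, h1, dirDeriv_linear hU (contDiffOn_pi.2 h2) L v hy, dirDeriv_pi hU h2 v hy]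
    refine congrArg L (funext fun i => ?_)
    rw [ih (hg.dirDeriv hU _) hy]
    exact taylorTerm_congr hU (fun z hz => dirDeriv_comm hU hg v (e i) hz) k hy

lemma dirDeriv_taylorExt (hU : IsOpen U) {g : E → Grassmann n} (hg : ContDiffOn ℝ ∞ g U) (v : E)
    {y : E} (hy : y ∈ U) :
    dirDeriv v (taylorExt e ν ξ g) y = taylorExt e ν ξ (dirDeriv v g) y := by
  have h := dirDeriv_linear hU (contDiffOn_pi.2 fun k : Fin (q + 1) =>
    contDiffOn_taylorTerm' (e := e) (ν := ν) (ξ := ξ) hU hg k)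
    (∑ k, LinearMap.proj k) v hy
  rw [dirDeriv_pi hU (fun k : Fin (q + 1) => contDiffOn_taylorTerm' hU hg k) v hy] at h
  simp only [LinearMap.sum_apply, LinearMap.proj_apply, dirDeriv_taylorTerm hU hg v _ hy,
    Fin.sum_univ_eq_sum_range (fun k => taylorTerm e ν ξ k (dirDeriv v g) y) (q + 1)] at h
  refine Eq.trans (congrFun (congrArg (dirDeriv v) (funext fun z => ?_)) y) h
  exact (Fin.sum_univ_eq_sum_range (fun k => taylorTerm e ν ξ k g z) (q + 1)).symm

lemma hasDerivAt_of_contDiffOn {F : Type*} [NormedAddCommGroup F] [NormedSpace ℝ F]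
    {D : Set (ℝ × E)} (hD : IsOpen D) {g : ℝ × E → F} (hg : ContDiffOn ℝ ∞ g D) {t : ℝ} {y : E}
    (h : (t, y) ∈ D) : HasDerivAt (fun t => g (t, y)) (dirDeriv ((1 : ℝ), (0 : E)) g (t, y)) t :=
  (hg.differentiableAt_of_isOpen hD h).hasFDerivAt.comp_hasDerivAt t
    ((hasDerivAt_id t).prodMk (hasDerivAt_const t y))

end

namespace SuperSpace

section

variable {m n q : ℕ}

/-- The value at the coordinates `X` of a superfunction whose coordinate expression depends on the
time. -/
def timeExt (X : Fin m ⊕ Fin n → Grassmann q) (F : ℝ × (Fin m → ℝ) → Grassmann n) (t : ℝ) :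
    Grassmann q :=
  taylorExt (fun i => ((0 : ℝ), Pi.single i 1)) (coordNil X) (fun j => X (.inr j)) F
    (t, coordBody X)

variable {D : Set (ℝ × (Fin m → ℝ))} {F : ℝ × (Fin m → ℝ) → Grassmann n}

lemma timeExt_eq (hD : IsOpen D) (hF : ContDiffOn ℝ ∞ F D) {X : Fin m ⊕ Fin n → Grassmann q} {t : ℝ}
    (h : (t, coordBody X) ∈ D) : timeExt X F t = coordExt X fun y => F (t, y) :=
  taylorExt_slice hD hF h

lemma hasDerivAt_timeExt (hD : IsOpen D) (hF : ContDiffOn ℝ ∞ F D)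
    {X : Fin m ⊕ Fin n → Grassmann q} {t : ℝ} (h : (t, coordBody X) ∈ D) :
    HasDerivAt (timeExt X F) (timeExt X (dirDeriv ((1 : ℝ), 0) F) t) t := by
  have h1 := hasDerivAt_of_contDiffOn hD (g := taylorExt (fun i => ((0 : ℝ), Pi.single i 1))
    (coordNil X) (fun j => X (.inr j)) F)
    (ContDiffOn.sum fun k _ => contDiffOn_taylorTerm' hD hF k) h
  rwa [dirDeriv_taylorExt hD hF _ h] at h1

lemma ContDiffOn.timeExt {E : Type*} [NormedAddCommGroup E] [NormedSpace ℝ E] (hD : IsOpen D)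
    (hF : ContDiffOn ℝ ∞ F D) {U : Set E} {τ : E → ℝ} {X : E → Fin m ⊕ Fin n → Grassmann q}
    (hτ : ContDiffOn ℝ ∞ τ U) (hX : ContDiffOn ℝ ∞ X U) (h : ∀ z ∈ U, (τ z, coordBody (X z)) ∈ D) :
    ContDiffOn ℝ ∞ (fun z => timeExt (X z) F (τ z)) U :=
  (contDiffOn_taylorExt (q := q) (e := fun i => ((0 : ℝ), Pi.single i 1)) hD hF).comp
    (t := D ×ˢ Set.univ)
    (f := fun z => ((τ z, coordBody (X z)), coordNil (X z), fun j => X z (.inr j)))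
    ((hτ.prodMk (contDiff_coordBody.comp_contDiffOn hX)).prodMk
      ((contDiff_coordNil.comp_contDiffOn hX).prodMk (contDiffOn_pi.2 fun j =>
        (contDiff_apply ℝ (Grassmann q) (Sum.inr j : Fin m ⊕ Fin n)).comp_contDiffOn hX)))
    fun _ hz => ⟨h _ hz, trivial⟩

end

/-! ### Points of the product with the real line -/

variable {X : SuperSpace.{u}} {S : SuperSpace.{v}} {Y : SuperSpace.{w}} {p q r : ℕ}

open Classical in
/-- The value of a section at a Grassmann-valued point, and zero if the section is not defined at the
point. -/
def GrPoint.ev (g : GrPoint X q) {U : Opens X.body} (f : X.O U) : Grassmann q :=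
  if h : g.pt ∈ U then g.app U h f else 0

lemma GrPoint.ev_eq (g : GrPoint X q) {U : Opens X.body} (f : X.O U) (h : g.pt ∈ U) :
    g.ev f = g.app U h f := dif_pos h

/-- The point of `ℝ × S` given by a time and a Grassmann-valued point of `S`. -/
def timePt (g : GrPoint S q) (t : ℝ) : GrPoint S.timeProd q where
  pt := (t, g.pt)
  app W h := (g.app (timeSlice W t) h).comp
    ((Pi.evalAlgHom ℝ (fun t => S.O (timeSlice W t)) t).comp (S.timeFun W).val)
  app_res {W W'} h hp a := g.app_res (U := timeSlice W t) (V := timeSlice W' t)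
    (fun _ hx => h hx) hp (a.1 t)
  app_mem {W} hp _ _ ha := g.app_mem (U := timeSlice W t) hp (ha t)
  app_val {W} hp a := g.app_val (U := timeSlice W t) hp (a.1 t)

lemma timeExpr_eq_app {V : Opens (Fin p → ℝ)} (c : Hom (superDomain p q V) S)
    {W : Opens S.timeProd.body} (f : S.timeProd.O W) {t : ℝ} (y : V) (h : (t, c.toMap y) ∈ W) :
    timeExpr S c f.1 (t, y.1) = (timePt (c.mapPt (domPt y)) t).app W h f :=
  timeExpr_eq c f.1 ⟨y.2, h⟩

lemma contDiffOn_timeExpr {V : Opens (Fin p → ℝ)} {c : Hom (superDomain p q V) S}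
    (hc : c.IsOpenImmersion) {W : Opens S.timeProd.body} (f : S.timeProd.O W) :
    ContDiffOn ℝ ∞ (timeExpr S c f.1) (timeDom S c W) :=
  grassmannSmooth_iff.1 (f.2 p q V c hc)

lemma time_sec_ext (hS : S.IsSupermanifold p q) {W : Opens S.timeProd.body} {f f' : S.timeProd.O W}
    (h : ∀ (V : Opens (Fin p → ℝ)) (c : Hom (superDomain p q V) S), c.IsOpenImmersion →
      ∀ (t : ℝ) (y : V) (h : (t, c.toMap y) ∈ W), (timePt (c.mapPt (domPt y)) t).app W h f =
        (timePt (c.mapPt (domPt y)) t).app W h f') : f = f' :=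
  Subtype.ext (funext fun t => hS.sec_ext fun V c hc y hy => h V c hc t y hy)

lemma Hom.IsOpenImmersion.time_sec_ext {V : Opens (Fin p → ℝ)} {c : Hom (superDomain p q V) S}
    (hc : c.IsOpenImmersion) {W : Opens S.timeProd.body} (hW : ∀ z ∈ W, z.2 ∈ hc.range)
    {f f' : S.timeProd.O W}
    (h : ∀ (t : ℝ) (y : V) (h : (t, c.toMap y) ∈ W), (timePt (c.mapPt (domPt y)) t).app W h f =
        (timePt (c.mapPt (domPt y)) t).app W h f') : f = f' :=
  Subtype.ext (funext fun t => hc.pull_injective (fun s hs => hW (t, s) hs)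
    (domPt_ext fun y hy => h t y hy))

/-- The coordinates of a Grassmann-valued point in a chart. -/
lemma Hom.IsOpenImmersion.exists_coordPt {V : Opens (Fin p → ℝ)} {c : Hom (superDomain p q V) X}
    (hc : c.IsOpenImmersion) (g : GrPoint X r) (hg : g.pt ∈ hc.range) {x : Fin p ⊕ Fin q → Grassmann r}
    (hx : ∀ k, g.app _ hg (hc.coord k) = x k) :
    ∃ hV : coordBody x ∈ V, g = c.mapPt (coordPt x hV) := by
  obtain ⟨g, rfl⟩ := hc.exists_mapPt_eq g hg
  obtain ⟨h, e⟩ := eq_coordPt g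
  have e1 : (fun k => g.app ⊤ trivial (stdCoord V k)) = x := funext fun k =>
    (hc.mapPt_coord k g hg).symm.trans (hx k)
  subst e1
  exact ⟨h, congrArg c.mapPt e⟩

/-- The value of a superfunction on `ℝ × S` at a Grassmann-valued point in terms of the coordinates of
the point and of the coordinate expression of the superfunction. -/
lemma Hom.IsOpenImmersion.timePt_app_eq {V : Opens (Fin p → ℝ)} {c : Hom (superDomain p q V) S}
    (hc : c.IsOpenImmersion) (g : GrPoint S r) (hg : g.pt ∈ hc.range) {W : Opens S.timeProd.body}
    (f : S.timeProd.O W) (t : ℝ) (h : (t, g.pt) ∈ W) :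
    (t, coordBody fun k => g.app _ hg (hc.coord k)) ∈ timeDom S c W ∧ (timePt g t).app W h f =
      timeExt (fun k => g.app _ hg (hc.coord k)) (timeExpr S c f.1) t := by
  obtain ⟨hV, e⟩ := hc.exists_coordPt g hg fun _ => rfl
  generalize (fun k => g.app _ hg (hc.coord k)) = X at hV e ⊢
  subst e
  have hD : (t, coordBody X) ∈ timeDom S c W := ⟨hV, h⟩
  refine ⟨hD, ?_⟩
  rw [timeExt_eq (isOpen_timeDom c W) (contDiffOn_timeExpr hc f) hD]
  rfl

/-- The coordinates in a chart `c` of the points given by a chart `d` depend smoothly on the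
parameters. -/
lemma contDiffOn_coord {V : Opens (Fin p → ℝ)} {c : Hom (superDomain p q V) S}
    (hc : c.IsOpenImmersion) {p' q' : ℕ} {V' : Opens (Fin p' → ℝ)} (d : Hom (superDomain p' q' V') S) :
    ContDiffOn ℝ ∞ (fun y k => secFun (d.pull hc.range (hc.coord k)) y)
      {y | ∃ hy : y ∈ V', d.toMap ⟨y, hy⟩ ∈ hc.range} :=
  contDiffOn_pi.2 fun k => (contDiffOn_secFun (d.pull hc.range (hc.coord k))).mono
    fun _ hy => mem_up.2 hy

/-- A smooth function of the time and the coordinates in a chart is the coordinate expression of a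
superfunction. -/
lemma Hom.IsOpenImmersion.exists_time_sec {V : Opens (Fin p → ℝ)} {c : Hom (superDomain p q V) S}
    (hc : c.IsOpenImmersion) {W : Opens S.timeProd.body} (hW : ∀ z ∈ W, z.2 ∈ hc.range)
    {F : ℝ × (Fin p → ℝ) → Grassmann q} (hF : ContDiffOn ℝ ∞ F (timeDom S c W)) :
    ∃ f : S.timeProd.O W, ∀ z ∈ timeDom S c W, timeExpr S c f.1 z = F z := by
  have hsl : ∀ t, timeSlice W t ≤ hc.range := fun t s hs => hW (t, s) hs
  have hsm : ∀ t, ContDiffOn ℝ ∞ (fun y => F (t, y))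
      {y | ∃ h : y ∈ V, (⟨y, h⟩ : V) ∈ (timeSlice W t).comap c.toMap} := fun t =>
    hF.comp (contDiffOn_const.prodMk contDiffOn_id) fun y hy => hy
  let f : ∀ t, S.O (timeSlice W t) := fun t =>
    (hc.pullEquiv _ (hsl t)).symm (mkSec _ (fun y => F (t, y)) (hsm t))
  have hf : ∀ z ∈ timeDom S c W, timeExpr S c f z = F z := fun z hz => by
    refine (timeExpr_eq c f hz).trans ?_
    exact congrArg (fun s : (superDomain p q V).O ((timeSlice W z.1).comap c.toMap) =>
      s.1 ⟨z.2, mem_up.2 hz⟩) (hc.pull_pullEquiv_symm _ (hsl z.1) _)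
  refine ⟨⟨f, fun p' q' V' d hd => grassmannSmooth_iff.2 ?_⟩, hf⟩
  have hD := isOpen_timeDom c W
  have key : ∀ z ∈ timeDom S d W,
      (z.1, coordBody fun k => secFun (d.pull hc.range (hc.coord k)) z.2) ∈ timeDom S c W ∧
      timeExpr S d f z = timeExt (fun k => secFun (d.pull hc.range (hc.coord k)) z.2) F z.1 := by
    rintro ⟨t, y⟩ hz
    obtain ⟨hy, hz⟩ := hz
    have hg : (d.mapPt (domPt ⟨y, hy⟩)).pt ∈ hc.range := hW _ hz
    obtain ⟨hV, e⟩ := hc.exists_coordPt (d.mapPt (domPt ⟨y, hy⟩)) hg fun k =>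
      domPt_secFun (d.pull hc.range (hc.coord k)) ⟨y, hy⟩ hg
    set X := fun k => secFun (d.pull hc.range (hc.coord k)) y with hX
    have hXW : (t, c.toMap ⟨coordBody X, hV⟩) ∈ W := by
      have : c.toMap ⟨coordBody X, hV⟩ = d.toMap ⟨y, hy⟩ := (congrArg GrPoint.pt e).symm
      rw [this]; exact hz
    have hD' : (t, coordBody X) ∈ timeDom S c W := ⟨hV, hXW⟩
    refine ⟨hD', ?_⟩
    rw [timeExt_eq hD hF hD']
    refine (timeExpr_eq d f ⟨hy, hz⟩).trans ((GrPoint.app_congr e (U := timeSlice W t) hz hXW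
      (f t)).trans ?_)
    have h2 : coordBody X ∈ up (W := V) ((timeSlice W t).comap c.toMap) := mem_up.2 ⟨hV, hXW⟩
    refine taylorExt_congr (up (W := V) ((timeSlice W t).comap c.toMap)).isOpen
      (fun y' hy' => ?_) h2
    exact hf (t, y') (mem_up.1 hy')
  have hcoord := contDiffOn_coord hc d
  refine (ContDiffOn.timeExt hD hF (U := timeDom S d W) (τ := Prod.fst)
    (X := fun z k => secFun (d.pull hc.range (hc.coord k)) z.2) contDiffOn_fst
    (hcoord.comp contDiffOn_snd fun z hz => ⟨hz.1, hW _ hz.2⟩) fun z hz => (key z hz).1).congr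
    fun z hz => (key z hz).2

end SuperSpace
end

noncomputable section

namespace SuperSpace

/-! ### The derivative with respect to the time -/

variable {X : SuperSpace.{u}} {S : SuperSpace.{v}} {Y : SuperSpace.{w}} {p q r : ℕ}

section GrassmannDeriv

/-- Differentiability of curves in the Grassmann algebra can be tested by linear functionals. -/
lemma hasDerivAt_grassmann {γ : ℝ → Grassmann q} {γ' : Grassmann q} {t : ℝ} :
    (∀ l : Grassmann q →ₗ[ℝ] ℝ, HasDerivAt (fun t => l (γ t)) (l γ') t) ↔ HasDerivAt γ γ' t := by
  refine ⟨fun h => ?_, fun h l => (l.toContinuousLinearMap.hasFDerivAt.comp_hasDerivAt t h)⟩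
  let b := (Pi.basisFun ℝ (Fin q)).ExteriorAlgebra
  have h1 := HasDerivAt.fun_sum (u := Finset.univ) fun i (_ : i ∈ Finset.univ) =>
    (h (b.coord i)).smul_const (b i)
  have h2 : ∀ a, ∑ i, b.coord i a • b i = a := fun a => b.sum_repr a
  simpa only [h2] using h1

end GrassmannDeriv

lemma isTimeDeriv_iff {W : Opens S.timeProd.body} {f g : S.timeProd.O W} :
    IsTimeDeriv f g ↔ ∀ (p q : ℕ) (V : Opens (Fin p → ℝ)) (c : Hom (superDomain p q V) S),
      c.IsOpenImmersion → ∀ z ∈ timeDom S c W,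
        HasDerivAt (fun t => timeExpr S c f.1 (t, z.2)) (timeExpr S c g.1 z) z.1 := by
  simp only [IsTimeDeriv, hasDerivAt_grassmann]

/-- The restriction of sections of the product with the real line. -/
lemma timeExpr_res' {V : Opens (Fin p → ℝ)} (c : Hom (superDomain p q V) S)
    {W W' : Opens S.timeProd.body} (h : W' ≤ W) (f : S.timeProd.O W) {z : ℝ × (Fin p → ℝ)}
    (hz : z ∈ timeDom S c W') :
    timeExpr S c (S.timeProd.res h f).1 z = timeExpr S c f.1 z :=
  timeExpr_res c h f.1 hz

lemma eventually_timeDom {V : Opens (Fin p → ℝ)} (c : Hom (superDomain p q V) S)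
    {W : Opens S.timeProd.body} {z : ℝ × (Fin p → ℝ)} (hz : z ∈ timeDom S c W) :
    ∀ᶠ t in nhds z.1, (t, z.2) ∈ timeDom S c W :=
  ((isOpen_timeDom c W).preimage (by fun_prop : Continuous fun t : ℝ => (t, z.2))).mem_nhds hz

lemma IsTimeDeriv.res {W W' : Opens S.timeProd.body} (h : W' ≤ W) {f g : S.timeProd.O W}
    (H : IsTimeDeriv f g) : IsTimeDeriv (S.timeProd.res h f) (S.timeProd.res h g) := by
  rw [isTimeDeriv_iff] at H ⊢
  intro p q V c hc z hz
  rw [timeExpr_res' c h g hz]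
  refine (H p q V c hc z ⟨hz.1, h hz.2⟩).congr_of_eventuallyEq ?_
  filter_upwards [eventually_timeDom c hz] with t ht using timeExpr_res' c h f ht

lemma IsTimeDeriv.unique (hS : S.IsSupermanifold p q) {W : Opens S.timeProd.body}
    {f g g' : S.timeProd.O W} (h : IsTimeDeriv f g) (h' : IsTimeDeriv f g') : g = g' := by
  rw [isTimeDeriv_iff] at h h'
  refine time_sec_ext hS fun V c hc t y hy => ?_
  rw [← timeExpr_eq_app, ← timeExpr_eq_app]
  exact (h p q V c hc (t, y.1) ⟨y.2, hy⟩).unique (h' p q V c hc (t, y.1) ⟨y.2, hy⟩)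

/-- The derivative of a superfunction at a Grassmann-valued point over the domain of a chart. -/
lemma Hom.IsOpenImmersion.hasDerivAt_timePt {V : Opens (Fin p → ℝ)} {c : Hom (superDomain p q V) S}
    (hc : c.IsOpenImmersion) {W : Opens S.timeProd.body} {f g : S.timeProd.O W}
    (h : ∀ z ∈ timeDom S c W, HasDerivAt (fun t => timeExpr S c f.1 (t, z.2))
      (timeExpr S c g.1 z) z.1) (x : GrPoint S r) (hx : x.pt ∈ hc.range) {t : ℝ} (ht : (t, x.pt) ∈ W) :
    HasDerivAt (fun t => (timePt x t).ev f) ((timePt x t).ev g) t := by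
  obtain ⟨hD, -⟩ := hc.timePt_app_eq x hx f t ht
  have hDo := isOpen_timeDom c W
  have hsm := contDiffOn_timeExpr hc f
  have h1 := hasDerivAt_timeExt hDo hsm hD
  have h2 : ∀ z ∈ timeDom S c W, dirDeriv ((1 : ℝ), (0 : Fin p → ℝ)) (timeExpr S c f.1) z =
      timeExpr S c g.1 z := fun z hz =>
    (hasDerivAt_of_contDiffOn hDo hsm (t := z.1) (y := z.2) hz).unique (h z hz)
  have h3 : (timePt x t).ev g = timeExt (fun k => x.app _ hx (hc.coord k))
      (dirDeriv ((1 : ℝ), 0) (timeExpr S c f.1)) t := by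
    rw [GrPoint.ev_eq _ _ ht, (hc.timePt_app_eq x hx g t ht).2]
    exact taylorExt_congr hDo (fun z hz => (h2 z hz).symm) hD
  rw [h3]
  refine h1.congr_of_eventuallyEq ?_
  have h4 : ∀ᶠ t' in nhds t, (t', x.pt) ∈ W :=
    (W.isOpen.preimage (by fun_prop : Continuous fun t' : ℝ => (t', x.pt))).mem_nhds ht
  filter_upwards [h4] with t' ht'
  rw [GrPoint.ev_eq _ _ ht']
  exact (hc.timePt_app_eq x hx f t' ht').2

lemma timeExpr_eq_ev {V : Opens (Fin p → ℝ)} (c : Hom (superDomain p q V) S)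
    {W : Opens S.timeProd.body} (f : S.timeProd.O W) (t : ℝ) (y : V) :
    timeExpr S c f.1 (t, y.1) = (timePt (c.mapPt (domPt y)) t).ev f := by
  by_cases h : (t, c.toMap y) ∈ W
  · rw [timeExpr_eq_app c f y h, GrPoint.ev_eq _ _ h]
  · have h1 : (timePt (c.mapPt (domPt y)) t).pt ∉ W := h
    rw [GrPoint.ev, dif_neg h1]
    change extendZero _ _ _ = 0
    unfold extendZero
    exact dif_neg fun h2 => h (mem_up.1 h2).2

/-- Every superfunction on the product with the real line has a derivative with respect to the
time. -/
lemma exists_isTimeDeriv (hS : S.IsSupermanifold p q) {W : Opens S.timeProd.body}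
    (f : S.timeProd.O W) : ∃ g, IsTimeDeriv f g := by
  choose V c hc hrange using hS.exists_chart
  let A : S.body → Opens S.timeProd.body := fun s =>
    W ⊓ ⟨Prod.snd ⁻¹' ((hc s).range : Set S.body), (hc s).range.isOpen.preimage continuous_snd⟩
  have hA : ∀ s, A s ≤ W := fun s => inf_le_left
  have hloc : ∀ s, ∃ g : S.timeProd.O (A s), IsTimeDeriv (S.timeProd.res (hA s) f) g := by
    intro s
    -- over a chart the derivative of the coordinate expression defines the derivative; it is also the
    -- derivative in all other charts `d`, because these give Grassmann-valued points of `S`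
    obtain ⟨g, hg⟩ := (hc s).exists_time_sec (W := A s) (fun z hz => hz.2)
      ((contDiffOn_timeExpr (hc s) (S.timeProd.res (hA s) f)).dirDeriv
        (isOpen_timeDom (c s) (A s)) ((1 : ℝ), (0 : Fin p → ℝ)))
    refine ⟨g, isTimeDeriv_iff.2 fun p' q' V' d hd z hz => ?_⟩
    have h := (hc s).hasDerivAt_timePt (f := S.timeProd.res (hA s) f) (g := g)
      (fun z hz => by
        rw [hg z hz]
        exact hasDerivAt_of_contDiffOn (isOpen_timeDom (c s) (A s))
          (contDiffOn_timeExpr (hc s) (S.timeProd.res (hA s) f)) (t := z.1) (y := z.2) hz)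
      (d.mapPt (domPt ⟨z.2, hz.1⟩)) hz.2.2 (t := z.1) hz.2
    simp only [← timeExpr_eq_ev] at h
    exact h
  choose g hg using hloc
  obtain ⟨G, hG⟩ := S.timeProd.gluing A g fun s s' => by
    refine IsTimeDeriv.unique hS ((hg s).res inf_le_left) ?_
    have h := (hg s').res (inf_le_right : A s ⊓ A s' ≤ A s')
    rwa [S.timeProd.res_res] at h ⊢
  have hle : W ≤ ⨆ s, A s := fun z hz => Opens.mem_iSup.2 ⟨z.2, hz, hrange z.2⟩
  refine ⟨S.timeProd.res hle G, isTimeDeriv_iff.2 fun p' q' V' d hd z hz => ?_⟩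
  have hzA : z ∈ timeDom S d (A (d.toMap ⟨z.2, hz.1⟩)) := ⟨hz.1, hz.2, hrange _⟩
  have h := isTimeDeriv_iff.1 (hg (d.toMap ⟨z.2, hz.1⟩)) p' q' V' d hd z hzA
  rw [← hG, timeExpr_res' d _ G hzA] at h
  rw [timeExpr_res' d hle G hz]
  refine h.congr_of_eventuallyEq ?_
  filter_upwards [eventually_timeDom d hzA] with t ht using (timeExpr_res' d (hA _) f ht).symm

lemma isTimeDeriv_timeDeriv (hS : S.IsSupermanifold p q) {W : Opens S.timeProd.body}
    (f : S.timeProd.O W) : IsTimeDeriv f (timeDeriv f) := by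
  have h := exists_isTimeDeriv hS f
  rw [timeDeriv, dif_pos h]
  exact h.choose_spec

/-- The derivative of a superfunction along the time at a Grassmann-valued point. -/
lemma hasDerivAt_ev (hS : S.IsSupermanifold p q) {W : Opens S.timeProd.body} (f : S.timeProd.O W)
    (x : GrPoint S r) {t : ℝ} (ht : (t, x.pt) ∈ W) :
    HasDerivAt (fun t => (timePt x t).ev f) ((timePt x t).ev (timeDeriv f)) t := by
  obtain ⟨V, c, hc, hx⟩ := hS.exists_chart x.pt
  exact hc.hasDerivAt_timePt (fun z hz => isTimeDeriv_iff.1 (isTimeDeriv_timeDeriv hS f) p q V c hc z hz)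
    x hx ht

/-! ### Curves of Grassmann-valued points -/

/-- The parity of a section can be read off from its values at a separating set of points. -/
lemma mem_gr_of_values {U : Opens X.body} (P : GrPoint X r → Prop)
    (hsep : ∀ f f' : X.O U, (∀ g, P g → ∀ h : g.pt ∈ U, g.app U h f = g.app U h f') → f = f')
    {i : ZMod 2} {f : X.O U} (h : ∀ g, P g → ∀ hg : g.pt ∈ U, g.app U hg f ∈ grassmannPart r i) :
    f ∈ X.gr U i := by
  have h0 : f ∈ X.gr U 0 ⊔ X.gr U 1 := by rw [(X.gr_isCompl U).sup_eq_top]; trivial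
  obtain ⟨a, ha, b, hb, rfl⟩ := Submodule.mem_sup.1 h0
  rcases zmod_two_cases i with rfl | rfl
  · have hb0 : b = 0 := hsep _ _ fun g hg hU => by
      rw [map_zero]
      have h1 := h g hg hU
      rw [map_add] at h1
      refine grassmannPart_disjoint ?_ (g.app_mem hU hb)
      simpa using Submodule.sub_mem _ h1 (g.app_mem hU ha)
    rw [hb0, add_zero]; exact ha
  · have ha0 : a = 0 := hsep _ _ fun g hg hU => by
      rw [map_zero]
      have h1 := h g hg hU
      rw [map_add] at h1
      refine grassmannPart_disjoint (g.app_mem hU ha) ?_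
      simpa using Submodule.sub_mem _ h1 (g.app_mem hU hb)
    rw [ha0, zero_add]; exact hb

variable {W : Opens S.timeProd.body}

/-- The points of an open subspace of `ℝ × S` given by a time and a Grassmann-valued point of `S`. -/
def curvePt (W : Opens S.timeProd.body) (x : GrPoint S r) (t : ℝ) (h : (t, x.pt) ∈ W) :
    GrPoint (S.timeProd.restrict W) r :=
  (timePt x t).restrict h

lemma curvePt_app (x : GrPoint S r) (t : ℝ) (h : (t, x.pt) ∈ W)
    {U : Opens (S.timeProd.restrict W).body} (hU : (curvePt W x t h).pt ∈ U)
    (f : (S.timeProd.restrict W).O U) :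
    (curvePt W x t h).app U hU f = (timePt x t).ev (U := up U) f :=
  ((timePt x t).ev_eq (U := up U) f (mem_up.2 ⟨h, hU⟩)).symm

/-- Sections of an open subspace of `ℝ × S` are determined by their values at the points given by a
time and a point of a chart of `S`. -/
lemma curve_sec_ext (hS : S.IsSupermanifold p q) {U : Opens (S.timeProd.restrict W).body}
    {f f' : (S.timeProd.restrict W).O U}
    (h : ∀ (x : GrPoint S q) (t : ℝ) (hW : (t, x.pt) ∈ W) (hU : (curvePt W x t hW).pt ∈ U),
      (curvePt W x t hW).app U hU f = (curvePt W x t hW).app U hU f') : f = f' :=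
  time_sec_ext hS fun _ c _ t y hy =>
    h (c.mapPt (domPt y)) t (mem_up.1 hy).1 (mem_up.1 hy).2

lemma curve_hom_ext (hS : S.IsSupermanifold p q) {Φ Φ' : Hom (S.timeProd.restrict W) Y}
    (h : ∀ (x : GrPoint S q) (t : ℝ) (hW : (t, x.pt) ∈ W),
      Φ.mapPt (curvePt W x t hW) = Φ'.mapPt (curvePt W x t hW)) : Φ = Φ' := by
  have e : Φ.toMap = Φ'.toMap := by
    ext z
    obtain ⟨V, c, hc, y, hy⟩ := hS.exists_chart z.1.2
    have hz : (z.1.1, (c.mapPt (domPt y)).pt) = z.1 := Prod.ext rfl hy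
    have hW : (z.1.1, (c.mapPt (domPt y)).pt) ∈ W := hz ▸ z.2
    have h1 := congrArg GrPoint.pt (h (c.mapPt (domPt y)) z.1.1 hW)
    have h2 : (curvePt W (c.mapPt (domPt y)) z.1.1 hW).pt = z := Subtype.ext hz
    exact (congrArg Φ.toMap h2).symm.trans (h1.trans (congrArg Φ'.toMap h2))
  refine Hom.ext' e fun U a => curve_sec_ext hS fun x t hW hU => ?_
  have hU' : Φ'.toMap (curvePt W x t hW).pt ∈ U := e ▸ hU
  refine (GrPoint.app_congr (h x t hW) (U := U) hU hU' a).trans ?_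
  exact ((curvePt W x t hW).app_res (U := U.comap Φ'.toMap) (V := U.comap Φ.toMap)
    (by rw [e]) hU (Φ'.pull U a)).symm

/-- At the points `(t, x)`, with `x` fixed, `dt` is the ordinary derivative of the values. -/
lemma hasDerivAt_curve (hS : S.IsSupermanifold p q) {U : Opens (S.timeProd.restrict W).body}
    (f : (S.timeProd.restrict W).O U) (x : GrPoint S r) {t : ℝ} (hW : (t, x.pt) ∈ W)
    (hU : (curvePt W x t hW).pt ∈ U) :
    HasDerivAt (fun t => (timePt x t).ev (U := up U) f) ((curvePt W x t hW).app U hU (dt f)) t := by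
  rw [curvePt_app]
  exact hasDerivAt_ev hS (W := up U) f x (mem_up.2 ⟨hW, hU⟩)

section dt

lemma GrPoint.ev_add (g : GrPoint X r) {U : Opens X.body} (f f' : X.O U) :
    g.ev (f + f') = g.ev f + g.ev f' := by
  by_cases h : g.pt ∈ U
  · simp only [g.ev_eq _ h, map_add]
  · simp [GrPoint.ev, h]

lemma GrPoint.ev_smul (g : GrPoint X r) {U : Opens X.body} (a : ℝ) (f : X.O U) :
    g.ev (a • f) = a • g.ev f := by
  by_cases h : g.pt ∈ U
  · simp only [g.ev_eq _ h, map_smul]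
  · simp [GrPoint.ev, h]

lemma GrPoint.ev_mul (g : GrPoint X r) {U : Opens X.body} (f f' : X.O U) :
    g.ev (f * f') = g.ev f * g.ev f' := by
  by_cases h : g.pt ∈ U
  · simp only [g.ev_eq _ h, map_mul]
  · simp [GrPoint.ev, h]

lemma GrPoint.ev_res (g : GrPoint X r) {U U' : Opens X.body} (h : U' ≤ U) (hg : g.pt ∈ U') (f : X.O U) :
    g.ev (X.res h f) = g.ev f := by
  rw [g.ev_eq _ hg, g.ev_eq _ (h hg), g.app_res]

lemma GrPoint.ev_mem (g : GrPoint X r) {U : Opens X.body} {i : ZMod 2} {f : X.O U} (hf : f ∈ X.gr U i) :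
    g.ev f ∈ grassmannPart r i := by
  by_cases h : g.pt ∈ U
  · rw [g.ev_eq _ h]; exact g.app_mem h hf
  · simp [GrPoint.ev, h]

variable {U U' : Opens (S.timeProd.restrict W).body}

/-- A section is the derivative of another one if its values at the Grassmann-valued points are
derivatives. -/
lemma eq_dt (hS : S.IsSupermanifold p q) {f g : (S.timeProd.restrict W).O U}
    (h : ∀ (x : GrPoint S q) (t : ℝ) (hW : (t, x.pt) ∈ W) (hU : (curvePt W x t hW).pt ∈ U),
      HasDerivAt (fun t => (timePt x t).ev (U := up U) f) ((curvePt W x t hW).app U hU g) t) :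
    dt f = g :=
  curve_sec_ext hS fun x t hW hU => (hasDerivAt_curve hS f x hW hU).unique (h x t hW hU)

lemma eventually_mem_up (x : GrPoint S r) {t : ℝ} (hW : (t, x.pt) ∈ W)
    (hU : (curvePt W x t hW).pt ∈ U) : ∀ᶠ t' in nhds t, (t', x.pt) ∈ up U :=
  ((up U).isOpen.preimage (by fun_prop : Continuous fun t' : ℝ => (t', x.pt))).mem_nhds
    (mem_up.2 ⟨hW, hU⟩)

lemma dt_res (hS : S.IsSupermanifold p q) (h : U' ≤ U) (f : (S.timeProd.restrict W).O U) :
    dt ((S.timeProd.restrict W).res h f) = (S.timeProd.restrict W).res h (dt f) := by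
  refine eq_dt hS fun x t hW hU => ?_
  rw [GrPoint.app_res]
  refine (hasDerivAt_curve hS f x hW (h hU)).congr_of_eventuallyEq ?_
  filter_upwards [eventually_mem_up x hW hU] with t' ht'
  exact (timePt x t').ev_res (up_mono h) ht' f

lemma dt_add (hS : S.IsSupermanifold p q) (f g : (S.timeProd.restrict W).O U) :
    dt (f + g) = dt f + dt g := by
  refine eq_dt hS fun x t hW hU => ?_
  rw [map_add]
  exact ((hasDerivAt_curve hS f x hW hU).add (hasDerivAt_curve hS g x hW hU)).congr_of_eventuallyEq
    (Filter.Eventually.of_forall fun t' => (timePt x t').ev_add (U := up U) f g)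

lemma dt_smul (hS : S.IsSupermanifold p q) (a : ℝ) (f : (S.timeProd.restrict W).O U) :
    dt (a • f) = a • dt f := by
  refine eq_dt hS fun x t hW hU => ?_
  rw [map_smul]
  exact ((hasDerivAt_curve hS f x hW hU).const_smul a).congr_of_eventuallyEq
    (Filter.Eventually.of_forall fun t' => (timePt x t').ev_smul (U := up U) a f)

lemma dt_mul (hS : S.IsSupermanifold p q) (f g : (S.timeProd.restrict W).O U) :
    dt (f * g) = dt f * g + f * dt g := by
  refine eq_dt hS fun x t hW hU => ?_
  have h2 := (hasDerivAt_curve hS f x hW hU).mul (hasDerivAt_curve hS g x hW hU)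
  rw [map_add, map_mul, map_mul, curvePt_app x t hW hU f, curvePt_app x t hW hU g]
  exact h2.congr_of_eventuallyEq
    (Filter.Eventually.of_forall fun t' => (timePt x t').ev_mul (U := up U) f g)

/-- The derivative with respect to the time as a linear map. -/
def dtLin (hS : S.IsSupermanifold p q) (U : Opens (S.timeProd.restrict W).body) :
    (S.timeProd.restrict W).O U →ₗ[ℝ] (S.timeProd.restrict W).O U where
  toFun := dt
  map_add' := dt_add hS
  map_smul' := dt_smul hS

lemma dt_mem (hS : S.IsSupermanifold p q) {i : ZMod 2} {f : (S.timeProd.restrict W).O U}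
    (hf : f ∈ (S.timeProd.restrict W).gr U i) : dt f ∈ (S.timeProd.restrict W).gr U i := by
  refine mem_gr_of_values (r := q)
    (fun g => ∃ (x : GrPoint S q) (t : ℝ) (hW : (t, x.pt) ∈ W), g = curvePt W x t hW)
    (fun f f' H => curve_sec_ext hS fun x t hW hU => H _ ⟨x, t, hW, rfl⟩ hU) ?_
  rintro _ ⟨x, t, hW, rfl⟩ hU
  -- the values of `f` are fixed by the projection to the homogeneous part, hence so is the derivative
  have h := hasDerivAt_curve hS f x hW hU
  have h2 : HasDerivAt (fun t => (timePt x t).ev (U := up U) f)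
      (grassmannProj q i ((curvePt W x t hW).app U hU (dt f))) t :=
    ((grassmannProj q i).toContinuousLinearMap.hasFDerivAt.comp_hasDerivAt t h).congr_of_eventuallyEq
      (Filter.Eventually.of_forall fun t' =>
        (grassmannProj_eq ((timePt x t').ev_mem (U := up U) hf)).symm)
  rw [h.unique h2]
  exact grassmannProj_mem i _

end dt

end SuperSpace
end

noncomputable section

namespace SuperSpace

/-! ### Morphisms that depend on the time -/

variable {X : SuperSpace.{u}} {S : SuperSpace.{v}} {Y : SuperSpace.{w}} {p q r : ℕ}

namespace Hom.IsOpenImmersion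

variable {V : Opens (Fin p → ℝ)} {c : Hom (superDomain p q V) S} (hc : c.IsOpenImmersion)
  {W : Opens S.timeProd.body} (hW : ∀ z ∈ W, z.2 ∈ hc.range)

include hW in
lemma curve_sec_ext {U : Opens (S.timeProd.restrict W).body}
    {f f' : (S.timeProd.restrict W).O U}
    (h : ∀ (t : ℝ) (y : V) (h : (t, c.toMap y) ∈ W) (hU : ⟨(t, c.toMap y), h⟩ ∈ U),
      (curvePt W (c.mapPt (domPt y)) t h).app U hU f =
        (curvePt W (c.mapPt (domPt y)) t h).app U hU f') : f = f' :=
  hc.time_sec_ext (W := up U) (fun z hz => hW z (mem_up.1 hz).1) fun t y hy =>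
    h t y (mem_up.1 hy).1 (mem_up.1 hy).2

include hW in
lemma curve_hom_ext {Φ Φ' : Hom (S.timeProd.restrict W) Y}
    (h : ∀ (t : ℝ) (y : V) (h : (t, c.toMap y) ∈ W),
      Φ.mapPt (curvePt W (c.mapPt (domPt y)) t h) = Φ'.mapPt (curvePt W (c.mapPt (domPt y)) t h)) :
    Φ = Φ' := by
  have e : Φ.toMap = Φ'.toMap := by
    ext ⟨⟨t, s⟩, hz⟩
    obtain ⟨y, rfl⟩ : s ∈ hc.range := hW _ hz
    exact congrArg GrPoint.pt (h t y hz)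
  refine Hom.ext' e fun U a => hc.curve_sec_ext hW fun t y hz hU => ?_
  have hU' : Φ'.toMap (curvePt W (c.mapPt (domPt y)) t hz).pt ∈ U := e ▸ hU
  refine (GrPoint.app_congr (h t y hz) (U := U) hU hU' a).trans ?_
  exact ((curvePt W (c.mapPt (domPt y)) t hz).app_res (U := U.comap Φ'.toMap)
    (V := U.comap Φ.toMap) (by rw [e]) hU (Φ'.pull U a)).symm

/-- The time and the even coordinates of the points over the range of a chart. -/
def timeCoord : C((S.timeProd.restrict W).body, timeDom S c W) :=
  ⟨fun w => ⟨(w.1.1, (hc.invMap ⟨w.1.2, hW _ w.2⟩).1), Subtype.prop _, by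
      have h : c.toMap (hc.invMap ⟨w.1.2, hW _ w.2⟩) = w.1.2 := hc.map_invMap ⟨w.1.2, hW _ w.2⟩
      have h2 : (w.1.1, c.toMap (hc.invMap ⟨w.1.2, hW _ w.2⟩)) ∈ W := by rw [h]; exact w.2
      exact h2⟩, by
    have h0 : Continuous fun w : (S.timeProd.restrict W).body => (w.1 : ℝ × S.body) :=
      continuous_subtype_val
    have h1 : Continuous fun w : (S.timeProd.restrict W).body => (⟨w.1.2, hW _ w.2⟩ : hc.range) :=
      (continuous_snd.comp h0).subtype_mk _
    have h2 : Continuous fun w : (S.timeProd.restrict W).body =>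
        (hc.invMap ⟨w.1.2, hW _ w.2⟩ : V) := hc.invMap.continuous.comp h1
    exact ((continuous_fst.comp h0).prodMk (continuous_subtype_val.comp h2)).subtype_mk _⟩

lemma timeCoord_eq {t : ℝ} {y : V} (h : (t, c.toMap y) ∈ W) :
    hc.timeCoord hW ⟨(t, c.toMap y), h⟩ = ⟨(t, y.1), y.2, h⟩ :=
  Subtype.ext (Prod.ext rfl (congrArg Subtype.val (hc.invMap_map y)))

include hc hW in
lemma exists_section_of_pts (G : timeDom S c W → GrPoint Y q)
    (hs : ∀ (U : Opens Y.body) (a : Y.O U), ∃ F : ℝ × (Fin p → ℝ) → Grassmann q,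
      ContDiffOn ℝ ∞ F {z | ∃ hz : z ∈ timeDom S c W, (G ⟨z, hz⟩).pt ∈ U} ∧
        ∀ (z : timeDom S c W) (hz : (G z).pt ∈ U), (G z).app U hz a = F z)
    (U : Opens Y.body) (U' : Opens (S.timeProd.restrict W).body)
    (hU' : ∀ w ∈ U', (G (hc.timeCoord hW w)).pt ∈ U) (a : Y.O U) :
    ∃ f : (S.timeProd.restrict W).O U',
      ∀ (t : ℝ) (y : V) (h : (t, c.toMap y) ∈ W) (hU : ⟨(t, c.toMap y), h⟩ ∈ U')
        (hG : (G ⟨(t, y.1), y.2, h⟩).pt ∈ U),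
        (curvePt W (c.mapPt (domPt y)) t h).app U' hU f = (G ⟨(t, y.1), y.2, h⟩).app U hG a := by
  obtain ⟨F, hF, hF'⟩ := hs U a
  have hsub : ∀ z ∈ timeDom S c (up U'), ∃ hz : z ∈ timeDom S c W, (G ⟨z, hz⟩).pt ∈ U := by
    rintro ⟨t, y⟩ ⟨hy, hz⟩
    have h1 : (t, c.toMap ⟨y, hy⟩) ∈ W := (mem_up.1 hz).1
    refine ⟨⟨hy, h1⟩, ?_⟩
    have h2 := hU' ⟨(t, c.toMap ⟨y, hy⟩), h1⟩ (mem_up.1 hz).2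
    rwa [hc.timeCoord_eq hW h1] at h2
  obtain ⟨f, hf⟩ := hc.exists_time_sec (W := up U') (fun z hz => hW z (mem_up.1 hz).1)
    (hF.mono hsub)
  refine ⟨f, fun t y h hU hG => ?_⟩
  have hm : (t, c.toMap y) ∈ up U' := mem_up.2 ⟨h, hU⟩
  exact (timeExpr_eq_app c f y hm).symm.trans ((hf (t, y.1) ⟨y.2, hm⟩).trans
    (hF' ⟨(t, y.1), y.2, h⟩ hG).symm)

include hc hW in
/-- A family of Grassmann-valued points, parametrized by the time and the even coordinates in a
chart, that is continuous and depends smoothly on the parameters, is a morphism. -/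
lemma exists_hom_of_pts (G : timeDom S c W → GrPoint Y q)
    (hcont : Continuous fun z => (G z).pt)
    (hs : ∀ (U : Opens Y.body) (a : Y.O U), ∃ F : ℝ × (Fin p → ℝ) → Grassmann q,
      ContDiffOn ℝ ∞ F {z | ∃ hz : z ∈ timeDom S c W, (G ⟨z, hz⟩).pt ∈ U} ∧
        ∀ (z : timeDom S c W) (hz : (G z).pt ∈ U), (G z).app U hz a = F z) :
    ∃ Φ : Hom (S.timeProd.restrict W) Y, ∀ (t : ℝ) (y : V) (h : (t, c.toMap y) ∈ W),
      Φ.mapPt (curvePt W (c.mapPt (domPt y)) t h) = G ⟨(t, y.1), y.2, h⟩ := by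
  let φ : C((S.timeProd.restrict W).body, Y.body) :=
    ⟨fun w => (G (hc.timeCoord hW w)).pt, hcont.comp (hc.timeCoord hW).continuous⟩
  have hφ : ∀ (t : ℝ) (y : V) (h : (t, c.toMap y) ∈ W),
      φ ⟨(t, c.toMap y), h⟩ = (G ⟨(t, y.1), y.2, h⟩).pt := fun t y h =>
    congrArg (fun z => (G z).pt) (hc.timeCoord_eq hW h)
  choose f hf using fun U => hc.exists_section_of_pts hW G hs U (U.comap φ) fun _ h => h
  have hf' : ∀ U a t (y : V) (h : (t, c.toMap y) ∈ W) (hU : ⟨(t, c.toMap y), h⟩ ∈ U.comap φ),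
      (curvePt W (c.mapPt (domPt y)) t h).app (U.comap φ) hU (f U a) =
        (G ⟨(t, y.1), y.2, h⟩).app U (hφ t y h ▸ hU) a := fun U a t y h hU => hf U a t y h hU _
  have hext : ∀ {U : Opens (S.timeProd.restrict W).body} {f f' : (S.timeProd.restrict W).O U},
      (∀ (t : ℝ) (y : V) (h : (t, c.toMap y) ∈ W) (hU : ⟨(t, c.toMap y), h⟩ ∈ U),
        (curvePt W (c.mapPt (domPt y)) t h).app U hU f =
          (curvePt W (c.mapPt (domPt y)) t h).app U hU f') → f = f' :=
    fun h => hc.curve_sec_ext hW h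
  let Φ : Hom (S.timeProd.restrict W) Y :=
    { toMap := φ
      pull := fun U => AlgHom.mk'
        { toFun := f U
          map_one' := hext fun t y h hU => by rw [hf', map_one, map_one]
          map_mul' := fun a b => hext fun t y h hU => by
            rw [map_mul, hf', hf', hf', map_mul]
          map_zero' := hext fun t y h hU => by rw [hf', map_zero, map_zero]
          map_add' := fun a b => hext fun t y h hU => by
            rw [map_add, hf', hf', hf', map_add] }
        fun r a => hext fun t y h hU => by
          refine (hf' U (r • a) t y h hU).trans ((map_smul _ _ _).trans ?_)
          exact ((map_smul ((curvePt W (c.mapPt (domPt y)) t h).app _ hU) r (f U a)).trans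
            (congrArg (r • ·) (hf' U a t y h hU))).symm
      pull_res := fun {U U'} h a => hext fun t y hz hU => by
        have h1 := (curvePt W (c.mapPt (domPt y)) t hz).app_res (U := U.comap φ) (V := U'.comap φ)
          (fun _ hx => h hx) hU (f U a)
        refine (hf' U' _ t y hz hU).trans (Eq.trans ?_ h1.symm)
        exact (GrPoint.app_res _ h _ a).trans (hf' U a t y hz (h hU)).symm
      pull_mem := fun {U i a} ha => mem_gr_of_values
        (fun g => ∃ (t : ℝ) (y : V) (h : (t, c.toMap y) ∈ W), g = curvePt W (c.mapPt (domPt y)) t h)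
        (fun f f' H => hext fun t y h hU => H _ ⟨t, y, h, rfl⟩ hU) (by
          rintro _ ⟨t, y, h, rfl⟩ hU
          have := (G ⟨(t, y.1), y.2, h⟩).app_mem (hφ t y h ▸ hU) ha
          rw [← hf'] at this
          exact this)
      pull_val := by
        rintro U a ⟨⟨⟨t, s⟩, hz⟩, hU⟩
        obtain ⟨y, rfl⟩ : s ∈ hc.range := hW _ hz
        have h1 := (curvePt W (c.mapPt (domPt y)) t hz).app_val (U := U.comap φ) hU (f U a)
        have h2 : (G ⟨(t, y.1), y.2, hz⟩).pt ∈ U := hφ t y hz ▸ hU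
        have h3 := (G ⟨(t, y.1), y.2, hz⟩).app_val h2 a
        have h4 : (⟨(G ⟨(t, y.1), y.2, hz⟩).pt, h2⟩ : U) = ⟨φ ⟨(t, c.toMap y), hz⟩, hU⟩ :=
          Subtype.ext (hφ t y hz).symm
        exact h1.symm.trans ((congrArg gbody (hf' U a t y hz hU)).trans
          (h3.trans (congrArg (Y.val U a) h4))) }
  refine ⟨Φ, fun t y h => GrPoint.ext' (hφ t y h) fun U hp a => ?_⟩
  exact hf' U a t y h hp

end Hom.IsOpenImmersion

/-- Morphisms with prescribed coordinates that depend on the time: `c` is a chart of `S`, and `k` is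
a chart of the target. -/
lemma Hom.IsOpenImmersion.exists_time_hom {V : Opens (Fin p → ℝ)} {c : Hom (superDomain p q V) S}
    (hc : c.IsOpenImmersion) {W : Opens S.timeProd.body} (hW : ∀ z ∈ W, z.2 ∈ hc.range) {m n : ℕ}
    {V' : Opens (Fin m → ℝ)} (k : Hom (superDomain m n V') Y)
    {x : ℝ × (Fin p → ℝ) → Fin m ⊕ Fin n → Grassmann q} (hx : ContDiffOn ℝ ∞ x (timeDom S c W))
    (hV : ∀ z ∈ timeDom S c W, coordBody (x z) ∈ V') :
    ∃ Φ : Hom (S.timeProd.restrict W) Y, ∀ (t : ℝ) (y : V) (h : (t, c.toMap y) ∈ W),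
      Φ.mapPt (curvePt W (c.mapPt (domPt y)) t h) =
        k.mapPt (coordPt (x (t, y.1)) (hV (t, y.1) ⟨y.2, h⟩)) := by
  refine hc.exists_hom_of_pts hW (G := fun z => k.mapPt (coordPt (x z.1) (hV z.1 z.2))) ?_ ?_
  · have h1 : ContinuousOn (fun z => coordBody (x z)) (timeDom S c W) :=
      (contDiff_coordBody.comp_contDiffOn hx).continuousOn
    have h2 := (continuousOn_iff_continuous_domRestrict.1 h1).subtype_mk fun z => hV z.1 z.2
    exact k.toMap.continuous.comp h2
  · intro U a
    refine ⟨fun z => coordExt (x z) (secFun (k.pull U a)), ?_, fun z hz => rfl⟩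
    have h1 := contDiffOn_secFun (k.pull U a)
    refine (contDiffOn_coordExt (up (U.comap k.toMap)).isOpen h1).comp
      (hx.mono fun z hz => hz.1) ?_
    rintro z ⟨hz, hU⟩
    exact mem_up.2 ⟨_, hU⟩

end SuperSpace
end

noncomputable section

namespace SuperSpace

/-! ### Vector fields in coordinates -/

variable {A : SuperSpace.{v}} {N : SuperSpace.{u}} {m n q : ℕ}

namespace vectorField

variable {U : Opens N.body}

lemma ext' {X Y : N.vectorField U} (h : ∀ (V : Opens N.body) (hV : V ≤ U) (f : N.O V),
    app X hV f = app Y hV f) : X = Y :=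
  Subtype.ext (funext fun V => LinearMap.ext fun f => h V.1 V.2 f)

lemma app_sum {ι : Type*} (s : Finset ι) (X : ι → N.vectorField U) {V : Opens N.body} (hV : V ≤ U)
    (f : N.O V) : app (∑ i ∈ s, X i) hV f = ∑ i ∈ s, app (X i) hV f := by
  simp only [app, Submodule.coe_sum, Finset.sum_apply, LinearMap.sum_apply]

lemma app_add (X Y : N.vectorField U) {V : Opens N.body} (hV : V ≤ U) (f : N.O V) :
    app (X + Y) hV f = app X hV f + app Y hV f := rfl

lemma app_smul (r : ℝ) (X : N.vectorField U) {V : Opens N.body} (hV : V ≤ U) (f : N.O V) :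
    app (r • X) hV f = r • app X hV f := rfl

lemma app_mul (g : N.O U) (X : N.vectorField U) {V : Opens N.body} (hV : V ≤ U) (f : N.O V) :
    app (mul g X) hV f = N.res hV g * app X hV f := rfl

lemma app_mul' (g : N.O U) (X : N.vectorField U) (f : N.O U) :
    app (mul g X) le_rfl f = g * app X le_rfl f := by
  rw [app_mul, N.res_self]

lemma add_mul_left (g g' : N.O U) (X : N.vectorField U) : mul (g + g') X = mul g X + mul g' X :=
  ext' fun V hV f => by rw [app_mul, app_add, app_mul, app_mul, map_add, add_mul]

/-- A vector field is compatible with restrictions. -/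
lemma app_restrict (X : N.vectorField U) {V V' : Opens N.body} (hV : V ≤ U) (h : V' ≤ V)
    (f : N.O V) : app X (h.trans hV) (N.res h f) = N.res h (app X hV f) := by
  obtain ⟨D, hD, E, hE, e⟩ := Submodule.mem_sup.1 X.2
  simp only [app, ← e]
  exact (congrArg₂ (· + ·) (hD.1 ⟨V, hV⟩ ⟨V', h.trans hV⟩ h f)
    (hE.1 ⟨V, hV⟩ ⟨V', h.trans hV⟩ h f)).trans (map_add _ _ _).symm

end vectorField

section Expansion

variable {V : Opens (Fin m → ℝ)} {c : Hom (superDomain m n V) N} (hc : c.IsOpenImmersion)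

include hc

/-- A derivation along a morphism is determined by its values on the coordinates. -/
lemma along_eq_sum (hA : ∀ {U : Opens A.body} {f f' : A.O U},
      (∀ (g : GrPoint A q) (h : g.pt ∈ U), g.app U h f = g.app U h f') → f = f') (Φ : Hom A N)
    {d : Fin m ⊕ Fin n → N.vectorField hc.range} (hd : IsCoordDer hc.coord d) {i : ZMod 2}
    {U₀ : Opens N.body} (hU₀ : U₀ ≤ hc.range)
    (Z : ∀ U : Opens N.body, U ≤ U₀ → (N.O U →ₗ[ℝ] A.O (U.comap Φ.toMap)))
    (hres : ∀ (U U' : Opens N.body) (h : U' ≤ U) (hU : U ≤ U₀) (f : N.O U),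
      Z U' (h.trans hU) (N.res h f) = A.res (fun _ hx => h hx) (Z U hU f))
    (hmem : ∀ (U : Opens N.body) (hU : U ≤ U₀) (j : ZMod 2) (a : N.O U), a ∈ N.gr U j →
      Z U hU a ∈ A.gr _ (i + j))
    (hleib : ∀ (U : Opens N.body) (hU : U ≤ U₀) (j : ZMod 2) (a b : N.O U), a ∈ N.gr U j →
      Z U hU (a * b) = Z U hU a * Φ.pull U b + superSign (i * j) • (Φ.pull U a * Z U hU b))
    (U : Opens N.body) (hU : U ≤ U₀) (f : N.O U) :
    Z U hU f = ∑ l, A.res (fun _ hx => hU hx) (Z U₀ le_rfl (N.res hU₀ (hc.coord l))) *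
      Φ.pull U (vectorField.app (d l) (hU.trans hU₀) f) := by
  refine hA fun g hg => ?_
  have h := grDeriv_eq hc hd (Φ.mapPt g) i hU₀ (hU hg)
    (fun U' hU' hp => (g.app (U'.comap Φ.toMap) hp).toLinearMap.comp (Z U' hU'))
    (fun U' U'' h hU' hp f => (congrArg (g.app _ hp) (hres U' U'' h hU' f)).trans
      (g.app_res _ hp _))
    (fun k => g.app_mem _ (hmem U₀ le_rfl _ _ (N.res_mem hU₀ (hc.isCoord.mem k))))
    (fun U' hU' hp j a b ha => (congrArg (g.app _ hp) (hleib U' hU' j a b ha)).trans (by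
      rw [map_add, map_mul, map_smul, map_mul]; rfl)) U hU hg f
  refine h.trans ?_
  rw [map_sum]
  refine Finset.sum_congr rfl fun l _ => ?_
  refine Eq.trans ?_ (map_mul (g.app _ hg) _ _).symm
  exact congrArg (· * _) (g.app_res (U := U₀.comap Φ.toMap) (V := U.comap Φ.toMap)
    (fun _ hx => hU hx) hg _).symm

lemma vectorField.app_eq_sum (hN : N.IsSupermanifold m n)
    {d : Fin m ⊕ Fin n → N.vectorField hc.range} (hd : IsCoordDer hc.coord d)
    {U₀ : Opens N.body} (hU₀ : U₀ ≤ hc.range) (Y : N.vectorField U₀) {U : Opens N.body} (hU : U ≤ U₀)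
    (f : N.O U) : app Y hU f = ∑ l, N.res hU (app Y le_rfl (N.res hU₀ (hc.coord l))) *
      app (d l) (hU.trans hU₀) f := by
  let I : Hom N N := ⟨ContinuousMap.id _, fun U => AlgHom.id ℝ _, fun _ _ => rfl, fun h => h,
    fun _ _ => rfl⟩
  obtain ⟨D, hD, E, hE, e⟩ := Submodule.mem_sup.1 Y.2
  have key : ∀ (i : ZMod 2) (D : ∀ V : Set.Iic U₀, N.O V →ₗ[ℝ] N.O V), D ∈ N.superDer U₀ i →
      D ⟨U, hU⟩ f = ∑ l, N.res hU (D ⟨U₀, le_refl U₀⟩ (N.res hU₀ (hc.coord l))) *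
        app (d l) (hU.trans hU₀) f := fun i D hD =>
    along_eq_sum (q := n) hc (A := N) (fun h => hN.sec_ext fun V c hc y hy => h _ hy) I hd (i := i) hU₀
      (fun U hU => D ⟨U, hU⟩) (fun U U' h hU f => hD.1 ⟨U, hU⟩ ⟨U', h.trans hU⟩ h f)
      (fun U hU j a ha => hD.2.1 ⟨U, hU⟩ j a ha)
      (fun U hU j a b ha => hD.2.2 ⟨U, hU⟩ j a ha b) U hU f
  have h0 := key 0 D hD
  have h1 := key 1 E hE
  have h2 : ∀ (U : Opens N.body) (hU : U ≤ U₀) (f : N.O U),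
      app Y hU f = D ⟨U, hU⟩ f + E ⟨U, hU⟩ f := fun U hU f => by
    simp only [app, ← e]; rfl
  rw [h2, h0, h1, ← Finset.sum_add_distrib]
  refine Finset.sum_congr rfl fun l _ => ?_
  rw [h2, map_add, add_mul]

lemma vectorField.eq_sum (hN : N.IsSupermanifold m n)
    {d : Fin m ⊕ Fin n → N.vectorField hc.range} (hd : IsCoordDer hc.coord d)
    {U₀ : Opens N.body} (hU₀ : U₀ ≤ hc.range) (Y : N.vectorField U₀) :
    Y = ∑ l, mul (app Y le_rfl (N.res hU₀ (hc.coord l))) (res hU₀ (d l)) :=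
  ext' fun U hU f => by
    rw [app_sum, app_eq_sum hc hN hd hU₀ Y hU f]
    rfl

end Expansion

/-! ### The covariant derivative of the velocity in coordinates -/

variable {S : SuperSpace.{v}} {p : ℕ} {W : Opens S.timeProd.body}
  {Φ : Hom (S.timeProd.restrict W) N}

/-- The chain rule for the derivative with respect to the time. -/
lemma dt_pull_eq_sum (hS : S.IsSupermanifold p q) {V : Opens (Fin m → ℝ)}
    {c : Hom (superDomain m n V) N} (hc : c.IsOpenImmersion)
    {d : Fin m ⊕ Fin n → N.vectorField hc.range} (hd : IsCoordDer hc.coord d)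
    {U₀ : Opens N.body} (hU₀ : U₀ ≤ hc.range) {U : Opens N.body} (hU : U ≤ U₀) (f : N.O U) :
    dt (Φ.pull U f) = ∑ l, (S.timeProd.restrict W).res (fun _ hx => hU hx)
        (dt (Φ.pull U₀ (N.res hU₀ (hc.coord l)))) *
      Φ.pull U (vectorField.app (d l) (hU.trans hU₀) f) :=
  along_eq_sum (q := q) hc (fun h => curve_sec_ext hS fun x t hW hU => h _ hU) Φ hd (i := 0) hU₀
    (fun U _ => (dtLin hS (U.comap Φ.toMap)).comp (Φ.pull U).toLinearMap)
    (fun U U' h hU f => (congrArg dt (Φ.pull_res h f)).trans (dt_res hS _ _))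
    (fun U hU j a ha => by rw [zero_add]; exact dt_mem hS (Φ.pull_mem ha))
    (fun U hU j a b ha => by
      rw [zero_mul, superSign_zero, one_smul]
      exact (congrArg dt (map_mul (Φ.pull U) a b)).trans (dt_mul hS _ _)) U hU f

section CovDeriv

lemma map_leibniz {R R' : Type*} [Ring R] [Algebra ℝ R] [Ring R'] [Algebra ℝ R'] (φ : R →ₐ[ℝ] R')
    (a b c g : R) (r : ℝ) : φ (a * b + r • (g * c)) = φ a * φ b + r • (φ g * φ c) := by
  rw [map_add, map_smul, map_mul, map_mul]

lemma mul_leibniz_swap {R : Type*} [Ring R] [Algebra ℝ R] {β g a b c e : R} {i : ZMod 2}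
    (h : β * g = superSign i • (g * β)) (h' : e = a * b + superSign i • (g * c)) :
    β * e = β * a * b + g * (β * c) := by
  rw [h', mul_add, mul_smul_comm, ← mul_assoc, ← mul_assoc, h, smul_mul_assoc, smul_smul,
    superSign_mul_self, one_smul, mul_assoc g]

open vectorField

variable (hS : S.IsSupermanifold p q) (D : N.Connection) {U : Opens N.body}
  {x : Fin m ⊕ Fin n → N.O U} {d : Fin m ⊕ Fin n → N.vectorField U}

lemma vectorField.app_frame (hframe : ∀ Y : N.vectorField U, Y = ∑ l, mul (app Y le_rfl (x l)) (d l))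
    (Y : N.vectorField U) (f : N.O U) :
    app Y le_rfl f = ∑ l, app Y le_rfl (x l) * app (d l) le_rfl f := by
  conv_lhs => rw [hframe Y]
  rw [app_sum]
  exact Finset.sum_congr rfl fun l _ => app_mul' _ _ _

/-- The covariant derivative in the direction of the velocity of a vector field on `N`, expressed in a
frame `d` of the directions. -/
lemma sum_nabla_eq (hframe : ∀ Y : N.vectorField U, Y = ∑ l, mul (app Y le_rfl (x l)) (d l)) {l : ℕ}
    (b : Fin l → (S.timeProd.restrict W).O (U.comap Φ.toMap)) (E : Fin l → N.vectorField U)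
    (hb : ∀ f : N.O U, dt (Φ.pull U f) = ∑ j, b j * Φ.pull U (app (E j) le_rfl f))
    (Y : N.vectorField U) (f : N.O U) :
    ∑ j, b j * Φ.pull U (app (D.nabla U (E j) Y) le_rfl f) =
      ∑ l, dt (Φ.pull U (x l)) * Φ.pull U (app (D.nabla U (d l) Y) le_rfl f) := by
  have h2 : ∀ j, app (D.nabla U (E j) Y) le_rfl f =
      ∑ l, app (E j) le_rfl (x l) * app (D.nabla U (d l) Y) le_rfl f := fun j => by
    conv_lhs => rw [hframe (E j)]
    rw [map_sum, LinearMap.sum_apply, app_sum]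
    exact Finset.sum_congr rfl fun l _ => by rw [D.nabla_mul, app_mul']
  simp only [h2, map_sum, map_mul, Finset.mul_sum, hb, Finset.sum_mul, mul_assoc]
  exact Finset.sum_comm

variable (hx : ∀ k, x k ∈ N.gr U (coordParity k)) (hd : ∀ k, (d k).1 ∈ N.superDer U (coordParity k))
  (hchain : ∀ f : N.O U, dt (Φ.pull U f) = ∑ l, dt (Φ.pull U (x l)) * Φ.pull U (app (d l) le_rfl f))

include hS hx hd hchain

lemma sum_nabla_mul_of_mem {j : ZMod 2} {g : N.O U} (hg : g ∈ N.gr U j) (Y : N.vectorField U)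
    (f : N.O U) :
    ∑ l, dt (Φ.pull U (x l)) * Φ.pull U (app (D.nabla U (d l) (mul g Y)) le_rfl f) =
      dt (Φ.pull U g) * Φ.pull U (app Y le_rfl f) +
        Φ.pull U g * ∑ l, dt (Φ.pull U (x l)) * Φ.pull U (app (D.nabla U (d l) Y) le_rfl f) := by
  have h1 : ∀ l, dt (Φ.pull U (x l)) * Φ.pull U g =
      superSign (coordParity l * j) • (Φ.pull U g * dt (Φ.pull U (x l))) := fun l =>
    (S.timeProd.restrict W).supercomm (dt_mem hS (Φ.pull_mem (hx l))) (Φ.pull_mem hg)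
  rw [hchain g, Finset.sum_mul, Finset.mul_sum, ← Finset.sum_add_distrib]
  refine Finset.sum_congr rfl fun l _ => ?_
  have h3 : app (D.nabla U (d l) (mul g Y)) le_rfl f = app (d l) le_rfl g * app Y le_rfl f +
      superSign (coordParity l * j) • (g * app (D.nabla U (d l) Y) le_rfl f) := by
    rw [D.leibniz Y (hd l) hg, app_add, app_smul, app_mul', app_mul']
  have h4 : Φ.pull U (app (D.nabla U (d l) (mul g Y)) le_rfl f) =
      Φ.pull U (app (d l) le_rfl g) * Φ.pull U (app Y le_rfl f) +
      superSign (coordParity l * j) • (Φ.pull U g * Φ.pull U (app (D.nabla U (d l) Y) le_rfl f)) :=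
    (congrArg (Φ.pull U) h3).trans (map_leibniz (Φ.pull U) _ _ _ _ _)
  exact mul_leibniz_swap (h1 l) h4

/-- The Leibniz rule for the covariant derivative in the direction of the velocity. -/
lemma sum_nabla_mul (g : N.O U) (Y : N.vectorField U) (f : N.O U) :
    ∑ l, dt (Φ.pull U (x l)) * Φ.pull U (app (D.nabla U (d l) (mul g Y)) le_rfl f) =
      dt (Φ.pull U g) * Φ.pull U (app Y le_rfl f) +
        Φ.pull U g * ∑ l, dt (Φ.pull U (x l)) * Φ.pull U (app (D.nabla U (d l) Y) le_rfl f) := by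
  have h0 : g ∈ N.gr U 0 ⊔ N.gr U 1 := by rw [(N.gr_isCompl U).sup_eq_top]; trivial
  obtain ⟨g0, hg0, g1, hg1, rfl⟩ := Submodule.mem_sup.1 h0
  have e0 := sum_nabla_mul_of_mem hS D hx hd hchain hg0 Y f
  have e1 := sum_nabla_mul_of_mem hS D hx hd hchain hg1 Y f
  have e2 : ∀ l, Φ.pull U (app (D.nabla U (d l) (mul (g0 + g1) Y)) le_rfl f) =
      Φ.pull U (app (D.nabla U (d l) (mul g0 Y)) le_rfl f) +
      Φ.pull U (app (D.nabla U (d l) (mul g1 Y)) le_rfl f) := fun l => by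
    rw [add_mul_left, map_add, app_add, map_add]
  have e3 : dt (Φ.pull U (g0 + g1)) = dt (Φ.pull U g0) + dt (Φ.pull U g1) :=
    (congrArg dt (map_add _ _ _)).trans (dt_add hS _ _)
  simp only [e2, mul_add, Finset.sum_add_distrib]
  rw [e0, e1, e3, map_add, add_mul, add_mul]
  exact add_add_add_comm _ _ _ _

/-- The covariant derivative in the direction of the velocity in terms of a frame `d`. -/
lemma sum_nabla_frame (hframe : ∀ Y : N.vectorField U, Y = ∑ l, mul (app Y le_rfl (x l)) (d l))
    (Y : N.vectorField U) (f : N.O U) :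
    ∑ l, dt (Φ.pull U (x l)) * Φ.pull U (app (D.nabla U (d l) Y) le_rfl f) =
      ∑ k, (dt (Φ.pull U (app Y le_rfl (x k))) * Φ.pull U (app (d k) le_rfl f) +
        Φ.pull U (app Y le_rfl (x k)) *
          ∑ l, dt (Φ.pull U (x l)) * Φ.pull U (app (D.nabla U (d l) (d k)) le_rfl f)) := by
  have h1 : ∀ l, dt (Φ.pull U (x l)) * Φ.pull U (app (D.nabla U (d l) Y) le_rfl f) =
      ∑ k, dt (Φ.pull U (x l)) *
        Φ.pull U (app (D.nabla U (d l) (mul (app Y le_rfl (x k)) (d k))) le_rfl f) := fun l => by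
    conv_lhs => rw [hframe Y]
    rw [map_sum, app_sum, map_sum, Finset.mul_sum]
  rw [Finset.sum_congr rfl fun l _ => h1 l, Finset.sum_comm]
  exact Finset.sum_congr rfl fun k _ => sum_nabla_mul hS D hx hd hchain _ _ _

/-- In a frame `d`, the covariant derivative of the velocity is zero if the system of differential
equations for geodesics holds: the derivatives of the coefficients of the vector fields `Y i` combine
with those of the `a i` to the second derivatives of the coordinates. -/
lemma covDeriv_eq_zero (hframe : ∀ Y : N.vectorField U, Y = ∑ l, mul (app Y le_rfl (x l)) (d l))
    (hgeo : GeodesicEquation D Φ x d) {k l : ℕ}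
    (a : Fin k → (S.timeProd.restrict W).O (U.comap Φ.toMap)) (Y : Fin k → N.vectorField U)
    (b : Fin l → (S.timeProd.restrict W).O (U.comap Φ.toMap)) (E : Fin l → N.vectorField U)
    (ha : ∀ f : N.O U, dt (Φ.pull U f) = ∑ i, a i * Φ.pull U (app (Y i) le_rfl f))
    (hb : ∀ f : N.O U, dt (Φ.pull U f) = ∑ j, b j * Φ.pull U (app (E j) le_rfl f)) (f : N.O U) :
    ∑ i, dt (a i) * Φ.pull U (app (Y i) le_rfl f) +
      ∑ i, ∑ j, a i * b j * Φ.pull U (app (D.nabla U (E j) (Y i)) le_rfl f) = 0 := by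
  have h4 : ∀ i, ∑ j, a i * b j * Φ.pull U (app (D.nabla U (E j) (Y i)) le_rfl f) =
      ∑ k, (a i * dt (Φ.pull U (app (Y i) le_rfl (x k))) * Φ.pull U (app (d k) le_rfl f) +
        a i * Φ.pull U (app (Y i) le_rfl (x k)) *
          ∑ l, dt (Φ.pull U (x l)) * Φ.pull U (app (D.nabla U (d l) (d k)) le_rfl f)) := fun i => by
    simp only [mul_assoc (a i)]
    rw [← Finset.mul_sum, sum_nabla_eq D hframe b E hb,
      sum_nabla_frame hS D hx hd hchain hframe, Finset.mul_sum]
    exact Finset.sum_congr rfl fun k _ => mul_add _ _ _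
  have h5 : ∀ i, dt (a i) * Φ.pull U (app (Y i) le_rfl f) =
      ∑ k, dt (a i) * Φ.pull U (app (Y i) le_rfl (x k)) * Φ.pull U (app (d k) le_rfl f) := fun i => by
    rw [app_frame hframe (Y i) f, map_sum, Finset.mul_sum]
    exact Finset.sum_congr rfl fun k _ => by rw [map_mul, mul_assoc]
  have hdt : ∀ k, dt (dt (Φ.pull U (x k))) = ∑ i, (dt (a i) * Φ.pull U (app (Y i) le_rfl (x k)) +
      a i * dt (Φ.pull U (app (Y i) le_rfl (x k)))) := fun k => by
    rw [ha (x k)]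
    refine (map_sum (dtLin hS (U.comap Φ.toMap)) _ _).trans ?_
    exact Finset.sum_congr rfl fun i _ => dt_mul hS _ _
  rw [Finset.sum_congr rfl fun i _ => h4 i, Finset.sum_congr rfl fun i _ => h5 i,
    ← Finset.sum_add_distrib]
  have h6 : ∀ i, ∑ k, dt (a i) * Φ.pull U (app (Y i) le_rfl (x k)) * Φ.pull U (app (d k) le_rfl f) +
      ∑ k, (a i * dt (Φ.pull U (app (Y i) le_rfl (x k))) * Φ.pull U (app (d k) le_rfl f) +
        a i * Φ.pull U (app (Y i) le_rfl (x k)) *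
          ∑ l, dt (Φ.pull U (x l)) * Φ.pull U (app (D.nabla U (d l) (d k)) le_rfl f)) =
      ∑ k, ((dt (a i) * Φ.pull U (app (Y i) le_rfl (x k)) +
        a i * dt (Φ.pull U (app (Y i) le_rfl (x k)))) * Φ.pull U (app (d k) le_rfl f) +
        a i * Φ.pull U (app (Y i) le_rfl (x k)) *
          ∑ l, dt (Φ.pull U (x l)) * Φ.pull U (app (D.nabla U (d l) (d k)) le_rfl f)) := fun i => by
    rw [← Finset.sum_add_distrib]
    exact Finset.sum_congr rfl fun k _ => by rw [add_mul, add_assoc]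
  rw [Finset.sum_congr rfl fun i _ => h6 i, Finset.sum_comm]
  simp only [Finset.sum_add_distrib (f := fun i => _ * Φ.pull U (app (d _) le_rfl f)),
    ← Finset.sum_mul, ← hdt, ← ha]
  have h7 : ∀ k, dt (Φ.pull U (x k)) *
      ∑ l, dt (Φ.pull U (x l)) * Φ.pull U (app (D.nabla U (d l) (d k)) le_rfl f) =
      ∑ r, (∑ l, dt (Φ.pull U (x k)) * dt (Φ.pull U (x l)) *
        Φ.pull U (app (D.nabla U (d l) (d k)) le_rfl (x r))) *
          Φ.pull U (app (d r) le_rfl f) := fun k => by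
    rw [Finset.mul_sum]
    simp only [Finset.sum_mul]
    rw [Finset.sum_comm]
    refine Finset.sum_congr rfl fun l _ => ?_
    rw [app_frame hframe (D.nabla U (d l) (d k)) f, map_sum, Finset.mul_sum, Finset.mul_sum]
    exact Finset.sum_congr rfl fun r _ => by rw [map_mul]; simp only [mul_assoc]
  rw [Finset.sum_congr rfl fun k _ => h7 k, Finset.sum_comm, ← Finset.sum_add_distrib]
  refine Finset.sum_eq_zero fun r _ => ?_
  rw [← Finset.sum_mul, ← add_mul, hgeo r, zero_mul]

end CovDeriv

end SuperSpace
end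

noncomputable section

namespace SuperSpace

/-! ### The system of differential equations for supergeodesics -/

variable {N : SuperSpace.{u}} {S : SuperSpace.{v}} {m n p q : ℕ} {W : Opens S.timeProd.body}
  {Φ : Hom (S.timeProd.restrict W) N}

open vectorField

/-- A supergeodesic satisfies the system of differential equations in all coordinates: the velocity is
expanded in the coordinate vector fields, with the derivatives of the coordinates as coefficients. -/
lemma IsSupergeodesic.geodesicEquation (hS : S.IsSupermanifold p q) {D : N.Connection}
    (h : IsSupergeodesic D Φ) {U : Opens N.body} {x : Fin m ⊕ Fin n → N.O U}
    {d : Fin m ⊕ Fin n → N.vectorField U} (hx : IsCoord x) (hd : IsCoordDer x d) :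
    GeodesicEquation D Φ x d := by
  obtain ⟨V, c, hc, rfl, e⟩ := hx.exists_chart
  obtain rfl : x = hc.coord := funext fun k => (e k).trans (N.res_self _ _)
  let σ : Fin (m + n) ≃ Fin m ⊕ Fin n := finSumFinEquiv.symm
  have key : ∀ (V : Opens N.body) (h : V ≤ hc.range) (f : N.O V), dt (Φ.pull V f) =
      ∑ i, (S.timeProd.restrict W).res (fun _ hx => h hx) (dt (Φ.pull hc.range (hc.coord (σ i)))) *
        Φ.pull V (app (d (σ i)) h f) := fun V h f => by
    have h1 := dt_pull_eq_sum (Φ := Φ) hS hc hd le_rfl h f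
    simp only [N.res_self] at h1
    exact h1.trans (σ.sum_comp fun l => (S.timeProd.restrict W).res (fun _ hx => h hx)
      (dt (Φ.pull hc.range (hc.coord l))) * Φ.pull V (app (d l) h f)).symm
  intro k
  have h1 := h hc.range (m + n) (m + n) (fun i => dt (Φ.pull hc.range (hc.coord (σ i))))
    (fun i => d (σ i)) (fun i => dt (Φ.pull hc.range (hc.coord (σ i)))) (fun i => d (σ i)) key key
    hc.range le_rfl (hc.coord k)
  have hr : ∀ a : (S.timeProd.restrict W).O (hc.range.comap Φ.toMap),
      (S.timeProd.restrict W).res (fun _ hx => hx) a = a := fun a => SuperSpace.res_self _ _ a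
  simp only [hr] at h1
  rw [h1]
  refine congrArg₂ (· + ·) ?_ ?_
  · rw [Finset.sum_eq_single (σ.symm k) (fun i _ hi => ?_) fun h => absurd (Finset.mem_univ _) h]
    · rw [(hd _).2 k]
      simp
    · rw [(hd _).2 k, if_neg (fun e => hi (by rw [← e]; simp)), map_zero, mul_zero]
  · rw [← σ.sum_comp]
    refine Finset.sum_congr rfl fun i _ => ?_
    exact (σ.sum_comp fun j => dt (Φ.pull hc.range (hc.coord (σ i))) * dt (Φ.pull hc.range (hc.coord j)) *
      Φ.pull hc.range (app (D.nabla hc.range (d j) (d (σ i))) le_rfl (hc.coord k))).symm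

/-- The system of differential equations on a smaller open set. -/
lemma GeodesicEquation.res (hS : S.IsSupermanifold p q) {D : N.Connection} {U U' : Opens N.body}
    {x : Fin m ⊕ Fin n → N.O U} {d : Fin m ⊕ Fin n → N.vectorField U}
    (h : GeodesicEquation D Φ x d) (hU : U' ≤ U) :
    GeodesicEquation D Φ (fun k => N.res hU (x k)) (fun k => vectorField.res hU (d k)) := by
  intro k
  let ρ := (S.timeProd.restrict W).res (U := U.comap Φ.toMap) (V := U'.comap Φ.toMap)
    fun _ hx => hU hx
  have h1 : ∀ l, dt (Φ.pull U' (N.res hU (x l))) = ρ (dt (Φ.pull U (x l))) := fun l =>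
    (congrArg dt (Φ.pull_res hU (x l))).trans (dt_res hS _ _)
  have h2 : ∀ i j, Φ.pull U' (app (D.nabla U' (vectorField.res hU (d j)) (vectorField.res hU (d i)))
      le_rfl (N.res hU (x k))) = ρ (Φ.pull U (app (D.nabla U (d j) (d i)) le_rfl (x k))) :=
    fun i j => by
      rw [← D.nabla_res]
      refine Eq.trans (congrArg (Φ.pull U') ?_) (Φ.pull_res hU _)
      exact app_restrict (D.nabla U (d j) (d i)) le_rfl hU (x k)
  have h3 : dt (dt (Φ.pull U' (N.res hU (x k)))) = ρ (dt (dt (Φ.pull U (x k)))) :=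
    (congrArg dt (h1 k)).trans (dt_res hS _ _)
  have h4 := congrArg ρ (h k)
  refine Eq.trans ?_ (h4.trans (map_zero ρ))
  refine (congrArg₂ (· + ·) h3 (Finset.sum_congr rfl fun i _ => Finset.sum_congr rfl fun j _ =>
    congrArg₂ (· * ·) (congrArg₂ (· * ·) (h1 i) (h1 j)) (h2 i j))).trans ?_
  simp only [map_add, map_sum, map_mul]

/-- A supercurve is a supergeodesic if it satisfies the system of differential equations in some
coordinates near every point. -/
lemma isSupergeodesic_of_local (hN : N.IsSupermanifold m n) (hS : S.IsSupermanifold p q)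
    {D : N.Connection}
    (h : ∀ w : (S.timeProd.restrict W).body, ∃ (V : Opens (Fin m → ℝ)) (c : Hom (superDomain m n V) N)
      (hc : c.IsOpenImmersion) (U₀ : Opens N.body) (hU₀ : U₀ ≤ hc.range)
      (d : Fin m ⊕ Fin n → N.vectorField hc.range), Φ.toMap w ∈ U₀ ∧ IsCoordDer hc.coord d ∧
        GeodesicEquation D Φ (fun k => N.res hU₀ (hc.coord k)) fun k => vectorField.res hU₀ (d k)) :
    IsSupergeodesic D Φ := by
  intro U k l a Y b E ha hb V hV f
  refine (S.timeProd.restrict W).locality _ _ fun w hw => ?_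
  obtain ⟨V', c, hc, U₀, hU₀, d, hwU, hd, hgeo⟩ := h w
  have hV₁ : V ⊓ U₀ ≤ U := inf_le_left.trans hV
  have hV₂ : V ⊓ U₀ ≤ hc.range := inf_le_right.trans hU₀
  refine ⟨(V ⊓ U₀).comap Φ.toMap, fun _ hx => hx.1, ⟨hw, hwU⟩, ?_⟩
  let ρ := (S.timeProd.restrict W).res (U := U.comap Φ.toMap) (V := (V ⊓ U₀).comap Φ.toMap)
    fun _ hx => hV₁ hx
  let ρ' := (S.timeProd.restrict W).res (U := V.comap Φ.toMap) (V := (V ⊓ U₀).comap Φ.toMap)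
    fun _ hx => hx.1
  have hρ : ∀ a : (S.timeProd.restrict W).O (U.comap Φ.toMap),
      ρ' ((S.timeProd.restrict W).res (fun _ hx => hV hx) a) = ρ a := fun a =>
    (S.timeProd.restrict W).res_res _ _ a
  have hsr : ∀ a : (S.timeProd.restrict W).O ((V ⊓ U₀).comap Φ.toMap),
      (S.timeProd.restrict W).res (fun _ hx => hx) a = a := fun a => SuperSpace.res_self _ _ a
  have hΦ : ∀ (Y : N.vectorField U), ρ' (Φ.pull V (app Y hV f)) =
      Φ.pull (V ⊓ U₀) (app (vectorField.res hV₁ Y) le_rfl (N.res inf_le_left f)) := fun Y =>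
    (Φ.pull_res inf_le_left _).symm.trans (congrArg (Φ.pull _)
      (app_restrict Y hV inf_le_left f).symm)
  have hchain : ∀ f : N.O (V ⊓ U₀), dt (Φ.pull (V ⊓ U₀) f) =
      ∑ l, dt (Φ.pull (V ⊓ U₀) (N.res hV₂ (hc.coord l))) *
        Φ.pull (V ⊓ U₀) (app (vectorField.res hV₂ (d l)) le_rfl f) := fun f => by
    have h1 := dt_pull_eq_sum (Φ := Φ) hS hc hd hV₂ le_rfl f
    simp only [hsr] at h1
    exact h1
  have hgeo' : GeodesicEquation D Φ (fun k => N.res hV₂ (hc.coord k))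
      (fun k => vectorField.res hV₂ (d k)) := by
    have h1 := hgeo.res hS (inf_le_right : V ⊓ U₀ ≤ U₀)
    simp only [N.res_res] at h1
    exact h1
  have hframe : ∀ Y : N.vectorField (V ⊓ U₀), Y = ∑ l, mul (app Y le_rfl (N.res hV₂ (hc.coord l)))
      (vectorField.res hV₂ (d l)) := fun Y => eq_sum hc hN hd hV₂ Y
  have ha' : ∀ f : N.O (V ⊓ U₀), dt (Φ.pull (V ⊓ U₀) f) =
      ∑ i, ρ (a i) * Φ.pull (V ⊓ U₀) (app (vectorField.res hV₁ (Y i)) le_rfl f) := fun f =>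
    ha _ hV₁ f
  have hb' : ∀ f : N.O (V ⊓ U₀), dt (Φ.pull (V ⊓ U₀) f) =
      ∑ i, ρ (b i) * Φ.pull (V ⊓ U₀) (app (vectorField.res hV₁ (E i)) le_rfl f) := fun f =>
    hb _ hV₁ f
  have key := covDeriv_eq_zero hS D (x := fun k => N.res hV₂ (hc.coord k))
    (fun k => N.res_mem _ (hc.isCoord.mem k))
    (fun k => ⟨fun V V' => (hd k).1.1 ⟨V.1, V.2.trans hV₂⟩ ⟨V'.1, V'.2.trans hV₂⟩,
        fun V => (hd k).1.2.1 ⟨V.1, V.2.trans hV₂⟩, fun V => (hd k).1.2.2 ⟨V.1, V.2.trans hV₂⟩⟩)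
    hchain hframe hgeo' (fun i => ρ (a i)) (fun i => vectorField.res hV₁ (Y i)) (fun i => ρ (b i))
    (fun i => vectorField.res hV₁ (E i)) ha' hb' (N.res inf_le_left f)
  refine (map_zero ρ').trans (key.symm.trans ?_)
  refine Eq.trans ?_ (map_add ρ' _ _).symm
  refine congrArg₂ (· + ·) ?_ ?_
  · refine Eq.trans ?_ (map_sum ρ' _ _).symm
    refine Finset.sum_congr rfl fun i _ => ?_
    refine Eq.trans ?_ (map_mul ρ' _ _).symm
    exact congrArg₂ (· * ·) ((dt_res hS _ _).trans (hρ _).symm) (hΦ _).symm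
  · refine Eq.trans ?_ (map_sum ρ' _ _).symm
    refine Finset.sum_congr rfl fun i _ => ?_
    refine Eq.trans ?_ (map_sum ρ' _ _).symm
    refine Finset.sum_congr rfl fun j _ => ?_
    refine Eq.trans ?_ (map_mul ρ' _ _).symm
    refine congrArg₂ (· * ·) ((map_mul ρ _ _).symm.trans (hρ _).symm) ?_
    rw [← D.nabla_res]
    exact (hΦ _).symm

/-- The characterization of supergeodesics in coordinates. -/
lemma isSupergeodesic_iff (hN : N.IsSupermanifold m n) (hS : S.IsSupermanifold p q)
    {D : N.Connection} : IsSupergeodesic D Φ ↔ ∀ (U : Opens N.body) (x : Fin m ⊕ Fin n → N.O U)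
      (d : Fin m ⊕ Fin n → N.vectorField U), IsCoord x → IsCoordDer x d →
        GeodesicEquation D Φ x d := by
  refine ⟨fun h U x d hx hd => h.geodesicEquation hS hx hd, fun h =>
    isSupergeodesic_of_local hN hS fun w => ?_⟩
  obtain ⟨V, c, hc, hw⟩ := hN.exists_chart (Φ.toMap w)
  obtain ⟨d, hd⟩ := hc.exists_isCoordDer
  refine ⟨V, c, hc, hc.range, le_rfl, d, hw, hd, ?_⟩
  exact (h _ _ d hc.isCoord hd).res hS le_rfl

end SuperSpace
end

noncomputable section

namespace SuperSpace

/-! ### Points of the tangent bundle -/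

variable {N : SuperSpace.{u}} {A : SuperSpace.{v}} {m n p q r : ℕ}

/-- The differentials of superfunctions satisfy the Leibniz rule. -/
lemma tangentDiff_mul {U : Opens N.body} (a b : N.O U) :
    N.tangentDiff U (a * b) = N.tangentDiff U a * N.tangentProj.pull U b +
      N.tangentProj.pull U a * N.tangentDiff U b :=
  Subtype.ext (funext fun τ => (congrArg (τ.dom.res (V := ⊤) (fun x _ => τ.mem x))
    (τ.point.leibniz a b)).trans ((map_add _ _ _).trans
      (congrArg₂ (· + ·) (map_mul _ _ _) (map_mul _ _ _))))

/-- The differential as a linear map. -/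
def tangentDiffLin (U : Opens N.body) : N.O U →ₗ[ℝ] N.tangent.O (U.comap N.tangentProj.toMap) where
  toFun := N.tangentDiff U
  map_add' a b := Subtype.ext (funext fun τ => (congrArg (τ.dom.res (V := ⊤) (fun x _ => τ.mem x))
    (map_add (τ.point.vec U) a b)).trans (map_add _ _ _))
  map_smul' t a := Subtype.ext (funext fun τ => (congrArg (τ.dom.res (V := ⊤) (fun x _ => τ.mem x))
    (map_smul (τ.point.vec U) t a)).trans (map_smul (τ.dom.res (V := ⊤) (fun x _ => τ.mem x)) t _))

lemma tangentDiff_res {U V : Opens N.body} (h : V ≤ U) (a : N.O U) :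
    N.tangentDiff V (N.res h a) = N.tangent.res (fun _ hx => h hx) (N.tangentDiff U a) :=
  Subtype.ext (funext fun τ => (congrArg (τ.dom.res (V := ⊤) (fun x _ => τ.mem x))
    (τ.point.vec_res h a)).trans (τ.dom.res_res _ _ _))

lemma tangentDiff_mem {U : Opens N.body} {i : ZMod 2} {a : N.O U} (ha : a ∈ N.gr U i) :
    N.tangentDiff U a ∈ N.tangent.gr (U.comap N.tangentProj.toMap) i :=
  fun τ => τ.dom.res_mem (V := ⊤) (fun x _ => τ.mem x) (τ.point.vec_mem ha)

/-- The value of a differential at a Grassmann-valued point of the tangent bundle, in coordinates. -/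
lemma tangentDiff_eq_sum {V : Opens (Fin m → ℝ)} {c : Hom (superDomain m n V) N}
    (hc : c.IsOpenImmersion) {d : Fin m ⊕ Fin n → N.vectorField hc.range} (hd : IsCoordDer hc.coord d)
    (g : GrPoint N.tangent r) (hg : N.tangentProj.toMap g.pt ∈ hc.range) {U : Opens N.body}
    (hU : U ≤ hc.range) (hgU : N.tangentProj.toMap g.pt ∈ U) (f : N.O U) :
    g.app (U.comap N.tangentProj.toMap) hgU (N.tangentDiff U f) =
      ∑ l, g.app (hc.range.comap N.tangentProj.toMap) hg (N.tangentDiff hc.range (hc.coord l)) *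
        (N.tangentProj.mapPt g).app U hgU (vectorField.app (d l) hU f) := by
  have h := grDeriv_eq hc hd (N.tangentProj.mapPt g) 0 le_rfl hg
    (fun U _ hp => (g.app (U.comap N.tangentProj.toMap) hp).toLinearMap.comp (tangentDiffLin U))
    (fun U U' h _ hp f => (congrArg (g.app (U'.comap N.tangentProj.toMap) hp)
      (tangentDiff_res h f)).trans (g.app_res (U := U.comap N.tangentProj.toMap)
        (V := U'.comap N.tangentProj.toMap) (fun _ hx => h hx) hp _))
    (fun k => by
      rw [zero_add]
      exact g.app_mem _ (tangentDiff_mem (N.res_mem _ (hc.isCoord.mem k))))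
    (fun U _ hp j a b _ => by
      rw [zero_mul, superSign_zero, one_smul]
      exact (congrArg (g.app (U.comap N.tangentProj.toMap) hp) (tangentDiff_mul a b)).trans
        ((map_add (g.app (U.comap N.tangentProj.toMap) hp) _ _).trans
          (congrArg₂ (· + ·) (map_mul (g.app (U.comap N.tangentProj.toMap) hp) _ _)
            (map_mul (g.app (U.comap N.tangentProj.toMap) hp) _ _))))
    U hU hgU f
  simp only [N.res_self] at h
  exact h

/-! ### Morphisms from superdomains to the tangent bundle -/

section ToHom

variable {V : Opens (Fin p → ℝ)}

/-- A vector field along a morphism from a superdomain, as a test point. -/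
def TangentPoint.test (ξ : TangentPoint (superDomain p q V) N) : TestPoint N Set.univ :=
  ⟨p, q, V, ξ, fun _ => trivial⟩

lemma TangentPoint.precomp_pointHom (ξ : TangentPoint (superDomain p q V) N) (y : V) :
    ξ.precomp (pointHom y) = (ξ.bodyMap y).toPoint := by
  refine TangentPoint.ext' (Hom.ext' rfl fun U a => ?_) fun U a => ?_
  · exact congrArg (superPointConst _) (funext fun z => ξ.base.pull_val a ⟨y, (mem_up.1 z.2).2⟩)
  · rfl

lemma pullTop_pointHom_val {X : SuperSpace.{u}} (x : X.body) (a : X.O ⊤) :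
    superPoint.val ⊤ ((pointHom x).pullTop a) ⟨superPoint.pt, trivial⟩ = X.val ⊤ a ⟨x, trivial⟩ :=
  (superPoint.val_res (U := (⊤ : Opens X.body).comap (pointHom x).toMap) (V := ⊤) (fun _ _ => trivial)
    _ _).trans ((pointHom x).pull_val (U := ⊤) a ⟨superPoint.pt, trivial⟩)

/-- The open set of points of the superdomain that are mapped to `U`. -/
abbrev TangentPoint.homDom (ξ : TangentPoint (superDomain p q V) N) (U : Opens (TangentVec N)) :
    Set (Fin p → ℝ) :=
  (up (W := V) ⟨ξ.bodyMap ⁻¹' U, U.isOpen.preimage ξ.continuous_bodyMap⟩ : Opens (Fin p → ℝ))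

lemma comap_bodyMap_le (ξ : TangentPoint (superDomain p q V) N) (U : Opens (TangentVec N)) :
    ξ.homDom U ⊆ (up (W := ξ.test.preim U) ⊤ : Opens (Fin p → ℝ)) :=
  fun _ hy => mem_up.2 ⟨hy, trivial⟩

/-- The pull-back of superfunctions on the tangent bundle by a vector field along a morphism. -/
def TangentPoint.homPull (ξ : TangentPoint (superDomain p q V) N) (U : Opens (TangentVec N)) :
    N.tangentFun (U : Set (TangentVec N)) →ₐ[ℝ] superFun p q (ξ.homDom U) :=
  (superFunRes (comap_bodyMap_le ξ U)).comp
    ((Pi.evalAlgHom ℝ (fun τ : TestPoint N (U : Set (TangentVec N)) => τ.dom.O ⊤) (ξ.test.loc U)).comp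
      (N.tangentFun (U : Set (TangentVec N))).val)

/-- The naturality of a superfunction on the tangent bundle, for a test point given up to equality. -/
lemma eq_pullTop_of_precomp_eq {W : Set (TangentVec N)} (f : N.tangentFun W) (τ : TestPoint N W)
    {p q : ℕ} {V : Opens (Fin p → ℝ)} (ψ : Hom (superDomain p q V) τ.dom)
    {η : TangentPoint (superDomain p q V) N} (h : τ.point.precomp ψ = η) (hη : ∀ x, η.bodyMap x ∈ W) :
    f.1 ⟨p, q, V, η, hη⟩ = ψ.pullTop (f.1 τ) := by
  subst h
  exact f.2 τ p q V ψ

lemma TangentPoint.homPull_val (ξ : TangentPoint (superDomain p q V) N) (U : Opens (TangentVec N))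
    (f : N.tangentFun (U : Set (TangentVec N))) (y : V) (hy : ξ.bodyMap y ∈ U) :
    ExteriorAlgebra.algebraMapInv ((ξ.homPull U f).1 ⟨y.1, mem_up.2 ⟨y.2, hy⟩⟩) =
      superPoint.val ⊤ (f.1 (TangentVec.toTest ⟨ξ.bodyMap y, hy⟩)) ⟨superPoint.pt, trivial⟩ := by
  have hy' : y.1 ∈ ξ.test.preim U := mem_up.2 ⟨y.2, hy⟩
  have h2 : (ξ.test.loc U).point.precomp (pointHom (N := (ξ.test.loc U).dom) ⟨y.1, hy'⟩) =
      (ξ.bodyMap y).toPoint :=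
    ((ξ.test.loc U).point.precomp_pointHom ⟨y.1, hy'⟩).trans (congrArg TangentVec.toPoint
      (ξ.bodyMap_precomp (restrictIncl _ (ξ.test.preim_le U)) ⟨y.1, hy'⟩))
  have h4 := eq_pullTop_of_precomp_eq f (ξ.test.loc U) _ h2 fun x =>
    (congrArg (· ∈ U) (TangentVec.toPoint_bodyMap (ξ.bodyMap y) x)).mpr hy
  refine Eq.trans ?_ (congrArg (fun a => superPoint.val ⊤ a ⟨superPoint.pt, trivial⟩) h4).symm
  exact (pullTop_pointHom_val (X := (ξ.test.loc U).dom) ⟨y.1, hy'⟩ (f.1 (ξ.test.loc U))).symm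

/-- The morphism to the tangent bundle given by a vector field along a morphism. -/
def TangentPoint.toHom (ξ : TangentPoint (superDomain p q V) N) : Hom (superDomain p q V) N.tangent where
  toMap := ⟨ξ.bodyMap, ξ.continuous_bodyMap⟩
  pull U := ξ.homPull U
  pull_res h f := Subtype.ext (funext fun y =>
    locValue_res ξ.test h f y.2 (up_mono (fun _ hx => h hx) y.2))
  pull_mem ha y := ha (ξ.test.loc _) ⟨y.1, comap_bodyMap_le ξ _ y.2⟩
  pull_val {U} f y := ξ.homPull_val U f y.1 y.2

/-- A vector field along a morphism is determined by the coordinates of the morphism and its values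
on the coordinates. -/
lemma TangentPoint.eq_of_coord {V' : Opens (Fin m → ℝ)} {c : Hom (superDomain m n V') N}
    (hc : c.IsOpenImmersion) {ξ η : TangentPoint (superDomain p q V) N}
    (hξ : ∀ y, ξ.base.toMap y ∈ hc.range) (hη : ∀ y, η.base.toMap y ∈ hc.range)
    (h : ∀ y k, (ξ.base.mapPt (domPt y)).app _ (hξ y) (hc.coord k) =
      (η.base.mapPt (domPt y)).app _ (hη y) (hc.coord k))
    (h' : ∀ y k, (domPt y).app (hc.range.comap ξ.base.toMap) (hξ y) (ξ.vec hc.range (hc.coord k)) =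
      (domPt y).app (hc.range.comap η.base.toMap) (hη y) (η.vec hc.range (hc.coord k))) :
    ξ = η := by
  obtain ⟨d, hd⟩ := hc.exists_isCoordDer
  have e : ξ.base = η.base := domain_hom_ext fun y => hc.grPoint_ext (hξ y) (hη y) (h y)
  have key : ∀ (ξ : TangentPoint (superDomain p q V) N) (hξ : ∀ y, ξ.base.toMap y ∈ hc.range) (y : V)
      (U : Opens N.body) (hU : U ≤ hc.range) (hy : ξ.base.toMap y ∈ U) (a : N.O U),
      (domPt y).app (U.comap ξ.base.toMap) hy (ξ.vec U a) =
      ∑ l, (domPt y).app (hc.range.comap ξ.base.toMap) (hξ y) (ξ.vec hc.range (hc.coord l)) *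
        (ξ.base.mapPt (domPt y)).app U hy (vectorField.app (d l) hU a) := fun ξ hξ y U hU hy a =>
    tangentDiff_eq_sum hc hd (ξ.toHom.mapPt (domPt y)) (hξ y) hU hy a
  refine TangentPoint.ext' e fun U a => domPt_ext fun y hy => ?_
  have hy' : η.base.toMap y ∈ U := e ▸ hy
  have hinf : ∀ z, z ∈ U → z ∈ hc.range → z ∈ U ⊓ hc.range := fun z h h' => ⟨h, h'⟩
  have h1 : ∀ (ξ : TangentPoint (superDomain p q V) N) (hy : ξ.base.toMap y ∈ U)
      (hξ : ∀ y, ξ.base.toMap y ∈ hc.range), (domPt y).app (U.comap ξ.base.toMap) hy (ξ.vec U a) =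
      (domPt y).app ((U ⊓ hc.range).comap ξ.base.toMap) (hinf _ hy (hξ y))
        (ξ.vec (U ⊓ hc.range) (N.res inf_le_left a)) := fun ξ hy hξ =>
    (((congrArg ((domPt y).app ((U ⊓ hc.range).comap ξ.base.toMap) (hinf _ hy (hξ y)))
      (ξ.vec_res inf_le_left a)).trans ((domPt y).app_res (U := U.comap ξ.base.toMap)
        (V := (U ⊓ hc.range).comap ξ.base.toMap) (fun _ hx => hx.1) (hinf _ hy (hξ y)) _))).symm
  refine (h1 ξ hy hξ).trans (Eq.trans ?_ (((domPt y).app_res (U := U.comap η.base.toMap)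
    (V := U.comap ξ.base.toMap) (by rw [e]) hy (η.vec U a)).trans (h1 η hy' hη)).symm)
  refine (key ξ hξ y _ inf_le_right _ _).trans (Eq.trans ?_ (key η hη y _ inf_le_right _ _).symm)
  refine Finset.sum_congr rfl fun l _ => congrArg₂ (· * ·) (h' y l) ?_
  exact GrPoint.app_congr (congrArg (fun φ : Hom (superDomain p q V) N => φ.mapPt (domPt y)) e) _ _ _

end ToHom

end SuperSpace
end

noncomputable section

namespace SuperSpace

/-! ### Charts of the tangent bundle -/

variable {N : SuperSpace.{u}} {A : SuperSpace.{v}} {m n p q r : ℕ}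

/-- Morphisms of superdomains with prescribed coordinates. -/
lemma exists_domain_hom {V' : Opens (Fin p → ℝ)} {V : Opens (Fin m → ℝ)}
    {x : (Fin p → ℝ) → Fin m ⊕ Fin n → Grassmann q} (hx : ContDiffOn ℝ ∞ x V')
    (hV : ∀ y ∈ V', coordBody (x y) ∈ V) :
    ∃ ψ : Hom (superDomain p q V') (superDomain m n V), ∀ y : V',
      ψ.mapPt (domPt y) = coordPt (x y) (hV y y.2) := by
  have h1 : ContinuousOn (fun y => coordBody (x y)) V' :=
    (contDiff_coordBody.comp_contDiffOn hx).continuousOn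
  refine ⟨Hom.ofPts (fun y => coordPt (x y) (hV y y.2))
    ((continuousOn_iff_continuous_domRestrict.1 h1).subtype_mk _) fun U a =>
      ⟨fun y => coordExt (x y) (secFun a), ?_, fun y hy => rfl⟩, fun y => rfl⟩
  refine (contDiffOn_coordExt (up U).isOpen (contDiffOn_secFun a)).comp
    (hx.mono fun y hy => hy.1) ?_
  rintro y ⟨hy, hU⟩
  exact mem_up.2 ⟨_, hU⟩

lemma domain_grPoint_ext {V : Opens (Fin m → ℝ)} {g g' : GrPoint (superDomain m n V) q}
    (h : ∀ k, g.app ⊤ trivial (stdCoord V k) = g'.app ⊤ trivial (stdCoord V k)) : g = g' := by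
  obtain ⟨h1, e1⟩ := eq_coordPt g
  obtain ⟨h2, e2⟩ := eq_coordPt g'
  rw [e1, e2]
  have e : (fun k => g.app ⊤ trivial (stdCoord V k)) = fun k => g'.app ⊤ trivial (stdCoord V k) :=
    funext h
  generalize (fun k => g.app ⊤ trivial (stdCoord V k)) = X at e h1
  subst e
  rfl

lemma Hom.IsOpenImmersion.hom_injective {k : Hom A N} (hk : k.IsOpenImmersion)
    {V : Opens (Fin p → ℝ)} {φ φ' : Hom (superDomain p q V) A} (h : k.comp φ = k.comp φ') : φ = φ' :=
  domain_hom_ext fun y => hk.mapPt_injective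
    (congrArg (fun χ : Hom (superDomain p q V) N => χ.mapPt (domPt y)) h)

lemma pullTop_pullTo {X : SuperSpace.{w}} (f : Hom A N) (g : Hom X A) {U : Opens N.body}
    (h : ∀ y, f.toMap y ∈ U) (a : N.O U) : g.pullTop (f.pullTo (V := ⊤) (fun y _ => h y) a) =
      (f.comp g).pullTo (V := ⊤) (fun x _ => h (g.toMap x)) a :=
  (congrArg (X.res (U := (⊤ : Opens A.body).comap g.toMap) (V := ⊤) fun _ _ => trivial)
    (g.pull_res (U := U.comap f.toMap) (V := ⊤) (fun y _ => h y) (f.pull U a))).trans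
      (X.res_res _ _ _)

section OfCoord

variable {V : Opens (Fin m → ℝ)} {c : Hom (superDomain m n V) N} (hc : c.IsOpenImmersion)
  (d : Fin m ⊕ Fin n → N.vectorField hc.range) (Φ : Hom A N) (hΦ : ∀ x, Φ.toMap x ∈ hc.range)
  (v : Fin m ⊕ Fin n → A.O ⊤)

/-- The vector field along `Φ` with components `v` in the coordinates of a chart. -/
def vecOf (U : Opens N.body) : N.O U →ₗ[ℝ] A.O (U.comap Φ.toMap) :=
  ∑ k, (LinearMap.mulLeft ℝ (A.res le_top (v k))).comp ((A.res (U := (U ⊓ hc.range).comap Φ.toMap)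
    fun _ hx => ⟨hx, hΦ _⟩).toLinearMap.comp ((Φ.pull (U ⊓ hc.range)).toLinearMap.comp
      ((vectorField.app (d k) inf_le_right).comp (N.res inf_le_left).toLinearMap)))

lemma vecOf_apply (U : Opens N.body) (f : N.O U) : vecOf hc d Φ hΦ v U f =
    ∑ k, A.res le_top (v k) * A.res (U := (U ⊓ hc.range).comap Φ.toMap) (fun _ hx => ⟨hx, hΦ _⟩)
      (Φ.pull (U ⊓ hc.range) (vectorField.app (d k) inf_le_right (N.res inf_le_left f))) := by
  rw [vecOf, LinearMap.sum_apply]; rfl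

variable {d} (hd : IsCoordDer hc.coord d) {v} (hv : ∀ k, v k ∈ A.gr ⊤ (coordParity k))

include hd hv in
lemma vecOf_leibniz (U : Opens N.body) (a b : N.O U) : vecOf hc d Φ hΦ v U (a * b) =
    vecOf hc d Φ hΦ v U a * Φ.pull U b + Φ.pull U a * vecOf hc d Φ hΦ v U b := by
  have hpar : ∀ (j : ZMod 2) (a : N.O U), a ∈ N.gr U j → vecOf hc d Φ hΦ v U (a * b) =
      vecOf hc d Φ hΦ v U a * Φ.pull U b + Φ.pull U a * vecOf hc d Φ hΦ v U b := by
    intro j a ha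
    simp only [vecOf_apply]
    rw [Finset.sum_mul, Finset.mul_sum, ← Finset.sum_add_distrib]
    refine Finset.sum_congr rfl fun k _ => mul_leibniz_swap (i := coordParity k * j)
      (A.supercomm (A.res_mem _ (hv k)) (Φ.pull_mem ha)) ?_
    let ρ : A.O ((U ⊓ hc.range).comap Φ.toMap) →ₐ[ℝ] A.O (U.comap Φ.toMap) :=
      A.res fun _ hx => ⟨hx, hΦ _⟩
    have hρ : ∀ f : N.O U, ρ (Φ.pull (U ⊓ hc.range) (N.res inf_le_left f)) = Φ.pull U f := fun f =>
      (congrArg ρ (Φ.pull_res inf_le_left f)).trans ((A.res_res _ _ _).trans (A.res_self _ _))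
    have h1 := (hd k).1.2.2 ⟨U ⊓ hc.range, (inf_le_right : U ⊓ hc.range ≤ hc.range)⟩ j (N.res inf_le_left a)
      (N.res_mem inf_le_left ha) (N.res inf_le_left b)
    have h2 : vectorField.app (d k) inf_le_right (N.res (inf_le_left : U ⊓ hc.range ≤ U) (a * b)) =
        vectorField.app (d k) inf_le_right (N.res (inf_le_left : U ⊓ hc.range ≤ U) a) *
          N.res inf_le_left b + superSign (coordParity k * j) • (N.res inf_le_left a *
          vectorField.app (d k) inf_le_right (N.res (inf_le_left : U ⊓ hc.range ≤ U) b)) := by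
      rw [map_mul]; exact h1
    refine (congrArg (fun f => ρ (Φ.pull (U ⊓ hc.range) f)) h2).trans
      ((map_leibniz (ρ.comp (Φ.pull (U ⊓ hc.range))) _ _ _ _ _).trans ?_)
    exact congrArg₂ (fun x y => _ * x + superSign (coordParity k * j) • (y * _)) (hρ b) (hρ a)
  have htop : a ∈ N.gr U 0 ⊔ N.gr U 1 := by rw [(N.gr_isCompl U).sup_eq_top]; trivial
  obtain ⟨a0, h0, a1, h1, rfl⟩ := Submodule.mem_sup.1 htop
  rw [add_mul, map_add, hpar 0 a0 h0, hpar 1 a1 h1, map_add, map_add, add_mul, add_mul]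
  exact add_add_add_comm _ _ _ _

/-- The vector field along `Φ` with components `v` in the coordinates of a chart. -/
def TangentPoint.ofCoord : TangentPoint A N where
  base := Φ
  vec := vecOf hc d Φ hΦ v
  vec_res {U U'} h f := by
    have h1 : ∀ k, A.res (U := (U' ⊓ hc.range).comap Φ.toMap) (V := U'.comap Φ.toMap)
        (fun _ hx => ⟨hx, hΦ _⟩)
        (Φ.pull (U' ⊓ hc.range) (vectorField.app (d k) inf_le_right (N.res inf_le_left (N.res h f)))) =
        A.res (U := U.comap Φ.toMap) (V := U'.comap Φ.toMap) (fun _ hx => h hx)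
          (A.res (U := (U ⊓ hc.range).comap Φ.toMap) (fun _ hx => ⟨hx, hΦ _⟩)
        (Φ.pull (U ⊓ hc.range) (vectorField.app (d k) inf_le_right (N.res inf_le_left f)))) := by
      intro k
      have h2 : vectorField.app (d k) inf_le_right (N.res (inf_le_left : U' ⊓ hc.range ≤ U')
          (N.res h f)) = N.res (inf_le_inf_right hc.range h)
            (vectorField.app (d k) inf_le_right (N.res (inf_le_left : U ⊓ hc.range ≤ U) f)) := by
        rw [← vectorField.app_restrict, N.res_res, N.res_res]
      rw [h2]
      exact (congrArg (A.res _) (Φ.pull_res (inf_le_inf_right hc.range h) _)).trans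
        ((A.res_res _ _ _).trans (A.res_res _ _ _).symm)
    rw [vecOf_apply, vecOf_apply, map_sum]
    refine Finset.sum_congr rfl fun k _ => ?_
    refine Eq.trans ?_ (map_mul _ _ _).symm
    exact congrArg₂ (· * ·) (A.res_res _ _ _).symm (h1 k)
  vec_mem {U i a} ha := by
    rw [vecOf_apply]
    refine Submodule.sum_mem _ fun k _ => ?_
    have h1 := A.mul_mem (A.res_mem (le_top : U.comap Φ.toMap ≤ ⊤) (hv k))
      (A.res_mem (U := (U ⊓ hc.range).comap Φ.toMap) (V := U.comap Φ.toMap) (fun _ hx => ⟨hx, hΦ _⟩)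
        (Φ.pull_mem ((hd k).1.2.1 ⟨U ⊓ hc.range, (inf_le_right : U ⊓ hc.range ≤ hc.range)⟩ i _ (N.res_mem inf_le_left ha))))
    have h2 : coordParity k + (coordParity k + i) = i := by
      rw [← add_assoc, CharTwo.add_self_eq_zero, zero_add]
    rwa [h2] at h1
  leibniz a b := vecOf_leibniz hc Φ hΦ hd hv _ a b

lemma TangentPoint.ofCoord_vec_coord (k : Fin m ⊕ Fin n) :
    (TangentPoint.ofCoord hc Φ hΦ hd hv).vec hc.range (hc.coord k) = A.res le_top (v k) := by
  refine (vecOf_apply hc d Φ hΦ v _ _).trans ?_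
  have h1 : ∀ l, vectorField.app (d l) inf_le_right
      (N.res (inf_le_left : hc.range ⊓ hc.range ≤ hc.range) (hc.coord k)) =
      if l = k then 1 else 0 := fun l => by
    have h2 := vectorField.app_restrict (d l) le_rfl
      (inf_le_left : hc.range ⊓ hc.range ≤ hc.range) (hc.coord k)
    rw [(hd l).2 k] at h2
    refine h2.trans ?_
    split_ifs <;> simp
  simp only [h1]
  rw [Finset.sum_eq_single k (fun l _ hl => ?_) fun h => absurd (Finset.mem_univ _) h]
  · simp; rfl
  · simp [hl]

end OfCoord

section Universal

variable {V : Opens (Fin p → ℝ)} {ξ : TangentPoint (superDomain p q V) N}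

/-- A test point factors through a universal one. -/
lemma app_eq_of_precomp {U : Opens (TangentVec N)} (f : N.tangentFun (U : Set (TangentVec N)))
    (τ : TestPoint N (U : Set (TangentVec N))) (ψ : Hom τ.dom (superDomain p q V))
    (h : ξ.precomp ψ = τ.point) :
    ∃ (χ : Hom τ.dom (ξ.test.loc U).dom), (restrictIncl _ (ξ.test.preim_le U)).comp χ = ψ ∧
      f.1 τ = χ.pullTop (f.1 (ξ.test.loc U)) := by
  have hm : ∀ x, ((inclusion (superR p q) V).comp ψ).toMap x ∈ ξ.test.preim U := fun x => by
    have h1 : (ξ.precomp ψ).bodyMap x ∈ U := by rw [h]; exact τ.mem x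
    rw [TangentPoint.bodyMap_precomp] at h1
    exact mem_up.2 ⟨(ψ.toMap x).2, h1⟩
  refine ⟨((inclusion (superR p q) V).comp ψ).codRestrict _ hm,
    codRestrict_incl ψ (ξ.test.preim_le U) hm, ?_⟩
  have h1 := f.2 (ξ.test.loc U) τ.p τ.q τ.V (((inclusion (superR p q) V).comp ψ).codRestrict _ hm)
  have h2 : ((ξ.test.loc U).precomp
      (((inclusion (superR p q) V).comp ψ).codRestrict _ hm)).point = τ.point :=
    (congrArg ξ.precomp (codRestrict_incl ψ (ξ.test.preim_le U) hm)).trans h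
  exact (congr_point f h2 τ.mem).symm.trans h1

/-- A superdomain with a vector field along a morphism to `N` through which all vector fields along
morphisms with underlying map in an open set factor uniquely is a chart of the tangent bundle. -/
lemma TangentPoint.isOpenImmersion_toHom (hopen : Topology.IsOpenEmbedding ξ.bodyMap)
    (hex : ∀ (p' q' : ℕ) (V' : Opens (Fin p' → ℝ)) (η : TangentPoint (superDomain p' q' V') N),
      (∀ y, η.bodyMap y ∈ Set.range ξ.bodyMap) →
        ∃ ψ : Hom (superDomain p' q' V') (superDomain p q V), ξ.precomp ψ = η)
    (huniq : ∀ (p' q' : ℕ) (V' : Opens (Fin p' → ℝ))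
      (ψ ψ' : Hom (superDomain p' q' V') (superDomain p q V)),
        ξ.precomp ψ = ξ.precomp ψ' → ψ = ψ') : ξ.toHom.IsOpenImmersion := by
  have key : ∀ U : Opens (TangentVec N), (U : Set (TangentVec N)) ⊆ Set.range ξ.bodyMap →
      Function.Bijective (ξ.homPull U) := fun U hU => by
    have hfac : ∀ τ : TestPoint N (U : Set (TangentVec N)),
        ∃ ψ : Hom τ.dom (superDomain p q V), ξ.precomp ψ = τ.point := fun τ =>
      hex _ _ _ τ.point fun y => hU (τ.mem y)
    choose ψ hψ using hfac
    constructor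
    · intro f g hfg
      refine Subtype.ext (funext fun τ => ?_)
      refine domValue_ext fun y => ?_
      obtain ⟨χ, hχ, h1⟩ := app_eq_of_precomp f τ (ψ τ) (hψ τ)
      obtain ⟨χ', hχ', h2⟩ := app_eq_of_precomp g τ (ψ τ) (hψ τ)
      have h3 : χ = χ' := (Hom.IsOpenImmersion.restrictIncl (ξ.test.preim_le U)).hom_injective
        (hχ.trans hχ'.symm)
      have h4 : f.1 (ξ.test.loc U) = g.1 (ξ.test.loc U) :=
        domValue_ext fun z => congrFun (congrArg Subtype.val hfg) ⟨z.1, z.2⟩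
      rw [h1, h2, h3, h4]
    · intro g
      have hm : ∀ (τ : TestPoint N (U : Set (TangentVec N))) (x : τ.dom.body),
          (ψ τ).toMap x ∈ (⟨ξ.bodyMap ⁻¹' U, U.isOpen.preimage ξ.continuous_bodyMap⟩ : Opens V) := fun τ x => by
        have h1 := ξ.bodyMap_precomp (ψ τ) x
        rw [hψ τ] at h1
        exact (congrArg (· ∈ U) h1).mp (τ.mem x)
      refine ⟨⟨fun τ => (ψ τ).pullTo (V := ⊤) (fun x _ => hm τ x) g, fun τ p' q' V' χ => ?_⟩, ?_⟩
      · have h1 : ψ (τ.precomp χ) = (ψ τ).comp χ := huniq _ _ _ _ _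
          ((hψ (τ.precomp χ)).trans (congrArg (fun η => TangentPoint.precomp η χ) (hψ τ)).symm)
        refine domValue_ext fun y => ?_
        have h2 : ∀ (φ φ' : Hom (superDomain p' q' V') (superDomain p q V)) (h : φ = φ')
            (h1 : ∀ x, φ.toMap x ∈ (⟨ξ.bodyMap ⁻¹' U, U.isOpen.preimage ξ.continuous_bodyMap⟩ : Opens V)) (h2 : ∀ x, φ'.toMap x ∈ (⟨ξ.bodyMap ⁻¹' U, U.isOpen.preimage ξ.continuous_bodyMap⟩ : Opens V)),
            φ.pullTo (V := ⊤) (fun x _ => h1 x) g = φ'.pullTo (V := ⊤) (fun x _ => h2 x) g := by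
          rintro φ _ rfl _ _; rfl
        refine congrArg (fun g => domValue g y) ((h2 _ _ h1 (hm (τ.precomp χ)) fun x =>
          hm τ (χ.toMap x)).trans ?_)
        exact (pullTop_pullTo (ψ τ) χ (hm τ) g).symm
      · have h1 : ψ (ξ.test.loc U) = restrictIncl _ (ξ.test.preim_le U) :=
          huniq _ _ _ _ _ (hψ (ξ.test.loc U))
        have h2 : ∀ (φ φ' : Hom (ξ.test.loc U).dom (superDomain p q V)) (h : φ = φ')
            (h1 : ∀ x, φ.toMap x ∈ (⟨ξ.bodyMap ⁻¹' U, U.isOpen.preimage ξ.continuous_bodyMap⟩ : Opens V)) (h2 : ∀ x, φ'.toMap x ∈ (⟨ξ.bodyMap ⁻¹' U, U.isOpen.preimage ξ.continuous_bodyMap⟩ : Opens V)),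
            φ.pullTo (V := ⊤) (fun x _ => h1 x) g = φ'.pullTo (V := ⊤) (fun x _ => h2 x) g := by
          rintro φ _ rfl _ _; rfl
        have h3 := h2 _ _ h1 (hm _) fun x => (mem_up.1 x.2).2
        refine Subtype.ext (funext fun y => ?_)
        exact congrFun (congrArg Subtype.val h3) ⟨y.1, comap_bodyMap_le ξ U y.2⟩
  exact ⟨hopen, fun U hU => key U hU⟩

end Universal

section Pair

/-- The indices of the coordinates `x i` of the tangent bundle. -/
def fstIdx (m n : ℕ) : Fin m ⊕ Fin n → Fin (m + m) ⊕ Fin (n + n) :=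
  Sum.map (Fin.castAdd m) (Fin.castAdd n)

/-- The indices of the coordinates `v i` of the tangent bundle. -/
def sndIdx (m n : ℕ) : Fin m ⊕ Fin n → Fin (m + m) ⊕ Fin (n + n) :=
  Sum.map (Fin.natAdd m) (Fin.natAdd n)

lemma coordParity_fstIdx (k : Fin m ⊕ Fin n) : coordParity (fstIdx m n k) = coordParity k := by
  rcases k with k | k <;> rfl

lemma coordParity_sndIdx (k : Fin m ⊕ Fin n) : coordParity (sndIdx m n k) = coordParity k := by
  rcases k with k | k <;> rfl

lemma fstIdx_or_sndIdx (l : Fin (m + m) ⊕ Fin (n + n)) :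
    (∃ k, l = fstIdx m n k) ∨ ∃ k, l = sndIdx m n k := by
  rcases l with l | l
  · induction l using Fin.addCases with
    | left i => exact .inl ⟨.inl i, rfl⟩
    | right i => exact .inr ⟨.inl i, rfl⟩
  · induction l using Fin.addCases with
    | left i => exact .inl ⟨.inr i, rfl⟩
    | right i => exact .inr ⟨.inr i, rfl⟩

/-- The coordinates of a point of the tangent bundle. -/
def pairCoord {R : Type*} (x v : Fin m ⊕ Fin n → R) : Fin (m + m) ⊕ Fin (n + n) → R :=
  Sum.elim (Fin.append (fun i => x (.inl i)) fun i => v (.inl i))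
    (Fin.append (fun i => x (.inr i)) fun i => v (.inr i))

lemma pairCoord_fst {R : Type*} (x v : Fin m ⊕ Fin n → R) (k : Fin m ⊕ Fin n) :
    pairCoord x v (fstIdx m n k) = x k := by
  rcases k with k | k <;> simp [pairCoord, fstIdx]

lemma pairCoord_snd {R : Type*} (x v : Fin m ⊕ Fin n → R) (k : Fin m ⊕ Fin n) :
    pairCoord x v (sndIdx m n k) = v k := by
  rcases k with k | k
  · exact Fin.append_right (fun i => x (.inl i)) (fun i => v (.inl i)) k
  · exact Fin.append_right (fun i => x (.inr i)) (fun i => v (.inr i)) k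

lemma contDiffOn_pairCoord {E : Type*} [NormedAddCommGroup E] [NormedSpace ℝ E] {U : Set E}
    {x v : E → Fin m ⊕ Fin n → Grassmann q} (hx : ContDiffOn ℝ ∞ x U) (hv : ContDiffOn ℝ ∞ v U) :
    ContDiffOn ℝ ∞ (fun y => pairCoord (x y) (v y)) U := by
  refine contDiffOn_pi.2 fun l => ?_
  rcases fstIdx_or_sndIdx l with ⟨k, rfl⟩ | ⟨k, rfl⟩
  · simp only [pairCoord_fst]
    exact contDiffOn_pi.1 hx k
  · simp only [pairCoord_snd]
    exact contDiffOn_pi.1 hv k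

/-- The domain of the chart of the tangent bundle defined by a chart with domain `V`. -/
def pairDom (V : Opens (Fin m → ℝ)) : Opens (Fin (m + m) → ℝ) :=
  ⟨{y | (fun i => y (Fin.castAdd m i)) ∈ V}, V.isOpen.preimage (by fun_prop)⟩

lemma coordBody_pairCoord {V : Opens (Fin m → ℝ)} {x v : Fin m ⊕ Fin n → Grassmann q}
    (h : coordBody x ∈ V) : coordBody (pairCoord x v) ∈ pairDom V := by
  have e : (fun i => coordBody (pairCoord x v) (Fin.castAdd m i)) = coordBody x :=
    funext fun i => congrArg gbody (pairCoord_fst x v (.inl i))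
  change (fun i => coordBody (pairCoord x v) (Fin.castAdd m i)) ∈ V
  rwa [e]

end Pair

end SuperSpace
end

noncomputable section

namespace SuperSpace

/-! ### The coordinate charts induced on the tangent bundle -/

variable {N : SuperSpace.{u}} {m n p q r : ℕ}

lemma isOpenEmbedding_of_continuousOn_inverse {β γ : Type*} [TopologicalSpace β] [TopologicalSpace γ]
    {V : Opens γ} (b : V → β) (hb : Continuous b) {R : Set β} (hR : IsOpen R)
    (hr : ∀ y, b y ∈ R) (hsurj : ∀ ξ ∈ R, ∃ y, b y = ξ) (g : R → γ) (hg : Continuous g)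
    (hgb : ∀ y, g ⟨b y, hr y⟩ = y) : Topology.IsOpenEmbedding b := by
  refine Topology.IsOpenEmbedding.of_continuous_injective_isOpenMap hb (fun y y' e => ?_)
    fun s hs => ?_
  · have h1 : (⟨b y, hr y⟩ : R) = ⟨b y', hr y'⟩ := Subtype.ext e
    exact Subtype.ext ((hgb y).symm.trans ((congrArg g h1).trans (hgb y')))
  · have h1 : b '' s = Subtype.val '' (g ⁻¹' (Subtype.val '' s)) := by
      ext ξ
      constructor
      · rintro ⟨y, hy, rfl⟩
        exact ⟨⟨b y, hr y⟩, ⟨y, hy, (hgb y).symm⟩, rfl⟩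
      · rintro ⟨⟨ξ, hξ⟩, ⟨y, hy, e⟩, rfl⟩
        obtain ⟨y', rfl⟩ := hsurj ξ hξ
        rw [hgb] at e
        obtain rfl : y = y' := Subtype.ext e
        exact ⟨y, hy, rfl⟩
    rw [h1]
    exact hR.isOpenMap_subtype_val _ ((V.isOpen.isOpenMap_subtype_val s hs).preimage hg)

lemma continuous_append {α : Type*} [TopologicalSpace α] {a b : α → Fin m → ℝ} (ha : Continuous a)
    (hb : Continuous b) : Continuous fun x => Fin.append (a x) (b x) := by
  refine continuous_pi fun l => ?_
  induction l using Fin.addCases with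
  | left i => simpa only [Fin.append_left] using continuous_pi_iff.1 ha i
  | right i => simpa only [Fin.append_right] using continuous_pi_iff.1 hb i

lemma append_eq {a b : Fin m → ℝ} {y : Fin (m + m) → ℝ} (ha : ∀ i, a i = y (Fin.castAdd m i))
    (hb : ∀ i, b i = y (Fin.natAdd m i)) : Fin.append a b = y := by
  refine funext fun l => ?_
  induction l using Fin.addCases with
  | left i => rw [Fin.append_left, ha]
  | right i => rw [Fin.append_right, hb]

lemma continuous_tangentVec_app {U : Opens N.body} (a : N.O U) :
    Continuous fun ξ : {ξ : TangentVec N // ξ.pt ∈ U} => ξ.1.app U ξ.2 a := by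
  refine continuous_def.2 fun I hI => ?_
  have h1 : IsOpen {ξ : TangentVec N | ∃ h : ξ.pt ∈ U, ξ.app U h a ∈ I} :=
    TopologicalSpace.isOpen_generateFrom_of_mem ⟨U, a, I, hI, rfl⟩
  convert h1.preimage continuous_subtype_val using 1
  ext ξ
  exact ⟨fun h => ⟨ξ.2, h⟩, fun h => h.2⟩

section

variable {V : Opens (Fin m → ℝ)} {c : Hom (superDomain m n V) N} (hc : c.IsOpenImmersion)

/-- The vector field on the domain of a chart of the tangent bundle: the base morphism has the
coordinates `x i`, and the components of the vector field are the coordinates `v i`. -/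
lemma exists_universal_tangentPoint :
    ∃ ξ : TangentPoint (superDomain (m + m) (n + n) (pairDom V)) N,
      (∀ y, ξ.base.toMap y ∈ hc.range) ∧
      (∀ k, ξ.base.pull hc.range (hc.coord k) =
        SuperSpace.res _ le_top (stdCoord (pairDom V) (fstIdx m n k))) ∧
      (∀ k, ξ.vec hc.range (hc.coord k) =
        SuperSpace.res _ le_top (stdCoord (pairDom V) (sndIdx m n k))) := by
  obtain ⟨d, hd⟩ := hc.exists_isCoordDer
  have hV : ∀ y ∈ pairDom V,
      coordBody (fun k => stdFun (m := m + m) (n := n + n) (fstIdx m n k) y) ∈ V := fun y hy => by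
    have e : coordBody (fun k => stdFun (m := m + m) (n := n + n) (fstIdx m n k) y) =
        fun i => y (Fin.castAdd m i) := funext fun i => gbody_algebraMap _
    rw [e]; exact hy
  obtain ⟨ψ, hψ⟩ := exists_domain_hom (V' := pairDom V) (V := V)
    (contDiffOn_pi.2 fun k => (contDiff_stdFun (fstIdx m n k)).contDiffOn) hV
  have hr : ∀ y, (c.comp ψ).toMap y ∈ hc.range := fun y => ⟨ψ.toMap y, rfl⟩
  have hv : ∀ k, stdCoord (pairDom V) (sndIdx m n k) ∈
      (superDomain (m + m) (n + n) (pairDom V)).gr ⊤ (coordParity k) := fun k =>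
    coordParity_sndIdx (m := m) (n := n) k ▸ stdCoord_mem _
  refine ⟨TangentPoint.ofCoord hc (c.comp ψ) hr hd hv, hr, fun k => domPt_ext fun y hy => ?_, fun k =>
    TangentPoint.ofCoord_vec_coord hc (c.comp ψ) hr hd hv k⟩
  have h1 : (domPt y).app (hc.range.comap (c.comp ψ).toMap) hy
      ((c.comp ψ).pull hc.range (hc.coord k)) =
      (c.mapPt (ψ.mapPt (domPt y))).app hc.range hy (hc.coord k) := rfl
  refine h1.trans ((hc.mapPt_coord k (ψ.mapPt (domPt y)) hy).trans ?_)
  refine (GrPoint.app_congr (hψ y) (U := ⊤) trivial trivial _).trans ?_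
  refine (coordPt_stdCoord _ _ _ k).trans ?_
  rw [parityProj_eq fun k => coordParity_fstIdx (m := m) (n := n) k ▸ stdFun_mem _ _]
  exact ((GrPoint.app_res _ _ _ _).trans (domPt_stdCoord _ _ _)).symm

/-- The chart of the tangent bundle that is defined by a chart `c` of `N`. -/
lemma exists_tangent_chart : ∃ (e : Hom (superDomain (m + m) (n + n) (pairDom V)) N.tangent)
    (he : e.IsOpenImmersion), (∀ ξ : TangentVec N, ξ.pt ∈ hc.range → ξ ∈ he.range) ∧
      ∀ (r : ℕ) (g : GrPoint (superDomain (m + m) (n + n) (pairDom V)) r),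
      ∃ hg : N.tangentProj.toMap (e.toMap g.pt) ∈ hc.range, ∀ k,
        (N.tangentProj.mapPt (e.mapPt g)).app hc.range hg (hc.coord k) =
          g.app ⊤ trivial (stdCoord _ (fstIdx m n k)) ∧
        (e.mapPt g).app (hc.range.comap N.tangentProj.toMap) hg (N.tangentDiff hc.range (hc.coord k)) =
          g.app ⊤ trivial (stdCoord _ (sndIdx m n k)) := by
  obtain ⟨ξ, hξ, h1, h2⟩ := exists_universal_tangentPoint hc
  have hval : ∀ (r : ℕ) (g : GrPoint (superDomain (m + m) (n + n) (pairDom V)) r) (k),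
      (ξ.base.mapPt g).app hc.range (hξ _) (hc.coord k) = g.app ⊤ trivial (stdCoord _ (fstIdx m n k)) ∧
      g.app (hc.range.comap ξ.base.toMap) (hξ _) (ξ.vec hc.range (hc.coord k)) =
        g.app ⊤ trivial (stdCoord _ (sndIdx m n k)) := fun r g k =>
    ⟨(congrArg (g.app (hc.range.comap ξ.base.toMap) (hξ _)) (h1 k)).trans (g.app_res _ _ _),
      (congrArg (g.app (hc.range.comap ξ.base.toMap) (hξ _)) (h2 k)).trans (g.app_res _ _ _)⟩
  -- vector fields along morphisms to the range of `c` factor through `ξ`, by means of the morphism with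
  -- their coordinates and components as coordinates
  have hex : ∀ (p' q' : ℕ) (V' : Opens (Fin p' → ℝ)) (η : TangentPoint (superDomain p' q' V') N),
      (∀ y, η.base.toMap y ∈ hc.range) →
        ∃ ψ : Hom (superDomain p' q' V') (superDomain (m + m) (n + n) (pairDom V)),
          ξ.precomp ψ = η := by
    intro p' q' V' η hη
    have hmem : ∀ y ∈ V', y ∈ up (W := V') (hc.range.comap η.base.toMap) := fun y hy =>
      mem_up.2 ⟨hy, hη ⟨y, hy⟩⟩
    let x : (Fin p' → ℝ) → Fin m ⊕ Fin n → Grassmann q' := fun y k =>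
      secFun (η.base.pull hc.range (hc.coord k)) y
    let v : (Fin p' → ℝ) → Fin m ⊕ Fin n → Grassmann q' := fun y k =>
      secFun (η.vec hc.range (hc.coord k)) y
    have hx : ContDiffOn ℝ ∞ x V' := contDiffOn_pi.2 fun k =>
      (contDiffOn_secFun (η.base.pull hc.range (hc.coord k))).mono hmem
    have hv : ContDiffOn ℝ ∞ v V' := contDiffOn_pi.2 fun k =>
      (contDiffOn_secFun (η.vec hc.range (hc.coord k))).mono hmem
    have hx' : ∀ (y : V') k, (η.base.mapPt (domPt y)).app _ (hη y) (hc.coord k) = x y k := fun y k =>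
      domPt_secFun (η.base.pull hc.range (hc.coord k)) y (hη y)
    have hv' : ∀ (y : V') k, (domPt y).app _ (hη y) (η.vec hc.range (hc.coord k)) = v y k :=
      fun y k => domPt_secFun (η.vec hc.range (hc.coord k)) y (hη y)
    have hxV : ∀ y ∈ V', coordBody (pairCoord (x y) (v y)) ∈ pairDom V := fun y hy => by
      obtain ⟨hV, -⟩ := hc.exists_coordPt (η.base.mapPt (domPt ⟨y, hy⟩)) (hη _) (hx' ⟨y, hy⟩)
      exact coordBody_pairCoord hV
    obtain ⟨ψ, hψ⟩ := exists_domain_hom (contDiffOn_pairCoord hx hv) hxV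
    have hpar : ∀ y : V', parityProj (pairCoord (x y) (v y)) = pairCoord (x y) (v y) := fun y =>
      parityProj_eq fun l => by
        rcases fstIdx_or_sndIdx l with ⟨k, rfl⟩ | ⟨k, rfl⟩
        · rw [pairCoord_fst, coordParity_fstIdx, ← hx' y k]
          exact GrPoint.app_mem _ _ (hc.isCoord.mem k)
        · rw [pairCoord_snd, coordParity_sndIdx, ← hv' y k]
          exact GrPoint.app_mem _ _ (η.vec_mem (hc.isCoord.mem k))
    have hstd : ∀ (y : V') l, (ψ.mapPt (domPt y)).app ⊤ trivial (stdCoord _ l) =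
        pairCoord (x y) (v y) l := fun y l => by
      refine (GrPoint.app_congr (hψ y) (U := ⊤) trivial trivial _).trans ((coordPt_stdCoord _ _ _ l).trans ?_)
      rw [hpar]
    refine ⟨ψ, TangentPoint.eq_of_coord hc (fun y => hξ (ψ.toMap y)) hη (fun y k => ?_) fun y k => ?_⟩
    · exact ((hval q' (ψ.mapPt (domPt y)) k).1.trans (hstd y _)).trans
        ((pairCoord_fst _ _ _).trans (hx' y k).symm)
    · exact ((hval q' (ψ.mapPt (domPt y)) k).2.trans (hstd y _)).trans
        ((pairCoord_snd _ _ _).trans (hv' y k).symm)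
  -- the factorization is unique, because the coordinates of `ψ` can be read off from `ξ.precomp ψ`
  have huniq : ∀ (p' q' : ℕ) (V' : Opens (Fin p' → ℝ))
      (ψ ψ' : Hom (superDomain p' q' V') (superDomain (m + m) (n + n) (pairDom V))),
        ξ.precomp ψ = ξ.precomp ψ' → ψ = ψ' := by
    intro p' q' V' ψ ψ' h
    have h3 : ∀ (η η' : TangentPoint (superDomain p' q' V') N) (_ : η = η')
        (hη : ∀ y, η.base.toMap y ∈ hc.range) (hη' : ∀ y, η'.base.toMap y ∈ hc.range) (y : V') (k),
        (η.base.mapPt (domPt y)).app hc.range (hη y) (hc.coord k) =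
          (η'.base.mapPt (domPt y)).app hc.range (hη' y) (hc.coord k) ∧
        (domPt y).app _ (hη y) (η.vec hc.range (hc.coord k)) =
          (domPt y).app _ (hη' y) (η'.vec hc.range (hc.coord k)) := by
      rintro η _ rfl _ _ _ _; exact ⟨rfl, rfl⟩
    have h4 := h3 _ _ h (fun y => hξ (ψ.toMap y)) fun y => hξ (ψ'.toMap y)
    refine domain_hom_ext fun y => domain_grPoint_ext fun l => ?_
    rcases fstIdx_or_sndIdx l with ⟨k, rfl⟩ | ⟨k, rfl⟩
    · exact (hval q' (ψ.mapPt (domPt y)) k).1.symm.trans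
        ((h4 y k).1.trans (hval q' (ψ'.mapPt (domPt y)) k).1)
    · exact (hval q' (ψ.mapPt (domPt y)) k).2.symm.trans
        ((h4 y k).2.trans (hval q' (ψ'.mapPt (domPt y)) k).2)
  have hsurj : ∀ η : TangentVec N, η.pt ∈ hc.range → ∃ y, ξ.bodyMap y = η := fun η hη => by
    obtain ⟨ψ, hψ⟩ := hex 0 0 ⊤ η.toPoint fun _ => hη
    refine ⟨ψ.toMap superPoint.pt, ?_⟩
    rw [← ξ.bodyMap_precomp, hψ, TangentVec.toPoint_bodyMap]
  have hR : IsOpen {η : TangentVec N | η.pt ∈ hc.range} :=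
    hc.range.isOpen.preimage N.tangentProj.toMap.continuous
  -- the coordinates and the even components are continuous functions on the tangent bundle; they define
  -- the inverse of the underlying map
  have hopen : Topology.IsOpenEmbedding ξ.bodyMap := by
    refine isOpenEmbedding_of_continuousOn_inverse (V := pairDom V) ξ.bodyMap
      ξ.continuous_bodyMap hR hξ hsurj
      (fun η => Fin.append (hc.invMap ⟨η.1.pt, η.2⟩).1 fun i => η.1.app hc.range η.2 (hc.coord (.inl i)))
      ?_ fun y => ?_
    · have h3 : Continuous fun η : {η : TangentVec N // η.pt ∈ hc.range} =>
          (hc.invMap ⟨η.1.pt, η.2⟩).1 := continuous_subtype_val.comp (hc.invMap.continuous.comp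
        ((N.tangentProj.toMap.continuous.comp continuous_subtype_val).subtype_mk _))
      exact continuous_append h3 (continuous_pi fun i =>
        continuous_tangentVec_app (U := hc.range) (hc.coord (.inl i)))
    · have h3 : ∀ (i : Fin m) (h : y ∈ hc.range.comap ξ.base.toMap),
          (superDomain (m + m) (n + n) (pairDom V)).val _ (ξ.vec hc.range (hc.coord (.inl i))) ⟨y, h⟩ =
            y.1 (Fin.natAdd m i) := fun i h =>
        ((domPt y).app_val (U := hc.range.comap ξ.base.toMap) h _).symm.trans
          ((congrArg gbody ((hval _ (domPt y) (.inl i)).2.trans (domPt_stdCoord _ _ _))).trans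
            (gbody_algebraMap _))
      have h4 : ∀ i : Fin m, (hc.invMap ⟨ξ.base.toMap y, hξ y⟩).1 i = y.1 (Fin.castAdd m i) := by
        obtain ⟨z, hz⟩ := hc.exists_mapPt_eq (ξ.base.mapPt (domPt y)) (hξ y)
        have h5 : ξ.base.toMap y = c.toMap z.pt := (congrArg GrPoint.pt hz).symm
        have h6 : hc.invMap ⟨ξ.base.toMap y, hξ y⟩ = z.pt := by
          refine Eq.trans ?_ (hc.invMap_map z.pt)
          exact congrArg hc.invMap (Subtype.ext h5)
        intro i
        have h7 := (hc.mapPt_coord (.inl i) z ⟨z.pt, rfl⟩).symm.trans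
          ((GrPoint.app_congr hz _ (hξ y) (hc.coord (.inl i))).trans
            ((hval _ (domPt y) (.inl i)).1.trans (domPt_stdCoord _ _ _)))
        have h8 := congrFun (coordBody_stdCoord z) i
        rw [h6, ← h8]
        exact (congrArg gbody h7).trans (gbody_algebraMap _)
      exact append_eq h4 fun i => h3 i (hξ y)
  have he := TangentPoint.isOpenImmersion_toHom hopen (fun p' q' V' η hη => hex p' q' V' η fun y => by
    obtain ⟨z, hz⟩ := hη y
    have h3 : ξ.base.toMap z = η.base.toMap y := congrArg TangentVec.pt hz
    rw [← h3]; exact hξ z) huniq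
  exact ⟨ξ.toHom, he, fun η hη => hsurj η hη, fun r g => ⟨hξ g.pt, fun k => hval r g k⟩⟩

end

end SuperSpace
end

noncomputable section

namespace SuperSpace

/-! ### The velocity of a supercurve -/

variable {N : SuperSpace.{u}} {S : SuperSpace.{v}} {m n p q r : ℕ}

/-- A Grassmann-valued point of the tangent bundle is determined by its projection and the
components of the tangent vector in a chart. -/
lemma Hom.IsOpenImmersion.tangent_ext {V : Opens (Fin m → ℝ)} {c : Hom (superDomain m n V) N}
    (hc : c.IsOpenImmersion) {ξ ξ' : GrPoint N.tangent r}
    (h : N.tangentProj.mapPt ξ = N.tangentProj.mapPt ξ')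
    (hξ : N.tangentProj.toMap ξ.pt ∈ hc.range) (hξ' : N.tangentProj.toMap ξ'.pt ∈ hc.range)
    (h' : ∀ k, ξ.app (hc.range.comap N.tangentProj.toMap) hξ (N.tangentDiff hc.range (hc.coord k)) =
      ξ'.app (hc.range.comap N.tangentProj.toMap) hξ' (N.tangentDiff hc.range (hc.coord k))) :
    ξ = ξ' := by
  obtain ⟨e, he, hmem, hval⟩ := exists_tangent_chart hc
  obtain ⟨g, rfl⟩ := he.exists_mapPt_eq ξ (hmem _ hξ)
  obtain ⟨g', rfl⟩ := he.exists_mapPt_eq ξ' (hmem _ hξ')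
  obtain ⟨h1, h2⟩ := hval r g
  obtain ⟨h3, h4⟩ := hval r g'
  refine congrArg e.mapPt (domain_grPoint_ext fun l => ?_)
  rcases fstIdx_or_sndIdx l with ⟨k, rfl⟩ | ⟨k, rfl⟩
  · exact (h2 k).1.symm.trans ((GrPoint.app_congr h (U := hc.range) h1 h3 (hc.coord k)).trans (h4 k).1)
  · exact (h2 k).2.symm.trans ((h' k).trans (h4 k).2)

variable {W W' : Opens S.timeProd.body} {Φ : Hom (S.timeProd.restrict W) N}

/-- The Grassmann-valued point `ξ` of the tangent bundle is the velocity of the supercurve `Φ` at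
the Grassmann-valued point `g` of its domain. -/
def IsVelocityAt (Φ : Hom (S.timeProd.restrict W) N) (g : GrPoint (S.timeProd.restrict W) r)
    (ξ : GrPoint N.tangent r) : Prop :=
  N.tangentProj.mapPt ξ = Φ.mapPt g ∧ ∀ (U : Opens N.body) (f : N.O U)
    (h : N.tangentProj.toMap ξ.pt ∈ U) (h' : Φ.toMap g.pt ∈ U),
      ξ.app (U.comap N.tangentProj.toMap) h (N.tangentDiff U f) =
        g.app (U.comap Φ.toMap) h' (dt (Φ.pull U f))

lemma IsVelocityAt.unique (hN : N.IsSupermanifold m n) {g : GrPoint (S.timeProd.restrict W) r}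
    {ξ ξ' : GrPoint N.tangent r} (h : IsVelocityAt Φ g ξ) (h' : IsVelocityAt Φ g ξ') : ξ = ξ' := by
  obtain ⟨V, c, hc, hx⟩ := hN.exists_chart (Φ.toMap g.pt)
  have h1 : N.tangentProj.toMap ξ.pt = Φ.toMap g.pt := congrArg GrPoint.pt h.1
  have h2 : N.tangentProj.toMap ξ'.pt = Φ.toMap g.pt := congrArg GrPoint.pt h'.1
  have hx' : Φ.toMap g.pt ∈ hc.range := hx
  exact hc.tangent_ext (h.1.trans h'.1.symm) (h1 ▸ hx') (h2 ▸ hx') fun k =>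
    (h.2 hc.range (hc.coord k) (h1 ▸ hx') hx').trans (h'.2 hc.range (hc.coord k) (h2 ▸ hx') hx').symm

/-- The velocity can be computed in a chart. -/
lemma isVelocityAt_of_coord (hS : S.IsSupermanifold p q) {V : Opens (Fin m → ℝ)}
    {c : Hom (superDomain m n V) N} (hc : c.IsOpenImmersion) {g : GrPoint (S.timeProd.restrict W) r}
    {ξ : GrPoint N.tangent r} (h : N.tangentProj.mapPt ξ = Φ.mapPt g)
    (hξ : N.tangentProj.toMap ξ.pt ∈ hc.range) (hg : Φ.toMap g.pt ∈ hc.range)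
    (h' : ∀ k, ξ.app (hc.range.comap N.tangentProj.toMap) hξ (N.tangentDiff hc.range (hc.coord k)) =
      g.app (hc.range.comap Φ.toMap) hg (dt (Φ.pull hc.range (hc.coord k)))) :
    IsVelocityAt Φ g ξ := by
  refine ⟨h, fun U f hU hU' => ?_⟩
  obtain ⟨d, hd⟩ := hc.exists_isCoordDer
  have hl : U ⊓ hc.range ≤ U := inf_le_left
  have hr : U ⊓ hc.range ≤ hc.range := inf_le_right
  have hm : N.tangentProj.toMap ξ.pt ∈ U ⊓ hc.range := ⟨hU, hξ⟩
  have hm' : Φ.toMap g.pt ∈ U ⊓ hc.range := ⟨hU', hg⟩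
  have e1 : ξ.app (U.comap N.tangentProj.toMap) hU (N.tangentDiff U f) =
      ξ.app ((U ⊓ hc.range).comap N.tangentProj.toMap) hm
        (N.tangentDiff (U ⊓ hc.range) (N.res hl f)) := by
    rw [tangentDiff_res]
    exact (ξ.app_res (U := U.comap N.tangentProj.toMap)
      (V := (U ⊓ hc.range).comap N.tangentProj.toMap) (fun _ hx => hl hx) hm _).symm
  have e2 : g.app (U.comap Φ.toMap) hU' (dt (Φ.pull U f)) =
      g.app ((U ⊓ hc.range).comap Φ.toMap) hm' (dt (Φ.pull (U ⊓ hc.range) (N.res hl f))) := by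
    refine Eq.trans ?_ (congrArg (g.app ((U ⊓ hc.range).comap Φ.toMap) hm')
      ((congrArg dt (Φ.pull_res hl f)).trans (dt_res hS _ _))).symm
    exact (g.app_res (U := U.comap Φ.toMap) (V := (U ⊓ hc.range).comap Φ.toMap)
      (fun _ hx => hl hx) hm' _).symm
  rw [e1, e2, tangentDiff_eq_sum hc hd ξ hξ hr hm]
  have e3 := dt_pull_eq_sum (Φ := Φ) hS hc hd le_rfl hr (N.res hl f)
  simp only [N.res_self] at e3
  rw [e3, map_sum]
  refine Finset.sum_congr rfl fun l _ => ?_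
  rw [map_mul]
  refine congrArg₂ (· * ·) ((h' l).trans ?_) ?_
  · exact (g.app_res (U := hc.range.comap Φ.toMap) (V := (U ⊓ hc.range).comap Φ.toMap)
      (fun _ hx => hr hx) hm' _).symm
  · exact GrPoint.app_congr h (U := U ⊓ hc.range) hm hm' _

lemma timeDeriv_res (hS : S.IsSupermanifold p q) (h : W' ≤ W) (f : S.timeProd.O W) :
    timeDeriv (S.timeProd.res h f) = S.timeProd.res h (timeDeriv f) :=
  IsTimeDeriv.unique hS (isTimeDeriv_timeDeriv hS _) ((isTimeDeriv_timeDeriv hS f).res h)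

lemma restrictIncl_mapPt_curvePt (h : W' ≤ W) (x : GrPoint S r) (t : ℝ) (hx : (t, x.pt) ∈ W') :
    (S.timeProd.restrictIncl h).mapPt (curvePt W' x t hx) = curvePt W x t (h hx) :=
  restrictIncl_mapPt_restrict (timePt x t) h hx

lemma up_comap_restrictIncl_le (h : W' ≤ W) (U : Opens (S.timeProd.restrict W).body) :
    up (W := W') (U.comap (S.timeProd.restrictIncl h).toMap) ≤ up U := fun _ hx =>
  mem_up.2 ⟨h (mem_up.1 hx).1, (mem_up.1 hx).2⟩

lemma dt_pull_restrictIncl (hS : S.IsSupermanifold p q) (h : W' ≤ W)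
    {U : Opens (S.timeProd.restrict W).body} (f : (S.timeProd.restrict W).O U) :
    dt ((S.timeProd.restrictIncl h).pull U f) = (S.timeProd.restrictIncl h).pull U (dt f) :=
  timeDeriv_res hS (up_comap_restrictIncl_le h U) f

lemma isVelocityAt_restrictIncl (hS : S.IsSupermanifold p q) (h : W' ≤ W)
    {g : GrPoint (S.timeProd.restrict W') r} {ξ : GrPoint N.tangent r} :
    IsVelocityAt (Φ.comp (S.timeProd.restrictIncl h)) g ξ ↔
      IsVelocityAt Φ ((S.timeProd.restrictIncl h).mapPt g) ξ := by
  refine and_congr_right fun _ => forall₄_congr fun U f hU hU' => ?_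
  have e : g.app (U.comap (Φ.comp (S.timeProd.restrictIncl h)).toMap) hU'
      (dt ((Φ.comp (S.timeProd.restrictIncl h)).pull U f)) =
      ((S.timeProd.restrictIncl h).mapPt g).app (U.comap Φ.toMap) hU' (dt (Φ.pull U f)) :=
    congrArg (g.app (U.comap (Φ.comp (S.timeProd.restrictIncl h)).toMap) hU')
      (dt_pull_restrictIncl hS h (Φ.pull U f))
  rw [e]

lemma isVelocity_of_forall (hS : S.IsSupermanifold p q) {Ψ : Hom (S.timeProd.restrict W) N.tangent}
    (h : ∀ (x : GrPoint S q) (t : ℝ) (hx : (t, x.pt) ∈ W),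
      IsVelocityAt Φ (curvePt W x t hx) (Ψ.mapPt (curvePt W x t hx))) : IsVelocity Φ Ψ := by
  have e : N.tangentProj.comp Ψ = Φ := curve_hom_ext hS fun x t hx => (h x t hx).1
  subst e
  exact ⟨rfl, fun U f => curve_sec_ext hS fun x t hx hU => (h x t hx).2 U f hU hU⟩

lemma IsVelocity.isVelocityAt {Ψ : Hom (S.timeProd.restrict W) N.tangent} (h : IsVelocity Φ Ψ)
    (g : GrPoint (S.timeProd.restrict W) r) : IsVelocityAt Φ g (Ψ.mapPt g) := by
  obtain ⟨rfl, h⟩ := h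
  exact ⟨rfl, fun U f hU _ => congrArg (g.app _ hU) (h U f)⟩

/-- The existence of the velocity over charts. -/
lemma exists_isVelocityAt_chart (hS : S.IsSupermanifold p q) {B : Opens (Fin p → ℝ)}
    {b : Hom (superDomain p q B) S} (hb : b.IsOpenImmersion) (hW : ∀ z ∈ W, z.2 ∈ hb.range)
    {V : Opens (Fin m → ℝ)} {c : Hom (superDomain m n V) N} (hc : c.IsOpenImmersion)
    (hΦ : ∀ z, Φ.toMap z ∈ hc.range) :
    ∃ Ψ : Hom (S.timeProd.restrict W) N.tangent, IsVelocity Φ Ψ := by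
  obtain ⟨e, he, -, hval⟩ := exists_tangent_chart hc
  have hsub : timeDom S b W ⊆ timeDom S b (up (hc.range.comap Φ.toMap)) := fun z hz =>
    ⟨hz.1, mem_up.2 ⟨hz.2, hΦ _⟩⟩
  let x : ℝ × (Fin p → ℝ) → Fin m ⊕ Fin n → Grassmann q := fun z k =>
    timeExpr S b (W := up (hc.range.comap Φ.toMap)) (Φ.pull hc.range (hc.coord k)).1 z
  let v : ℝ × (Fin p → ℝ) → Fin m ⊕ Fin n → Grassmann q := fun z k =>
    timeExpr S b (W := up (hc.range.comap Φ.toMap)) (timeDeriv (W := up (hc.range.comap Φ.toMap))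
      (Φ.pull hc.range (hc.coord k))).1 z
  have hx : ContDiffOn ℝ ∞ x (timeDom S b W) := contDiffOn_pi.2 fun k =>
    (contDiffOn_timeExpr hb (W := up (hc.range.comap Φ.toMap)) _).mono hsub
  have hv : ContDiffOn ℝ ∞ v (timeDom S b W) := contDiffOn_pi.2 fun k =>
    (contDiffOn_timeExpr hb (W := up (hc.range.comap Φ.toMap)) _).mono hsub
  have hx' : ∀ t (y : B) (h : (t, b.toMap y) ∈ W) k,
      (Φ.mapPt (curvePt W (b.mapPt (domPt y)) t h)).app hc.range (hΦ _) (hc.coord k) = x (t, y.1) k :=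
    fun t y h k => (timeExpr_eq_app b (W := up (hc.range.comap Φ.toMap)) _ y
      (mem_up.2 ⟨h, hΦ _⟩)).symm
  have hv' : ∀ t (y : B) (h : (t, b.toMap y) ∈ W) k,
      (curvePt W (b.mapPt (domPt y)) t h).app (hc.range.comap Φ.toMap) (hΦ _)
        (dt (Φ.pull hc.range (hc.coord k))) = v (t, y.1) k :=
    fun t y h k => (timeExpr_eq_app b (W := up (hc.range.comap Φ.toMap)) _ y
      (mem_up.2 ⟨h, hΦ _⟩)).symm
  have hxV : ∀ z ∈ timeDom S b W, coordBody (pairCoord (x z) (v z)) ∈ pairDom V := by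
    rintro ⟨t, y⟩ ⟨hy, hz⟩
    obtain ⟨hV, -⟩ := hc.exists_coordPt _ (hΦ _) (hx' t ⟨y, hy⟩ hz)
    exact coordBody_pairCoord hV
  obtain ⟨Ψ, hΨ⟩ := hb.exists_time_hom hW e (contDiffOn_pairCoord hx hv) hxV
  have hstd : ∀ t (y : B) (h : (t, b.toMap y) ∈ W) l,
      (coordPt (pairCoord (x (t, y.1)) (v (t, y.1))) (hxV (t, y.1) ⟨y.2, h⟩)).app ⊤ trivial
        (stdCoord (pairDom V) l) = pairCoord (x (t, y.1)) (v (t, y.1)) l := fun t y h l => by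
    refine (coordPt_stdCoord _ _ _ l).trans (congrFun (parityProj_eq fun l => ?_) l)
    rcases fstIdx_or_sndIdx l with ⟨k, rfl⟩ | ⟨k, rfl⟩
    · rw [pairCoord_fst, coordParity_fstIdx, ← hx' t y h k]
      exact GrPoint.app_mem _ _ (hc.isCoord.mem k)
    · rw [pairCoord_snd, coordParity_sndIdx, ← hv' t y h k]
      exact GrPoint.app_mem _ _ (dt_mem hS (Φ.pull_mem (hc.isCoord.mem k)))
  have key : ∀ t (y : B) (h : (t, b.toMap y) ∈ W),
      IsVelocityAt Φ (curvePt W (b.mapPt (domPt y)) t h) (Ψ.mapPt (curvePt W (b.mapPt (domPt y)) t h)) := by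
    intro t y h
    rw [hΨ t y h]
    obtain ⟨h1, h2⟩ := hval q (coordPt (pairCoord (x (t, y.1)) (v (t, y.1))) (hxV (t, y.1) ⟨y.2, h⟩))
    refine isVelocityAt_of_coord hS hc (hc.grPoint_ext h1 (hΦ _) fun k => ?_) h1 (hΦ _) fun k => ?_
    · exact (h2 k).1.trans ((hstd t y h _).trans ((pairCoord_fst _ _ k).trans (hx' t y h k).symm))
    · exact (h2 k).2.trans ((hstd t y h _).trans ((pairCoord_snd _ _ k).trans (hv' t y h k).symm))
  have hproj : N.tangentProj.comp Ψ = Φ := hb.curve_hom_ext hW fun t y h => (key t y h).1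
  refine ⟨Ψ, hproj, fun U f => ?_⟩
  subst hproj
  exact hb.curve_sec_ext hW fun t y h hU => (key t y h).2 U f hU hU

/-- Every supercurve has a velocity. -/
lemma exists_isVelocity (hN : N.IsSupermanifold m n) (hS : S.IsSupermanifold p q)
    (Φ : Hom (S.timeProd.restrict W) N) :
    ∃ Ψ : Hom (S.timeProd.restrict W) N.tangent, IsVelocity Φ Ψ := by
  have hloc : ∀ z : W, ∃ (A : Opens S.timeProd.body) (hA : A ≤ W) (_ : z.1 ∈ A)
      (Ψ : Hom (S.timeProd.restrict A) N.tangent),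
      IsVelocity (Φ.comp (S.timeProd.restrictIncl hA)) Ψ := by
    intro z
    obtain ⟨B, b, hb, hz⟩ := hS.exists_chart z.1.2
    obtain ⟨V, c, hc, hz'⟩ := hN.exists_chart (Φ.toMap z)
    let R : Opens S.timeProd.body :=
      ⟨Prod.snd ⁻¹' (hb.range : Set S.body), hb.range.isOpen.preimage continuous_snd⟩
    have hA : up (hc.range.comap Φ.toMap) ⊓ R ≤ W := fun x hx => (mem_up.1 hx.1).1
    refine ⟨up (hc.range.comap Φ.toMap) ⊓ R, hA, ⟨mem_up.2 ⟨z.2, hz'⟩, hz⟩, ?_⟩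
    exact exists_isVelocityAt_chart hS hb (fun z hz => hz.2) hc fun z => (mem_up.1 z.2.1).2
  choose A hA hzA Ψ hΨ using hloc
  have key : ∀ z (x : GrPoint S q) (t : ℝ) (hx : (t, x.pt) ∈ A z),
      IsVelocityAt Φ (curvePt W x t (hA z hx)) ((Ψ z).mapPt (curvePt (A z) x t hx)) :=
    fun z x t hx => by
      have h1 := (isVelocityAt_restrictIncl hS (hA z)).1 ((hΨ z).isVelocityAt (curvePt (A z) x t hx))
      rwa [restrictIncl_mapPt_curvePt] at h1
  obtain ⟨F, hF⟩ := exists_glue A W hA (fun z hz => ⟨⟨z, hz⟩, hzA _⟩) Ψ fun i j =>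
    curve_hom_ext hS fun x t hx => by
      rw [mapPt_comp, mapPt_comp, restrictIncl_mapPt_curvePt, restrictIncl_mapPt_curvePt]
      exact (key i x t hx.1).unique hN (key j x t hx.2)
  refine ⟨F, isVelocity_of_forall hS fun x t hx => ?_⟩
  have h1 := key ⟨_, hx⟩ x t (hzA ⟨_, hx⟩)
  rw [← hF ⟨_, hx⟩, mapPt_comp, restrictIncl_mapPt_curvePt] at h1
  exact h1

end SuperSpace
end

noncomputable section

namespace SuperSpace

/-! ### Uniqueness of supergeodesics -/

variable {N : SuperSpace.{u}} {S : SuperSpace.{v}} {m n p q r : ℕ}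

/-- The vector field on the space of coordinates and velocities that defines the geodesic flow in a
chart, evaluated at Grassmann-valued coordinates. -/
def geodesicField (D : N.Connection) {V : Opens (Fin m → ℝ)} {c : Hom (superDomain m n V) N}
    (hc : c.IsOpenImmersion) (d : Fin m ⊕ Fin n → N.vectorField hc.range)
    (Z : (Fin m ⊕ Fin n → Grassmann r) × (Fin m ⊕ Fin n → Grassmann r)) :
    (Fin m ⊕ Fin n → Grassmann r) × (Fin m ⊕ Fin n → Grassmann r) :=
  (Z.2, fun k => -∑ i, ∑ j, Z.2 i * Z.2 j * coordExt Z.1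
    (secFun (c.pull hc.range (vectorField.app (D.nabla hc.range (d j) (d i)) le_rfl (hc.coord k)))))

/-- The domain of the vector field of the geodesic flow in a chart with domain `V`. -/
def phaseDom (n r : ℕ) (V : Opens (Fin m → ℝ)) :
    Set ((Fin m ⊕ Fin n → Grassmann r) × (Fin m ⊕ Fin n → Grassmann r)) :=
  {Z | coordBody Z.1 ∈ V}

lemma isOpen_phaseDom (V : Opens (Fin m → ℝ)) : IsOpen (phaseDom n r V) :=
  V.isOpen.preimage ((contDiff_coordBody (m := m) (n := n) (q := r)).continuous.comp continuous_fst)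

section Chart

variable {V : Opens (Fin m → ℝ)} {c : Hom (superDomain m n V) N} (hc : c.IsOpenImmersion)
  {D : N.Connection} {d : Fin m ⊕ Fin n → N.vectorField hc.range}

lemma contDiffOn_geodesicField :
    ContDiffOn ℝ ∞ (geodesicField (r := r) D hc d) (phaseDom n r V) := by
  refine contDiffOn_snd.prodMk (contDiffOn_pi.2 fun k => ContDiffOn.neg (ContDiffOn.sum fun i _ =>
    ContDiffOn.sum fun j _ => ?_))
  have h1 : ∀ l, ContDiffOn ℝ ∞ (fun Z : (Fin m ⊕ Fin n → Grassmann r) ×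
      (Fin m ⊕ Fin n → Grassmann r) => Z.2 l) (phaseDom n r V) := fun l =>
    contDiffOn_pi.1 contDiffOn_snd l
  refine ((h1 i).mul (h1 j)).mul ?_
  have h2 := contDiffOn_secFun (c.pull hc.range
    (vectorField.app (D.nabla hc.range (d j) (d i)) le_rfl (hc.coord k)))
  refine (contDiffOn_coordExt (up (hc.range.comap c.toMap)).isOpen h2).comp contDiffOn_fst ?_
  intro Z hZ
  exact mem_up.2 ⟨hZ, ⟨_, rfl⟩⟩

variable {W W' : Opens S.timeProd.body} {Φ : Hom (S.timeProd.restrict W) N}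
  {Φ' : Hom (S.timeProd.restrict W') N}

/-- The coordinates and velocities of a supercurve at the Grassmann-valued point `x` as functions of
the time. -/
def coordCurve (Φ : Hom (S.timeProd.restrict W) N) (x : GrPoint S r) (t : ℝ) :
    (Fin m ⊕ Fin n → Grassmann r) × (Fin m ⊕ Fin n → Grassmann r) :=
  (fun k => (timePt x t).ev (U := up (hc.range.comap Φ.toMap)) (Φ.pull hc.range (hc.coord k)),
    fun k => (timePt x t).ev (U := up (hc.range.comap Φ.toMap))
      (timeDeriv (W := up (hc.range.comap Φ.toMap)) (Φ.pull hc.range (hc.coord k))))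

variable {hc}

lemma coordCurve_fst (x : GrPoint S r) {t : ℝ} (hW : (t, x.pt) ∈ W)
    (hx : Φ.toMap (curvePt W x t hW).pt ∈ hc.range) (k : Fin m ⊕ Fin n) :
    (coordCurve hc Φ x t).1 k = (Φ.mapPt (curvePt W x t hW)).app hc.range hx (hc.coord k) :=
  (curvePt_app x t hW (U := hc.range.comap Φ.toMap) hx (Φ.pull hc.range (hc.coord k))).symm

lemma coordCurve_snd (x : GrPoint S r) {t : ℝ} (hW : (t, x.pt) ∈ W)
    (hx : Φ.toMap (curvePt W x t hW).pt ∈ hc.range) (k : Fin m ⊕ Fin n) :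
    (coordCurve hc Φ x t).2 k = (curvePt W x t hW).app (hc.range.comap Φ.toMap) hx
      (dt (Φ.pull hc.range (hc.coord k))) :=
  (curvePt_app x t hW (U := hc.range.comap Φ.toMap) hx (dt (Φ.pull hc.range (hc.coord k)))).symm

lemma coordCurve_mem (x : GrPoint S r) {t : ℝ} (hW : (t, x.pt) ∈ W)
    (hx : Φ.toMap (curvePt W x t hW).pt ∈ hc.range) : coordCurve hc Φ x t ∈ phaseDom n r V :=
  (hc.exists_coordPt (Φ.mapPt (curvePt W x t hW)) hx fun k => (coordCurve_fst x hW hx k).symm).1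

/-- The acceleration that is prescribed by the Christoffel symbols. -/
lemma geodesicField_snd_coordCurve (x : GrPoint S r) {t : ℝ} (hW : (t, x.pt) ∈ W)
    (hx : Φ.toMap (curvePt W x t hW).pt ∈ hc.range) (k : Fin m ⊕ Fin n) :
    (geodesicField D hc d (coordCurve hc Φ x t)).2 k = -(curvePt W x t hW).app (hc.range.comap Φ.toMap) hx
      (∑ i, ∑ j, dt (Φ.pull hc.range (hc.coord i)) * dt (Φ.pull hc.range (hc.coord j)) *
        Φ.pull hc.range (vectorField.app (D.nabla hc.range (d j) (d i)) le_rfl (hc.coord k))) := by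
  obtain ⟨hV, e⟩ := hc.exists_coordPt (Φ.mapPt (curvePt W x t hW)) hx fun k =>
    (coordCurve_fst x hW hx k).symm
  rw [map_sum]
  refine congrArg Neg.neg (Finset.sum_congr rfl fun i _ => ((map_sum _ _ _).trans
    (Finset.sum_congr rfl fun j _ => ?_)).symm)
  rw [map_mul, map_mul, coordCurve_snd x hW hx, coordCurve_snd x hW hx]
  refine congrArg _ ?_
  exact GrPoint.app_congr e (U := hc.range) hx ⟨_, rfl⟩ _

/-- In a chart supergeodesics are integral curves of the geodesic flow. -/
lemma hasDerivAt_coordCurve (hS : S.IsSupermanifold p q) (hd : IsCoordDer hc.coord d)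
    (h : IsSupergeodesic D Φ) (x : GrPoint S r) {t : ℝ} (hW : (t, x.pt) ∈ W)
    (hx : Φ.toMap (curvePt W x t hW).pt ∈ hc.range) :
    HasDerivAt (coordCurve hc Φ x) (geodesicField D hc d (coordCurve hc Φ x t)) t := by
  refine HasDerivAt.prodMk (hasDerivAt_pi.2 fun k => ?_) (hasDerivAt_pi.2 fun k => ?_)
  · have h1 := hasDerivAt_curve hS (Φ.pull hc.range (hc.coord k)) x hW hx
    rw [← coordCurve_snd x hW hx k] at h1
    exact h1
  · have h1 := hasDerivAt_curve hS (dt (Φ.pull hc.range (hc.coord k))) x hW hx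
    have h2 := congrArg ((curvePt W x t hW).app (hc.range.comap Φ.toMap) hx)
      (h.geodesicEquation hS hc.isCoord hd k)
    rw [map_add, map_zero] at h2
    rw [eq_neg_of_add_eq_zero_left h2, ← geodesicField_snd_coordCurve x hW hx k] at h1
    exact h1

/-- The velocities of two supercurves at a time are equal if and only if their coordinates and
components in a chart are. -/
lemma eq_iff_coordCurve_eq {x : GrPoint S r} {t : ℝ} (hW : (t, x.pt) ∈ W) (hW' : (t, x.pt) ∈ W')
    (hx : Φ.toMap (curvePt W x t hW).pt ∈ hc.range)
    (hx' : Φ'.toMap (curvePt W' x t hW').pt ∈ hc.range) {ξ ξ' : GrPoint N.tangent r}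
    (h : IsVelocityAt Φ (curvePt W x t hW) ξ) (h' : IsVelocityAt Φ' (curvePt W' x t hW') ξ') :
    ξ = ξ' ↔ coordCurve hc Φ x t = coordCurve hc Φ' x t := by
  have h1 : N.tangentProj.toMap ξ.pt = Φ.toMap (curvePt W x t hW).pt := congrArg GrPoint.pt h.1
  have h2 : N.tangentProj.toMap ξ'.pt = Φ'.toMap (curvePt W' x t hW').pt := congrArg GrPoint.pt h'.1
  have hξ : N.tangentProj.toMap ξ.pt ∈ hc.range := h1 ▸ hx
  have hξ' : N.tangentProj.toMap ξ'.pt ∈ hc.range := h2 ▸ hx'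
  have e1 : ∀ k, (coordCurve hc Φ x t).1 k = (N.tangentProj.mapPt ξ).app hc.range hξ (hc.coord k) :=
    fun k => (coordCurve_fst x hW hx k).trans (GrPoint.app_congr h.1 (U := hc.range) hξ hx _).symm
  have e2 : ∀ k, (coordCurve hc Φ' x t).1 k = (N.tangentProj.mapPt ξ').app hc.range hξ' (hc.coord k) :=
    fun k => (coordCurve_fst x hW' hx' k).trans (GrPoint.app_congr h'.1 (U := hc.range) hξ' hx' _).symm
  have e3 := fun k => (coordCurve_snd x hW hx k).trans (h.2 hc.range (hc.coord k) hξ hx).symm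
  have e4 := fun k => (coordCurve_snd x hW' hx' k).trans (h'.2 hc.range (hc.coord k) hξ' hx').symm
  constructor
  · rintro rfl
    exact Prod.ext (funext fun k => (e1 k).trans (e2 k).symm)
      (funext fun k => (e3 k).trans (e4 k).symm)
  · intro e
    exact hc.tangent_ext (hc.grPoint_ext hξ hξ' fun k =>
      (e1 k).symm.trans ((congrFun (congrArg Prod.fst e) k).trans (e2 k))) hξ hξ' fun k =>
        (e3 k).symm.trans ((congrFun (congrArg Prod.snd e) k).trans (e4 k))

end Chart

variable {W W' : Opens S.timeProd.body} {Φ : Hom (S.timeProd.restrict W) N}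
  {Φ' : Hom (S.timeProd.restrict W') N}

/-- `Φ` is a supergeodesic with initial condition `J` on a domain that meets every line `ℝ × {s}` in
an interval that is empty or contains `0`. The initial condition is stated for the Grassmann-valued
points of `S`. -/
structure IsPartialGeodesic (q : ℕ) (D : N.Connection) (J : Hom S N.tangent) (W : Opens S.timeProd.body)
    (Φ : Hom (S.timeProd.restrict W) N) : Prop where
  zero_mem : ∀ z ∈ W, ((0 : ℝ), z.2) ∈ W
  ordConnected : ∀ s : S.body, {t : ℝ | (t, s) ∈ W}.OrdConnected
  geodesic : IsSupergeodesic D Φ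
  initial : ∀ (x : GrPoint S q) (h : ((0 : ℝ), x.pt) ∈ W),
    IsVelocityAt Φ (curvePt W x 0 h) (J.mapPt x)

lemma injZero_mapPt (h : ∀ s : S.body, ((0 : ℝ), s) ∈ W) (x : GrPoint S r) :
    (injZero W h).mapPt x = curvePt W x 0 (h _) :=
  GrPoint.ext' rfl fun U _ _ => x.app_res (U := timeSlice (up U) 0) _ _ _

lemma IsGeodesicFrom.isPartialGeodesic {D : N.Connection} {J : Hom S N.tangent}
    (h : IsGeodesicFrom D J W Φ) : IsPartialGeodesic q D J W Φ where
  zero_mem z _ := h.zero_mem z.2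
  ordConnected := h.ordConnected
  geodesic := h.geodesic
  initial x hx := by
    obtain ⟨Ψ, hΨ, hJ⟩ := h.initial
    rw [← hJ, mapPt_comp, injZero_mapPt]
    exact hΨ.isVelocityAt _

/-- The velocities of two supergeodesics that agree at a time agree near this time. -/
lemma eventually_coordCurve_eq (hS : S.IsSupermanifold p q) {D : N.Connection}
    {V : Opens (Fin m → ℝ)} {c : Hom (superDomain m n V) N} (hc : c.IsOpenImmersion)
    (h : IsSupergeodesic D Φ) (h' : IsSupergeodesic D Φ') (x : GrPoint S r) {t₀ : ℝ}
    (hx : ∀ᶠ t in nhds t₀, ∃ hW, Φ.toMap (curvePt W x t hW).pt ∈ hc.range)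
    (hx' : ∀ᶠ t in nhds t₀, ∃ hW, Φ'.toMap (curvePt W' x t hW).pt ∈ hc.range)
    (e : coordCurve hc Φ x t₀ = coordCurve hc Φ' x t₀) :
    ∀ᶠ t in nhds t₀, coordCurve hc Φ x t = coordCurve hc Φ' x t := by
  obtain ⟨d, hd⟩ := hc.exists_isCoordDer
  obtain ⟨hW, hr⟩ := hx.self_of_nhds
  have hmem := coordCurve_mem x hW hr
  have hsm := (contDiffOn_geodesicField (r := r) hc (D := D) (d := d)).contDiffAt
    ((isOpen_phaseDom V).mem_nhds hmem)
  obtain ⟨K, s, hs, hK⟩ := (hsm.of_le (m := 1) (by norm_cast)).exists_lipschitzOnWith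
  have h1 : ∀ᶠ t in nhds t₀, HasDerivAt (coordCurve hc Φ x)
      (geodesicField D hc d (coordCurve hc Φ x t)) t := by
    filter_upwards [hx] with t ht
    exact hasDerivAt_coordCurve hS hd h x ht.1 ht.2
  have h2 : ∀ᶠ t in nhds t₀, HasDerivAt (coordCurve hc Φ' x)
      (geodesicField D hc d (coordCurve hc Φ' x t)) t := by
    filter_upwards [hx'] with t ht
    exact hasDerivAt_coordCurve hS hd h' x ht.1 ht.2
  exact ODE_solution_unique_of_eventually (v := fun _ => geodesicField D hc d) (s := fun _ => s)
    (Filter.Eventually.of_forall fun _ => hK)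
    (h1.and (h1.self_of_nhds.continuousAt.eventually_mem hs))
    (h2.and (h2.self_of_nhds.continuousAt.eventually_mem (e ▸ hs))) e

/-- Uniqueness of supergeodesics with a given initial condition. -/
lemma IsPartialGeodesic.eq (hN : N.IsSupermanifold m n) (hS : S.IsSupermanifold p q)
    {D : N.Connection} {J : Hom S N.tangent} (h : IsPartialGeodesic q D J W Φ)
    (h' : IsPartialGeodesic q D J W' Φ') (x : GrPoint S q) (t : ℝ) (hW : (t, x.pt) ∈ W)
    (hW' : (t, x.pt) ∈ W') : Φ.mapPt (curvePt W x t hW) = Φ'.mapPt (curvePt W' x t hW') := by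
  obtain ⟨Ψ, hΨ⟩ := exists_isVelocity hN hS Φ
  obtain ⟨Ψ', hΨ'⟩ := exists_isVelocity hN hS Φ'
  have := hN.t2
  let I : Set ℝ := {t | (t, x.pt) ∈ W} ∩ {t | (t, x.pt) ∈ W'}
  have hI : I.OrdConnected := (h.ordConnected x.pt).inter (h'.ordConnected x.pt)
  have : PreconnectedSpace I := isPreconnected_iff_preconnectedSpace.1 hI.isPreconnected
  let f : I → N.body := fun t => Φ.toMap (curvePt W x t t.2.1).pt
  let f' : I → N.body := fun t => Φ'.toMap (curvePt W' x t t.2.2).pt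
  have hf : Continuous f := by
    refine Φ.toMap.continuous.comp (Continuous.subtype_mk ?_ _)
    exact continuous_subtype_val.prodMk continuous_const
  have hf' : Continuous f' := by
    refine Φ'.toMap.continuous.comp (Continuous.subtype_mk ?_ _)
    exact continuous_subtype_val.prodMk continuous_const
  have hnhds : ∀ {R : Opens N.body} (t : I), f t ∈ R →
      ∀ᶠ t in nhds t.1, ∃ hW, Φ.toMap (curvePt W x t hW).pt ∈ R := fun {R} t ht => by
    filter_upwards [eventually_mem_up x t.2.1 (U := R.comap Φ.toMap) ht] with t' ht'
    exact mem_up.1 ht'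
  have hnhds' : ∀ {R : Opens N.body} (t : I), f' t ∈ R →
      ∀ᶠ t in nhds t.1, ∃ hW, Φ'.toMap (curvePt W' x t hW).pt ∈ R := fun {R} t ht => by
    filter_upwards [eventually_mem_up x t.2.2 (U := R.comap Φ'.toMap) ht] with t' ht'
    exact mem_up.1 ht'
  -- the times at which the velocities, as points of the tangent bundle, agree; the points of `N` alone
  -- would not define an open set
  let A : Set I := {t | Ψ.mapPt (curvePt W x t t.2.1) = Ψ'.mapPt (curvePt W' x t t.2.2)}
  have hAf : ∀ t ∈ A, f t = f' t := fun t ht => by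
    have h1 : N.tangentProj.toMap (Ψ.mapPt (curvePt W x t t.2.1)).pt = f t :=
      congrArg GrPoint.pt (hΨ.isVelocityAt (curvePt W x t t.2.1)).1
    have h2 : N.tangentProj.toMap (Ψ'.mapPt (curvePt W' x t t.2.2)).pt = f' t :=
      congrArg GrPoint.pt (hΨ'.isVelocityAt (curvePt W' x t t.2.2)).1
    rw [← h1, ← h2, show Ψ.mapPt (curvePt W x t t.2.1) = Ψ'.mapPt (curvePt W' x t t.2.2) from ht]
  have hiff : ∀ (t : I) {V : Opens (Fin m → ℝ)} {c : Hom (superDomain m n V) N}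
      (hc : c.IsOpenImmersion), f t ∈ hc.range → f' t ∈ hc.range →
      (t ∈ A ↔ coordCurve hc Φ x t = coordCurve hc Φ' x t) := fun t V c hc h1 h2 =>
    eq_iff_coordCurve_eq t.2.1 t.2.2 h1 h2 (hΨ.isVelocityAt _) (hΨ'.isVelocityAt _)
  have hopen : IsOpen A := by
    refine isOpen_iff_mem_nhds.2 fun t ht => ?_
    obtain ⟨V, c, hc, hr⟩ := hN.exists_chart (f t)
    have hr' : f t ∈ hc.range := hr
    have hr2 : f' t ∈ hc.range := hAf t ht ▸ hr'
    have h1 := eventually_coordCurve_eq hS hc h.geodesic h'.geodesic x (hnhds t hr') (hnhds' t hr2)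
      ((hiff t hc hr' hr2).1 ht)
    filter_upwards [continuous_subtype_val.continuousAt.eventually h1,
      hf.continuousAt.eventually_mem (hc.range.isOpen.mem_nhds hr'),
      hf'.continuousAt.eventually_mem (hc.range.isOpen.mem_nhds hr2)] with t' h1 h2 h3
    exact (hiff t' hc h2 h3).2 h1
  -- `N` is Hausdorff, so that two curves with different values at a time remain apart near this time; at
  -- equal values the continuous coordinates and velocities in a chart are compared
  have hclosed : IsClosed A := by
    refine ⟨isOpen_iff_mem_nhds.2 fun t ht => ?_⟩
    by_cases e : f t = f' t
    · obtain ⟨V, c, hc, hr⟩ := hN.exists_chart (f t)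
      have hr' : f t ∈ hc.range := hr
      have hr2 : f' t ∈ hc.range := e ▸ hr'
      obtain ⟨d, hd⟩ := hc.exists_isCoordDer
      have h1 := (hasDerivAt_coordCurve hS hd h.geodesic x t.2.1 hr').continuousAt
      have h2 := (hasDerivAt_coordCurve hS hd h'.geodesic x t.2.2 hr2).continuousAt
      have h3 : ∀ᶠ t in nhds t.1, coordCurve hc Φ x t ≠ coordCurve hc Φ' x t := by
        filter_upwards [(h1.sub h2).eventually_ne (sub_ne_zero.2 fun e =>
          ht ((hiff t hc hr' hr2).2 e))] with t' ht' using sub_ne_zero.1 ht'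
      filter_upwards [continuous_subtype_val.continuousAt.eventually h3,
        hf.continuousAt.eventually_mem (hc.range.isOpen.mem_nhds hr'),
        hf'.continuousAt.eventually_mem (hc.range.isOpen.mem_nhds hr2)] with t' h1 h2 h3 ht'
      exact h1 ((hiff t' hc h2 h3).1 ht')
    · filter_upwards [((isClosed_eq hf hf').isOpen_compl).mem_nhds e] with t' h1 ht'
      exact h1 (hAf t' ht')
  have h0 : (0 : ℝ) ∈ I := ⟨h.zero_mem _ hW, h'.zero_mem _ hW'⟩
  have hA0 : (⟨0, h0⟩ : I) ∈ A :=
    ((hΨ.isVelocityAt _).unique hN (h.initial x h0.1)).trans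
      ((hΨ'.isVelocityAt _).unique hN (h'.initial x h0.2)).symm
  have hA : A = Set.univ := IsClopen.eq_univ ⟨hclosed, hopen⟩ ⟨_, hA0⟩
  have ht : (⟨t, hW, hW'⟩ : I) ∈ A := hA ▸ Set.mem_univ _
  exact (hΨ.isVelocityAt (curvePt W x t hW)).1.symm.trans
    ((congrArg N.tangentProj.mapPt ht).trans (hΨ'.isVelocityAt (curvePt W' x t hW')).1)

end SuperSpace
end

noncomputable section

namespace SuperSpace

/-! ### Local existence of supergeodesics -/

variable {N : SuperSpace.{u}} {S : SuperSpace.{v}} {m n p q r : ℕ}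

/-- The geodesic flow preserves the parity of the velocities, because the Christoffel symbols have the
parity of the sum of the parities of their indices. -/
lemma geodesicField_mem {D : N.Connection} {V : Opens (Fin m → ℝ)} {c : Hom (superDomain m n V) N}
    (hc : c.IsOpenImmersion) {d : Fin m ⊕ Fin n → N.vectorField hc.range}
    (hd : IsCoordDer hc.coord d) {Z : (Fin m ⊕ Fin n → Grassmann r) × (Fin m ⊕ Fin n → Grassmann r)}
    (hZ : Z ∈ phaseDom n r V) (h : ∀ k, Z.2 k ∈ grassmannPart r (coordParity k)) (k : Fin m ⊕ Fin n) :
    (geodesicField D hc d Z).2 k ∈ grassmannPart r (coordParity k) := by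
  refine Submodule.neg_mem _ (Submodule.sum_mem _ fun i _ => Submodule.sum_mem _ fun j _ => ?_)
  have h1 := (D.nabla_mem (hd j).1 (hd i).1).2.1 ⟨hc.range, Set.mem_Iic.2 le_rfl⟩ _ _ (hc.isCoord.mem k)
  have h2 := (coordPt Z.1 hZ).app_mem (U := hc.range.comap c.toMap) ⟨_, rfl⟩ (c.pull_mem h1)
  have h3 := CliffordAlgebra.evenOdd_mul_le _ _ _ (Submodule.mul_mem_mul
    (CliffordAlgebra.evenOdd_mul_le _ _ _ (Submodule.mul_mem_mul (h i) (h j))) h2)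
  have e : ∀ a b c : ZMod 2, a + b + (b + a + c) = c := by decide
  rw [e] at h3
  exact h3

/-- The projection of coordinates and velocities to their homogeneous parts. -/
def phaseProj (m n r : ℕ) :
    ((Fin m ⊕ Fin n → Grassmann r) × (Fin m ⊕ Fin n → Grassmann r)) →L[ℝ]
      ((Fin m ⊕ Fin n → Grassmann r) × (Fin m ⊕ Fin n → Grassmann r)) :=
  (LinearMap.prodMap parityProj parityProj).toContinuousLinearMap

lemma parityProj_mem (X : Fin m ⊕ Fin n → Grassmann r) (k : Fin m ⊕ Fin n) :
    parityProj X k ∈ grassmannPart r (coordParity k) := grassmannProj_mem _ _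

lemma phaseProj_mem {V : Opens (Fin m → ℝ)}
    {Z : (Fin m ⊕ Fin n → Grassmann r) × (Fin m ⊕ Fin n → Grassmann r)} (h : Z ∈ phaseDom n r V) :
    phaseProj m n r Z ∈ phaseDom n r V := by
  have e : coordBody (phaseProj m n r Z).1 = coordBody Z.1 := coordBody_parityProj Z.1
  change coordBody (phaseProj m n r Z).1 ∈ V
  rw [e]; exact h

lemma phaseProj_eq {Z : (Fin m ⊕ Fin n → Grassmann r) × (Fin m ⊕ Fin n → Grassmann r)}
    (h : ∀ k, Z.1 k ∈ grassmannPart r (coordParity k)) (h' : ∀ k, Z.2 k ∈ grassmannPart r (coordParity k)) :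
    phaseProj m n r Z = Z := Prod.ext (parityProj_eq h) (parityProj_eq h')

/-- The geodesic flow in a chart: a smooth local flow whose homogeneous parts are integral curves. -/
lemma exists_geodesic_flow (D : N.Connection) {V : Opens (Fin m → ℝ)} {c : Hom (superDomain m n V) N}
    (hc : c.IsOpenImmersion) {d : Fin m ⊕ Fin n → N.vectorField hc.range}
    (hd : IsCoordDer hc.coord d) {Z₀ : (Fin m ⊕ Fin n → Grassmann r) × (Fin m ⊕ Fin n → Grassmann r)}
    (hZ₀ : Z₀ ∈ phaseDom n r V) :
    ∃ (T : ℝ) (Y : ℝ × ((Fin m ⊕ Fin n → Grassmann r) × (Fin m ⊕ Fin n → Grassmann r)) →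
        (Fin m ⊕ Fin n → Grassmann r) × (Fin m ⊕ Fin n → Grassmann r)), 0 < T ∧
      ContDiffOn ℝ ∞ Y (Set.Ioo (-T) T ×ˢ Metric.ball Z₀ T) ∧ ∀ Z ∈ Metric.ball Z₀ T,
        Y (0, Z) = phaseProj m n r Z ∧ ∀ t ∈ Set.Ioo (-T) T, Y (t, Z) ∈ phaseDom n r V ∧
          (∀ k, (Y (t, Z)).1 k ∈ grassmannPart r (coordParity k)) ∧
          HasDerivAt (fun t => Y (t, Z)) (geodesicField D hc d (Y (t, Z))) t := by
  obtain ⟨T, φ, hT, hφ, h⟩ := exists_smooth_flow_on (isOpen_phaseDom V)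
    ((contDiffOn_geodesicField hc (D := D) (d := d)).comp (phaseProj m n r).contDiff.contDiffOn
      fun _ hZ => phaseProj_mem hZ) hZ₀
  refine ⟨T, fun z => phaseProj m n r (φ z), hT, (phaseProj m n r).contDiff.comp_contDiffOn hφ,
    fun Z hZ => ⟨congrArg _ (h Z hZ).1, fun t ht => ?_⟩⟩
  obtain ⟨h1, h2⟩ := (h Z hZ).2 t ht
  refine ⟨phaseProj_mem h1, fun k => parityProj_mem _ k, ?_⟩
  have h3 := (phaseProj m n r).hasFDerivAt.comp_hasDerivAt t h2
  have h4 : phaseProj m n r (geodesicField D hc d (phaseProj m n r (φ (t, Z)))) =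
      geodesicField D hc d (phaseProj m n r (φ (t, Z))) :=
    phaseProj_eq (fun k => parityProj_mem _ k)
      (geodesicField_mem hc hd (phaseProj_mem h1) fun k => parityProj_mem _ k)
  have h5 : phaseProj m n r ((geodesicField D hc d ∘ phaseProj m n r) (φ (t, Z))) =
      geodesicField D hc d (phaseProj m n r (φ (t, Z))) := h4
  rw [h5] at h3
  exact h3

/-- Equalities of sections can be checked at the points of a chart. -/
lemma Hom.IsOpenImmersion.app_eq_of_domPt {B : Opens (Fin p → ℝ)} {b : Hom (superDomain p q B) S}
    (hb : b.IsOpenImmersion) {Q U U' : Opens S.body} (hQ : Q ≤ hb.range) (hU : Q ≤ U) (hU' : Q ≤ U')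
    {f : S.O U} {f' : S.O U'}
    (h : ∀ (y : B) (hy : b.toMap y ∈ Q), (b.mapPt (domPt y)).app U (hU hy) f =
      (b.mapPt (domPt y)).app U' (hU' hy) f') (x : GrPoint S r) (hx : x.pt ∈ Q) :
    x.app U (hU hx) f = x.app U' (hU' hx) f' := by
  have e : S.res hU f = S.res hU' f' := hb.pull_injective hQ (domPt_ext fun y hy =>
    ((b.mapPt (domPt y)).app_res hU hy f).trans
      ((h y hy).trans ((b.mapPt (domPt y)).app_res hU' hy f').symm))
  exact (x.app_res hU hx f).symm.trans ((congrArg (x.app Q hx) e).trans (x.app_res hU' hx f'))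

section Chart

variable {V : Opens (Fin m → ℝ)} {c : Hom (superDomain m n V) N} {hc : c.IsOpenImmersion}
  {D : N.Connection} {d : Fin m ⊕ Fin n → N.vectorField hc.range} {W : Opens S.timeProd.body}
  {Φ : Hom (S.timeProd.restrict W) N}

/-- Supercurves whose coordinates are integral curves of the geodesic flow are supergeodesics. -/
lemma isSupergeodesic_of_hasDerivAt (hN : N.IsSupermanifold m n) (hS : S.IsSupermanifold p q)
    {B : Opens (Fin p → ℝ)} {b : Hom (superDomain p q B) S} (hb : b.IsOpenImmersion)
    (hW : ∀ z ∈ W, z.2 ∈ hb.range) (hd : IsCoordDer hc.coord d) (hΦ : ∀ z, Φ.toMap z ∈ hc.range)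
    (h : ∀ t (y : B), (t, b.toMap y) ∈ W → HasDerivAt (coordCurve hc Φ (b.mapPt (domPt y)))
      (geodesicField D hc d (coordCurve hc Φ (b.mapPt (domPt y)) t)) t) : IsSupergeodesic D Φ := by
  refine isSupergeodesic_of_local hN hS fun w => ⟨V, c, hc, hc.range, le_rfl, d, hΦ w, hd, ?_⟩
  have key : GeodesicEquation D Φ hc.coord d := fun k => hb.curve_sec_ext hW fun t y hz hU => by
    have h1 := hasDerivAt_curve hS (dt (Φ.pull hc.range (hc.coord k))) (b.mapPt (domPt y)) hz hU
    have h2 := h1.unique (hasDerivAt_pi.1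
      ((ContinuousLinearMap.snd ℝ _ _).hasFDerivAt.comp_hasDerivAt t (h t y hz)) k)
    have h3 := geodesicField_snd_coordCurve (D := D) (d := d) (b.mapPt (domPt y)) hz hU k
    rw [map_add, map_zero, h2]
    exact (congrArg (· + _) h3).trans (neg_add_cancel _)
  have e : (fun k => N.res (le_refl hc.range) (hc.coord k)) = hc.coord :=
    funext fun k => N.res_self _ _
  rw [e]
  exact key

end Chart

/-- Local existence of supergeodesics with a given initial condition. -/
lemma exists_local_geodesic (hN : N.IsSupermanifold m n) (hS : S.IsSupermanifold p q)
    (D : N.Connection) (J : Hom S N.tangent) (s₀ : S.body) :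
    ∃ (W : Opens S.timeProd.body) (Φ : Hom (S.timeProd.restrict W) N),
      IsPartialGeodesic q D J W Φ ∧ ((0 : ℝ), s₀) ∈ W := by
  obtain ⟨B, b, hb, y₀, rfl⟩ := hS.exists_chart s₀
  obtain ⟨V, c, hc, hr⟩ := hN.exists_chart (N.tangentProj.toMap (J.toMap (b.toMap y₀)))
  obtain ⟨d, hd⟩ := hc.exists_isCoordDer
  let R : Opens S.body := (hc.range.comap N.tangentProj.toMap).comap J.toMap
  have hr' : b.toMap y₀ ∈ R := hr
  -- the coordinates and the components of the initial condition, and their expressions `Z` in the chart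
  -- `b` of `S`
  let X₀ : Fin m ⊕ Fin n → S.O R := fun k =>
    J.pull (hc.range.comap N.tangentProj.toMap) (N.tangentProj.pull hc.range (hc.coord k))
  let V₀ : Fin m ⊕ Fin n → S.O R := fun k =>
    J.pull (hc.range.comap N.tangentProj.toMap) (N.tangentDiff hc.range (hc.coord k))
  have hX₀ : ∀ k, X₀ k ∈ S.gr R (coordParity k) := fun k =>
    J.pull_mem (N.tangentProj.pull_mem (hc.isCoord.mem k))
  have hV₀ : ∀ k, V₀ k ∈ S.gr R (coordParity k) := fun k =>
    J.pull_mem (tangentDiff_mem (hc.isCoord.mem k))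
  let Z : (Fin p → ℝ) → (Fin m ⊕ Fin n → Grassmann q) × (Fin m ⊕ Fin n → Grassmann q) := fun y =>
    (fun k => secFun (b.pull R (X₀ k)) y, fun k => secFun (b.pull R (V₀ k)) y)
  have hZ1 : ∀ (y : B) (hy : b.toMap y ∈ R) k, (b.mapPt (domPt y)).app R hy (X₀ k) = (Z y.1).1 k :=
    fun y hy k => domPt_secFun (b.pull R (X₀ k)) y hy
  have hZ2 : ∀ (y : B) (hy : b.toMap y ∈ R) k, (b.mapPt (domPt y)).app R hy (V₀ k) = (Z y.1).2 k :=
    fun y hy k => domPt_secFun (b.pull R (V₀ k)) y hy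
  have hZ : ContDiffOn ℝ ∞ Z (up (W := B) (R.comap b.toMap)) :=
    (contDiffOn_pi.2 fun k => contDiffOn_secFun (b.pull R (X₀ k))).prodMk
      (contDiffOn_pi.2 fun k => contDiffOn_secFun (b.pull R (V₀ k)))
  have hZV : ∀ (y : B), b.toMap y ∈ R → Z y.1 ∈ phaseDom n q V := fun y hy =>
    (hc.exists_coordPt (N.tangentProj.mapPt (J.mapPt (b.mapPt (domPt y)))) hy fun k => hZ1 y hy k).1
  obtain ⟨T, Y, hT, hY, hflow⟩ := exists_geodesic_flow D hc hd (hZV y₀ hr')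
  have hB' : IsOpen ((up (W := B) (R.comap b.toMap) : Set (Fin p → ℝ)) ∩ Z ⁻¹' Metric.ball (Z y₀.1) T) :=
    hZ.continuousOn.isOpen_inter_preimage (up (W := B) (R.comap b.toMap)).isOpen Metric.isOpen_ball
  let B' : Opens (superDomain p q B).body :=
    ⟨{y | b.toMap y ∈ R ∧ Z y.1 ∈ Metric.ball (Z y₀.1) T}, by
      have h1 : IsOpen {y : B | y.1 ∈ (up (W := B) (R.comap b.toMap) : Set (Fin p → ℝ)) ∩
        Z ⁻¹' Metric.ball (Z y₀.1) T} := hB'.preimage continuous_subtype_val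
      have e : {y : B | b.toMap y ∈ R ∧ Z y.1 ∈ Metric.ball (Z y₀.1) T} = {y : B | y.1 ∈
          (up (W := B) (R.comap b.toMap) : Set (Fin p → ℝ)) ∩ Z ⁻¹' Metric.ball (Z y₀.1) T} :=
        Set.ext fun y => and_congr_left fun _ => ⟨fun h => mem_up.2 ⟨y.2, h⟩, fun h => (mem_up.1 h).2⟩
      exact e ▸ h1⟩
  let W : Opens S.timeProd.body := ⟨Set.Ioo (-T) T ×ˢ (hb.img B' : Set S.body),
    isOpen_Ioo.prod (hb.img B').isOpen⟩
  have hWr : ∀ z ∈ W, z.2 ∈ hb.range := by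
    rintro ⟨t, s⟩ ⟨-, y, -, rfl⟩
    exact ⟨y, rfl⟩
  have hmemW : ∀ t (y : B), (t, b.toMap y) ∈ W ↔ t ∈ Set.Ioo (-T) T ∧ y ∈ B' := fun t y => by
    constructor
    · rintro ⟨ht, y', hy', e⟩
      obtain rfl := hb.injective e
      exact ⟨ht, hy'⟩
    · rintro ⟨ht, hy⟩
      exact ⟨ht, y, hy, rfl⟩
  have hD : ∀ z ∈ timeDom S b W, z.1 ∈ Set.Ioo (-T) T ∧ Z z.2 ∈ Metric.ball (Z y₀.1) T ∧
      z.2 ∈ up (W := B) (R.comap b.toMap) := by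
    rintro ⟨t, y⟩ ⟨hy, h⟩
    obtain ⟨h1, h2, h3⟩ := (hmemW t ⟨y, hy⟩).1 h
    exact ⟨h1, h3, mem_up.2 ⟨hy, h2⟩⟩
  have hYs : ContDiffOn ℝ ∞ (fun z : ℝ × (Fin p → ℝ) => (Y (z.1, Z z.2)).1) (timeDom S b W) := by
    refine ContDiff.comp_contDiffOn contDiff_fst (hY.comp
      (contDiffOn_fst.prodMk (hZ.comp contDiffOn_snd fun z hz => (hD z hz).2.2)) fun z hz => ?_)
    exact ⟨(hD z hz).1, (hD z hz).2.1⟩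
  -- the supercurve whose coordinates are the values of the flow at the initial conditions `Z`
  obtain ⟨Φ, hΦ⟩ := hb.exists_time_hom hWr c hYs fun z hz =>
    ((hflow _ (hD z hz).2.1).2 _ (hD z hz).1).1
  have hΦr : ∀ z, Φ.toMap z ∈ hc.range := by
    rintro ⟨⟨t, s⟩, hz⟩
    obtain ⟨y, rfl⟩ : s ∈ hb.range := hWr _ hz
    exact ⟨_, (congrArg GrPoint.pt (hΦ t y hz)).symm⟩
  -- the second component of the flow is the velocity of the first one
  have hcoord : ∀ t (y : B) (hz : (t, b.toMap y) ∈ W),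
      coordCurve hc Φ (b.mapPt (domPt y)) t = Y (t, Z y.1) := by
    have h1 : ∀ t (y : B) (hz : (t, b.toMap y) ∈ W) k,
        (coordCurve hc Φ (b.mapPt (domPt y)) t).1 k = (Y (t, Z y.1)).1 k := fun t y hz k => by
      have h2 := (hflow _ (hD (t, y.1) ⟨y.2, hz⟩).2.1).2 _ (hD (t, y.1) ⟨y.2, hz⟩).1
      refine (coordCurve_fst (b.mapPt (domPt y)) hz (hΦr _) k).trans
        ((GrPoint.app_congr (hΦ t y hz) (U := hc.range) (hΦr _) ⟨_, rfl⟩ (hc.coord k)).trans ?_)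
      refine (hc.mapPt_coord k _ _).trans ((coordPt_stdCoord _ _ _ k).trans ?_)
      exact congrFun (parityProj_eq h2.2.1) k
    intro t y hz
    have h2 := (hflow _ (hD (t, y.1) ⟨y.2, hz⟩).2.1).2 _ (hD (t, y.1) ⟨y.2, hz⟩).1
    refine Prod.ext (funext fun k => h1 t y hz k) (funext fun k => ?_)
    have h3 := hasDerivAt_curve hS (Φ.pull hc.range (hc.coord k)) (b.mapPt (domPt y)) hz (hΦr _)
    have h4 := hasDerivAt_pi.1 ((ContinuousLinearMap.fst ℝ _ _).hasFDerivAt.comp_hasDerivAt t h2.2.2) k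
    refine (coordCurve_snd (b.mapPt (domPt y)) hz (hΦr _) k).trans (h3.unique
      (h4.congr_of_eventuallyEq ?_))
    filter_upwards [isOpen_Ioo.mem_nhds (hD (t, y.1) ⟨y.2, hz⟩).1] with t' ht'
    exact h1 t' y ((hmemW t' y).2 ⟨ht', ((hmemW t y).1 hz).2⟩) k
  refine ⟨W, Φ, ⟨?_, fun s => ?_, ?_, fun x hx => ?_⟩, (hmemW 0 y₀).2 ⟨⟨by linarith, hT⟩, hr',
    Metric.mem_ball_self hT⟩⟩
  · rintro ⟨t, s⟩ ⟨-, hs⟩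
    exact ⟨⟨by change -T < (0 : ℝ); linarith, hT⟩, hs⟩
  · by_cases hs : s ∈ hb.img B'
    · have e : {t : ℝ | (t, s) ∈ W} = Set.Ioo (-T) T := Set.ext fun t => ⟨fun h => h.1, fun h => ⟨h, hs⟩⟩
      rw [e]; exact Set.ordConnected_Ioo
    · have e : {t : ℝ | (t, s) ∈ W} = ∅ := Set.eq_empty_of_forall_notMem fun t h => hs h.2
      rw [e]; exact Set.ordConnected_empty
  · refine isSupergeodesic_of_hasDerivAt hN hS hb hWr hd hΦr fun t y hz => ?_
    have h2 := (hflow _ (hD (t, y.1) ⟨y.2, hz⟩).2.1).2 _ (hD (t, y.1) ⟨y.2, hz⟩).1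
    rw [hcoord t y hz]
    refine h2.2.2.congr_of_eventuallyEq ?_
    filter_upwards [isOpen_Ioo.mem_nhds (hD (t, y.1) ⟨y.2, hz⟩).1] with t' ht'
    exact hcoord t' y ((hmemW t' y).2 ⟨ht', ((hmemW t y).1 hz).2⟩)
  · have hQr : hb.img B' ≤ hb.range := by rintro _ ⟨y, -, rfl⟩; exact ⟨y, rfl⟩
    have hQR : hb.img B' ≤ R := by rintro _ ⟨y, hy, rfl⟩; exact hy.1
    have hQW : ∀ s ∈ hb.img B', ((0 : ℝ), s) ∈ W := fun s hs => ⟨⟨by linarith, hT⟩, hs⟩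
    have hQt : hb.img B' ≤ timeSlice (up (hc.range.comap Φ.toMap)) 0 := fun s hs =>
      mem_up.2 ⟨hQW s hs, hΦr _⟩
    have hinit : ∀ (y : B) (hy : b.toMap y ∈ hb.img B'),
        coordCurve hc Φ (b.mapPt (domPt y)) 0 = Z y.1 := fun y hy => by
      rw [hcoord 0 y (hQW _ hy), (hflow _ (hD (0, y.1) ⟨y.2, hQW _ hy⟩).2.1).1]
      refine phaseProj_eq (fun k => ?_) fun k => ?_
      · rw [← hZ1 y (hQR hy) k]; exact GrPoint.app_mem _ _ (hX₀ k)
      · rw [← hZ2 y (hQR hy) k]; exact GrPoint.app_mem _ _ (hV₀ k)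
    have hxR : N.tangentProj.toMap (J.toMap x.pt) ∈ hc.range := hQR hx.2
    refine isVelocityAt_of_coord hS hc (hc.grPoint_ext hxR (hΦr _) fun k => ?_) hxR (hΦr _) fun k => ?_
    · exact hb.app_eq_of_domPt (f := X₀ k) (f' := (Φ.pull hc.range (hc.coord k)).1 0) hQr hQR hQt
        (fun y hy => (hZ1 y (hQR hy) k).trans ((congrFun (congrArg Prod.fst (hinit y hy)) k).symm.trans
          (coordCurve_fst (b.mapPt (domPt y)) (hQW _ hy) (hΦr _) k))) x hx.2
    · exact hb.app_eq_of_domPt (f := V₀ k) (f' := (timeDeriv (W := up (hc.range.comap Φ.toMap))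
          (Φ.pull hc.range (hc.coord k))).1 0) hQr hQR hQt
        (fun y hy => (hZ2 y (hQR hy) k).trans ((congrFun (congrArg Prod.snd (hinit y hy)) k).symm.trans
          (coordCurve_snd (b.mapPt (domPt y)) (hQW _ hy) (hΦr _) k))) x hx.2

end SuperSpace
end

noncomputable section

namespace SuperSpace

/-! ### Maximal supergeodesics -/

variable {N : SuperSpace.{u}} {S : SuperSpace.{v}} {m n p q r : ℕ} {D : N.Connection}

lemma GeodesicEquation.of_cover (hS : S.IsSupermanifold p q) {W : Opens S.timeProd.body}
    {Φ : Hom (S.timeProd.restrict W) N} {U : Opens N.body} {x : Fin m ⊕ Fin n → N.O U}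
    {d : Fin m ⊕ Fin n → N.vectorField U}
    (h : ∀ z ∈ W, ∃ (A : Opens S.timeProd.body) (hA : A ≤ W), z ∈ A ∧
      GeodesicEquation D (Φ.comp (S.timeProd.restrictIncl hA)) x d) : GeodesicEquation D Φ x d := by
  refine fun k => curve_sec_ext hS fun y t hz hU => ?_
  obtain ⟨A, hA, hzA, hgeo⟩ := h _ hz
  have hρ : ∀ f : (S.timeProd.restrict W).O (U.comap Φ.toMap),
      (curvePt A y t hzA).app (U.comap (Φ.comp (S.timeProd.restrictIncl hA)).toMap) hU
        ((S.timeProd.restrictIncl hA).pull (U.comap Φ.toMap) f) =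
      (curvePt W y t hz).app (U.comap Φ.toMap) hU f := fun f =>
    GrPoint.app_congr (restrictIncl_mapPt_curvePt hA y t hzA) (U := U.comap Φ.toMap) hU hU f
  have h1 : ∀ l, dt ((Φ.comp (S.timeProd.restrictIncl hA)).pull U (x l)) =
      (S.timeProd.restrictIncl hA).pull (U.comap Φ.toMap) (dt (Φ.pull U (x l))) := fun l =>
    dt_pull_restrictIncl hS hA _
  have h2 : dt (dt ((Φ.comp (S.timeProd.restrictIncl hA)).pull U (x k))) =
      (S.timeProd.restrictIncl hA).pull (U.comap Φ.toMap) (dt (dt (Φ.pull U (x k)))) :=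
    (congrArg dt (h1 k)).trans (dt_pull_restrictIncl hS hA _)
  have h3 := congrArg ((curvePt A y t hzA).app
    (U.comap (Φ.comp (S.timeProd.restrictIncl hA)).toMap) hU) (hgeo k)
  rw [map_zero, map_add, map_sum] at h3 ⊢
  refine Eq.trans (congrArg₂ (· + ·) ((congrArg _ h2).trans (hρ _)).symm
    (Finset.sum_congr rfl fun i _ => ?_)) h3
  rw [map_sum, map_sum]
  refine Finset.sum_congr rfl fun j _ => ?_
  rw [map_mul, map_mul, map_mul, map_mul]
  exact congrArg₂ (· * ·) (congrArg₂ (· * ·) ((congrArg _ (h1 i)).trans (hρ _)).symm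
    ((congrArg _ (h1 j)).trans (hρ _)).symm) (hρ _).symm

/-- Being a supergeodesic is a local condition on the domain. -/
lemma IsSupergeodesic.of_cover (hN : N.IsSupermanifold m n) (hS : S.IsSupermanifold p q)
    {W : Opens S.timeProd.body} {Φ : Hom (S.timeProd.restrict W) N}
    (h : ∀ z ∈ W, ∃ (A : Opens S.timeProd.body) (hA : A ≤ W), z ∈ A ∧
      IsSupergeodesic D (Φ.comp (S.timeProd.restrictIncl hA))) : IsSupergeodesic D Φ := by
  refine (isSupergeodesic_iff hN hS).2 fun U x d hx hd => GeodesicEquation.of_cover hS fun z hz => ?_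
  obtain ⟨A, hA, hzA, hgeo⟩ := h z hz
  exact ⟨A, hA, hzA, hgeo.geodesicEquation hS hx hd⟩

/-- If the domain meets every line `ℝ × {s}`, the velocity at time `0` is the initial condition as a
morphism, since morphisms from `S` are determined by their values at Grassmann-valued points. -/
lemma IsPartialGeodesic.isGeodesicFrom (hN : N.IsSupermanifold m n) (hS : S.IsSupermanifold p q)
    {J : Hom S N.tangent} {W : Opens S.timeProd.body} {Φ : Hom (S.timeProd.restrict W) N}
    (h : IsPartialGeodesic q D J W Φ) (h0 : ∀ s : S.body, ((0 : ℝ), s) ∈ W) :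
    IsGeodesicFrom D J W Φ := by
  refine ⟨h0, h.ordConnected, h.geodesic, ?_⟩
  obtain ⟨Ψ, hΨ⟩ := exists_isVelocity hN hS Φ
  refine ⟨Ψ, hΨ, hS.hom_ext fun V c hc y => ?_⟩
  rw [mapPt_comp, injZero_mapPt]
  exact (hΨ.isVelocityAt _).unique hN (h.initial _ (h0 _))

/-- Two supergeodesics with the same initial condition agree on the intersection of their domains. -/
lemma IsPartialGeodesic.comp_restrictIncl_eq (hN : N.IsSupermanifold m n) (hS : S.IsSupermanifold p q)
    {J : Hom S N.tangent} {W W' A : Opens S.timeProd.body} {Φ : Hom (S.timeProd.restrict W) N}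
    {Φ' : Hom (S.timeProd.restrict W') N} (h : IsPartialGeodesic q D J W Φ)
    (h' : IsPartialGeodesic q D J W' Φ') (hA : A ≤ W) (hA' : A ≤ W') :
    Φ.comp (S.timeProd.restrictIncl hA) = Φ'.comp (S.timeProd.restrictIncl hA') :=
  curve_hom_ext hS fun x t hx => by
    rw [mapPt_comp, mapPt_comp, restrictIncl_mapPt_curvePt, restrictIncl_mapPt_curvePt]
    exact h.eq hN hS h' x t _ _

/-- There is a largest supergeodesic with a given initial condition. -/
lemma exists_maximal_partialGeodesic (hN : N.IsSupermanifold m n) (hS : S.IsSupermanifold p q)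
    (D : N.Connection) (J : Hom S N.tangent) :
    ∃ (W : Opens S.timeProd.body) (Φ : Hom (S.timeProd.restrict W) N), IsPartialGeodesic q D J W Φ ∧
      ∀ (W' : Opens S.timeProd.body) (Φ' : Hom (S.timeProd.restrict W') N),
        IsPartialGeodesic q D J W' Φ' → W' ≤ W := by
  let W₀ : Opens S.timeProd.body := sSup {W | ∃ Φ, IsPartialGeodesic q D J W Φ}
  have hmem : ∀ z : W₀, ∃ (A : Opens S.timeProd.body) (Φ : Hom (S.timeProd.restrict A) N),
      IsPartialGeodesic q D J A Φ ∧ z.1 ∈ A := fun z => by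
    obtain ⟨A, ⟨Φ, hΦ⟩, hz⟩ := Opens.mem_sSup.1 z.2
    exact ⟨A, Φ, hΦ, hz⟩
  choose A Φ hΦ hA using hmem
  have hle : ∀ z, A z ≤ W₀ := fun z => le_sSup ⟨_, hΦ z⟩
  obtain ⟨F, hF⟩ := exists_glue A W₀ hle (fun z hz => ⟨⟨z, hz⟩, hA _⟩) Φ fun i j =>
    (hΦ i).comp_restrictIncl_eq hN hS (hΦ j) _ _
  refine ⟨W₀, F, ⟨fun z hz => hle ⟨z, hz⟩ ((hΦ ⟨z, hz⟩).zero_mem _ (hA ⟨z, hz⟩)), fun s => ?_,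
    IsSupergeodesic.of_cover hN hS fun z hz => ⟨A ⟨z, hz⟩, hle _, hA ⟨z, hz⟩, ?_⟩, fun x hx => ?_⟩,
    fun W' Φ' h => le_sSup ⟨Φ', h⟩⟩
  · -- a time between two times of the union lies between one of them and `0`
    have key : ∀ a ∈ {t : ℝ | (t, s) ∈ W₀}, Set.uIcc 0 a ⊆ {t : ℝ | (t, s) ∈ W₀} := fun a ha t ht =>
      hle ⟨_, ha⟩ (((hΦ ⟨_, ha⟩).ordConnected s).uIcc_subset ((hΦ ⟨_, ha⟩).zero_mem _ (hA ⟨_, ha⟩))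
        (hA ⟨_, ha⟩) ht)
    refine ⟨fun a ha a' ha' t ht => ?_⟩
    rcases le_total 0 t with h0 | h0
    · exact key a' ha' (Set.mem_uIcc.2 (.inl ⟨h0, ht.2⟩))
    · exact key a ha (Set.mem_uIcc.2 (.inr ⟨ht.1, h0⟩))
  · rw [hF]
    exact (hΦ _).geodesic
  · have h1 := (hΦ ⟨_, hx⟩).initial x (hA ⟨_, hx⟩)
    rw [← hF, isVelocityAt_restrictIncl hS, restrictIncl_mapPt_curvePt] at h1
    exact h1

/-- Existence and uniqueness of maximal supergeodesics. -/
lemma hasUniqueGeodesic (hN : N.IsSupermanifold m n) (hS : S.IsSupermanifold p q)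
    (D : N.Connection) (J : Hom S N.tangent) : HasUniqueGeodesic D J := by
  obtain ⟨W, Φ, hΦ, hmax⟩ := exists_maximal_partialGeodesic hN hS D J
  refine ⟨W, Φ, hΦ.isGeodesicFrom hN hS fun s => ?_, fun W' Φ' h' => ?_⟩
  · obtain ⟨W', Φ', h', hs⟩ := exists_local_geodesic hN hS D J s
    exact hmax W' Φ' h' hs
  · have h2 : IsPartialGeodesic q D J W' Φ' := h'.isPartialGeodesic
    refine ⟨hmax W' Φ' h2, curve_hom_ext hS fun x t hx => ?_⟩
    rw [mapPt_comp, restrictIncl_mapPt_curvePt]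
    exact h2.eq hN hS hΦ x t _ _

lemma isSupermanifold_superR (p q : ℕ) : (superR p q).IsSupermanifold p q where
  t2 := inferInstanceAs (T2Space (Fin p → ℝ))
  secondCountable := inferInstanceAs (SecondCountableTopology (Fin p → ℝ))
  exists_chart x := ⟨⊤, inclusion (superR p q) ⊤, Hom.IsOpenImmersion.inclusion ⊤, ⟨x, trivial⟩, rfl⟩

end SuperSpace
end

theorem theorem2p15 {m n : ℕ} (N : SuperSpace.{u}) (hN : N.IsSupermanifold m n)
    (D : N.Connection) :
    (∀ J : SuperSpace.Hom (superR 0 1) N.tangent, SuperSpace.HasUniqueGeodesic D J) ∧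
    (∀ (S : SuperSpace.{v}) (p q : ℕ), S.IsSupermanifold p q →
      ∀ J : SuperSpace.Hom S N.tangent, SuperSpace.HasUniqueGeodesic D J) ∧
    (∀ (S : SuperSpace.{v}) (p q : ℕ), S.IsSupermanifold p q →
      ∀ (W : Opens S.timeProd.body) (Φ : SuperSpace.Hom (S.timeProd.restrict W) N),
        SuperSpace.IsSupergeodesic D Φ ↔
          ∀ (U : Opens N.body) (x : Fin m ⊕ Fin n → N.O U) (d : Fin m ⊕ Fin n → N.vectorField U),
            SuperSpace.IsCoord x → SuperSpace.IsCoordDer x d →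
              SuperSpace.GeodesicEquation D Φ x d) :=
  ⟨fun J => SuperSpace.hasUniqueGeodesic hN (SuperSpace.isSupermanifold_superR 0 1) D J,
    fun _ _ _ hS J => SuperSpace.hasUniqueGeodesic hN hS D J,
    fun _ _ _ hS _ _ => SuperSpace.isSupergeodesic_iff hN hS⟩
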